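/- **Setting.** Fix $\zeta\in(-1,0)\cup(0,1)$ and $\gamma\ge 0$, and put $\sigma=\begin{pmatrix}0&1\\1&0\end{pmatrix}$. Vectors in $\mathbb C^2$ are row vectors. *Contour and jump.* Let $\Sigma\subset\mathbb C$ consist of finitely many $C^\infty$ regular oriented curves, each a compact arc (with its end points) or a closed curve, with at most finitely many intersections and self-intersections, all transversal (non-parallel tangents). Assume $0,\zeta\notin\Sigma$, that $\Sigma$ is invariant under $z\mapsto z^{-1}$, and that this map sends the positive (left) side of $\Sigma$ to the negative (right) side. Let the jump matrix on $\Sigma$ be $v=b_-^{-1}b_+=(\mathbb I-w_-)^{-1}(\mathbb I+w_+)$, where $b_\pm=\mathbb I\pm w_\pm$ is invertible, $w_\pm:\Sigma\to\mathbb C^{2\times2}$ are continuous, and $$w_\pm(z^{-1})=-\sigma\,w_\mp(z)\,\sigma,\qquad z\in\Sigma .$$ *Boundary values* are taken in the sense of $L^2$: $f_\pm\in L^2(\Sigma)$ (with respect to arc length) are the boundary values of $F$ from the $\pm$ side if, for each parametrized curve $s:[0,1]\to\Sigma$ of the contour, $F(s(t)\pm \mathrm i\varepsilon s'(t))\to f_\pm(s(t))$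 in $L^2(dt)$ as $\varepsilon\downarrow0$. $L^2_s(\Sigma)$ is the set of $f\in L^2(\Sigma;\mathbb C^2)$ with $f(z^{-1})=f(z)\sigma$ a.e. on $\Sigma$. *Riemann–Hilbert problem.* $m$ solves the RHP if it is holomorphic in $\mathbb C\setminus(\Sigma\cup\{\zeta,\zeta^{-1}\})$ with at most simple poles at $\zeta,\zeta^{-1}$, has boundary values $m_\pm$ on $\Sigma$, satisfies $|m(z)|=O(\mathrm{dist}(z,\Sigma)^{-1/2})$ near $\Sigma$, and $$m_+=m_-v\ \text{ a.e. on }\Sigma,\qquad m(z^{-1})=m(z)\sigma,\qquad m(0)=(1\ \ m_2)\ \text{ with } m_2 \text{ arbitrary},$$ $$\operatorname{res}_{\zeta}m=\lim_{z\to\zeta}m(z)\begin{pmatrix}0&0\\-\zeta\gamma&0\end{pmatrix},\qquad \operatorname{res}_{\zeta^{-1}}m=\lim_{z\to\zeta^{-1}}m(z)\begin{pmatrix}0&\zeta^{-1}\gamma\\0&0\end{pmatrix}.$$ *Cauchy operator.* Let $$\Omega_\zeta(s,z)=\begin{pmatrix}\frac{z-\zeta^{-1}}{s-\zeta^{-1}}\frac1{s-z}&0\\0&\frac{z-\zeta}{s-\zeta}\frac1{s-z}\end{pmatrix}ds,\qquad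 (Cf)(z)=\frac1{2\pi\mathrm i}\int_\Sigma f(s)\,\Omega_\zeta(s,z),$$ let $C_\pm f$ be the boundary values of $Cf$, and $C_wf=C_+(fw_-)+C_-(fw_+)$. Let $m_0(z)=(f(z)\ \ f(1/z))$ with $f(z)=\frac1{1-\zeta^2+\gamma}\Bigl(\gamma\zeta^2\frac{z-\zeta^{-1}}{z-\zeta}+1-\zeta^2\Bigr)$ (extended holomorphically to $z=0$). **Theorem.** (i) Suppose $m$ solves the RHP. Put $\mu=m_+b_+^{-1}$ and $c_0=\bigl(C(\mu(w_++w_-))(0)\bigr)_1$ (first component). Then $\mu=m_-b_-^{-1}$ a.e., for all $z\notin\Sigma\cup\{\zeta,\zeta^{-1}\}$ $$m(z)=(1-c_0)\,m_0(z)+\frac1{2\pi\mathrm i}\int_\Sigma\mu(s)\bigl(w_+(s)+w_-(s)\bigr)\,\Omega_\zeta(s,z),\tag{$*$}$$ and $\mu\in L^2_s(\Sigma)$ solves $(\mathbb I-C_w)\mu=(1-c_0)m_0$, the boundary values in $C_w\mu$ existing. (ii) Conversely, suppose $\tilde\mu\in L^2_s(\Sigma)$ solves $(\mathbb I-C_w)\tilde\mu=m_0$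 and $\tilde c_0=\bigl(C(\tilde\mu(w_++w_-))(0)\bigr)_1\neq-1$. Then $m$ defined by $(*)$ with $1-c_0$ replaced by $(1+\tilde c_0)^{-1}$ and $\mu=(1+\tilde c_0)^{-1}\tilde\mu$ solves the RHP, and $\mu=m_+b_+^{-1}=m_-b_-^{-1}$ a.e. -/

import Mathlib

open scoped Matrix Topology ENNReal ContDiff

noncomputable section

namespace SymRHP

/-- A contour in the complex plane: finitely many smooth regular oriented curves, each of them
either a compact arc (parametrised by `[0, 1]`) or a closed curve (parametrised with period `1`),
with at most finitely many intersections and self-intersections, all of them transversal. The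
orientation is the direction of increasing parameter. For an arc, only the restriction of
`curve j` to `[0, 1]` matters. -/
structure Contour where
  n : ℕ
  curve : Fin n → ℝ → ℂ
  closed : Fin n → Bool
  smooth : ∀ j, ContDiff ℝ ∞ (curve j)
  periodic : ∀ j, closed j = true → Function.Periodic (curve j) 1
  regular : ∀ j, ∀ t ∈ Set.Icc (0 : ℝ) 1, deriv (curve j) t ≠ 0
  finite_inter : Set.Finite {p : (Fin n × ℝ) × (Fin n × ℝ) |
    p.1 ≠ p.2 ∧
    p.1.2 ∈ (if closed p.1.1 then Set.Ico (0 : ℝ) 1 else Set.Icc 0 1) ∧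
    p.2.2 ∈ (if closed p.2.1 then Set.Ico (0 : ℝ) 1 else Set.Icc 0 1) ∧
    curve p.1.1 p.1.2 = curve p.2.1 p.2.2}
  transversal : ∀ j k : Fin n,
    ∀ s ∈ (if closed j then Set.Ico (0 : ℝ) 1 else Set.Icc 0 1),
    ∀ t ∈ (if closed k then Set.Ico (0 : ℝ) 1 else Set.Icc 0 1),
    (j, s) ≠ (k, t) → curve j s = curve k t →
    LinearIndependent ℝ ![deriv (curve j) s, deriv (curve k) t]

namespace Contour

variable (Γ : Contour)

/-- The contour as a subset of the plane. -/
def support : Set ℂ := ⋃ j, Γ.curve j '' Set.Icc 0 1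

/-- Arc length on the contour, as a measure on the plane. -/
def arcLength : MeasureTheory.Measure ℂ :=
  ∑ j, MeasureTheory.Measure.map (Γ.curve j)
    ((MeasureTheory.volume.restrict (Set.Icc (0 : ℝ) 1)).withDensity
      fun t => ‖deriv (Γ.curve j) t‖ₑ)

/-- The contour integral `∫_Σ g(s) ds` of a vector-valued function. -/
def integral (g : ℂ → Fin 2 → ℂ) : Fin 2 → ℂ :=
  ∑ j, ∫ t in (0 : ℝ)..1, deriv (Γ.curve j) t • g (Γ.curve j t)

end Contour

/-- The matrix `(0 1; 1 0)`. -/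
def swapMatrix : Matrix (Fin 2) (Fin 2) ℂ := !![0, 1; 1, 0]

/-- `F` has the boundary values `f ∈ L²(Σ)` on the contour in the sense of `L²`: on the normal
translates of the curves, on the positive (left) side for `side = 1` and on the negative (right)
side for `side = -1`, the function `F` converges to `f` in `L²`. -/
def HasBoundaryValues (Γ : Contour) (side : ℝ) (F f : ℂ → Fin 2 → ℂ) : Prop :=
  MeasureTheory.MemLp f 2 Γ.arcLength ∧
  ∀ j, Filter.Tendsto
    (fun ε : ℝ => ∫⁻ t in Set.Icc (0 : ℝ) 1,
      ‖F (Γ.curve j t + (side * ε : ℝ) * Complex.I * deriv (Γ.curve j) t)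
        - f (Γ.curve j t)‖ₑ ^ 2)
    (𝓝[>] 0) (𝓝 0)

/-- The contour hypothesis on `Σ` and the jump data. The orientation condition says that the
image of the oriented tangent under the differential `-dz/z²` of `z ↦ 1/z` is a negative multiple
of the oriented tangent at the image point, so that `z ↦ 1/z` leaves `Σ` invariant and maps its
positive side to its negative side. -/
structure SymmetricHypothesis (Γ : Contour) (ζ : ℝ) (v wp wm : ℂ → Matrix (Fin 2) (Fin 2) ℂ) : Prop where
  zero_notMem : (0 : ℂ) ∉ Γ.support
  zeta_notMem : (ζ : ℂ) ∉ Γ.support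
  inversion : ∀ j, ∀ t ∈ Set.Icc (0 : ℝ) 1, ∃ k, ∃ u ∈ Set.Icc (0 : ℝ) 1,
    Γ.curve k u = (Γ.curve j t)⁻¹ ∧
    ∃ r : ℝ, 0 < r ∧
      -deriv (Γ.curve j) t / Γ.curve j t ^ 2 = -((r : ℂ) * deriv (Γ.curve k) u)
  isUnit_bm : ∀ z ∈ Γ.support, IsUnit (1 - wm z)
  jump_eq : ∀ z ∈ Γ.support, v z = (1 - wm z)⁻¹ * (1 + wp z)
  continuousOn_wp : ContinuousOn wp Γ.support
  continuousOn_wm : ContinuousOn wm Γ.support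
  symm_wp : ∀ z ∈ Γ.support, wp z⁻¹ = -(swapMatrix * wm z * swapMatrix)
  symm_wm : ∀ z ∈ Γ.support, wm z⁻¹ = -(swapMatrix * wp z * swapMatrix)

/-- `res_a m = lim_{z → a} m(z) A`, with at most a simple pole at `a`. -/
def ResidueCondition (m : ℂ → Fin 2 → ℂ) (a : ℂ) (A : Matrix (Fin 2) (Fin 2) ℂ) : Prop :=
  ∃ r : Fin 2 → ℂ,
    Filter.Tendsto (fun z => (z - a) • m z) (𝓝[≠] a) (𝓝 r) ∧
    Filter.Tendsto (fun z => m z ᵥ* A) (𝓝[≠] a) (𝓝 r)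

/-- `m` solves the meromorphic vector Riemann-Hilbert problem with jump `v` on `Σ`, poles at
`ζ`, `1/ζ` and norming constant `γ`, and `mp`, `mm` are its boundary values from the positive and
the negative side of `Σ`. Boundary values are taken in the sense of `L²`; `growth` is the bound
that goes with this (it holds for bounded functions and for Cauchy integrals of `L²` densities)
and excludes singularities at the end points of `Σ`. -/
structure SolvesRHP (Γ : Contour) (ζ γ : ℝ) (v : ℂ → Matrix (Fin 2) (Fin 2) ℂ)
    (m mp mm : ℂ → Fin 2 → ℂ) : Prop where
  holomorphic : DifferentiableOn ℂ m (Γ.support ∪ {(ζ : ℂ), (ζ : ℂ)⁻¹})ᶜ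
  growth : ∃ K δ : ℝ, 0 < δ ∧ ∀ z ∉ Γ.support, Metric.infDist z Γ.support < δ →
    ‖m z‖ * Real.sqrt (Metric.infDist z Γ.support) ≤ K
  boundary_plus : HasBoundaryValues Γ 1 m mp
  boundary_minus : HasBoundaryValues Γ (-1) m mm
  jump : ∀ᵐ z ∂Γ.arcLength, mp z = mm z ᵥ* v z
  residue : ResidueCondition m (ζ : ℂ) !![0, 0; -(ζ : ℂ) * γ, 0]
  residue_inv : ResidueCondition m (ζ : ℂ)⁻¹ !![0, (ζ : ℂ)⁻¹ * γ; 0, 0]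
  symm : ∀ z ∉ Γ.support ∪ {0, (ζ : ℂ), (ζ : ℂ)⁻¹}, m z⁻¹ = m z ᵥ* swapMatrix
  normalization : m 0 0 = 1

/-- The matrix Cauchy kernel `Ω_ζ(s, z)` (without the factor `ds`). -/
def cauchyKernel (ζ s z : ℂ) : Matrix (Fin 2) (Fin 2) ℂ :=
  !![(z - ζ⁻¹) / (s - ζ⁻¹) * (1 / (s - z)), 0; 0, (z - ζ) / (s - ζ) * (1 / (s - z))]

/-- The Cauchy operator `(C f)(z) = (2πi)⁻¹ ∫_Σ f(s) Ω_ζ(s, z)`. -/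
def cauchyOp (Γ : Contour) (ζ : ℝ) (f : ℂ → Fin 2 → ℂ) (z : ℂ) : Fin 2 → ℂ :=
  (2 * Real.pi * Complex.I)⁻¹ • Γ.integral fun s => f s ᵥ* cauchyKernel ζ s z

/-- The one-soliton solution `m₀(z) = (f(z), f(1/z))` with
`f(z) = (γ ζ² (z - ζ⁻¹) / (z - ζ) + 1 - ζ²) / (1 - ζ² + γ)`; in the second component the fraction
is cleared of `1/z`, so that it has the right value at `z = 0`. -/
def oneSoliton (ζ γ : ℝ) (z : ℂ) : Fin 2 → ℂ :=
  ![(γ * ζ ^ 2 * ((z - (ζ : ℂ)⁻¹) / (z - ζ)) + 1 - ζ ^ 2) / (1 - ζ ^ 2 + γ),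
    (γ * ζ ^ 2 * ((1 - (ζ : ℂ)⁻¹ * z) / (1 - ζ * z)) + 1 - ζ ^ 2) / (1 - ζ ^ 2 + γ)]

/-- Membership in `L²_s(Σ)`: square integrable with `f(1/z) = f(z) (0 1; 1 0)` a.e. on `Σ`. -/
def MemL2s (Γ : Contour) (f : ℂ → Fin 2 → ℂ) : Prop :=
  MeasureTheory.MemLp f 2 Γ.arcLength ∧ ∀ᵐ z ∂Γ.arcLength, f z⁻¹ = f z ᵥ* swapMatrix

/-- `g = C_w f = C_+(f w_-) + C_-(f w_+)` in `L²(Σ)`, both boundary values existing. -/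
def IsCw (Γ : Contour) (ζ : ℝ) (wp wm : ℂ → Matrix (Fin 2) (Fin 2) ℂ)
    (f g : ℂ → Fin 2 → ℂ) : Prop :=
  ∃ p q : ℂ → Fin 2 → ℂ,
    HasBoundaryValues Γ 1 (cauchyOp Γ ζ fun s => f s ᵥ* wm s) p ∧
    HasBoundaryValues Γ (-1) (cauchyOp Γ ζ fun s => f s ᵥ* wp s) q ∧
    ∀ᵐ z ∂Γ.arcLength, g z = p z + q z

/-- `μ ∈ L²_s(Σ)` solves the singular integral equation `(I - C_w) μ = r`. -/
def SolvesSIE (Γ : Contour) (ζ : ℝ) (wp wm : ℂ → Matrix (Fin 2) (Fin 2) ℂ)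
    (μ r : ℂ → Fin 2 → ℂ) : Prop :=
  MemL2s Γ μ ∧ ∃ g, IsCw Γ ζ wp wm μ g ∧ ∀ᵐ z ∂Γ.arcLength, μ z - g z = r z

end SymRHP

end

open SymRHP

open scoped Matrix Topology ENNReal ContDiff

noncomputable section

namespace SymRHP

open MeasureTheory Filter Set

/-! ### The Cauchy integral on the real line -/

/-! Since (z−a)/((s−a)(s−z)) = 1/(s−z) − 1/(s−a), each component of `cauchyOp` is a scalar Cauchy
integral minus its value at 1/ζ, respectively ζ (`cauchyOp_apply`). The theorem rests on three facts
about scalar Cauchy integrals of L² densities: the Plemelj formula C₊f − C₋f = f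
(`Contour.exists_bv_cauchy`), a Liouville theorem for functions without jump
(`Contour.eq_const_of_no_jump`), and the compatibility of boundary values with z ↦ 1/z
(`Contour.ae_bv_inv`).

From the integral equation to the Riemann–Hilbert problem: by Plemelj, the boundary values of m₀ +
C(μ̃(w₊+w₋)) are m₀ + C_w μ̃ + μ̃w₊ = μ̃(1+w₊) and m₀ + C_w μ̃ − μ̃w₋ = μ̃(1−w₋), so the jump is v.
Each component of the Cauchy term vanishes at the pole of the other component, so the residue
relations are those of m₀. The density is antisymmetric under inversion, which makes the Cauchy term
symmetric, and the division by 1+c̃₀ normalizes at 0.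

From the Riemann–Hilbert problem to the integral equation: m₊ − m₋ = μ(w₊+w₋). After subtraction of
the scalar Cauchy integral of this jump and of the polar part, each component of m has no jump left
and is constant. The normalization at 0, the symmetry and the residue condition at 1/ζ are linear
equations for the constants and residues, solved by those of (1−c₀)m₀. The boundary values of the
resulting formula are the integral equation. That μ is symmetric needs m₊(1/z) = m₋(z)σ; boundary
values are taken along normals, which the inversion bends, so limits along normals are compared with
limits inside cones at almost every point.

Plemelj: on the real line the Cauchy integrals at heights ε and δ have an inner product that depends
only on ε+δ. This forces convexity, monotonicity and hence an L² limit as ε ↓ 0; the difference of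
the two sides is a Poisson integral. On a contour, near each pair of parameters the kernel is
bounded, or a bounded perturbation of the kernel of the line, or, at a transversal crossing,
dominated by a constant over |t−a|+|u−b|, to which the Schur test applies. Compactness of the
parameter square assembles the pieces.

Liouville: at a point of Σ that is not an end point or an intersection, Cauchy's formula on a small
curved square gives a holomorphic extension. The finitely many other points are isolated
singularities. Since dist(z,Σ)^(-1/2) is locally integrable in the plane, the area mean value
property leaves at most a pole, and the growth bound along a ray transversal to Σ excludes it. -/

/-- The Cauchy integral of `f` over the real line at the point `t + iε`. -/
def lineCauchy (ε : ℝ) (f : ℝ → ℂ) (t : ℝ) : ℂ := ∫ u : ℝ, f u / ((u : ℂ) - t - ε * Complex.I)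

lemma normSq_sub_sub_mul_I (u t ε : ℝ) :
    Complex.normSq ((u : ℂ) - t - ε * Complex.I) = (u - t) ^ 2 + ε ^ 2 := by
  simp [Complex.normSq_apply]; ring

lemma norm_sq_sub_sub_mul_I (u t ε : ℝ) :
    ‖(u : ℂ) - t - ε * Complex.I‖ ^ 2 = (u - t) ^ 2 + ε ^ 2 := by
  rw [← Complex.normSq_eq_norm_sq, normSq_sub_sub_mul_I]

lemma sub_sub_mul_I_ne_zero (u t : ℝ) {ε : ℝ} (hε : ε ≠ 0) :
    (u : ℂ) - t - ε * Complex.I ≠ 0 := by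
  intro h
  have := normSq_sub_sub_mul_I u t ε
  rw [h] at this
  simp only [map_zero] at this
  have : 0 < ε ^ 2 := by positivity
  nlinarith [sq_nonneg (u - t)]

lemma integrable_inv_sub_sq_add_sq (u : ℝ) {ε : ℝ} (hε : ε ≠ 0) :
    Integrable fun t : ℝ => ((u - t) ^ 2 + ε ^ 2)⁻¹ := by
  have h : Integrable fun t : ℝ => (ε ^ 2)⁻¹ * (1 + ((t - u) / ε) ^ 2)⁻¹ :=
    (((integrable_inv_one_add_sq).comp_div hε).comp_sub_right u).const_mul _
  refine h.congr (Eventually.of_forall fun t => ?_)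
  have : 0 < ε ^ 2 := by positivity
  have h2 : (u - t) ^ 2 + ε ^ 2 ≠ 0 := by positivity
  have h3 : 1 + ((t - u) / ε) ^ 2 ≠ 0 := by positivity
  simp only
  rw [← mul_inv]
  congr 1
  field_simp
  ring

/-- AM–GM decouples the two factors, leaving kernels that are integrable in `t` one at a time. -/
lemma norm_inv_mul_inv_le (u v t ε δ : ℝ) :
    ‖(u : ℂ) - t - ε * Complex.I‖⁻¹ * ‖(v : ℂ) - t - δ * Complex.I‖⁻¹ ≤
      ((u - t) ^ 2 + ε ^ 2)⁻¹ + ((v - t) ^ 2 + δ ^ 2)⁻¹ := by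
  rw [← norm_sq_sub_sub_mul_I, ← norm_sq_sub_sub_mul_I, ← inv_pow, ← inv_pow]
  nlinarith [sq_nonneg (‖(u : ℂ) - t - ε * Complex.I‖⁻¹ - ‖(v : ℂ) - t - δ * Complex.I‖⁻¹),
    sq_nonneg (‖(u : ℂ) - t - ε * Complex.I‖⁻¹), sq_nonneg (‖(v : ℂ) - t - δ * Complex.I‖⁻¹)]

lemma tendsto_log_sub_sub_log_sub_atTop (a b : ℂ) :
    Tendsto (fun t : ℝ => Complex.log (t - a) - Complex.log (t - b)) atTop (𝓝 0) := by
  have key : ∀ a : ℂ, Tendsto (fun t : ℝ => 1 - a / (t : ℂ)) atTop (𝓝 1) := by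
    intro a
    have : Tendsto (fun t : ℝ => a * ((t⁻¹ : ℝ) : ℂ)) atTop (𝓝 (a * ((0 : ℝ) : ℂ))) :=
      ((Complex.continuous_ofReal.tendsto 0).comp tendsto_inv_atTop_zero).const_mul a
    simpa [div_eq_mul_inv] using tendsto_const_nhds (x := (1 : ℂ)).sub this
  have hl : ∀ a : ℂ, Tendsto (fun t : ℝ => Complex.log (1 - a / (t : ℂ))) atTop (𝓝 0) := by
    intro a
    have := ((continuousAt_clog (by simp : (1 : ℂ) ∈ Complex.slitPlane)).tendsto).comp
      (key a)
    simpa [Function.comp_def] using this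
  have h0 := (hl a).sub (hl b)
  simp only [sub_zero] at h0
  refine h0.congr' ?_
  have hne : ∀ a : ℂ, ∀ᶠ t : ℝ in atTop, 1 - a / (t : ℂ) ≠ 0 :=
    fun a => (key a).eventually_ne one_ne_zero
  filter_upwards [hne a, hne b, eventually_gt_atTop 0] with t h1 h2 ht
  have e : ∀ a : ℂ, (t : ℂ) - a = (t : ℂ) * (1 - a / t) := by
    intro a
    have : (t : ℂ) ≠ 0 := by exact_mod_cast ht.ne'
    field_simp
  rw [e a, e b, Complex.log_ofReal_mul ht h1, Complex.log_ofReal_mul ht h2]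
  ring

/-- As t → −∞ the points t − a and t − b approach the negative axis from above and from below, so
the principal arguments tend to π and −π. This branch difference is the whole value of the integral
below. -/
lemma tendsto_log_sub_sub_log_sub_atBot {a b : ℂ} (ha : a.im < 0) (hb : 0 < b.im) :
    Tendsto (fun t : ℝ => Complex.log (t - a) - Complex.log (t - b)) atBot
      (𝓝 (2 * Real.pi * Complex.I)) := by
  have key : ∀ a : ℂ, Tendsto (fun t : ℝ => -1 + a / (t : ℂ)) atBot (𝓝 (-1)) := by
    intro a
    have : Tendsto (fun t : ℝ => a * ((t⁻¹ : ℝ) : ℂ)) atBot (𝓝 (a * ((0 : ℝ) : ℂ))) :=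
      ((Complex.continuous_ofReal.tendsto 0).comp tendsto_inv_atBot_zero).const_mul a
    simpa [div_eq_mul_inv] using tendsto_const_nhds (x := (-1 : ℂ)).add this
  have him : ∀ (a : ℂ) (t : ℝ), (-1 + a / (t : ℂ)).im = a.im / t := by
    intro a t
    simp [Complex.div_ofReal_im]
  have h1 : Tendsto (fun t : ℝ => Complex.log (-1 + a / (t : ℂ))) atBot
      (𝓝 (Real.pi * Complex.I)) := by
    have := (Complex.tendsto_log_nhdsWithin_im_nonneg_of_re_neg_of_im_zero (z := -1)
      (by simp) (by simp)).comp (tendsto_nhdsWithin_iff.2 ⟨key a, by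
        filter_upwards [eventually_lt_atBot 0] with t ht
        simp only [him]
        exact (div_pos_of_neg_of_neg ha ht).le⟩)
    simpa [Function.comp_def] using this
  have h2 : Tendsto (fun t : ℝ => Complex.log (-1 + b / (t : ℂ))) atBot
      (𝓝 (-(Real.pi * Complex.I))) := by
    have := (Complex.tendsto_log_nhdsWithin_im_neg_of_re_neg_of_im_zero (z := -1)
      (by simp) (by simp)).comp (tendsto_nhdsWithin_iff.2 ⟨key b, by
        filter_upwards [eventually_lt_atBot 0] with t ht
        simp only [him]
        exact (div_neg_of_pos_of_neg hb ht)⟩)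
    simpa [Function.comp_def] using this
  have h0 := h1.sub h2
  have : (Real.pi * Complex.I - -(Real.pi * Complex.I) : ℂ) = 2 * Real.pi * Complex.I := by ring
  rw [this] at h0
  refine h0.congr' ?_
  have hne : ∀ a : ℂ, ∀ᶠ t : ℝ in atBot, -1 + a / (t : ℂ) ≠ 0 :=
    fun a => (key a).eventually_ne (by simp)
  filter_upwards [hne a, hne b, eventually_lt_atBot 0] with t h1 h2 ht
  have e : ∀ a : ℂ, (t : ℂ) - a = ((-t : ℝ) : ℂ) * (-1 + a / t) := by
    intro a
    have : (t : ℂ) ≠ 0 := by exact_mod_cast ht.ne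
    push_cast
    field_simp
    ring
  rw [e a, e b, Complex.log_ofReal_mul (by linarith) h1, Complex.log_ofReal_mul (by linarith) h2]
  ring

/-- By partial fractions (a−b)⁻¹(log(t−a) − log(t−b)) is an antiderivative on the whole line,
because t − a and t − b never meet the branch cut. Only its limits at ±∞ contribute. -/
lemma integral_inv_mul_inv (u v : ℝ) {ε δ : ℝ} (hε : 0 < ε) (hδ : 0 < δ) :
    ∫ t : ℝ, ((u : ℂ) - t - ε * Complex.I)⁻¹ * ((v : ℂ) - t + δ * Complex.I)⁻¹ =
      -(2 * Real.pi * Complex.I) / ((u : ℂ) - v - ((ε + δ : ℝ) : ℂ) * Complex.I) := by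
  set a : ℂ := u - ε * Complex.I with ha
  set b : ℂ := v + δ * Complex.I with hb
  have hai : a.im < 0 := by simp [ha, hε]
  have hbi : 0 < b.im := by simp [hb, hδ]
  have hab : a - b ≠ 0 := by
    intro h
    have := congrArg Complex.im h
    simp only [Complex.sub_im, Complex.zero_im] at this
    linarith
  have hta : ∀ t : ℝ, (t : ℂ) - a ∈ Complex.slitPlane := fun t => by
    right; simp only [Complex.sub_im, Complex.ofReal_im]; linarith
  have htb : ∀ t : ℝ, (t : ℂ) - b ∈ Complex.slitPlane := fun t => by
    right; simp only [Complex.sub_im, Complex.ofReal_im]; linarith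
  have hd : ∀ t : ℝ, HasDerivAt (fun t : ℝ => (a - b)⁻¹ * (Complex.log (t - a) - Complex.log (t - b)))
      (((u : ℂ) - t - ε * Complex.I)⁻¹ * ((v : ℂ) - t + δ * Complex.I)⁻¹) t := by
    intro t
    have h1 : HasDerivAt (fun t : ℝ => (t : ℂ) - a) 1 t :=
      (Complex.ofRealCLM.hasDerivAt (x := t)).sub_const a
    have h2 : HasDerivAt (fun t : ℝ => (t : ℂ) - b) 1 t :=
      (Complex.ofRealCLM.hasDerivAt (x := t)).sub_const b
    have h3 := ((h1.clog_real (hta t)).sub (h2.clog_real (htb t))).const_mul (a - b)⁻¹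
    refine h3.congr_deriv ?_
    have e1 : (u : ℂ) - t - ε * Complex.I = -((t : ℂ) - a) := by rw [ha]; ring
    have e2 : (v : ℂ) - t + δ * Complex.I = -((t : ℂ) - b) := by rw [hb]; ring
    rw [e1, e2]
    have := Complex.slitPlane_ne_zero (hta t)
    have := Complex.slitPlane_ne_zero (htb t)
    field_simp
    ring
  have hint : Integrable fun t : ℝ =>
      ((u : ℂ) - t - ε * Complex.I)⁻¹ * ((v : ℂ) - t + δ * Complex.I)⁻¹ := by
    refine ((integrable_inv_sub_sq_add_sq u hε.ne').add
      (integrable_inv_sub_sq_add_sq v hδ.ne')).mono' ?_ ?_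
    · exact (by fun_prop : Measurable _).aestronglyMeasurable
    · refine Eventually.of_forall fun t => ?_
      have h := norm_inv_mul_inv_le u v t ε (-δ)
      rw [norm_mul, norm_inv, norm_inv]
      simpa using h
  rw [integral_of_hasDerivAt_of_tendsto hd hint
    ((tendsto_log_sub_sub_log_sub_atBot hai hbi).const_mul _)
    ((tendsto_log_sub_sub_log_sub_atTop a b).const_mul _)]
  have : (u : ℂ) - v - ((ε + δ : ℝ) : ℂ) * Complex.I = a - b := by
    rw [ha, hb]; push_cast; ring
  rw [this]
  field_simp
  ring

/-- Justifies Fubini in the inner product of two Cauchy integrals. The integrand is dominated by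
‖f(u)‖‖f(v)‖ times a sum of two Poisson-type kernels in `t`, whose integrals over `t` do not depend
on u and v. -/
lemma integrable_prod_cauchy {f : ℝ → ℂ} (hf : Integrable f) {ε δ : ℝ} (hε : 0 < ε) (hδ : 0 < δ) :
    Integrable (fun p : ℝ × (ℝ × ℝ) =>
      f p.2.1 / ((p.2.1 : ℂ) - p.1 - ε * Complex.I) *
        (starRingEnd ℂ) (f p.2.2 / ((p.2.2 : ℂ) - p.1 - δ * Complex.I)))
      (volume.prod (volume.prod volume)) := by
  have hff : Integrable (fun q : ℝ × ℝ => ‖f q.1‖ * ‖f q.2‖) (volume.prod volume) :=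
    hf.norm.mul_prod hf.norm
  have hmeas : AEStronglyMeasurable (fun p : ℝ × (ℝ × ℝ) => ‖f p.2.1‖ * ‖f p.2.2‖)
      (volume.prod (volume.prod volume)) := hff.aestronglyMeasurable.comp_snd
  have key : ∀ (g : ℝ × ℝ → ℝ) (_ : Measurable g) (ε : ℝ), 0 < ε →
      Integrable (fun p : ℝ × (ℝ × ℝ) => ‖f p.2.1‖ * ‖f p.2.2‖ *
        ((g p.2 - p.1) ^ 2 + ε ^ 2)⁻¹) (volume.prod (volume.prod volume)) := by
    intro g hg ε hε
    rw [integrable_prod_iff']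
    · refine ⟨Eventually.of_forall fun q =>
        (integrable_inv_sub_sq_add_sq (g q) hε.ne').const_mul (‖f q.1‖ * ‖f q.2‖), ?_⟩
      have : ∀ q : ℝ × ℝ, ∫ t : ℝ, ‖‖f q.1‖ * ‖f q.2‖ * ((g q - t) ^ 2 + ε ^ 2)⁻¹‖ =
          ‖f q.1‖ * ‖f q.2‖ * ∫ t : ℝ, (t ^ 2 + ε ^ 2)⁻¹ := by
        intro q
        rw [← integral_const_mul, ← integral_sub_left_eq_self _ volume (g q)]
        refine integral_congr_ae (Eventually.of_forall fun t => ?_)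
        simp only
        rw [Real.norm_of_nonneg (by positivity)]
        simp
      simp only [this]
      exact hff.mul_const _
    · refine hmeas.mul ?_
      exact (by fun_prop : Measurable fun p : ℝ × (ℝ × ℝ) =>
        ((g p.2 - p.1) ^ 2 + ε ^ 2)⁻¹).aestronglyMeasurable
  refine ((key Prod.fst measurable_fst ε hε).add (key Prod.snd measurable_snd δ hδ)).mono' ?_ ?_
  · have h1 : AEStronglyMeasurable (fun p : ℝ × (ℝ × ℝ) => f p.2.1)
        (volume.prod (volume.prod volume)) := hf.aestronglyMeasurable.comp_fst.comp_snd
    have h2 : AEStronglyMeasurable (fun p : ℝ × (ℝ × ℝ) => f p.2.2)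
        (volume.prod (volume.prod volume)) := hf.aestronglyMeasurable.comp_snd.comp_snd
    have m1 : AEStronglyMeasurable (fun p : ℝ × (ℝ × ℝ) =>
        ((p.2.1 : ℂ) - p.1 - ε * Complex.I)⁻¹) (volume.prod (volume.prod volume)) :=
      (by fun_prop : Measurable _).aestronglyMeasurable
    have m2 : AEStronglyMeasurable (fun p : ℝ × (ℝ × ℝ) =>
        ((p.2.2 : ℂ) - p.1 - δ * Complex.I)⁻¹) (volume.prod (volume.prod volume)) :=
      (by fun_prop : Measurable _).aestronglyMeasurable
    simp only [div_eq_mul_inv]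
    exact (h1.mul m1).mul (Complex.continuous_conj.comp_aestronglyMeasurable (h2.mul m2))
  · refine Eventually.of_forall fun p => ?_
    simp only [norm_mul, norm_div, RCLike.norm_conj, Pi.add_apply]
    have h := norm_inv_mul_inv_le p.2.1 p.2.2 p.1 ε δ
    calc _ = ‖f p.2.1‖ * ‖f p.2.2‖ * (‖(p.2.1 : ℂ) - p.1 - ε * Complex.I‖⁻¹ *
          ‖(p.2.2 : ℂ) - p.1 - δ * Complex.I‖⁻¹) := by ring
      _ ≤ _ := by
        rw [← mul_add]
        exact mul_le_mul_of_nonneg_left h (by positivity)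

lemma lineCauchy_mul_conj (f : ℝ → ℂ) (ε δ t : ℝ) :
    lineCauchy ε f t * (starRingEnd ℂ) (lineCauchy δ f t) =
      ∫ q : ℝ × ℝ, f q.1 / ((q.1 : ℂ) - t - ε * Complex.I) *
        (starRingEnd ℂ) (f q.2 / ((q.2 : ℂ) - t - δ * Complex.I)) := by
  rw [lineCauchy, lineCauchy, ← integral_conj, ← integral_prod_mul]
  rfl

lemma integrable_lineCauchy_mul_conj {f : ℝ → ℂ} (hf : Integrable f) {ε δ : ℝ} (hε : 0 < ε)
    (hδ : 0 < δ) :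
    Integrable fun t => lineCauchy ε f t * (starRingEnd ℂ) (lineCauchy δ f t) := by
  simp only [lineCauchy_mul_conj]
  exact (integrable_prod_cauchy hf hε hδ).integral_prod_left

/-- Fubini and the explicit integral of the two poles. The essential point is that the right-hand
side depends on the two heights only through their sum. -/
lemma integral_lineCauchy_mul_conj {f : ℝ → ℂ} (hf : Integrable f) {ε δ : ℝ} (hε : 0 < ε)
    (hδ : 0 < δ) :
    ∫ t, lineCauchy ε f t * (starRingEnd ℂ) (lineCauchy δ f t) =
      -(2 * Real.pi * Complex.I) * ∫ v, (starRingEnd ℂ) (f v) * lineCauchy (ε + δ) f v := by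
  simp only [lineCauchy_mul_conj]
  have hI := integrable_prod_cauchy hf hε hδ
  have hsw : ∫ t : ℝ, ∫ q : ℝ × ℝ, f q.1 / ((q.1 : ℂ) - t - ε * Complex.I) *
        (starRingEnd ℂ) (f q.2 / ((q.2 : ℂ) - t - δ * Complex.I)) =
      ∫ q : ℝ × ℝ, ∫ t : ℝ, f q.1 / ((q.1 : ℂ) - t - ε * Complex.I) *
        (starRingEnd ℂ) (f q.2 / ((q.2 : ℂ) - t - δ * Complex.I)) := integral_integral_swap hI
  rw [hsw]
  have hin : ∀ q : ℝ × ℝ, ∫ t : ℝ, f q.1 / ((q.1 : ℂ) - t - ε * Complex.I) *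
        (starRingEnd ℂ) (f q.2 / ((q.2 : ℂ) - t - δ * Complex.I)) =
      -(2 * Real.pi * Complex.I) * ((starRingEnd ℂ) (f q.2) *
        (f q.1 / ((q.1 : ℂ) - q.2 - ((ε + δ : ℝ) : ℂ) * Complex.I))) := by
    intro q
    have := integral_inv_mul_inv q.1 q.2 hε hδ
    have e : ∀ t : ℝ, f q.1 / ((q.1 : ℂ) - t - ε * Complex.I) *
        (starRingEnd ℂ) (f q.2 / ((q.2 : ℂ) - t - δ * Complex.I)) =
        (f q.1 * (starRingEnd ℂ) (f q.2)) * (((q.1 : ℂ) - t - ε * Complex.I)⁻¹ *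
          ((q.2 : ℂ) - t + δ * Complex.I)⁻¹) := by
      intro t
      simp only [map_div₀, map_sub, map_mul, Complex.conj_ofReal, Complex.conj_I]
      rw [show (q.2 : ℂ) - t - δ * -Complex.I = (q.2 : ℂ) - t + δ * Complex.I by ring]
      ring
    simp only [e]
    rw [integral_const_mul, this]
    ring
  have hI2 : Integrable (fun q : ℝ × ℝ => -(2 * Real.pi * Complex.I) * ((starRingEnd ℂ) (f q.2) *
        (f q.1 / ((q.1 : ℂ) - q.2 - ((ε + δ : ℝ) : ℂ) * Complex.I)))) (volume.prod volume) := by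
    have := hI.integral_prod_right
    simpa only [hin] using this
  simp only [hin]
  rw [← integral_const_mul]
  rw [Measure.volume_eq_prod, integral_prod_symm _ hI2]
  refine integral_congr_ae (Eventually.of_forall fun v => ?_)
  simp only
  rw [lineCauchy, ← integral_const_mul, ← integral_const_mul]

/-! ### `L²` norms as lower integrals, Cauchy–Schwarz and dominated convergence -/

section L2tools
variable {α : Type*} [MeasurableSpace α] {μ : Measure α}

lemma eLpNorm_two_sq {E : Type*} [NormedAddCommGroup E] (f : α → E) :
    eLpNorm f 2 μ ^ 2 = ∫⁻ x, ‖f x‖ₑ ^ 2 ∂μ := by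
  rw [eLpNorm_eq_lintegral_rpow_enorm_toReal (by norm_num) (by norm_num)]
  simp only [ENNReal.toReal_ofNat, ENNReal.rpow_ofNat]
  rw [← ENNReal.rpow_natCast, ← ENNReal.rpow_mul]
  norm_num

lemma lintegral_mul_sq_le {f g : α → ℝ≥0∞} (hf : AEMeasurable f μ) (hg : AEMeasurable g μ) :
    (∫⁻ x, f x * g x ∂μ) ^ 2 ≤ (∫⁻ x, f x ^ 2 ∂μ) * ∫⁻ x, g x ^ 2 ∂μ := by
  have h := ENNReal.lintegral_mul_le_Lp_mul_Lq μ Real.HolderConjugate.two_two hf hg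
  simp only [Pi.mul_apply, ENNReal.rpow_ofNat] at h
  calc _ ≤ ((∫⁻ x, f x ^ 2 ∂μ) ^ (1 / 2 : ℝ) * (∫⁻ x, g x ^ 2 ∂μ) ^ (1 / 2 : ℝ)) ^ 2 := by gcongr
    _ = _ := by
      rw [mul_pow, ← ENNReal.rpow_natCast, ← ENNReal.rpow_natCast, ← ENNReal.rpow_mul,
        ← ENNReal.rpow_mul]
      norm_num

/-- The Cauchy-Schwarz inequality for the measure with density `k`. -/
lemma lintegral_mul_sq_le_weighted {g k : α → ℝ≥0∞} (hg : AEMeasurable g μ)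
    (hk : AEMeasurable k μ) :
    (∫⁻ x, g x * k x ∂μ) ^ 2 ≤ (∫⁻ x, k x ∂μ) * ∫⁻ x, g x ^ 2 * k x ∂μ := by
  have hsq : ∀ x, k x = (k x ^ (1 / 2 : ℝ)) ^ 2 := fun x => by
    rw [← ENNReal.rpow_natCast, ← ENNReal.rpow_mul]; norm_num
  have h := lintegral_mul_sq_le (hk.pow_const (1 / 2 : ℝ)) (hg.mul (hk.pow_const (1 / 2 : ℝ)))
  calc _ = (∫⁻ x, k x ^ (1 / 2 : ℝ) * (g x * k x ^ (1 / 2 : ℝ)) ∂μ) ^ 2 := by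
        congr 2 with x
        conv_lhs => rw [hsq x]
        ring
    _ ≤ _ := h
    _ = _ := by
        congr 1
        · congr 1 with x
          exact (hsq x).symm
        · congr 1 with x
          simp only [Pi.mul_apply]
          rw [mul_pow, ← hsq x]

lemma tendsto_eLpNorm_two_iff {ι E : Type*} [NormedAddCommGroup E] {l : Filter ι}
    (F : ι → α → E) :
    Tendsto (fun i => eLpNorm (F i) 2 μ) l (𝓝 0) ↔
      Tendsto (fun i => ∫⁻ x, ‖F i x‖ₑ ^ 2 ∂μ) l (𝓝 0) := by
  simp only [← eLpNorm_two_sq]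
  constructor
  · intro h
    simpa [Function.comp_def] using ((ENNReal.continuous_pow 2).tendsto 0).comp h
  · intro h
    have := ((ENNReal.continuous_rpow_const (y := (1 / 2 : ℝ))).tendsto 0).comp h
    have e : ∀ x : ℝ≥0∞, (x ^ 2) ^ (2⁻¹ : ℝ) = x := fun x => by
      rw [← ENNReal.rpow_natCast, ← ENNReal.rpow_mul]; norm_num
    simpa [Function.comp_def, e] using this

lemma norm_toLp_two_sq {E : Type*} [NormedAddCommGroup E] {f : α → E} (hf : MemLp f 2 μ) :
    ‖hf.toLp f‖ ^ 2 = ∫ x, ‖f x‖ ^ 2 ∂μ := by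
  rw [Lp.norm_toLp, ← ENNReal.toReal_pow, eLpNorm_two_sq,
    integral_eq_lintegral_of_nonneg_ae (f := fun x => ‖f x‖ ^ 2)
      (Eventually.of_forall fun x => by positivity) (hf.1.norm.pow 2)]
  congr 2 with x
  rw [ENNReal.ofReal_pow (norm_nonneg _), ofReal_norm]

/-- Dominated convergence along a countably generated filter, for almost everywhere measurable
functions. -/
lemma tendsto_lintegral_of_dominated {ι : Type*} {l : Filter ι} [l.IsCountablyGenerated]
    {F : ι → α → ℝ≥0∞} {f : α → ℝ≥0∞} (bound : α → ℝ≥0∞)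
    (hF : ∀ᶠ i in l, AEMeasurable (F i) μ) (hb : ∀ᶠ i in l, ∀ᵐ x ∂μ, F i x ≤ bound x)
    (hfin : ∫⁻ x, bound x ∂μ ≠ ⊤) (hlim : ∀ᵐ x ∂μ, Tendsto (fun i => F i x) l (𝓝 (f x))) :
    Tendsto (fun i => ∫⁻ x, F i x ∂μ) l (𝓝 (∫⁻ x, f x ∂μ)) := by
  rw [tendsto_iff_seq_tendsto]
  intro x hx
  have h := (hx.eventually (hF.and hb))
  obtain ⟨N, hN⟩ := eventually_atTop.1 h
  rw [← tendsto_add_atTop_iff_nat N]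
  refine tendsto_lintegral_of_dominated_convergence' bound (fun n => (hN _ (by omega)).1)
    (fun n => (hN _ (by omega)).2) hfin ?_
  filter_upwards [hlim] with a ha
  exact (ha.comp hx).comp (tendsto_add_atTop_nat N)

end L2tools

/-! ### Convergence in `L²` of the Cauchy integral on the real line -/

/-- A function on `(0, ∞)` which is midpoint convex and bounded at infinity is decreasing. -/
lemma antitoneOn_of_midpoint_convex {φ : ℝ → ℝ}
    (hconv : ∀ a b, 0 < a → 0 < b → 2 * φ ((a + b) / 2) ≤ φ a + φ b)
    (hbdd : ∀ x, 0 < x → ∃ M, ∀ y, x ≤ y → φ y ≤ M) : AntitoneOn φ (Ioi 0) := by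
  intro x hx y hy hxy
  by_contra! hlt
  have hx : 0 < x := hx
  obtain ⟨M, hM⟩ := hbdd x hx
  set d := y - x with hd
  have hd0 : 0 ≤ d := by linarith
  -- Midpoint convexity makes the increments along an arithmetic progression nondecreasing, so a
  -- single strict increase forces linear growth and contradicts the bound.
  have hinc : ∀ n : ℕ, φ y - φ x ≤ φ (x + (n + 1) * d) - φ (x + n * d) := by
    intro n
    induction n with
    | zero => simp [hd]
    | succ n ih =>
      have h := hconv (x + n * d) (x + (n + 2) * d) (by positivity) (by positivity)
      rw [show (x + n * d + (x + (n + 2) * d)) / 2 = x + (n + 1) * d by ring] at h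
      push_cast
      rw [show (n + 1 + 1 : ℝ) = n + 2 by ring]
      linarith
  have hsum : ∀ n : ℕ, φ x + n * (φ y - φ x) ≤ φ (x + n * d) := by
    intro n
    induction n with
    | zero => simp
    | succ n ih =>
      have := hinc n
      push_cast
      linarith
  obtain ⟨n, hn⟩ := exists_nat_gt ((M - φ x) / (φ y - φ x))
  rw [div_lt_iff₀ (by linarith)] at hn
  have h1 := hsum n
  have h2 := hM (x + n * d) (by nlinarith [(Nat.cast_nonneg n : (0 : ℝ) ≤ n)])
  linarith

lemma norm_lineCauchy_le {f : ℝ → ℂ} (hf : Integrable f) {ε : ℝ} (hε : 0 < ε) (t : ℝ) :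
    ‖lineCauchy ε f t‖ ≤ (∫ u, ‖f u‖) / ε := by
  rw [lineCauchy, div_eq_mul_inv, ← integral_mul_const]
  refine norm_integral_le_of_norm_le (hf.norm.mul_const _) (Eventually.of_forall fun u => ?_)
  rw [norm_div, div_eq_mul_inv]
  refine mul_le_mul_of_nonneg_left ?_ (norm_nonneg _)
  refine inv_anti₀ hε ?_
  refine le_of_sq_le_sq ?_ (norm_nonneg _)
  rw [norm_sq_sub_sub_mul_I]
  nlinarith [sq_nonneg (u - t)]

lemma aestronglyMeasurable_lineCauchy {f : ℝ → ℂ} (hf : AEStronglyMeasurable f) (ε : ℝ) :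
    AEStronglyMeasurable (lineCauchy ε f) := by
  have h : AEStronglyMeasurable (fun p : ℝ × ℝ => f p.2 / ((p.2 : ℂ) - p.1 - ε * Complex.I))
      (volume.prod volume) := by
    simp only [div_eq_mul_inv]
    exact hf.comp_snd.mul (by fun_prop : Measurable _).aestronglyMeasurable
  exact h.integral_prod_right'

lemma memLp_lineCauchy {f : ℝ → ℂ} (hf : Integrable f) {ε : ℝ} (hε : 0 < ε) :
    MemLp (lineCauchy ε f) 2 := by
  rw [memLp_two_iff_integrable_sq_norm (aestronglyMeasurable_lineCauchy hf.1 ε)]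
  refine (integrable_lineCauchy_mul_conj hf hε hε).norm.congr (Eventually.of_forall fun t => ?_)
  simp only [norm_mul, RCLike.norm_conj, sq]

/-- The quadratic form of the Cauchy integral. -/
def cauchyForm (f : ℝ → ℂ) (s : ℝ) : ℝ :=
  (-(2 * Real.pi * Complex.I) * ∫ v, (starRingEnd ℂ) (f v) * lineCauchy s f v).re

/-- Expand the square and use the dependence on the sum of heights. Nonnegativity of the left side
is midpoint convexity of `cauchyForm`; smallness of the right side will be the Cauchy criterion. -/
lemma integral_norm_sub_sq_lineCauchy {f : ℝ → ℂ} (hf : Integrable f) {ε δ : ℝ} (hε : 0 < ε)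
    (hδ : 0 < δ) :
    ∫ t, ‖lineCauchy ε f t - lineCauchy δ f t‖ ^ 2 =
      cauchyForm f (ε + ε) + cauchyForm f (δ + δ) - 2 * cauchyForm f (ε + δ) := by
  have hre : ∀ {ε δ : ℝ} (_ : 0 < ε) (_ : 0 < δ),
      ∫ t, (lineCauchy ε f t * (starRingEnd ℂ) (lineCauchy δ f t)).re = cauchyForm f (ε + δ) := by
    intro ε δ hε hδ
    rw [cauchyForm, ← integral_lineCauchy_mul_conj hf hε hδ]
    exact integral_re (integrable_lineCauchy_mul_conj hf hε hδ)
  have hi : ∀ {ε δ : ℝ} (_ : 0 < ε) (_ : 0 < δ),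
      Integrable fun t => (lineCauchy ε f t * (starRingEnd ℂ) (lineCauchy δ f t)).re :=
    fun hε hδ => (integrable_lineCauchy_mul_conj hf hε hδ).re
  rw [← hre hε hε, ← hre hδ hδ, ← hre hε hδ, ← integral_add (hi hε hε) (hi hδ hδ),
    ← integral_const_mul]
  refine Eq.trans ?_ (integral_sub ((hi hε hε).add (hi hδ hδ)) ((hi hε hδ).const_mul 2))
  refine integral_congr_ae (Eventually.of_forall fun t => ?_)
  simp only
  rw [← Complex.normSq_eq_norm_sq]
  simp [Complex.normSq_apply]
  ring

lemma integral_norm_sq_lineCauchy {f : ℝ → ℂ} (hf : Integrable f) {ε : ℝ} (hε : 0 < ε) :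
    ∫ t, ‖lineCauchy ε f t‖ ^ 2 = cauchyForm f (ε + ε) := by
  rw [cauchyForm, ← integral_lineCauchy_mul_conj hf hε hε]
  refine Eq.trans ?_ (integral_re (integrable_lineCauchy_mul_conj hf hε hε))
  refine integral_congr_ae (Eventually.of_forall fun t => ?_)
  simp only
  rw [← Complex.normSq_eq_norm_sq]
  simp [Complex.normSq_apply]

/-- A crude bound by the `L¹` norm, needed only to keep the form bounded away from 0. -/
lemma cauchyForm_le {f : ℝ → ℂ} (hf : Integrable f) {s : ℝ} (hs : 0 < s) :
    cauchyForm f s ≤ 2 * Real.pi * (∫ u, ‖f u‖) ^ 2 / s := by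
  refine (Complex.re_le_norm _).trans ?_
  rw [norm_mul, norm_neg]
  have h : ‖∫ v, (starRingEnd ℂ) (f v) * lineCauchy s f v‖ ≤ (∫ u, ‖f u‖) * ((∫ u, ‖f u‖) / s) := by
    rw [← integral_mul_const]
    refine norm_integral_le_of_norm_le (hf.norm.mul_const _) (Eventually.of_forall fun u => ?_)
    rw [norm_mul, RCLike.norm_conj]
    exact mul_le_mul_of_nonneg_left (norm_lineCauchy_le hf hs u) (norm_nonneg _)
  have h2 : ‖(2 * Real.pi * Complex.I : ℂ)‖ = 2 * Real.pi := by
    simp [abs_of_pos Real.pi_pos]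
  rw [h2]
  calc _ ≤ 2 * Real.pi * ((∫ u, ‖f u‖) * ((∫ u, ‖f u‖) / s)) := by gcongr
    _ = _ := by ring

lemma antitoneOn_cauchyForm {f : ℝ → ℂ} (hf : Integrable f) :
    AntitoneOn (cauchyForm f) (Ioi 0) := by
  refine antitoneOn_of_midpoint_convex (fun a b ha hb => ?_) fun x hx =>
    ⟨2 * Real.pi * (∫ u, ‖f u‖) ^ 2 / x, fun y hy => (cauchyForm_le hf (hx.trans_le hy)).trans ?_⟩
  · have h := integral_norm_sub_sq_lineCauchy hf (half_pos ha) (half_pos hb)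
    have h0 : 0 ≤ ∫ t, ‖lineCauchy (a / 2) f t - lineCauchy (b / 2) f t‖ ^ 2 := by positivity
    rw [h, add_halves, add_halves] at h0
    rw [add_div]
    linarith
  · gcongr

/-- With φ the form, AM–GM with weights π and 1/(4π) gives φ(s) ≤ 2π²‖f‖² + φ(2s)/2. Monotonicity
replaces φ(2s) by φ(s), and the last term is absorbed into the left side. -/
lemma cauchyForm_le_integral_norm_sq {f : ℝ → ℂ} (hf : Integrable f) (hf2 : MemLp f 2) {s : ℝ}
    (hs : 0 < s) : cauchyForm f s ≤ 4 * Real.pi ^ 2 * ∫ u, ‖f u‖ ^ 2 := by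
  have hπ := Real.pi_pos
  have i1 : Integrable fun u => ‖f u‖ ^ 2 := (memLp_two_iff_integrable_sq_norm hf2.1).1 hf2
  have hT := memLp_lineCauchy hf hs
  have i2 : Integrable fun u => ‖lineCauchy s f u‖ ^ 2 := (memLp_two_iff_integrable_sq_norm hT.1).1 hT
  have h : ‖∫ v, (starRingEnd ℂ) (f v) * lineCauchy s f v‖ ≤
      Real.pi * (∫ u, ‖f u‖ ^ 2) + (4 * Real.pi)⁻¹ * ∫ u, ‖lineCauchy s f u‖ ^ 2 := by
    rw [← integral_const_mul, ← integral_const_mul, ← integral_add (i1.const_mul _) (i2.const_mul _)]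
    refine norm_integral_le_of_norm_le ((i1.const_mul _).add (i2.const_mul _))
      (Eventually.of_forall fun u => ?_)
    rw [norm_mul, RCLike.norm_conj]
    have e : Real.pi * ‖f u‖ ^ 2 + (4 * Real.pi)⁻¹ * ‖lineCauchy s f u‖ ^ 2 -
        ‖f u‖ * ‖lineCauchy s f u‖ =
        (4 * Real.pi)⁻¹ * (2 * Real.pi * ‖f u‖ - ‖lineCauchy s f u‖) ^ 2 := by
      field_simp
      ring
    have : 0 ≤ (4 * Real.pi)⁻¹ * (2 * Real.pi * ‖f u‖ - ‖lineCauchy s f u‖) ^ 2 := by positivity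
    linarith
  rw [integral_norm_sq_lineCauchy hf hs] at h
  have hanti := antitoneOn_cauchyForm hf (mem_Ioi.2 hs) (mem_Ioi.2 (by linarith : 0 < s + s))
    (by linarith)
  have h2 : ‖(2 * Real.pi * Complex.I : ℂ)‖ = 2 * Real.pi := by
    simp [abs_of_pos Real.pi_pos]
  have h3 : cauchyForm f s ≤ 2 * Real.pi *
      (Real.pi * (∫ u, ‖f u‖ ^ 2) + (4 * Real.pi)⁻¹ * cauchyForm f s) := by
    refine (Complex.re_le_norm _).trans ?_
    rw [norm_mul, norm_neg, h2]
    refine mul_le_mul_of_nonneg_left (h.trans ?_) (by positivity)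
    gcongr
  have h4 : 2 * Real.pi * (Real.pi * (∫ u, ‖f u‖ ^ 2) + (4 * Real.pi)⁻¹ * cauchyForm f s) =
      2 * Real.pi ^ 2 * (∫ u, ‖f u‖ ^ 2) + cauchyForm f s / 2 := by
    field_simp
    ring
  rw [h4] at h3
  linarith

/-- The Cauchy integral of an integrable `L²` function has `L²` boundary values. -/
theorem exists_tendsto_lineCauchy {f : ℝ → ℂ} (hf : Integrable f) (hf2 : MemLp f 2) :
    ∃ h : ℝ → ℂ, MemLp h 2 ∧
      Tendsto (fun ε => eLpNorm (lineCauchy ε f - h) 2) (𝓝[>] 0) (𝓝 0) := by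
  have hbdd : BddAbove (cauchyForm f '' Ioi 0) :=
    ⟨_, by rintro _ ⟨s, hs, rfl⟩; exact cauchyForm_le_integral_norm_sq hf hf2 hs⟩
  obtain ⟨L, hL⟩ : ∃ L, Tendsto (cauchyForm f) (𝓝[>] 0) (𝓝 L) := by
    exact ⟨_, AntitoneOn.tendsto_nhdsGT (antitoneOn_cauchyForm hf) hbdd⟩
  have hpos : ∀ᶠ ε : ℝ in 𝓝[>] 0, 0 < ε := self_mem_nhdsWithin
  let F : ℝ → Lp ℂ 2 (volume : Measure ℝ) := fun ε =>
    if h : 0 < ε then (memLp_lineCauchy hf h).toLp _ else 0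
  have hF : ∀ {ε} (h : 0 < ε), F ε = (memLp_lineCauchy hf h).toLp _ := fun h => dif_pos h
  have hcauchy : Cauchy (map F (𝓝[>] 0)) := by
    rw [cauchy_map_iff]
    refine ⟨inferInstance, ?_⟩
    rw [tendsto_uniformity_iff_dist_tendsto_zero]
    -- The three sums of heights all tend to 0 from the right, where the monotone bounded form has
    -- one limit L; the squared distances therefore tend to L + L − 2L.
    have hlim : Tendsto (fun p : ℝ × ℝ => cauchyForm f (p.1 + p.1) + cauchyForm f (p.2 + p.2) -
        2 * cauchyForm f (p.1 + p.2)) (𝓝[>] 0 ×ˢ 𝓝[>] 0) (𝓝 (L + L - 2 * L)) := by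
      have hadd : ∀ g : ℝ × ℝ → ℝ × ℝ, Tendsto g (𝓝[>] 0 ×ˢ 𝓝[>] 0) (𝓝[>] 0 ×ˢ 𝓝[>] 0) →
          Tendsto (fun p => (g p).1 + (g p).2) (𝓝[>] 0 ×ˢ 𝓝[>] 0) (𝓝[>] (0 : ℝ)) := by
        intro g hg
        rw [tendsto_nhdsWithin_iff]
        have h1 : Tendsto (fun p => (g p).1) (𝓝[>] 0 ×ˢ 𝓝[>] 0) (𝓝[>] (0 : ℝ)) :=
          tendsto_fst.comp hg
        have h2 : Tendsto (fun p => (g p).2) (𝓝[>] 0 ×ˢ 𝓝[>] 0) (𝓝[>] (0 : ℝ)) :=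
          tendsto_snd.comp hg
        refine ⟨?_, ?_⟩
        · simpa using (tendsto_nhds_of_tendsto_nhdsWithin h1).add
            (tendsto_nhds_of_tendsto_nhdsWithin h2)
        · filter_upwards [h1.eventually hpos, h2.eventually hpos] with p h1 h2
          exact add_pos h1 h2
      refine ((hL.comp ?_).add (hL.comp ?_)).sub ((hL.comp ?_).const_mul 2)
      · exact hadd (fun p => (p.1, p.1)) (tendsto_fst.prodMk tendsto_fst)
      · exact hadd (fun p => (p.2, p.2)) (tendsto_snd.prodMk tendsto_snd)
      · exact hadd id tendsto_id
    rw [show L + L - 2 * L = 0 by ring] at hlim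
    have hsq : Tendsto (fun p : ℝ × ℝ => dist (F p.1) (F p.2) ^ 2) (𝓝[>] 0 ×ˢ 𝓝[>] 0) (𝓝 0) := by
      refine hlim.congr' ?_
      filter_upwards [prod_mem_prod self_mem_nhdsWithin self_mem_nhdsWithin] with p hp
      rw [← integral_norm_sub_sq_lineCauchy hf hp.1 hp.2, hF hp.1, hF hp.2, dist_eq_norm,
        ← MemLp.toLp_sub, norm_toLp_two_sq]
      rfl
    have := hsq.sqrt
    simpa [Real.sqrt_sq dist_nonneg] using this
  obtain ⟨g, hg⟩ := CompleteSpace.complete hcauchy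
  refine ⟨g, Lp.memLp g, ?_⟩
  have hg' : Tendsto F (𝓝[>] 0) (𝓝 g) := hg
  rw [Lp.tendsto_Lp_iff_tendsto_eLpNorm'] at hg'
  refine hg'.congr' ?_
  filter_upwards [hpos] with ε hε
  refine eLpNorm_congr_ae ?_
  rw [hF hε]
  filter_upwards [(memLp_lineCauchy hf hε).coeFn_toLp] with t ht
  simp [ht]

/-! ### The Poisson kernel as an approximate identity in `L²` -/

/-- Continuity of translations in `L²`, from the joint continuity of composition with measure
preserving continuous maps. -/
lemma tendsto_lintegral_translate_sub {f : ℝ → ℂ} (hf : MemLp f 2) :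
    Tendsto (fun x => ∫⁻ t, ‖f (t + x) - f t‖ₑ ^ 2) (𝓝 0) (𝓝 0) := by
  rw [← tendsto_eLpNorm_two_iff (F := fun x t => f (t + x) - f t)]
  let g : ℝ → C(ℝ, ℝ) := fun x => ⟨fun t => t + x, by fun_prop⟩
  have hg : Tendsto g (𝓝 0) (𝓝 (g 0)) :=
    (ContinuousMap.curry ⟨fun p : ℝ × ℝ => p.2 + p.1, by fun_prop⟩).continuous.tendsto 0
  have hgm : ∀ x, MeasurePreserving (g x) volume volume := fun x =>
    measurePreserving_add_right volume x
  have h := (tendsto_const_nhds (x := hf.toLp f)).compMeasurePreservingLp hg hgm (hgm 0)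
    (by norm_num)
  rw [Lp.tendsto_Lp_iff_tendsto_eLpNorm'] at h
  refine h.congr fun x => eLpNorm_congr_ae ?_
  have e : ∀ x, (Lp.compMeasurePreserving (g x) (hgm x) (hf.toLp f) : ℝ → ℂ) =ᵐ[volume]
      fun t => f (t + x) := fun x => by
    rw [Lp.toLp_compMeasurePreserving]
    exact MemLp.coeFn_toLp _
  filter_upwards [e x, e 0] with t h1 h2
  rw [Pi.sub_apply, h1, h2, add_zero]

/-- The mean oscillation of `f` at `t` with respect to the Poisson kernel of height `ε`. -/
def poissonOsc (f : ℝ → ℂ) (ε t : ℝ) : ℝ≥0∞ :=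
  ∫⁻ y, ‖f (t + ε * y) - f t‖ₑ * ENNReal.ofReal ((1 + y ^ 2)⁻¹)

/-- For ε ≠ 0 the map (t, y) ↦ t + εy pulls null sets back to null sets, so an almost everywhere
measurable `f` may be composed with it. -/
lemma aemeasurable_translate {f : ℝ → ℂ} (hf : AEStronglyMeasurable f) (ε : ℝ) (hε : ε ≠ 0) :
    AEMeasurable (fun p : ℝ × ℝ => ‖f (p.1 + ε * p.2) - f p.1‖ₑ) (volume.prod volume) := by
  have hq : Measure.QuasiMeasurePreserving (fun p : ℝ × ℝ => p.1 + ε * p.2)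
      (volume.prod volume) volume := by
    refine ⟨by fun_prop, Measure.AbsolutelyContinuous.mk fun s hs h0 => ?_⟩
    rw [Measure.map_apply (by fun_prop) hs,
      Measure.measure_prod_null ((by fun_prop : Measurable fun p : ℝ × ℝ => p.1 + ε * p.2) hs)]
    refine Eventually.of_forall fun x => ?_
    have h1 := Real.volume_preimage_mul_left hε ((fun y => x + y) ⁻¹' s)
    rw [measure_preimage_add, h0, mul_zero] at h1
    exact h1
  exact ((hf.comp_quasiMeasurePreserving hq).sub hf.comp_fst).enorm

lemma measurable_inv_one_add_sq : Measurable fun y : ℝ => ENNReal.ofReal ((1 + y ^ 2)⁻¹) := by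
  fun_prop

lemma aemeasurable_poissonOsc {f : ℝ → ℂ} (hf : AEStronglyMeasurable f) (ε : ℝ) (hε : ε ≠ 0) :
    AEMeasurable (poissonOsc f ε) := by
  have h : AEMeasurable (fun p : ℝ × ℝ => ‖f (p.1 + ε * p.2) - f p.1‖ₑ *
      ENNReal.ofReal ((1 + p.2 ^ 2)⁻¹)) (volume.prod volume) :=
    (aemeasurable_translate hf ε hε).mul (measurable_inv_one_add_sq.comp measurable_snd).aemeasurable
  exact h.lintegral_prod_right'

/-- Cauchy–Schwarz for the finite weight 1/(1+y²) and Tonelli bound the integral by an average over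
y of the `L²` modulus of continuity at εy. That modulus is bounded by (2‖f‖)² and tends to 0 for
each y, so dominated convergence applies. -/
theorem tendsto_lintegral_poissonOsc_sq {f : ℝ → ℂ} (hf : MemLp f 2) :
    Tendsto (fun ε => ∫⁻ t, poissonOsc f ε t ^ 2) (𝓝[>] 0) (𝓝 0) := by
  set k : ℝ → ℝ≥0∞ := fun y => ENNReal.ofReal ((1 + y ^ 2)⁻¹) with hk
  have hkm : Measurable k := measurable_inv_one_add_sq
  set osc : ℝ → ℝ≥0∞ := fun x => ∫⁻ t, ‖f (t + x) - f t‖ₑ ^ 2 with hosc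
  have hkfin : ∫⁻ y, k y ≠ ⊤ := by
    have := integrable_inv_one_add_sq.lintegral_lt_top
    exact this.ne
  have hle : ∀ ε : ℝ, 0 < ε → ∫⁻ t, poissonOsc f ε t ^ 2 ≤ (∫⁻ y, k y) * ∫⁻ y, osc (ε * y) * k y := by
    intro ε hε
    have hm := aemeasurable_translate hf.1 ε hε.ne'
    have hm2 : AEMeasurable (fun p : ℝ × ℝ => ‖f (p.1 + ε * p.2) - f p.1‖ₑ ^ 2 * k p.2)
      (volume.prod volume) := (hm.pow_const 2).mul (hkm.comp measurable_snd).aemeasurable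
    calc ∫⁻ t, poissonOsc f ε t ^ 2
        ≤ ∫⁻ t, (∫⁻ y, k y) * ∫⁻ y, ‖f (t + ε * y) - f t‖ₑ ^ 2 * k y := by
          refine lintegral_mono_ae ?_
          filter_upwards [hm.aestronglyMeasurable.prodMk_left] with t ht
          exact lintegral_mul_sq_le_weighted ht.aemeasurable hkm.aemeasurable
      _ = (∫⁻ y, k y) * ∫⁻ t, ∫⁻ y, ‖f (t + ε * y) - f t‖ₑ ^ 2 * k y :=
          lintegral_const_mul' _ _ hkfin
      _ = (∫⁻ y, k y) * ∫⁻ y, osc (ε * y) * k y := by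
          rw [lintegral_lintegral_swap hm2]
          congr 2 with y
          rw [lintegral_mul_const' _ _ (by simp [hk])]
  have hosc_le : ∀ x, osc x ≤ (2 * eLpNorm f 2) ^ 2 := by
    intro x
    have hmp := measurePreserving_add_right (volume : Measure ℝ) x
    have e : eLpNorm (fun t => f (t + x)) 2 = eLpNorm f 2 :=
      eLpNorm_comp_measurePreserving hf.1 hmp
    rw [hosc]
    simp only
    rw [← eLpNorm_two_sq]
    gcongr
    have := eLpNorm_sub_le (p := 2) (hf.1.comp_measurePreserving hmp) hf.1 (by norm_num)
    refine this.trans ?_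
    rw [show (f ∘ fun t => t + x) = fun t => f (t + x) from rfl, e, two_mul]
  have hlim : Tendsto (fun ε : ℝ => (∫⁻ y, k y) * ∫⁻ y, osc (ε * y) * k y) (𝓝[>] 0) (𝓝 0) := by
    have h0 : Tendsto (fun ε : ℝ => ∫⁻ y, osc (ε * y) * k y) (𝓝[>] 0) (𝓝 (∫⁻ _ : ℝ, 0)) := by
      refine tendsto_lintegral_of_dominated
        (fun y => (2 * eLpNorm f 2) ^ 2 * k y) ?_ ?_ ?_ ?_
      · filter_upwards [self_mem_nhdsWithin] with ε hε
        exact (((aemeasurable_translate hf.1 ε (ne_of_gt hε)).pow_const 2).lintegral_prod_left').mul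
          hkm.aemeasurable
      · exact Eventually.of_forall fun ε => Eventually.of_forall fun y => by
          gcongr; exact hosc_le _
      · rw [lintegral_const_mul _ hkm]
        exact ENNReal.mul_ne_top (ENNReal.pow_ne_top (ENNReal.mul_ne_top (by norm_num) hf.2.ne)) hkfin
      · refine Eventually.of_forall fun y => ?_
        have h1 : Tendsto (fun ε : ℝ => ε * y) (𝓝[>] 0) (𝓝 0) := by
          have : Tendsto (fun ε : ℝ => ε * y) (𝓝 0) (𝓝 (0 * y)) := (continuous_mul_const y).tendsto 0
          rw [zero_mul] at this
          exact this.mono_left nhdsWithin_le_nhds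
        have h2 := (tendsto_lintegral_translate_sub hf).comp h1
        have := ENNReal.Tendsto.mul_const (b := k y) h2 (Or.inr (by simp [hk]))
        simpa [hosc, Function.comp_def] using this
    have := ENNReal.Tendsto.const_mul (a := ∫⁻ y, k y) h0 (Or.inr hkfin)
    simpa using this
  refine tendsto_of_tendsto_of_tendsto_of_le_of_le' tendsto_const_nhds hlim
    (Eventually.of_forall fun _ => zero_le) ?_
  filter_upwards [self_mem_nhdsWithin] with ε hε using hle ε hε

/-! ### The Schur test for a kernel homogeneous of degree `-1` -/

/-- The weight `|u|^{-1/2}` of the Schur test. -/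
def schurWeight (u : ℝ) : ℝ≥0∞ := ENNReal.ofReal (|u| ^ (-(1 / 2) : ℝ))

/-- The constant of the Schur test. -/
def schurConst : ℝ≥0∞ := ∫⁻ x : ℝ, ENNReal.ofReal ((1 + |x|)⁻¹) * schurWeight x

lemma measurable_schurWeight : Measurable schurWeight := by
  unfold schurWeight; fun_prop

/-- The integrand behaves like |x|^(-1/2) at 0 and like |x|^(-3/2) at infinity. -/
lemma schurConst_lt_top : schurConst < ⊤ := by
  have h1 : IntegrableOn (fun x : ℝ => (1 + x)⁻¹ * x ^ (-(1 / 2) : ℝ)) (Ioi 0) := by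
    rw [← Ioc_union_Ioi_eq_Ioi zero_le_one]
    refine IntegrableOn.union ?_ ?_
    · have : IntegrableOn (fun x : ℝ => x ^ (-(1 / 2) : ℝ)) (Ioc 0 1) :=
        (intervalIntegrable_iff_integrableOn_Ioc_of_le zero_le_one).1
          (intervalIntegral.intervalIntegrable_rpow' (by norm_num))
      refine this.mono' (by fun_prop) ?_
      filter_upwards [ae_restrict_mem measurableSet_Ioc] with x hx
      have hx0 : 0 < x := hx.1
      rw [Real.norm_of_nonneg (by positivity)]
      exact mul_le_of_le_one_left (by positivity) (inv_le_one_of_one_le₀ (by linarith))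
    · have : IntegrableOn (fun x : ℝ => x ^ (-(3 / 2) : ℝ)) (Ioi 1) :=
        integrableOn_Ioi_rpow_of_lt (by norm_num) one_pos
      refine this.mono' (by fun_prop) ?_
      filter_upwards [ae_restrict_mem measurableSet_Ioi] with x hx
      have hx0 : 0 < x := one_pos.trans hx
      rw [Real.norm_of_nonneg (by positivity)]
      have e : x ^ (-(3 / 2) : ℝ) = x⁻¹ * x ^ (-(1 / 2) : ℝ) := by
        rw [← Real.rpow_neg_one, ← Real.rpow_add hx0]; norm_num
      rw [e]
      gcongr
      linarith
  have h2 : Integrable (fun x : ℝ => (1 + |x|)⁻¹ * |x| ^ (-(1 / 2) : ℝ)) :=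
by
    have hpos : IntegrableOn (fun x : ℝ => (1 + |x|)⁻¹ * |x| ^ (-(1 / 2) : ℝ)) (Ioi 0) :=
      h1.congr_fun (fun x hx => by simp only [abs_of_pos (mem_Ioi.1 hx)]) measurableSet_Ioi
    have hneg : IntegrableOn (fun x : ℝ => (1 + |x|)⁻¹ * |x| ^ (-(1 / 2) : ℝ)) (Iio 0) := by
      have := (Measure.measurePreserving_neg (volume : Measure ℝ)).integrableOn_comp_preimage
        (Homeomorph.neg ℝ).measurableEmbedding
          (f := fun x : ℝ => (1 + |x|)⁻¹ * |x| ^ (-(1 / 2) : ℝ)) (s := Ioi 0)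
      simpa [Function.comp_def] using this.2 hpos
    rw [← integrableOn_univ, ← Iio_union_Ici (a := (0 : ℝ))]
    exact hneg.union ((integrableOn_Ici_iff_integrableOn_Ioi (by simp)).2 hpos)
  have h3 := h2.lintegral_lt_top
  refine lt_of_le_of_lt (lintegral_mono fun x => ?_) h3
  simp only [schurWeight]
  rw [ENNReal.ofReal_mul (by positivity)]

/-- The kernel is homogeneous of degree −1, so the substitution u = tx shows that the weight is an
eigenfunction. -/
lemma lintegral_schurKernel (t : ℝ) (ht : t ≠ 0) :
    ∫⁻ u : ℝ, ENNReal.ofReal ((|t| + |u|)⁻¹) * schurWeight u = schurConst * schurWeight t := by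
  have ht' : 0 < |t| := abs_pos.2 ht
  have hmeas : Measurable fun u : ℝ => ENNReal.ofReal ((|t| + |u|)⁻¹) * schurWeight u :=
    (by fun_prop : Measurable fun u : ℝ => ENNReal.ofReal ((|t| + |u|)⁻¹)).mul measurable_schurWeight
  conv_lhs => rw [← Real.smul_map_volume_mul_left ht]
  rw [lintegral_smul_measure, lintegral_map hmeas (by fun_prop), schurConst, mul_comm,
    ← lintegral_const_mul' _ _ (by simp [schurWeight]), smul_eq_mul,
    ← lintegral_const_mul' _ _ (by simp)]
  congr 1 with x
  simp only [schurWeight]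
  rw [← ENNReal.ofReal_mul (by positivity), ← ENNReal.ofReal_mul (by positivity),
    ← ENNReal.ofReal_mul (by positivity), ← ENNReal.ofReal_mul (by positivity)]
  congr 1
  rw [abs_mul, Real.mul_rpow (abs_nonneg _) (abs_nonneg _)]
  have : |t| + |t| * |x| = |t| * (1 + |x|) := by ring
  rw [this, mul_inv]
  field_simp

/-- Write g = (g/w)·w with the weight w and apply Cauchy–Schwarz with the kernel as density. The
eigenfunction property is used once in each variable, which gives the square of the constant. -/
lemma schur_sq_le {g : ℝ → ℝ≥0∞} (hg : AEMeasurable g) :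
    ∫⁻ t : ℝ, (∫⁻ u : ℝ, g u * ENNReal.ofReal ((|t| + |u|)⁻¹)) ^ 2 ≤
      schurConst ^ 2 * ∫⁻ u, g u ^ 2 := by
  have hkm : Measurable fun p : ℝ × ℝ => ENNReal.ofReal ((|p.1| + |p.2|)⁻¹) := by fun_prop
  have hw := measurable_schurWeight
  have hae : ∀ᵐ u : ℝ, u ≠ 0 := by
    simp [ae_iff]
  have hw0 : ∀ u : ℝ, u ≠ 0 → schurWeight u ≠ 0 := fun u hu => by
    have : 0 < |u| := abs_pos.2 hu
    simp only [schurWeight, ne_eq, ENNReal.ofReal_eq_zero, not_le]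
    positivity
  have hwt : ∀ u : ℝ, schurWeight u ≠ ⊤ := fun u => by simp [schurWeight]
  have h1 : ∀ t : ℝ, t ≠ 0 → (∫⁻ u : ℝ, g u * ENNReal.ofReal ((|t| + |u|)⁻¹)) ^ 2 ≤
      schurConst * ∫⁻ u : ℝ, g u ^ 2 * (schurWeight u)⁻¹ *
        (ENNReal.ofReal ((|u| + |t|)⁻¹) * schurWeight t) := by
    intro t ht
    have hk : Measurable fun u : ℝ => ENNReal.ofReal ((|t| + |u|)⁻¹) := by fun_prop
    have h := lintegral_mul_sq_le_weighted (μ := volume) (g := fun u => g u * (schurWeight u)⁻¹)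
      (k := fun u => ENNReal.ofReal ((|t| + |u|)⁻¹) * schurWeight u)
      (hg.mul hw.inv.aemeasurable) (hk.mul hw).aemeasurable
    rw [lintegral_schurKernel t ht] at h
    calc _ = (∫⁻ u : ℝ, g u * (schurWeight u)⁻¹ *
          (ENNReal.ofReal ((|t| + |u|)⁻¹) * schurWeight u)) ^ 2 := by
          congr 1
          refine lintegral_congr_ae ?_
          filter_upwards [hae] with u hu
          calc _ = g u * ENNReal.ofReal ((|t| + |u|)⁻¹) * ((schurWeight u)⁻¹ * schurWeight u) := by
                rw [ENNReal.inv_mul_cancel (hw0 u hu) (hwt u), mul_one]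
            _ = _ := by ring
      _ ≤ _ := h
      _ = _ := by
          rw [mul_assoc, ← lintegral_const_mul' (schurWeight t) _ (hwt t)]
          congr 1
          refine lintegral_congr_ae ?_
          filter_upwards [hae] with u hu
          rw [add_comm |u|]
          calc _ = g u ^ 2 * (schurWeight u)⁻¹ * (ENNReal.ofReal ((|t| + |u|)⁻¹) * schurWeight t)
                * ((schurWeight u)⁻¹ * schurWeight u) := by ring
            _ = _ := by rw [ENNReal.inv_mul_cancel (hw0 u hu) (hwt u), mul_one]
  have hm2 : AEMeasurable (fun p : ℝ × ℝ => g p.2 ^ 2 * (schurWeight p.2)⁻¹ *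
        (ENNReal.ofReal ((|p.2| + |p.1|)⁻¹) * schurWeight p.1)) (volume.prod volume) := by
    refine AEMeasurable.mul (AEMeasurable.mul (hg.comp_snd.pow_const 2)
      (hw.inv.comp measurable_snd).aemeasurable) (Measurable.aemeasurable ?_)
    exact (by fun_prop : Measurable fun p : ℝ × ℝ => ENNReal.ofReal ((|p.2| + |p.1|)⁻¹)).mul
      (hw.comp measurable_fst)
  calc _ ≤ ∫⁻ t : ℝ, schurConst * ∫⁻ u : ℝ, g u ^ 2 * (schurWeight u)⁻¹ *
        (ENNReal.ofReal ((|u| + |t|)⁻¹) * schurWeight t) :=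
        lintegral_mono_ae (hae.mono h1)
    _ = schurConst * ∫⁻ u : ℝ, g u ^ 2 * (schurWeight u)⁻¹ * (schurConst * schurWeight u) := by
        rw [lintegral_const_mul' _ _ schurConst_lt_top.ne, lintegral_lintegral_swap hm2]
        congr 1
        refine lintegral_congr_ae ?_
        filter_upwards [hae] with u hu
        rw [← lintegral_schurKernel u hu]
        exact lintegral_const_mul _
          ((by fun_prop : Measurable fun t : ℝ => ENNReal.ofReal ((|u| + |t|)⁻¹)).mul hw)
    _ = schurConst * ∫⁻ u : ℝ, schurConst * g u ^ 2 := by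
        congr 1
        refine lintegral_congr_ae ?_
        filter_upwards [hae] with u hu
        calc _ = schurConst * g u ^ 2 * ((schurWeight u)⁻¹ * schurWeight u) := by ring
          _ = _ := by rw [ENNReal.inv_mul_cancel (hw0 u hu) (hwt u), mul_one]
    _ = _ := by
        rw [lintegral_const_mul' _ _ schurConst_lt_top.ne]
        ring

/-- The Schur test, for a kernel bounded by `C / (|t - a| + |u - b|)`. -/
lemma lintegral_sq_le_of_schur {K : ℝ → ℝ → ℂ} {I J : Set ℝ} (hI : MeasurableSet I)
    (hJ : MeasurableSet J) {C a b : ℝ}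
    (hK : ∀ t ∈ I, ∀ u ∈ J, ‖K t u‖ * (|t - a| + |u - b|) ≤ C)
    {g : ℝ → ℂ} (hg : AEStronglyMeasurable g (volume.restrict J)) :
    ∫⁻ t in I, (∫⁻ u in J, ‖K t u * g u‖ₑ) ^ 2 ≤
      (ENNReal.ofReal C * schurConst) ^ 2 * ∫⁻ u in J, ‖g u‖ₑ ^ 2 := by
  have hG : AEMeasurable (J.indicator fun u => ‖g u‖ₑ) :=
    (aemeasurable_indicator_iff hJ).2 hg.enorm
  have hG' : AEMeasurable (fun u => J.indicator (fun u => ‖g u‖ₑ) (u + b)) :=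
    hG.comp_quasiMeasurePreserving
      (measurePreserving_add_right volume b).quasiMeasurePreserving
  have hae : ∀ᵐ u : ℝ, u ≠ b := by simp [ae_iff]
  have h1 : ∀ t ∈ I, ∫⁻ u in J, ‖K t u * g u‖ₑ ≤ ENNReal.ofReal C *
      ∫⁻ u, J.indicator (fun u => ‖g u‖ₑ) (u + b) * ENNReal.ofReal ((|t - a| + |u|)⁻¹) := by
    intro t ht
    rw [← lintegral_const_mul' _ _ (by simp), ← lintegral_indicator hJ,
      ← lintegral_add_right_eq_self _ b]
    refine lintegral_mono_ae ?_
    have hae0 : ∀ᵐ u : ℝ, u ≠ 0 := by simp [ae_iff]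
    filter_upwards [hae0] with u hu0
    by_cases hu : u + b ∈ J
    · simp only [indicator_of_mem hu]
      have h := hK t ht _ hu
      have hpos : 0 < |t - a| + |u| := by positivity
      rw [add_sub_cancel_right, ← le_div_iff₀ hpos] at h
      rw [enorm_mul]
      calc _ ≤ ENNReal.ofReal (C / (|t - a| + |u|)) * ‖g (u + b)‖ₑ := by
            gcongr
            rw [← ofReal_norm]
            exact ENNReal.ofReal_le_ofReal h
        _ = _ := by
            rw [div_eq_mul_inv, ENNReal.ofReal_mul' (by positivity)]
            ring
    · simp [hu]
  calc _ ≤ ∫⁻ t in I, (ENNReal.ofReal C *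
      ∫⁻ u, J.indicator (fun u => ‖g u‖ₑ) (u + b) * ENNReal.ofReal ((|t - a| + |u|)⁻¹)) ^ 2 :=
        setLIntegral_mono' hI fun t ht => by gcongr; exact h1 t ht
    _ ≤ ∫⁻ t, (ENNReal.ofReal C *
      ∫⁻ u, J.indicator (fun u => ‖g u‖ₑ) (u + b) * ENNReal.ofReal ((|t - a| + |u|)⁻¹)) ^ 2 :=
        setLIntegral_le_lintegral _ _
    _ = ENNReal.ofReal C ^ 2 * ∫⁻ t, (∫⁻ u, J.indicator (fun u => ‖g u‖ₑ) (u + b) *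
          ENNReal.ofReal ((|t| + |u|)⁻¹)) ^ 2 := by
        simp only [mul_pow]
        rw [lintegral_const_mul' _ _ (by simp),
          lintegral_sub_right_eq_self (fun t => (∫⁻ u, J.indicator (fun u => ‖g u‖ₑ) (u + b) *
          ENNReal.ofReal ((|t| + |u|)⁻¹)) ^ 2) a]
    _ ≤ ENNReal.ofReal C ^ 2 * (schurConst ^ 2 *
          ∫⁻ u, (J.indicator (fun u => ‖g u‖ₑ) (u + b)) ^ 2) := by
        gcongr
        exact schur_sq_le hG'
    _ = _ := by
        rw [lintegral_add_right_eq_self (fun u => (J.indicator (fun u => ‖g u‖ₑ) u) ^ 2) b,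
          mul_pow, mul_assoc, ← lintegral_indicator hJ]
        congr 3 with u
        by_cases hu : u ∈ J <;> simp [hu]

/-! ### Families converging in `L²(0, 1)` -/

/-- The measure on the parameter interval. -/
abbrev unitMeasure : Measure ℝ := volume.restrict (Icc 0 1)

/-- `F ε` converges to `h` in `L²(0, 1)` as `ε ↓ 0`. -/
structure L2Lim (F : ℝ → ℝ → ℂ) (h : ℝ → ℂ) : Prop where
  meas : ∀ᶠ ε in 𝓝[>] 0, AEStronglyMeasurable (F ε) unitMeasure
  memLp : MemLp h 2 unitMeasure
  lim : Tendsto (fun ε => eLpNorm (F ε - h) 2 unitMeasure) (𝓝[>] 0) (𝓝 0)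

namespace L2Lim
variable {F G : ℝ → ℝ → ℂ} {h k : ℝ → ℂ}

lemma add (hF : L2Lim F h) (hG : L2Lim G k) : L2Lim (fun ε => F ε + G ε) (h + k) := by
  refine ⟨?_, hF.memLp.add hG.memLp, ?_⟩
  · filter_upwards [hF.meas, hG.meas] with ε h1 h2 using h1.add h2
  · have := hF.lim.add hG.lim
    rw [add_zero] at this
    refine tendsto_of_tendsto_of_tendsto_of_le_of_le' tendsto_const_nhds this
      (Eventually.of_forall fun _ => zero_le) ?_
    filter_upwards [hF.meas, hG.meas] with ε h1 h2
    rw [add_sub_add_comm]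
    exact eLpNorm_add_le (h1.sub hF.memLp.1) (h2.sub hG.memLp.1) (by norm_num)

lemma zero : L2Lim (fun _ => 0) 0 :=
  ⟨Eventually.of_forall fun _ => aestronglyMeasurable_zero, MemLp.zero, by simp⟩

lemma sum {ι : Type*} (s : Finset ι) {F : ι → ℝ → ℝ → ℂ} {h : ι → ℝ → ℂ}
    (hF : ∀ i ∈ s, L2Lim (F i) (h i)) : L2Lim (fun ε => ∑ i ∈ s, F i ε) (∑ i ∈ s, h i) := by
  classical
  induction s using Finset.induction_on with
  | empty => simpa using zero
  | insert a s ha ih =>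
    simp only [Finset.sum_insert ha]
    exact (hF a (by simp)).add (ih fun i hi => hF i (by simp [hi]))

lemma const_mul (c : ℂ) (hF : L2Lim F h) : L2Lim (fun ε => c • F ε) (c • h) := by
  refine ⟨?_, hF.memLp.const_smul c, ?_⟩
  · filter_upwards [hF.meas] with ε h1 using h1.const_smul c
  · have := ENNReal.Tendsto.const_mul (a := ‖c‖ₑ) hF.lim (Or.inr (by simp))
    rw [mul_zero] at this
    refine this.congr fun ε => ?_
    rw [← smul_sub, eLpNorm_const_smul]

lemma congr (hF : L2Lim F h) (h1 : ∀ᶠ ε in 𝓝[>] 0, F ε =ᵐ[unitMeasure] G ε)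
    (h2 : h =ᵐ[unitMeasure] k) : L2Lim G k := by
  refine ⟨?_, hF.memLp.ae_eq h2, hF.lim.congr' ?_⟩
  · filter_upwards [hF.meas, h1] with ε h3 h4 using h3.congr h4
  · filter_upwards [h1] with ε h3
    exact eLpNorm_congr_ae (h3.sub h2)

lemma indicator {I : Set ℝ} (hI : MeasurableSet I) (hF : L2Lim F h) :
    L2Lim (fun ε => I.indicator (F ε)) (I.indicator h) := by
  refine ⟨?_, hF.memLp.indicator hI, ?_⟩
  · filter_upwards [hF.meas] with ε h1 using h1.indicator hI
  · refine tendsto_of_tendsto_of_tendsto_of_le_of_le tendsto_const_nhds hF.lim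
      (fun _ => zero_le) fun ε => ?_
    simp only
    rw [← indicator_sub']
    exact eLpNorm_indicator_le _

lemma unique (hF : L2Lim F h) (hF' : L2Lim F k) : h =ᵐ[unitMeasure] k := by
  have h0 : eLpNorm (h - k) 2 unitMeasure = 0 := by
    have := hF.lim.add hF'.lim
    rw [add_zero] at this
    refine le_antisymm (ge_of_tendsto this ?_) zero_le
    filter_upwards [hF.meas] with ε h1
    have e : h - k = (F ε - k) - (F ε - h) := by abel
    rw [e, add_comm]
    exact eLpNorm_sub_le (h1.sub hF'.memLp.1) (h1.sub hF.memLp.1) (by norm_num)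
  rw [eLpNorm_eq_zero_iff (hF.memLp.1.sub hF'.memLp.1) (by norm_num)] at h0
  filter_upwards [h0] with t ht
  simpa [sub_eq_zero] using ht

end L2Lim

/-- The integral operator with kernel `K` on `J`, restricted to `I`. -/
def kernelOp (K : ℝ → ℝ → ℂ) (I J : Set ℝ) (g : ℝ → ℂ) : ℝ → ℂ :=
  I.indicator fun t => ∫ u in J, K t u * g u

lemma aestronglyMeasurable_kernelOp {K : ℝ → ℝ → ℂ} {I J : Set ℝ} {g : ℝ → ℂ}
    (hK : Measurable (Function.uncurry K)) (hI : MeasurableSet I)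
    (hg : AEStronglyMeasurable g (volume.restrict J)) :
    AEStronglyMeasurable (kernelOp K I J g) := by
  refine AEStronglyMeasurable.indicator ?_ hI
  have : AEStronglyMeasurable (fun p : ℝ × ℝ => K p.1 p.2 * g p.2)
      (volume.prod (volume.restrict J)) := hK.aestronglyMeasurable.mul hg.comp_snd
  exact this.integral_prod_right'

lemma integrableOn_of_memLp_unitMeasure {g : ℝ → ℂ} (hg : MemLp g 2 unitMeasure) {J : Set ℝ}
    (hJ : J ⊆ Icc 0 1) : IntegrableOn g J :=
  IntegrableOn.mono_set (μ := volume) (hg.integrable (by norm_num)) hJ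

/-- Bounded kernels converging pointwise. -/
lemma L2Lim.of_bounded_kernel {K : ℝ → ℝ → ℝ → ℂ} {K₀ : ℝ → ℝ → ℂ} {I J : Set ℝ}
    (hK : ∀ ε, Measurable (Function.uncurry (K ε))) (hI : MeasurableSet I) (hJ : MeasurableSet J)
    (hJ1 : J ⊆ Icc 0 1) {M : ℝ} (hM : ∀ᶠ ε in 𝓝[>] 0, ∀ t ∈ I, ∀ u ∈ J, ‖K ε t u‖ ≤ M)
    (hlim : ∀ t ∈ I, ∀ᵐ u ∂volume.restrict J,
      Tendsto (fun ε => K ε t u) (𝓝[>] 0) (𝓝 (K₀ t u)))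
    {g : ℝ → ℂ} (hg : MemLp g 2 unitMeasure) :
    L2Lim (fun ε => kernelOp (K ε) I J g) (kernelOp K₀ I J g) := by
  have hgi := integrableOn_of_memLp_unitMeasure hg hJ1
  set B := M * ∫ u in J, ‖g u‖ with hB
  have hb : ∀ᶠ ε in 𝓝[>] (0 : ℝ), ∀ t ∈ I, ∀ᵐ u ∂volume.restrict J, ‖K ε t u * g u‖ ≤ M * ‖g u‖ := by
    filter_upwards [hM] with ε hε t ht
    filter_upwards [ae_restrict_mem hJ] with u hu
    rw [norm_mul]
    exact mul_le_mul_of_nonneg_right (hε t ht u hu) (norm_nonneg _)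
  have hpt : ∀ t, Tendsto (fun ε => kernelOp (K ε) I J g t) (𝓝[>] 0) (𝓝 (kernelOp K₀ I J g t)) := by
    intro t
    by_cases ht : t ∈ I
    · simp only [kernelOp, indicator_of_mem ht]
      refine tendsto_integral_filter_of_dominated_convergence (fun u => M * ‖g u‖) ?_ ?_
        (hgi.norm.const_mul _) ?_
      · refine Eventually.of_forall fun ε => ?_
        have : Measurable (K ε t) := (hK ε).comp measurable_prodMk_left
        exact this.aestronglyMeasurable.mul hgi.1
      · filter_upwards [hb] with ε hε using hε t ht
      · filter_upwards [hlim t ht] with u hu using hu.mul_const _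
    · simp [kernelOp, ht]
  have hbd : ∀ᶠ ε in 𝓝[>] (0 : ℝ), ∀ t, ‖kernelOp (K ε) I J g t‖ ≤ max B 0 := by
    filter_upwards [hb] with ε hε t
    by_cases ht : t ∈ I
    · simp only [kernelOp, indicator_of_mem ht]
      refine (norm_integral_le_of_norm_le (hgi.norm.const_mul M) (hε t ht)).trans ?_
      rw [integral_const_mul]
      exact le_max_left _ _
    · simp [kernelOp, ht]
  have hbd0 : ∀ t, ‖kernelOp K₀ I J g t‖ ≤ max B 0 := fun t =>
    le_of_tendsto (hpt t).norm (hbd.mono fun ε h => h t)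
  have hme : ∀ ε, AEStronglyMeasurable (kernelOp (K ε) I J g) := fun ε =>
    aestronglyMeasurable_kernelOp (hK ε) hI hgi.1
  have hme0 : AEStronglyMeasurable (kernelOp K₀ I J g) :=
    aestronglyMeasurable_of_tendsto_ae (𝓝[>] (0 : ℝ)) hme (Eventually.of_forall hpt)
  refine ⟨Eventually.of_forall fun ε => (hme ε).restrict, ?_, ?_⟩
  · exact MemLp.of_bound hme0.restrict (max B 0) (Eventually.of_forall hbd0)
  · have := (tendsto_eLpNorm_two_iff (μ := unitMeasure) (l := 𝓝[>] (0 : ℝ))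
      (fun ε => kernelOp (K ε) I J g - kernelOp K₀ I J g)).2
    refine this ?_
    have h0 : Tendsto (fun ε => ∫⁻ t in Icc 0 1, ‖kernelOp (K ε) I J g t - kernelOp K₀ I J g t‖ₑ ^ 2)
        (𝓝[>] 0) (𝓝 (∫⁻ _ in Icc (0 : ℝ) 1, 0)) := by
      refine tendsto_lintegral_of_dominated (fun _ => ENNReal.ofReal (max B 0 + max B 0) ^ 2)
        ?_ ?_ ?_ ?_
      · exact Eventually.of_forall fun ε => (((hme ε).sub hme0).restrict).enorm.pow_const 2
      · filter_upwards [hbd] with ε hε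
        refine Eventually.of_forall fun t => ?_
        gcongr
        rw [← ofReal_norm]
        exact ENNReal.ofReal_le_ofReal ((norm_sub_le _ _).trans (add_le_add (hε t) (hbd0 t)))
      · simp [ENNReal.pow_eq_top_iff]
      · refine Eventually.of_forall fun t => ?_
        have h1 := ((hpt t).sub_const (kernelOp K₀ I J g t)).enorm
        have h2 := ((ENNReal.continuous_pow 2).tendsto _).comp h1
        simpa [Function.comp_def] using h2
    simpa using h0

lemma eLpNorm_kernelOp_le_of_schur {K : ℝ → ℝ → ℂ} {I J : Set ℝ} (hI : MeasurableSet I)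
    (hJ : MeasurableSet J) {C a b : ℝ}
    (hC : ∀ t ∈ I, ∀ u ∈ J, ‖K t u‖ * (|t - a| + |u - b|) ≤ C)
    {g : ℝ → ℂ} (hg : AEStronglyMeasurable g (volume.restrict J)) :
    eLpNorm (kernelOp K I J g) 2 unitMeasure ≤
      (ENNReal.ofReal C * schurConst) * eLpNorm g 2 (volume.restrict J) := by
  rw [← ENNReal.pow_le_pow_left_iff two_ne_zero, eLpNorm_two_sq, mul_pow, eLpNorm_two_sq]
  refine le_trans ?_ (lintegral_sq_le_of_schur hI hJ hC hg)
  refine (setLIntegral_le_lintegral _ _).trans ?_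
  rw [← lintegral_indicator hI]
  refine lintegral_mono fun t => ?_
  by_cases ht : t ∈ I
  · simp only [kernelOp, indicator_of_mem ht]
    gcongr
    exact enorm_integral_le_lintegral_enorm _
  · simp [kernelOp, ht]

/-- A Bochner integral may be split only where it converges absolutely. The Schur bound ensures this
for almost every `t`, but not for every `t`. -/
lemma kernelOp_split_of_schur {K : ℝ → ℝ → ℂ} {I J : Set ℝ} (hI : MeasurableSet I)
    (hJ : MeasurableSet J) (hK : Measurable (Function.uncurry K)) {C a b : ℝ}
    (hC : ∀ t ∈ I, ∀ u ∈ J, ‖K t u‖ * (|t - a| + |u - b|) ≤ C)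
    {g : ℝ → ℂ} (hg : MemLp g 2 (volume.restrict J)) {A : Set ℝ} (hA : MeasurableSet A) :
    kernelOp K I J g =ᵐ[volume] kernelOp K I (J ∩ A) g + kernelOp K I (J \ A) g := by
  have hfin : ∫⁻ t in I, (∫⁻ u in J, ‖K t u * g u‖ₑ) ^ 2 ≠ ⊤ := by
    refine ((lintegral_sq_le_of_schur hI hJ hC hg.1).trans_lt ?_).ne
    rw [← eLpNorm_two_sq]
    exact ENNReal.mul_lt_top (ENNReal.pow_lt_top (ENNReal.mul_lt_top ENNReal.ofReal_lt_top
      schurConst_lt_top)) (ENNReal.pow_lt_top hg.2)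
  have hKg : AEStronglyMeasurable (fun p : ℝ × ℝ => K p.1 p.2 * g p.2)
      (volume.prod (volume.restrict J)) := hK.aestronglyMeasurable.mul hg.1.comp_snd
  have hae := ae_lt_top' ((hKg.enorm.lintegral_prod_right').restrict.pow_const 2) hfin
  rw [ae_restrict_iff' hI] at hae
  filter_upwards [hae] with t ht
  by_cases htI : t ∈ I
  · simp only [kernelOp, Pi.add_apply, indicator_of_mem htI]
    refine (integral_inter_add_sdiff hA ⟨?_, ?_⟩).symm
    · exact (hK.comp measurable_prodMk_left).aestronglyMeasurable.mul hg.1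
    · have := ht htI
      exact (ENNReal.pow_lt_top_iff.1 this).resolve_right (by norm_num)
  · simp [kernelOp, htI]

/-- Kernels with a transversal singularity. -/
lemma L2Lim.of_cross_kernel {K : ℝ → ℝ → ℝ → ℂ} {K₀ : ℝ → ℝ → ℂ} {I J : Set ℝ}
    (hK : ∀ ε, Measurable (Function.uncurry (K ε))) (hK₀ : Measurable (Function.uncurry K₀))
    (hI : MeasurableSet I) (hJ : MeasurableSet J) (hJ1 : J ⊆ Icc 0 1) {C b₀ : ℝ}
    (hC : ∀ᶠ ε in 𝓝[>] 0, ∃ a b, ∀ t ∈ I, ∀ u ∈ J, ‖K ε t u‖ * (|t - a| + |u - b|) ≤ C)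
    (hC₀ : ∃ a b, ∀ t ∈ I, ∀ u ∈ J, ‖K₀ t u‖ * (|t - a| + |u - b|) ≤ C)
    (hM : ∀ η > 0, ∃ M, ∀ᶠ ε in 𝓝[>] 0, ∀ t ∈ I, ∀ u ∈ J, η ≤ |u - b₀| → ‖K ε t u‖ ≤ M)
    (hlim : ∀ t ∈ I, ∀ u ∈ J, u ≠ b₀ → Tendsto (fun ε => K ε t u) (𝓝[>] 0) (𝓝 (K₀ t u)))
    {g : ℝ → ℂ} (hg : MemLp g 2 unitMeasure) :
    L2Lim (fun ε => kernelOp (K ε) I J g) (kernelOp K₀ I J g) := by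
  obtain ⟨a₀, b', hC₀⟩ := hC₀
  have hgJ : MemLp g 2 (volume.restrict J) := hg.mono_measure (Measure.restrict_mono hJ1 le_rfl)
  set D := ENNReal.ofReal C * schurConst with hD
  have hDt : D < ⊤ := ENNReal.mul_lt_top ENNReal.ofReal_lt_top schurConst_lt_top
  have hme : ∀ (ε) (J' : Set ℝ), J' ⊆ J → AEStronglyMeasurable (kernelOp (K ε) I J' g)
      unitMeasure := fun ε J' hJ' =>
    (aestronglyMeasurable_kernelOp (hK ε) hI (hgJ.1.mono_set hJ')).restrict
  have hme0 : ∀ (J' : Set ℝ), J' ⊆ J → AEStronglyMeasurable (kernelOp K₀ I J' g)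
      unitMeasure := fun J' hJ' =>
    (aestronglyMeasurable_kernelOp hK₀ hI (hgJ.1.mono_set hJ')).restrict
  refine ⟨Eventually.of_forall fun ε => hme ε J Subset.rfl, ⟨hme0 J Subset.rfl, ?_⟩, ?_⟩
  · exact (eLpNorm_kernelOp_le_of_schur hI hJ hC₀ hgJ.1).trans_lt (ENNReal.mul_lt_top hDt hgJ.2)
  rw [ENNReal.tendsto_nhds_zero]
  intro δ hδ
  let A : ℝ → Set ℝ := fun η => {u | |u - b₀| < η}
  have hA : ∀ η, MeasurableSet (A η) := fun η =>
    measurableSet_lt (by fun_prop) measurable_const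
  -- The Schur bound is uniform in ε even though its centre moves, and it is proportional to the
  -- norm of g on the strip |u − b₀| < η, which is small by absolute continuity. Off the strip the
  -- kernels are bounded.
  obtain ⟨η, hη, hηs⟩ : ∃ η > 0, D * eLpNorm g 2 (volume.restrict (J ∩ A η)) ≤ δ / 3 := by
    have h1 : Tendsto (fun η => ∫⁻ u in A η, ‖g u‖ₑ ^ 2 ∂(volume.restrict J)) (𝓝[>] 0) (𝓝 0) := by
      refine tendsto_setLIntegral_zero ?_ ?_
      · rw [← eLpNorm_two_sq]; exact (ENNReal.pow_lt_top hgJ.2).ne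
      · have hle : ∀ η, (volume.restrict J) (A η) ≤ ENNReal.ofReal (2 * η) := by
          intro η
          refine (Measure.restrict_apply_le _ _).trans ?_
          have : A η = Metric.ball b₀ η := by ext u; simp [A, Real.dist_eq]
          rw [this, Real.volume_ball]
        have h0 : Tendsto (fun η : ℝ => ENNReal.ofReal (2 * η)) (𝓝[>] 0) (𝓝 0) := by
          have : Tendsto (fun η : ℝ => ENNReal.ofReal (2 * η)) (𝓝 0) (𝓝 (ENNReal.ofReal (2 * 0))) :=
            (ENNReal.continuous_ofReal.comp (continuous_const_mul 2)).tendsto 0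
          simpa using this.mono_left nhdsWithin_le_nhds
        exact tendsto_of_tendsto_of_tendsto_of_le_of_le tendsto_const_nhds h0 (fun _ => zero_le) hle
    simp only [Measure.restrict_restrict (hA _)] at h1
    simp only [← eLpNorm_two_sq] at h1
    have h2 := ENNReal.Tendsto.const_mul (a := D ^ 2) h1 (Or.inr (ENNReal.pow_lt_top hDt).ne)
    rw [mul_zero] at h2
    have h3 := ENNReal.tendsto_nhds_zero.1 h2 ((δ / 3) ^ 2)
      (pos_iff_ne_zero.2 (pow_ne_zero 2 (by simpa using hδ.ne')))
    obtain ⟨η, hη, hη0⟩ := (h3.and self_mem_nhdsWithin).exists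
    refine ⟨η, hη0, ?_⟩
    rw [← mul_pow, inter_comm] at hη
    exact (ENNReal.pow_le_pow_left_iff two_ne_zero).1 hη
  obtain ⟨M, hM⟩ := hM η hη
  have hfar : L2Lim (fun ε => kernelOp (K ε) I (J \ A η) g) (kernelOp K₀ I (J \ A η) g) := by
    refine L2Lim.of_bounded_kernel hK hI (hJ.diff (hA η)) (sdiff_subset.trans hJ1) (M := M) ?_ ?_ hg
    · filter_upwards [hM] with ε hε t ht u hu
      exact hε t ht u hu.1 (not_lt.1 hu.2)
    · intro t ht
      filter_upwards [ae_restrict_mem (hJ.diff (hA η))] with u hu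
      refine hlim t ht u hu.1 ?_
      rintro rfl
      exact hu.2 (by simpa [A] using hη)
  have hfar' := (ENNReal.tendsto_nhds_zero.1 hfar.lim) (δ / 3) (by simpa using hδ.ne')
  filter_upwards [hC, hfar'] with ε ⟨a, b, hCε⟩ hε
  have e1 := kernelOp_split_of_schur hI hJ (hK ε) hCε hgJ (hA η)
  have e2 := kernelOp_split_of_schur hI hJ hK₀ hC₀ hgJ (hA η)
  have e3 : kernelOp (K ε) I J g - kernelOp K₀ I J g =ᵐ[unitMeasure]
      (kernelOp (K ε) I (J ∩ A η) g - kernelOp K₀ I (J ∩ A η) g) +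
        (kernelOp (K ε) I (J \ A η) g - kernelOp K₀ I (J \ A η) g) := by
    filter_upwards [ae_restrict_of_ae e1, ae_restrict_of_ae e2] with t h1 h2
    simp only [Pi.sub_apply, Pi.add_apply] at h1 h2 ⊢
    rw [h1, h2]
    ring
  have hn1 := (eLpNorm_kernelOp_le_of_schur hI (hJ.inter (hA η))
    (fun t ht u hu => hCε t ht u hu.1) (hgJ.1.mono_set inter_subset_left)).trans hηs
  have hn2 := (eLpNorm_kernelOp_le_of_schur hI (hJ.inter (hA η))
    (fun t ht u hu => hC₀ t ht u hu.1) (hgJ.1.mono_set inter_subset_left)).trans hηs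
  rw [eLpNorm_congr_ae e3]
  calc _ ≤ eLpNorm (kernelOp (K ε) I (J ∩ A η) g - kernelOp K₀ I (J ∩ A η) g) 2 unitMeasure +
        eLpNorm (kernelOp (K ε) I (J \ A η) g - kernelOp K₀ I (J \ A η) g) 2 unitMeasure :=
        eLpNorm_add_le ((hme ε _ inter_subset_left).sub (hme0 _ inter_subset_left))
          ((hme ε _ sdiff_subset).sub (hme0 _ sdiff_subset)) (by norm_num)
    _ ≤ (δ / 3 + δ / 3) + δ / 3 := by
        refine add_le_add ((eLpNorm_sub_le (hme ε _ inter_subset_left) (hme0 _ inter_subset_left)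
          (by norm_num)).trans (add_le_add hn1 hn2)) hε
    _ = δ := ENNReal.add_thirds δ

/-! ### The jump of the Cauchy integral on the real line -/

lemma integrable_div_sub_sub_mul_I {f : ℝ → ℂ} (hf : Integrable f) (t : ℝ) {ε : ℝ} (hε : ε ≠ 0) :
    Integrable fun u : ℝ => f u / ((u : ℂ) - t - ε * Complex.I) := by
  have hε' : 0 < |ε| := abs_pos.2 hε
  refine (hf.norm.mul_const |ε|⁻¹).mono' ?_ (Eventually.of_forall fun u => ?_)
  · simp only [div_eq_mul_inv]
    exact hf.1.mul (by fun_prop : Measurable _).aestronglyMeasurable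
  · rw [norm_div, div_eq_mul_inv]
    gcongr
    refine le_of_sq_le_sq ?_ (norm_nonneg _)
    rw [norm_sq_sub_sub_mul_I, sq_abs]
    nlinarith [sq_nonneg (u - t)]

lemma inv_sub_inv_eq_poisson (x : ℝ) {ε : ℝ} (hε : ε ≠ 0) :
    ((x : ℂ) - ε * Complex.I)⁻¹ - ((x : ℂ) - ((-ε : ℝ) : ℂ) * Complex.I)⁻¹ =
      2 * Complex.I * ((ε * (x ^ 2 + ε ^ 2)⁻¹ : ℝ) : ℂ) := by
  have h1 := sub_sub_mul_I_ne_zero x 0 hε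
  have h2 := sub_sub_mul_I_ne_zero x 0 (neg_ne_zero.2 hε)
  simp only [Complex.ofReal_zero, sub_zero] at h1 h2
  have h2' : (x : ℂ) + ε * Complex.I ≠ 0 := by
    intro h; apply h2; push_cast; rw [← h]; ring
  have h3 : ((x : ℂ) ^ 2 + (ε : ℂ) ^ 2) = ((x : ℂ) - ε * Complex.I) * ((x : ℂ) + ε * Complex.I) := by
    ring_nf
    rw [Complex.I_sq]
    ring
  have h4 : (x : ℂ) - ((-ε : ℝ) : ℂ) * Complex.I = x + ε * Complex.I := by push_cast; ring
  rw [h4]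
  push_cast
  rw [h3]
  field_simp
  ring

lemma integral_poisson {ε : ℝ} (hε : 0 < ε) :
    ∫ x : ℝ, ε * (x ^ 2 + ε ^ 2)⁻¹ = Real.pi := by
  have h := Measure.integral_comp_div (fun y : ℝ => (1 + y ^ 2)⁻¹) ε
  rw [integral_univ_inv_one_add_sq, abs_of_pos hε, smul_eq_mul] at h
  have e : ∀ x : ℝ, ε * (x ^ 2 + ε ^ 2)⁻¹ = ε⁻¹ * (1 + (x / ε) ^ 2)⁻¹ := by
    intro x
    have h3 : x ^ 2 + ε ^ 2 ≠ 0 := by positivity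
    have h4 : 1 + (x / ε) ^ 2 ≠ 0 := by positivity
    field_simp
    ring
  simp only [e]
  rw [integral_const_mul, h]
  field_simp

/-- A kernel dominated by the Poisson kernel acts on `f - f t` with norm at most the Poisson mean
oscillation. -/
lemma lintegral_poisson_le_poissonOsc (f : ℝ → ℂ) {ε : ℝ} (hε : 0 < ε) (t : ℝ) :
    ∫⁻ u, ‖f u - f t‖ₑ * ENNReal.ofReal (ε * ((u - t) ^ 2 + ε ^ 2)⁻¹) = poissonOsc f ε t := by
  rw [← lintegral_add_left_eq_self _ t]
  conv_lhs => rw [← Real.smul_map_volume_mul_left hε.ne']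
  have hemb : MeasurableEmbedding fun y : ℝ => ε * y :=
    (Homeomorph.mulLeft₀ ε hε.ne').measurableEmbedding
  rw [lintegral_smul_measure, hemb.lintegral_map, smul_eq_mul,
    ← lintegral_const_mul' _ _ ENNReal.ofReal_ne_top, poissonOsc]
  congr 1 with y
  rw [mul_left_comm, ← ENNReal.ofReal_mul (abs_nonneg _), abs_of_pos hε]
  congr 2
  have h3 : 1 + y ^ 2 ≠ 0 := by positivity
  have h4 : (t + ε * y - t) ^ 2 + ε ^ 2 = ε ^ 2 * (1 + y ^ 2) := by ring
  rw [h4]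
  field_simp

/-- The kernels at heights ±ε differ by 2i times the Poisson kernel, whose mass is π. Subtracting
2πi f(t) therefore turns the integrand into f(u) − f(t) against that kernel. -/
lemma enorm_lineCauchy_sub_neg_sub_le {f : ℝ → ℂ} (hf : Integrable f) {ε : ℝ} (hε : 0 < ε)
    (t : ℝ) :
    ‖lineCauchy ε f t - lineCauchy (-ε) f t - 2 * Real.pi * Complex.I * f t‖ₑ ≤
      2 * poissonOsc f ε t := by
  have e1 : lineCauchy ε f t - lineCauchy (-ε) f t =
      ∫ u, f u * (2 * Complex.I * ((ε * ((u - t) ^ 2 + ε ^ 2)⁻¹ : ℝ) : ℂ)) := by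
    rw [lineCauchy, lineCauchy, ← integral_sub (integrable_div_sub_sub_mul_I hf t hε.ne')
      (integrable_div_sub_sub_mul_I hf t (neg_ne_zero.2 hε.ne'))]
    refine integral_congr_ae (Eventually.of_forall fun u => ?_)
    have := inv_sub_inv_eq_poisson (u - t) hε.ne'
    simp only
    rw [← this]
    push_cast
    ring
  have hP : Integrable fun u : ℝ => ε * ((u - t) ^ 2 + ε ^ 2)⁻¹ := by
    have := (integrable_inv_sub_sq_add_sq t hε.ne').const_mul ε
    refine this.congr (Eventually.of_forall fun u => ?_)
    simp only
    rw [show (t - u) ^ 2 = (u - t) ^ 2 by ring]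
  have e2 : 2 * Real.pi * Complex.I * f t =
      ∫ u, f t * (2 * Complex.I * ((ε * ((u - t) ^ 2 + ε ^ 2)⁻¹ : ℝ) : ℂ)) := by
    rw [integral_const_mul, integral_const_mul, integral_complex_ofReal,
      integral_sub_right_eq_self (fun x : ℝ => ε * (x ^ 2 + ε ^ 2)⁻¹) t, integral_poisson hε]
    ring
  have hI1 : Integrable fun u => f u * (2 * Complex.I * ((ε * ((u - t) ^ 2 + ε ^ 2)⁻¹ : ℝ) : ℂ)) := by
    have := (integrable_div_sub_sub_mul_I hf t hε.ne').sub
      (integrable_div_sub_sub_mul_I hf t (neg_ne_zero.2 hε.ne'))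
    refine this.congr (Eventually.of_forall fun u => ?_)
    have := inv_sub_inv_eq_poisson (u - t) hε.ne'
    simp only [Pi.sub_apply]
    rw [← this]
    push_cast
    ring
  have hI2 : Integrable fun u => f t * (2 * Complex.I * ((ε * ((u - t) ^ 2 + ε ^ 2)⁻¹ : ℝ) : ℂ)) :=
    (hP.ofReal.const_mul _).const_mul _
  rw [e1, e2, ← integral_sub hI1 hI2]
  refine (enorm_integral_le_lintegral_enorm _).trans (le_of_eq ?_)
  rw [← lintegral_poisson_le_poissonOsc f hε t, ← lintegral_const_mul' _ _ (by simp)]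
  congr 1 with u
  rw [← sub_mul, enorm_mul, enorm_mul, mul_left_comm]
  have h1 : ‖(2 * Complex.I : ℂ)‖ₑ = 2 := by
    rw [← ofReal_norm]; simp
  have h2 : ‖((ε * ((u - t) ^ 2 + ε ^ 2)⁻¹ : ℝ) : ℂ)‖ₑ =
      ENNReal.ofReal (ε * ((u - t) ^ 2 + ε ^ 2)⁻¹) := by
    rw [← ofReal_norm, Complex.norm_real, Real.norm_of_nonneg (by positivity)]
  rw [h1, h2]

theorem tendsto_lineCauchy_sub_neg {f : ℝ → ℂ} (hf : Integrable f) (hf2 : MemLp f 2) :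
    Tendsto (fun ε => eLpNorm (lineCauchy ε f - lineCauchy (-ε) f -
      fun t => 2 * Real.pi * Complex.I * f t) 2) (𝓝[>] 0) (𝓝 0) := by
  rw [tendsto_eLpNorm_two_iff]
  have h := ENNReal.Tendsto.const_mul (a := 4) (tendsto_lintegral_poissonOsc_sq hf2)
    (Or.inr (by norm_num))
  rw [mul_zero] at h
  refine tendsto_of_tendsto_of_tendsto_of_le_of_le' tendsto_const_nhds h
    (Eventually.of_forall fun _ => zero_le) ?_
  filter_upwards [self_mem_nhdsWithin] with ε hε
  rw [← lintegral_const_mul' _ _ (by norm_num)]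
  refine lintegral_mono fun t => ?_
  have := enorm_lineCauchy_sub_neg_sub_le hf hε t
  calc _ ≤ (2 * poissonOsc f ε t) ^ 2 := by gcongr; exact this
    _ = _ := by rw [mul_pow]; norm_num

/-! ### Local estimates for smooth curves -/

lemma exists_curve_taylor {s : ℝ → ℂ} (hs : ContDiff ℝ ∞ s) (R : ℝ) :
    ∃ L : ℝ, 0 ≤ L ∧ ∀ t ∈ Icc (-R) R, ∀ v ∈ Icc (-R) R,
      ‖deriv s v - deriv s t‖ ≤ L * |v - t| ∧
      ‖s v - s t - deriv s t * ((v - t : ℝ) : ℂ)‖ ≤ L * |v - t| ^ 2 := by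
  have hs1 : ContDiff ℝ ∞ (deriv s) := hs.deriv' 
  have hs2 : Continuous (deriv (deriv s)) := hs1.continuous_deriv (by simp)
  obtain ⟨L, hL⟩ := isCompact_Icc.exists_bound_of_continuousOn (s := Icc (-R) R) hs2.continuousOn
  refine ⟨max L 0, le_max_right _ _, fun t ht v hv => ?_⟩
  have h1 : ∀ t ∈ Icc (-R) R, ∀ v ∈ Icc (-R) R, ‖deriv s v - deriv s t‖ ≤ max L 0 * |v - t| := by
    intro t ht v hv
    have := (convex_Icc (-R) R).norm_image_sub_le_of_norm_deriv_le (f := deriv s) (C := max L 0)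
      (fun x _ => (hs1.differentiable (by simp)).differentiableAt)
      (fun x hx => (hL x hx).trans (le_max_left _ _)) ht hv
    simpa [Real.norm_eq_abs] using this
  refine ⟨h1 t ht v hv, ?_⟩
  have hsub : uIcc t v ⊆ Icc (-R) R := (ordConnected_Icc.uIcc_subset ht hv)
  have hd : ∀ x, HasDerivAt (fun x : ℝ => s x - deriv s t * ((x : ℝ) : ℂ))
      (deriv s x - deriv s t) x := by
    intro x
    have h2 : HasDerivAt (fun x : ℝ => deriv s t * ((x : ℝ) : ℂ)) (deriv s t * 1) x :=
      (Complex.ofRealCLM.hasDerivAt (x := x)).const_mul _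
    rw [mul_one] at h2
    exact ((hs.differentiable (by simp)).differentiableAt.hasDerivAt).sub h2
  have := (convex_uIcc t v).norm_image_sub_le_of_norm_deriv_le
    (f := fun x : ℝ => s x - deriv s t * ((x : ℝ) : ℂ)) (C := max L 0 * |v - t|)
    (fun x _ => (hd x).differentiableAt)
    (fun x hx => by
      rw [(hd x).deriv]
      refine (h1 t ht x (hsub hx)).trans ?_
      exact mul_le_mul_of_nonneg_left (abs_sub_left_of_mem_uIcc hx) (le_max_right _ _)) left_mem_uIcc right_mem_uIcc
  rw [Real.norm_eq_abs] at this
  calc _ = ‖s v - deriv s t * ((v : ℝ) : ℂ) - (s t - deriv s t * ((t : ℝ) : ℂ))‖ := by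
        congr 1; push_cast; ring
    _ ≤ _ := this
    _ = _ := by ring

/-- Near a point of a regular curve, the Cauchy kernel with pole `z` close to the normal translate
`s t + iρ s'(t)` differs from the Cauchy kernel of the line by a bounded function. -/
lemma exists_kernel_local {s : ℝ → ℂ} (hs : ContDiff ℝ ∞ s) {t₀ : ℝ} (h0 : deriv s t₀ ≠ 0)
    (A : ℝ) (hA : 0 ≤ A) :
    ∃ c δ M : ℝ, 0 < c ∧ 0 < δ ∧ ∀ t v ρ : ℝ, |t - t₀| < δ → |v - t₀| < δ → |ρ| < δ →
      ∀ z : ℂ, ‖z - (s t + ρ * Complex.I * deriv s t)‖ ≤ A * ρ ^ 2 →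
        c * ‖(v : ℂ) - t - ρ * Complex.I‖ ≤ ‖s v - z‖ ∧
        ‖deriv s v / (s v - z) - 1 / ((v : ℂ) - t - ρ * Complex.I)‖ ≤ M := by
  obtain ⟨L, hL0, hL⟩ := exists_curve_taylor hs (|t₀| + 1)
  set c₀ := ‖deriv s t₀‖ with hc₀
  have hc₀p : 0 < c₀ := norm_pos_iff.2 h0
  have hcont : Continuous (deriv s) := hs.continuous_deriv (by simp)
  obtain ⟨δ₁, hδ₁, hδ₁c⟩ : ∃ δ₁ > 0, ∀ t, |t - t₀| < δ₁ → c₀ / 2 ≤ ‖deriv s t‖ := by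
    have : ∀ᶠ t in 𝓝 t₀, c₀ / 2 < ‖deriv s t‖ :=
      (hcont.norm.tendsto t₀).eventually_const_lt (by simp only [← hc₀]; linarith)
    obtain ⟨δ, hδ, h⟩ := Metric.eventually_nhds_iff.1 this
    exact ⟨δ, hδ, fun t ht => (h (by rwa [Real.dist_eq])).le⟩
  -- Chosen so that the Taylor error, at most (2L + A)δ‖w‖ below, uses up only half of the lower
  -- bound (c₀/2)‖w‖ for the linear term.
  set δ := min (min δ₁ 1) (c₀ / (4 * (2 * L + A + 1))) with hδ
  have hδp : 0 < δ := by
    have : 0 < c₀ / (4 * (2 * L + A + 1)) := by positivity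
    simp only [hδ, lt_min_iff]
    exact ⟨⟨hδ₁, one_pos⟩, this⟩
  have hδ1 : δ ≤ δ₁ := (min_le_left _ _).trans (min_le_left _ _)
  have hδ2 : δ ≤ 1 := (min_le_left _ _).trans (min_le_right _ _)
  have hδ3 : (2 * L + A) * δ ≤ c₀ / 4 := by
    have h1 : δ ≤ c₀ / (4 * (2 * L + A + 1)) := min_le_right _ _
    have h2 : (2 * L + A + 1) * δ ≤ c₀ / 4 := by
      calc _ ≤ (2 * L + A + 1) * (c₀ / (4 * (2 * L + A + 1))) := by gcongr
        _ = _ := by field_simp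
    nlinarith
  refine ⟨c₀ / 4, δ, 4 * (2 * L + A) / c₀, by positivity, hδp, ?_⟩
  intro t v ρ ht hv hρ z hz
  have hmem : ∀ x, |x - t₀| < δ → x ∈ Icc (-(|t₀| + 1)) (|t₀| + 1) := by
    intro x hx
    have h1 := abs_sub_abs_le_abs_sub x t₀
    have h2 : |x| ≤ |t₀| + 1 := by linarith
    exact abs_le.1 h2
  set w : ℂ := (v : ℂ) - t - ρ * Complex.I with hw
  have hw2 : ‖w‖ ^ 2 = (v - t) ^ 2 + ρ ^ 2 := norm_sq_sub_sub_mul_I v t ρ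
  have hvt : |v - t| ≤ ‖w‖ := by
    exact abs_le_of_sq_le_sq (a := v - t) (by rw [hw2]; nlinarith [sq_nonneg ρ]) (norm_nonneg _)
  have hρw : |ρ| ≤ ‖w‖ := by
    exact abs_le_of_sq_le_sq (a := ρ) (by rw [hw2]; nlinarith [sq_nonneg (v - t)]) (norm_nonneg _)
  obtain ⟨T1, T2⟩ := hL t (hmem t ht) v (hmem v hv)
  obtain ⟨-, T3⟩ := hL v (hmem v hv) t (hmem t ht)
  rw [abs_sub_comm t v] at T3
  have hvt2 : |v - t| < 2 * δ := by
    have : v - t = (v - t₀) - (t - t₀) := by ring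
    rw [this]
    exact (abs_sub _ _).trans_lt (by linarith)
  have hlow : c₀ / 4 * ‖w‖ ≤ ‖s v - z‖ := by
    have e : s v - z = deriv s t * w + ((s v - s t - deriv s t * ((v - t : ℝ) : ℂ)) -
        (z - (s t + ρ * Complex.I * deriv s t))) := by
      rw [hw]; push_cast; ring
    have h1 : ‖(s v - s t - deriv s t * ((v - t : ℝ) : ℂ)) -
        (z - (s t + ρ * Complex.I * deriv s t))‖ ≤ L * |v - t| ^ 2 + A * ρ ^ 2 :=
      (norm_sub_le _ _).trans (add_le_add T2 hz)
    have h2 : L * |v - t| ^ 2 + A * ρ ^ 2 ≤ ((2 * L + A) * δ) * ‖w‖ := by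
      rw [← sq_abs ρ]
      have i1 : L * |v - t| ^ 2 ≤ L * (2 * δ * ‖w‖) := by
        rw [sq]; gcongr
      have i2 : A * |ρ| ^ 2 ≤ A * (δ * ‖w‖) := by
        rw [sq]; gcongr
      linarith
    have h3 : c₀ / 2 * ‖w‖ ≤ ‖deriv s t * w‖ := by
      rw [norm_mul]; gcongr; exact hδ₁c t (ht.trans_le hδ1)
    have h4 : ((2 * L + A) * δ) * ‖w‖ ≤ c₀ / 4 * ‖w‖ := by gcongr
    have h5 := norm_sub_le_norm_add (deriv s t * w) ((s v - s t - deriv s t * ((v - t : ℝ) : ℂ)) -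
        (z - (s t + ρ * Complex.I * deriv s t)))
    rw [e]
    linarith
  refine ⟨hlow, ?_⟩
  -- In the degenerate case v = t and ρ = 0, so z = s t; both quotients have denominator 0 and are 0
  -- by convention.
  by_cases hw0 : w = 0
  · have hv0 : v = t := by
      have := hw2; rw [hw0] at this; simp at this; nlinarith [sq_nonneg (v - t), sq_nonneg ρ]
    have hρ0 : ρ = 0 := by
      have := hw2; rw [hw0] at this; simp at this; nlinarith [sq_nonneg (v - t), sq_nonneg ρ]
    have : s v - z = 0 := by
      subst hv0 hρ0
      simp at hz
      rw [sub_eq_zero] at hz ⊢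
      exact hz.symm
    rw [this, hw0]
    simp
    positivity
  have hwp : 0 < ‖w‖ := norm_pos_iff.2 hw0
  have hsz : 0 < ‖s v - z‖ := lt_of_lt_of_le (by positivity) hlow
  have hsz0 : s v - z ≠ 0 := norm_pos_iff.1 hsz
  -- The numerator splits into a Taylor remainder at v, the variation of the tangent times ρ, and
  -- the displacement of z from the normal. Each is O(‖w‖²), which cancels the denominator.
  have e : deriv s v / (s v - z) - 1 / w = ((s t - s v - deriv s v * ((t - v : ℝ) : ℂ)) +
      ((-(ρ * Complex.I) * (deriv s v - deriv s t)) + (z - (s t + ρ * Complex.I * deriv s t)))) /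
      ((s v - z) * w) := by
    rw [div_sub_div _ _ hsz0 hw0]
    congr 1
    rw [hw]; push_cast; ring
  rw [e, norm_div, norm_mul, div_le_iff₀ (by positivity)]
  have hnum : ‖(s t - s v - deriv s v * ((t - v : ℝ) : ℂ)) +
      ((-(ρ * Complex.I) * (deriv s v - deriv s t)) + (z - (s t + ρ * Complex.I * deriv s t)))‖ ≤
      (2 * L + A) * ‖w‖ ^ 2 := by
    refine (norm_add_le _ _).trans ?_
    have i1 : L * |v - t| ^ 2 ≤ L * ‖w‖ ^ 2 := by gcongr
    have i2 : ‖-(ρ * Complex.I) * (deriv s v - deriv s t)‖ ≤ L * ‖w‖ ^ 2 := by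
      rw [norm_mul]
      have : ‖-((ρ : ℂ) * Complex.I)‖ = |ρ| := by simp
      rw [this]
      calc _ ≤ ‖w‖ * (L * ‖w‖) := by gcongr; exact T1.trans (by gcongr)
        _ = _ := by ring
    have i3 : A * ρ ^ 2 ≤ A * ‖w‖ ^ 2 := by rw [← sq_abs ρ]; gcongr
    have := norm_add_le (-(ρ * Complex.I) * (deriv s v - deriv s t))
      (z - (s t + ρ * Complex.I * deriv s t))
    linarith
  refine hnum.trans ?_
  calc (2 * L + A) * ‖w‖ ^ 2 = 4 * (2 * L + A) / c₀ * (c₀ / 4 * ‖w‖ * ‖w‖) := by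
        field_simp
    _ ≤ _ := by gcongr

/-- Transversal vectors in the plane. -/
lemma exists_lower_of_linearIndependent {a b : ℂ} (h : LinearIndependent ℝ ![b, a]) :
    ∃ c > 0, ∀ x y : ℝ, c * (|x| + |y|) ≤ ‖(x : ℂ) * a - y * b‖ := by
  -- This is the determinant of the pair; pairing x·a − y·b with b isolates x, and pairing it with a
  -- isolates y.
  have hD : ((starRingEnd ℂ) b * a).im ≠ 0 := by
    intro h0
    rw [LinearIndependent.pair_iff] at h
    have hb : b ≠ 0 := by
      rintro rfl
      have := h 1 0 (by simp)
      simp at this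
    have hr : (((starRingEnd ℂ) b * a).re : ℂ) = (starRingEnd ℂ) b * a :=
      Complex.ext (by simp) (by simp only [Complex.ofReal_im]; exact h0.symm)
    have := h ((starRingEnd ℂ) b * a).re (-Complex.normSq b) (by
      simp only [Complex.real_smul]
      rw [hr]
      push_cast
      rw [Complex.normSq_eq_conj_mul_self]
      ring)
    exact hb (Complex.normSq_eq_zero.1 (by linarith [this.2]))
  set D := |((starRingEnd ℂ) b * a).im| with hDd
  have hDp : 0 < D := abs_pos.2 hD
  have hx : ∀ x y : ℝ, |x| * D ≤ ‖b‖ * ‖(x : ℂ) * a - y * b‖ := by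
    intro x y
    have e : x * ((starRingEnd ℂ) b * a).im = ((starRingEnd ℂ) b * ((x : ℂ) * a - y * b)).im := by
      simp [Complex.mul_im, Complex.mul_re]; ring
    rw [hDd, ← abs_mul, e]
    refine (Complex.abs_im_le_norm _).trans ?_
    rw [norm_mul, RCLike.norm_conj]
  have hy : ∀ x y : ℝ, |y| * D ≤ ‖a‖ * ‖(x : ℂ) * a - y * b‖ := by
    intro x y
    have e : y * ((starRingEnd ℂ) b * a).im = ((starRingEnd ℂ) a * ((x : ℂ) * a - y * b)).im := by
      simp [Complex.mul_im, Complex.mul_re]; ring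
    rw [hDd, ← abs_mul, e]
    refine (Complex.abs_im_le_norm _).trans ?_
    rw [norm_mul, RCLike.norm_conj]
  refine ⟨D / (‖a‖ + ‖b‖ + 1), by positivity, fun x y => ?_⟩
  rw [div_mul_eq_mul_div, div_le_iff₀ (by positivity)]
  nlinarith [hx x y, hy x y, norm_nonneg ((x : ℂ) * a - y * b)]

/-- Near a transversal intersection of `s` and `σ` the difference between `σ` and the normal
translates of `s` is uniformly bi-Lipschitz. -/
lemma exists_cross_lower {s σ : ℝ → ℂ} (hs : ContDiff ℝ ∞ s) (hσ : ContDiff ℝ ∞ σ) {t₀ u₀ : ℝ}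
    (hli : LinearIndependent ℝ ![deriv s t₀, deriv σ u₀]) :
    ∃ c δ : ℝ, 0 < c ∧ 0 < δ ∧ ∀ ε t t' u u' : ℝ, |ε| < δ → |t - t₀| < δ → |t' - t₀| < δ →
      |u - u₀| < δ → |u' - u₀| < δ → c * (|t - t'| + |u - u'|) ≤
        ‖(σ u - (s t + ε * Complex.I * deriv s t)) -
          (σ u' - (s t' + ε * Complex.I * deriv s t'))‖ := by
  obtain ⟨c₀, hc₀, hlow⟩ := exists_lower_of_linearIndependent hli
  obtain ⟨L₁, hL₁0, hL₁⟩ := exists_curve_taylor hs (|t₀| + 1)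
  obtain ⟨L₂, hL₂0, hL₂⟩ := exists_curve_taylor hσ (|u₀| + 1)
  -- Makes the Lipschitz constant 4(L₁ + L₂)δ of the deviation from the linearization at most half
  -- of the constant c₀ of the two tangents.
  set δ := min 1 (c₀ / (2 * (4 * (L₁ + L₂) + 1))) with hδ
  have hδp : 0 < δ := lt_min one_pos (by positivity)
  have hδ1 : δ ≤ 1 := min_le_left _ _
  have hδ2 : 4 * (L₁ + L₂) * δ ≤ c₀ / 2 := by
    have h2 : (4 * (L₁ + L₂) + 1) * δ ≤ c₀ / 2 := by
      calc _ ≤ (4 * (L₁ + L₂) + 1) * (c₀ / (2 * (4 * (L₁ + L₂) + 1))) := by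
            gcongr; exact min_le_right _ _
        _ = _ := by field_simp
    nlinarith
  have hmem : ∀ x₀ x : ℝ, |x - x₀| < δ → x ∈ Icc (-(|x₀| + 1)) (|x₀| + 1) := by
    intro x₀ x hx
    have h1 := abs_sub_abs_le_abs_sub x x₀
    have h2 : |x| ≤ |x₀| + 1 := by linarith
    exact abs_le.1 h2
  have hmem0 : ∀ x₀ : ℝ, x₀ ∈ Icc (-(|x₀| + 1)) (|x₀| + 1) := fun x₀ =>
    hmem x₀ x₀ (by simpa using hδp)
  have key : ∀ (r : ℝ → ℂ) (L x₀ x x' : ℝ), 0 ≤ L → (∀ t ∈ Icc (-(|x₀| + 1)) (|x₀| + 1),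
      ∀ v ∈ Icc (-(|x₀| + 1)) (|x₀| + 1), ‖deriv r v - deriv r t‖ ≤ L * |v - t| ∧
      ‖r v - r t - deriv r t * ((v - t : ℝ) : ℂ)‖ ≤ L * |v - t| ^ 2) → |x - x₀| < δ →
      |x' - x₀| < δ → ‖r x - r x' - ((x - x' : ℝ) : ℂ) * deriv r x₀‖ ≤ 3 * L * δ * |x - x'| := by
    intro r L x₀ x x' hL0 hL hx hx'
    have h1 := (hL x' (hmem _ _ hx') x (hmem _ _ hx)).2
    have h2 := (hL x₀ (hmem0 _) x' (hmem _ _ hx')).1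
    have e : r x - r x' - ((x - x' : ℝ) : ℂ) * deriv r x₀ =
        (r x - r x' - deriv r x' * ((x - x' : ℝ) : ℂ)) +
          (deriv r x' - deriv r x₀) * ((x - x' : ℝ) : ℂ) := by ring
    rw [e]
    refine (norm_add_le _ _).trans ?_
    rw [norm_mul, Complex.norm_real, Real.norm_eq_abs]
    have hxx : |x - x'| ≤ 2 * δ := by
      have : x - x' = (x - x₀) - (x' - x₀) := by ring
      rw [this]
      exact (abs_sub _ _).trans (by linarith)
    have i1 : L * |x - x'| ^ 2 ≤ L * (2 * δ * |x - x'|) := by rw [sq]; gcongr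
    have i2 : ‖deriv r x' - deriv r x₀‖ * |x - x'| ≤ L * δ * |x - x'| := by
      gcongr
      exact h2.trans (by gcongr)
    linarith
  refine ⟨c₀ / 2, δ, by positivity, hδp, ?_⟩
  intro ε t t' u u' hε ht ht' hu hu'
  have k1 := key s L₁ t₀ t t' hL₁0 hL₁ ht ht'
  have k2 := key σ L₂ u₀ u u' hL₂0 hL₂ hu hu'
  have k3 := (hL₁ t' (hmem _ _ ht') t (hmem _ _ ht)).1
  have k4 := hlow (u - u') (t - t')
  have e : (σ u - (s t + ε * Complex.I * deriv s t)) - (σ u' - (s t' + ε * Complex.I * deriv s t')) =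
      (((u - u' : ℝ) : ℂ) * deriv σ u₀ - ((t - t' : ℝ) : ℂ) * deriv s t₀) +
      ((σ u - σ u' - ((u - u' : ℝ) : ℂ) * deriv σ u₀) -
        ((s t - s t' - ((t - t' : ℝ) : ℂ) * deriv s t₀) +
          ε * Complex.I * (deriv s t - deriv s t'))) := by ring
  have k5 : ‖(ε : ℂ) * Complex.I * (deriv s t - deriv s t')‖ ≤ δ * (L₁ * |t - t'|) := by
    rw [norm_mul]
    have : ‖(ε : ℂ) * Complex.I‖ = |ε| := by simp
    rw [this]
    gcongr
  have k6 : ‖(σ u - σ u' - ((u - u' : ℝ) : ℂ) * deriv σ u₀) -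
        ((s t - s t' - ((t - t' : ℝ) : ℂ) * deriv s t₀) +
          ε * Complex.I * (deriv s t - deriv s t'))‖ ≤ 4 * (L₁ + L₂) * δ * (|t - t'| + |u - u'|) := by
    refine (norm_sub_le _ _).trans ?_
    have := norm_add_le (s t - s t' - ((t - t' : ℝ) : ℂ) * deriv s t₀)
          (ε * Complex.I * (deriv s t - deriv s t'))
    have p1 : 0 ≤ L₁ * δ * |u - u'| := by positivity
    have p2 : 0 ≤ L₂ * δ * |u - u'| := by positivity
    have p3 : 0 ≤ L₂ * δ * |t - t'| := by positivity
    linarith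
  have k7 : 4 * (L₁ + L₂) * δ * (|t - t'| + |u - u'|) ≤ c₀ / 2 * (|t - t'| + |u - u'|) := by
    gcongr
  rw [e]
  have k8 := norm_sub_le_norm_add (((u - u' : ℝ) : ℂ) * deriv σ u₀ - ((t - t' : ℝ) : ℂ) * deriv s t₀)
    ((σ u - σ u' - ((u - u' : ℝ) : ℂ) * deriv σ u₀) -
        ((s t - s t' - ((t - t' : ℝ) : ℂ) * deriv s t₀) +
          ε * Complex.I * (deriv s t - deriv s t')))
  linarith

/-! ### The kernel of the Cauchy integral along a pair of curves -/

/-- The kernel of the Cauchy integral over the curve `σ` at the normal translates of `s`. -/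
def curveKernel (s σ : ℝ → ℂ) (ε t u : ℝ) : ℂ :=
  deriv σ u / (σ u - (s t + ε * Complex.I * deriv s t))

section
variable {s σ : ℝ → ℂ} {I J : Set ℝ} {g : ℝ → ℂ}

lemma measurable_curveKernel (hs : ContDiff ℝ ∞ s) (hσ : ContDiff ℝ ∞ σ) (ε : ℝ) :
    Measurable (Function.uncurry (curveKernel s σ ε)) := by
  have h1 : Measurable (deriv σ) := (hσ.continuous_deriv (by simp)).measurable
  have h2 : Measurable (deriv s) := (hs.continuous_deriv (by simp)).measurable
  have h3 : Measurable σ := hσ.continuous.measurable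
  have h4 : Measurable s := hs.continuous.measurable
  unfold curveKernel Function.uncurry
  fun_prop

lemma exists_deriv_bound (hs : ContDiff ℝ ∞ s) :
    ∃ B : ℝ, 0 < B ∧ ∀ t ∈ Icc (0 : ℝ) 1, ‖deriv s t‖ ≤ B := by
  obtain ⟨B, hB⟩ := isCompact_Icc.exists_bound_of_continuousOn (s := Icc (0 : ℝ) 1)
    (hs.continuous_deriv (by simp)).continuousOn
  exact ⟨max B 1, by positivity, fun t ht => (hB t ht).trans (le_max_left _ _)⟩

lemma tendsto_curveKernel (side : ℝ) {t u : ℝ} (h : σ u ≠ s t) :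
    Tendsto (fun ε => curveKernel s σ (side * ε) t u) (𝓝[>] 0) (𝓝 (curveKernel s σ 0 t u)) := by
  have hc : ContinuousAt (fun ε : ℝ => curveKernel s σ (side * ε) t u) 0 := by
    unfold curveKernel
    refine ContinuousAt.div continuousAt_const (by fun_prop) ?_
    simpa [sub_eq_zero] using h
  have := hc.tendsto.mono_left (nhdsWithin_le_nhds (s := Ioi 0))
  simpa using this

lemma eventually_side_mul {P : ℝ → Prop} (h : ∀ᶠ ε in 𝓝 (0 : ℝ), P ε) (side : ℝ) :
    ∀ᶠ ε in 𝓝[>] (0 : ℝ), P (side * ε) := by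
  have h1 : Tendsto (fun ε : ℝ => side * ε) (𝓝 0) (𝓝 (side * 0)) :=
    (continuous_const_mul side).tendsto 0
  rw [mul_zero] at h1
  exact (h1.eventually h).filter_mono nhdsWithin_le_nhds

lemma l2Lim_far (hs : ContDiff ℝ ∞ s) (hσ : ContDiff ℝ ∞ σ) (hI : MeasurableSet I)
    (hJ : MeasurableSet J) (hJ1 : J ⊆ Icc 0 1) {c : ℝ} (hc : 0 < c)
    (hlow : ∀ᶠ ε : ℝ in 𝓝 0, ∀ t ∈ I, ∀ u ∈ J,
      c ≤ ‖σ u - (s t + ε * Complex.I * deriv s t)‖)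
    (hg : MemLp g 2 unitMeasure) (side : ℝ) :
    L2Lim (fun ε => kernelOp (curveKernel s σ (side * ε)) I J g)
      (kernelOp (curveKernel s σ 0) I J g) := by
  obtain ⟨B, hB, hBb⟩ := exists_deriv_bound hσ
  refine L2Lim.of_bounded_kernel (fun ε => measurable_curveKernel hs hσ _) hI hJ hJ1 (M := B / c)
    ?_ ?_ hg
  · filter_upwards [eventually_side_mul hlow side] with ε hε t ht u hu
    rw [curveKernel, norm_div]
    have := hε t ht u hu
    have := hBb u (hJ1 hu)
    gcongr
  · intro t ht
    filter_upwards [ae_restrict_mem hJ] with u hu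
    refine tendsto_curveKernel side fun h => ?_
    have := hlow.self_of_nhds t ht u hu
    rw [h] at this
    simp at this
    linarith

/-- When `s` is displaced along its normals, the intersection with `σ` moves or leaves the box. The
bi-Lipschitz bound still yields a Schur kernel, centred at the minimum of the distance instead of at
the crossing. -/
lemma l2Lim_cross (hs : ContDiff ℝ ∞ s) (hσ : ContDiff ℝ ∞ σ) (hI : MeasurableSet I)
    (hJ : MeasurableSet J) (hI1 : I ⊆ Icc 0 1) (hJ1 : J ⊆ Icc 0 1) {c δ t₀ u₀ : ℝ} (hc : 0 < c)
    (hδ : 0 < δ) (heq : σ u₀ = s t₀)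
    (hlow : ∀ ε t t' u u' : ℝ, |ε| < δ → |t - t₀| < δ → |t' - t₀| < δ →
      |u - u₀| < δ → |u' - u₀| < δ → c * (|t - t'| + |u - u'|) ≤
        ‖(σ u - (s t + ε * Complex.I * deriv s t)) -
          (σ u' - (s t' + ε * Complex.I * deriv s t'))‖)
    (hIδ : ∀ t ∈ I, |t - t₀| ≤ δ / 2) (hJδ : ∀ u ∈ J, |u - u₀| ≤ δ / 2)
    (hg : MemLp g 2 unitMeasure) (side : ℝ) :
    L2Lim (fun ε => kernelOp (curveKernel s σ (side * ε)) I J g)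
      (kernelOp (curveKernel s σ 0) I J g) := by
  obtain ⟨B, hB, hBb⟩ := exists_deriv_bound hσ
  obtain ⟨B', hB', hBb'⟩ := exists_deriv_bound hs
  have hzero : ∀ t ∈ I, ∀ u ∈ J, c * (|t - t₀| + |u - u₀|) ≤ ‖σ u - s t‖ := by
    intro t ht u hu
    have := hlow 0 t t₀ u u₀ (by simpa using hδ) ((hIδ t ht).trans_lt (by linarith))
      (by simpa using hδ) ((hJδ u hu).trans_lt (by linarith)) (by simpa using hδ)
    simpa [heq] using this
  have hkb : ∀ (ε a b t u : ℝ), u ∈ J → c / 2 * (|t - a| + |u - b|) ≤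
      ‖σ u - (s t + ε * Complex.I * deriv s t)‖ →
      ‖curveKernel s σ ε t u‖ * (|t - a| + |u - b|) ≤ 2 * B / c := by
    intro ε a b t u hu h
    rw [curveKernel, norm_div]
    rcases eq_or_lt_of_le (norm_nonneg (σ u - (s t + ε * Complex.I * deriv s t))) with h0 | h0
    · rw [← h0]; simp; positivity
    · rw [div_mul_eq_mul_div, div_le_div_iff₀ h0 hc]
      calc ‖deriv σ u‖ * (|t - a| + |u - b|) * c
          = 2 * ‖deriv σ u‖ * (c / 2 * (|t - a| + |u - b|)) := by ring
        _ ≤ 2 * B * ‖σ u - (s t + ε * Complex.I * deriv s t)‖ := by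
            have := hBb u (hJ1 hu)
            gcongr
  have hsmall : ∀ r > 0, ∀ᶠ ε : ℝ in 𝓝 0, |ε| < r := fun r hr => by
    filter_upwards [Metric.ball_mem_nhds (0 : ℝ) hr] with ε hε
    simpa [Real.dist_eq] using hε
  refine L2Lim.of_cross_kernel (fun ε => measurable_curveKernel hs hσ _)
    (measurable_curveKernel hs hσ _) hI hJ hJ1 (C := 2 * B / c) (b₀ := u₀) ?_ ?_ ?_ ?_ hg
  · filter_upwards [eventually_side_mul (hsmall δ hδ) side] with ε hε
    set Q : Set (ℝ × ℝ) := Metric.closedBall t₀ (δ / 2) ×ˢ Metric.closedBall u₀ (δ / 2) with hQ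
    have hQc : IsCompact Q := (isCompact_closedBall _ _).prod (isCompact_closedBall _ _)
    have hcont : Continuous fun p : ℝ × ℝ =>
        ‖σ p.2 - (s p.1 + ((side * ε : ℝ) : ℂ) * Complex.I * deriv s p.1)‖ := by
      have h1 := hs.continuous
      have h2 := hσ.continuous
      have h3 := hs.continuous_deriv (by simp)
      fun_prop
    -- At a minimizer (a, b) of the modulus of the difference D, one has c(|t−a| + |u−b|) ≤ ‖D(t,u)‖
    -- + ‖D(a,b)‖ ≤ 2‖D(t,u)‖.
    obtain ⟨⟨a, b⟩, hab, hmin⟩ := hQc.exists_isMinOn (f := fun p : ℝ × ℝ =>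
        ‖σ p.2 - (s p.1 + ((side * ε : ℝ) : ℂ) * Complex.I * deriv s p.1)‖)
        ⟨(t₀, u₀), by simp [hQ]; positivity⟩ hcont.continuousOn
    simp only [hQ, mem_prod, Metric.mem_closedBall, Real.dist_eq] at hab
    refine ⟨a, b, fun t ht u hu => hkb _ _ _ _ _ hu ?_⟩
    have h1 := hlow (side * ε) t a u b hε ((hIδ t ht).trans_lt (by linarith))
      (hab.1.trans_lt (by linarith)) ((hJδ u hu).trans_lt (by linarith))
      (hab.2.trans_lt (by linarith))
    have h2 : ‖σ b - (s a + ((side * ε : ℝ) : ℂ) * Complex.I * deriv s a)‖ ≤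
        ‖σ u - (s t + ((side * ε : ℝ) : ℂ) * Complex.I * deriv s t)‖ :=
      hmin (show (t, u) ∈ Q by
        simp only [hQ, mem_prod, Metric.mem_closedBall, Real.dist_eq]; exact ⟨hIδ t ht, hJδ u hu⟩)
    have h3 := norm_sub_le (σ u - (s t + ((side * ε : ℝ) : ℂ) * Complex.I * deriv s t))
      (σ b - (s a + ((side * ε : ℝ) : ℂ) * Complex.I * deriv s a))
    linarith
  · refine ⟨t₀, u₀, fun t ht u hu => hkb _ _ _ _ _ hu ?_⟩
    have := hzero t ht u hu
    simp only [Complex.ofReal_zero, zero_mul, add_zero]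
    have h0 : 0 ≤ c * (|t - t₀| + |u - u₀|) := by positivity
    linarith
  · intro η hη
    refine ⟨B / (c * η / 2), ?_⟩
    filter_upwards [eventually_side_mul (hsmall (c * η / 2 / B') (by positivity)) side]
      with ε hε t ht u hu hηu
    rw [curveKernel, norm_div]
    have h1 := hzero t ht u hu
    have h2 : c * η ≤ c * (|t - t₀| + |u - u₀|) := by
      have := abs_nonneg (t - t₀)
      gcongr
      linarith
    have h3 : ‖((side * ε : ℝ) : ℂ) * Complex.I * deriv s t‖ ≤ c * η / 2 := by
      rw [norm_mul]
      have : ‖((side * ε : ℝ) : ℂ) * Complex.I‖ = |side * ε| := by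
        rw [norm_mul, Complex.norm_real, Complex.norm_I, mul_one, Real.norm_eq_abs]
      rw [this]
      calc _ ≤ c * η / 2 / B' * B' := by
            gcongr
            exact hBb' t (hI1 ht)
        _ = _ := by field_simp
    have h4 : c * η / 2 ≤ ‖σ u - (s t + ((side * ε : ℝ) : ℂ) * Complex.I * deriv s t)‖ := by
      rw [← sub_sub]
      have := norm_sub_norm_le (σ u - s t) (((side * ε : ℝ) : ℂ) * Complex.I * deriv s t)
      linarith
    have := hBb u (hJ1 hu)
    gcongr
  · intro t ht u hu hne
    refine tendsto_curveKernel side fun h => ?_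
    have := hzero t ht u hu
    rw [h, sub_self, norm_zero] at this
    have h5 : 0 < |u - u₀| := abs_pos.2 (sub_ne_zero.2 hne)
    have h6 := abs_nonneg (t - t₀)
    nlinarith

end

lemma L2Lim.of_volume {F : ℝ → ℝ → ℂ} {h : ℝ → ℂ}
    (hF : ∀ᶠ ε in 𝓝[>] 0, AEStronglyMeasurable (F ε) volume) (hh : MemLp h 2)
    (hlim : Tendsto (fun ε => eLpNorm (F ε - h) 2) (𝓝[>] 0) (𝓝 0)) : L2Lim F h := by
  refine ⟨hF.mono fun ε h => h.restrict, hh.restrict _, ?_⟩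
  exact tendsto_of_tendsto_of_tendsto_of_le_of_le tendsto_const_nhds hlim (fun _ => zero_le)
    fun ε => eLpNorm_mono_measure _ Measure.restrict_le_self

lemma exists_l2Lim_lineCauchy {f : ℝ → ℂ} (hf : Integrable f) (hf2 : MemLp f 2) :
    ∃ h, L2Lim (fun ε => lineCauchy ε f) h ∧
      L2Lim (fun ε => lineCauchy (-ε) f) (h - (2 * Real.pi * Complex.I : ℂ) • f) := by
  obtain ⟨h, hh, hlim⟩ := exists_tendsto_lineCauchy hf hf2
  have h1 : L2Lim (fun ε => lineCauchy ε f) h :=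
    L2Lim.of_volume (Eventually.of_forall fun ε => aestronglyMeasurable_lineCauchy hf.1 ε) hh hlim
  refine ⟨h, h1, ?_⟩
  have h2 : L2Lim (fun ε => lineCauchy ε f - lineCauchy (-ε) f)
      ((2 * Real.pi * Complex.I : ℂ) • f) :=
    L2Lim.of_volume (Eventually.of_forall fun ε => (aestronglyMeasurable_lineCauchy hf.1 ε).sub
      (aestronglyMeasurable_lineCauchy hf.1 (-ε))) (hf2.const_smul _)
      (tendsto_lineCauchy_sub_neg hf hf2)
  refine (h1.add (h2.const_mul (-1))).congr (Eventually.of_forall fun ε => ?_) ?_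
  · refine Eventually.of_forall fun t => ?_
    simp
  · refine Eventually.of_forall fun t => ?_
    simp
    ring

section
variable {s : ℝ → ℂ} {I J : Set ℝ} {g : ℝ → ℂ}

/-- The kernel of the curve with itself is the kernel of the line plus a bounded remainder `R`. The
number `n` is a period of the curve: it allows `I` and `J` to lie at opposite ends of the parameter
interval of a closed curve, and the density is translated by `n` before the result on the line is
applied. -/
lemma exists_l2Lim_diag (hs : ContDiff ℝ ∞ s) (hI : MeasurableSet I) (hJ : MeasurableSet J)
    (hJ1 : J ⊆ Icc 0 1) {c δ M t₀ n : ℝ} (hc : 0 < c) (hδ : 0 < δ)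
    (hper : ∀ u, s (u - n) = s u)
    (hker : ∀ t v ρ : ℝ, |t - t₀| < δ → |v - t₀| < δ → |ρ| < δ →
      c * ‖(v : ℂ) - t - ρ * Complex.I‖ ≤ ‖s v - (s t + ρ * Complex.I * deriv s t)‖ ∧
      ‖deriv s v / (s v - (s t + ρ * Complex.I * deriv s t)) -
        1 / ((v : ℂ) - t - ρ * Complex.I)‖ ≤ M)
    (hIδ : ∀ t ∈ I, |t - t₀| < δ) (hJδ : ∀ u ∈ J, |u - n - t₀| < δ)
    (hg : MemLp g 2 unitMeasure) :
    ∃ h, L2Lim (fun ε => kernelOp (curveKernel s s ε) I J g) h ∧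
      L2Lim (fun ε => kernelOp (curveKernel s s (-ε)) I J g)
        (h - (2 * Real.pi * Complex.I : ℂ) • I.indicator fun v => J.indicator g (v + n)) := by
  have hgi := integrableOn_of_memLp_unitMeasure hg hJ1
  set f : ℝ → ℂ := fun v => J.indicator g (v + n) with hf
  have hmp := measurePreserving_add_right (volume : Measure ℝ) n
  have hJi : Integrable (J.indicator g) := (integrable_indicator_iff hJ).2 hgi
  have hJ2 : MemLp (J.indicator g) 2 := (memLp_indicator_iff_restrict hJ).2
    (hg.mono_measure (Measure.restrict_mono hJ1 le_rfl))
  have hfi : Integrable f := hmp.integrable_comp_of_integrable hJi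
  have hf2 : MemLp f 2 := hJ2.comp_measurePreserving hmp
  have hder : ∀ u, deriv s (u - n) = deriv s u := by
    intro u
    have h1 : (fun x => s (x - n)) = s := funext hper
    rw [← deriv_comp_sub_const, h1]
  set R : ℝ → ℝ → ℝ → ℂ := fun ε t u =>
    curveKernel s s ε t u - 1 / (((u - n : ℝ) : ℂ) - t - ε * Complex.I) with hR
  have hRm : ∀ ε, Measurable (Function.uncurry (R ε)) := by
    intro ε
    refine (measurable_curveKernel hs hs ε).sub ?_
    fun_prop
  have hKe : ∀ ε t u, curveKernel s s ε t u =
      deriv s (u - n) / (s (u - n) - (s t + ε * Complex.I * deriv s t)) := by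
    intro ε t u
    rw [curveKernel, hper, hder]
  have hRb : ∀ ε, |ε| < δ → ∀ t ∈ I, ∀ u ∈ J, ‖R ε t u‖ ≤ M := by
    intro ε hε t ht u hu
    simp only [hR, hKe]
    exact (hker t (u - n) ε (hIδ t ht) (hJδ u hu) hε).2
  have hsmall : ∀ᶠ ε : ℝ in 𝓝 0, |ε| < δ := by
    filter_upwards [Metric.ball_mem_nhds (0 : ℝ) hδ] with ε hε
    simpa [Real.dist_eq] using hε
  have hRlim : ∀ side : ℝ, L2Lim (fun ε => kernelOp (R (side * ε)) I J g) (kernelOp (R 0) I J g) := by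
    intro side
    refine L2Lim.of_bounded_kernel (fun ε => hRm _) hI hJ hJ1 (M := M) ?_ ?_ hg
    · filter_upwards [eventually_side_mul hsmall side] with ε hε using hRb _ hε
    · intro t ht
      have hne : ∀ᵐ u : ℝ ∂volume.restrict J, u ≠ t + n :=
        ae_restrict_of_ae (by simp [ae_iff])
      filter_upwards [ae_restrict_mem hJ, hne] with u hu hut
      have hut' : ((u - n : ℝ) : ℂ) - t ≠ 0 := by
        rw [← Complex.ofReal_sub]
        exact_mod_cast fun h => hut (by linarith)
      refine (tendsto_curveKernel side fun h => ?_).sub ?_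
      · have h1 := (hker t (u - n) 0 (hIδ t ht) (hJδ u hu) (by simpa using hδ)).1
        rw [hper] at h1
        simp only [Complex.ofReal_zero, zero_mul, sub_zero, add_zero, h, sub_self, norm_zero] at h1
        have h2 : 0 < ‖((u - n : ℝ) : ℂ) - t‖ := norm_pos_iff.2 hut'
        nlinarith
      · have hc : ContinuousAt (fun ε : ℝ =>
            1 / (((u - n : ℝ) : ℂ) - t - ((side * ε : ℝ) : ℂ) * Complex.I)) 0 := by
          refine ContinuousAt.div continuousAt_const (by fun_prop) ?_
          simpa using hut'
        have := hc.tendsto.mono_left (nhdsWithin_le_nhds (s := Ioi 0))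
        simpa using this
  have hdec : ∀ ε, ε ≠ 0 → |ε| < δ →
      I.indicator (lineCauchy ε f) + kernelOp (R ε) I J g = kernelOp (curveKernel s s ε) I J g := by
    intro ε hε0 hε
    ext t
    by_cases ht : t ∈ I
    · simp only [Pi.add_apply, kernelOp, indicator_of_mem ht]
      have e1 : lineCauchy ε f t =
          ∫ u in J, 1 / (((u - n : ℝ) : ℂ) - t - ε * Complex.I) * g u := by
        rw [lineCauchy]
        conv_rhs => rw [← integral_indicator hJ, ← integral_add_right_eq_self _ n]
        congr 1 with v
        simp only [hf]
        by_cases hv : v + n ∈ J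
        · simp [hv]; ring
        · simp [hv]
      have i1 : IntegrableOn (fun u : ℝ => 1 / (((u - n : ℝ) : ℂ) - t - ε * Complex.I) * g u) J := by
        have := integrable_div_sub_sub_mul_I hJi (t + n) hε0
        have h2 := this.integrableOn (s := J)
        refine h2.congr_fun (fun u hu => ?_) hJ
        simp only [indicator_of_mem hu]
        push_cast
        rw [one_div, div_eq_mul_inv, mul_comm]
        congr 2
        ring
      have i2 : IntegrableOn (fun u : ℝ => R ε t u * g u) J := by
        refine Integrable.bdd_mul hgi ((hRm ε).comp measurable_prodMk_left).aestronglyMeasurable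
          (c := M) ?_
        filter_upwards [ae_restrict_mem hJ] with u hu using hRb ε hε t ht u hu
      rw [e1, ← integral_add i1 i2]
      congr 1 with u
      simp only [hR]
      ring
    · simp [kernelOp, ht]
  obtain ⟨h, hh1, hh2⟩ := exists_l2Lim_lineCauchy hfi hf2
  refine ⟨I.indicator h + kernelOp (R 0) I J g, ?_, ?_⟩
  · have hR1 := hRlim 1
    simp only [one_mul] at hR1
    refine ((hh1.indicator hI).add hR1).congr ?_ (Eventually.of_forall fun _ => rfl)
    have := eventually_side_mul hsmall 1
    filter_upwards [this, self_mem_nhdsWithin] with ε hε hε0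
    rw [one_mul] at hε
    rw [hdec ε (ne_of_gt hε0) hε]
  · have hR1 := hRlim (-1)
    simp only [neg_one_mul] at hR1
    refine ((hh2.indicator hI).add hR1).congr ?_ (Eventually.of_forall fun t => ?_)
    · have := eventually_side_mul hsmall (-1)
      filter_upwards [this, self_mem_nhdsWithin] with ε hε hε0
      rw [neg_one_mul] at hε
      rw [hdec (-ε) (neg_ne_zero.2 (ne_of_gt hε0)) hε]
    · by_cases ht : t ∈ I
      · simp [ht]; ring
      · simp [ht]

end

/-- The Cauchy integral over `σ ∣ J` has `L²` boundary values on `s ∣ I` from both sides, with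
jump `χ • g` on `I ∩ J`. -/
def HasBoxLim (s σ : ℝ → ℂ) (χ : ℂ) (I J : Set ℝ) : Prop :=
  ∀ g, MemLp g 2 unitMeasure →
    ∃ h, L2Lim (fun ε => kernelOp (curveKernel s σ ε) I J g) h ∧
      L2Lim (fun ε => kernelOp (curveKernel s σ (-ε)) I J g) (h - χ • (I ∩ J).indicator g)

/-- A set of parameters on which the Cauchy integral is under control. -/
structure GoodBox (s σ : ℝ → ℂ) (χ : ℂ) (U : Set (ℝ × ℝ)) : Prop where
  lim : ∀ I J, MeasurableSet I → MeasurableSet J → I ⊆ Icc 0 1 → J ⊆ Icc 0 1 → I ×ˢ J ⊆ U →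
    HasBoxLim s σ χ I J
  hit : ∀ᶠ ε : ℝ in 𝓝[≠] 0,
    {t | ∃ u, (t, u) ∈ U ∧ σ u = s t + ε * Complex.I * deriv s t}.Subsingleton

lemma GoodBox.mono {s σ : ℝ → ℂ} {χ : ℂ} {U V : Set (ℝ × ℝ)} (h : GoodBox s σ χ U) (hVU : V ⊆ U) :
    GoodBox s σ χ V := by
  refine ⟨fun I J hI hJ hI1 hJ1 hIJ => h.lim I J hI hJ hI1 hJ1 (hIJ.trans hVU), ?_⟩
  filter_upwards [h.hit] with ε hε
  exact hε.anti fun t ⟨u, hu, hu2⟩ => ⟨u, hVU hu, hu2⟩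

/-- If the limits from the two sides coincide, the box contributes no jump. This is consistent
because either χ vanishes or the box does not meet the diagonal. -/
lemma HasBoxLim.of_eq {s σ : ℝ → ℂ} {χ : ℂ} {I J : Set ℝ} (hχ : χ = 0 ∨ I ∩ J = ∅)
    (h : ∀ g, MemLp g 2 unitMeasure → ∀ side : ℝ,
      L2Lim (fun ε => kernelOp (curveKernel s σ (side * ε)) I J g)
        (kernelOp (curveKernel s σ 0) I J g)) : HasBoxLim s σ χ I J := by
  intro g hg
  refine ⟨_, by simpa using h g hg 1, ?_⟩
  have e : χ • (I ∩ J).indicator g = 0 := by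
    rcases hχ with h | h
    · simp [h]
    · rw [h, indicator_empty]; exact smul_zero _
  rw [e, sub_zero]
  simpa using h g hg (-1)

lemma HasBoxLim.of_empty {s σ : ℝ → ℂ} {χ : ℂ} {I J : Set ℝ} (h : I = ∅ ∨ J = ∅) :
    HasBoxLim s σ χ I J := by
  refine HasBoxLim.of_eq (Or.inr ?_) fun g hg side => ?_
  · rcases h with rfl | rfl <;> simp
  · have hz : ∀ K : ℝ → ℝ → ℂ, kernelOp K I J g = 0 := fun K => by
      rcases h with rfl | rfl
      · exact indicator_empty _
      · ext t
        simp [kernelOp]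
    simp only [hz]
    exact L2Lim.zero

lemma exists_goodBox_far {s σ : ℝ → ℂ} (hs : ContDiff ℝ ∞ s) (hσ : ContDiff ℝ ∞ σ) {χ : ℂ}
    (hχ : χ = 0 ∨ s = σ) {t₀ u₀ : ℝ} (hne : σ u₀ ≠ s t₀) :
    ∃ U ∈ 𝓝 (t₀, u₀), GoodBox s σ χ U := by
  have hcont : Continuous fun q : ℝ × (ℝ × ℝ) =>
      ‖σ q.2.2 - (s q.2.1 + q.1 * Complex.I * deriv s q.2.1)‖ := by
    have h1 := hs.continuous
    have h2 := hσ.continuous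
    have h3 := hs.continuous_deriv (by simp)
    fun_prop
  have hpos : 0 < ‖σ u₀ - s t₀‖ := norm_pos_iff.2 (sub_ne_zero.2 hne)
  have hev : ∀ᶠ q : ℝ × (ℝ × ℝ) in 𝓝 (0, (t₀, u₀)), ‖σ u₀ - s t₀‖ / 2 <
      ‖σ q.2.2 - (s q.2.1 + q.1 * Complex.I * deriv s q.2.1)‖ := by
    refine (hcont.tendsto (0, (t₀, u₀))).eventually_const_lt ?_
    simp only [Complex.ofReal_zero, zero_mul, add_zero]
    linarith
  rw [nhds_prod_eq] at hev
  obtain ⟨P, hP, Q, hQ, hPQ⟩ := eventually_prod_iff.1 hev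
  refine ⟨{p | Q p}, hQ, ?_, ?_⟩
  · intro I J hI hJ hI1 hJ1 hIJ
    have hlow : ∀ᶠ ε : ℝ in 𝓝 0, ∀ t ∈ I, ∀ u ∈ J,
        ‖σ u₀ - s t₀‖ / 2 ≤ ‖σ u - (s t + ε * Complex.I * deriv s t)‖ := by
      filter_upwards [hP] with ε hε t ht u hu
      exact (hPQ hε (hIJ (mk_mem_prod ht hu))).le
    refine HasBoxLim.of_eq ?_ fun g hg side => l2Lim_far hs hσ hI hJ hJ1 (half_pos hpos) hlow hg side
    refine hχ.imp_right fun h => ?_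
    subst h
    by_contra hne2
    obtain ⟨t, ht1, ht2⟩ := nonempty_iff_ne_empty.2 hne2
    have := hlow.self_of_nhds t ht1 t ht2
    simp only [Complex.ofReal_zero, zero_mul, add_zero, sub_self, norm_zero] at this
    linarith
  · filter_upwards [hP.filter_mono nhdsWithin_le_nhds] with ε hε
    rintro t ⟨u, hu, hu2⟩
    have := hPQ hε hu
    simp only [hu2, sub_self, norm_zero] at this
    linarith

lemma exists_goodBox_cross {s σ : ℝ → ℂ} (hs : ContDiff ℝ ∞ s) (hσ : ContDiff ℝ ∞ σ) {χ : ℂ}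
    {t₀ u₀ : ℝ} (hχ : χ = 0 ∨ (s = σ ∧ t₀ ≠ u₀)) (heq : σ u₀ = s t₀)
    (hli : LinearIndependent ℝ ![deriv s t₀, deriv σ u₀]) :
    ∃ U ∈ 𝓝 (t₀, u₀), GoodBox s σ χ U := by
  obtain ⟨c, δ, hc, hδ, hlow⟩ := exists_cross_lower hs hσ hli
  refine ⟨Metric.ball t₀ (δ / 2) ×ˢ Metric.ball u₀ (δ / 2),
    prod_mem_nhds (Metric.ball_mem_nhds _ (by positivity)) (Metric.ball_mem_nhds _ (by positivity)),
    ?_, ?_⟩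
  · intro I J hI hJ hI1 hJ1 hIJ
    rcases I.eq_empty_or_nonempty with rfl | ⟨t₁, ht₁⟩
    · exact HasBoxLim.of_empty (Or.inl rfl)
    rcases J.eq_empty_or_nonempty with rfl | ⟨u₁, hu₁⟩
    · exact HasBoxLim.of_empty (Or.inr rfl)
    have hIδ : ∀ t ∈ I, |t - t₀| ≤ δ / 2 := fun t ht => by
      have := (hIJ (mk_mem_prod ht hu₁)).1
      rw [Metric.mem_ball, Real.dist_eq] at this
      exact this.le
    have hJδ : ∀ u ∈ J, |u - u₀| ≤ δ / 2 := fun u hu => by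
      have := (hIJ (mk_mem_prod ht₁ hu)).2
      rw [Metric.mem_ball, Real.dist_eq] at this
      exact this.le
    refine HasBoxLim.of_eq ?_ fun g hg side =>
      l2Lim_cross hs hσ hI hJ hI1 hJ1 hc hδ heq hlow hIδ hJδ hg side
    refine hχ.imp_right fun ⟨h, hne⟩ => ?_
    subst h
    by_contra hne2
    obtain ⟨t, ht1, ht2⟩ := nonempty_iff_ne_empty.2 hne2
    have := hlow 0 t t₀ t u₀ (by simpa using hδ) ((hIδ t ht1).trans_lt (by linarith))
      (by simpa using hδ) ((hJδ t ht2).trans_lt (by linarith)) (by simpa using hδ)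
    simp [heq] at this
    have h1 := abs_nonneg (t - t₀)
    have h2 := abs_nonneg (t - u₀)
    have h3 : |t - t₀| = 0 := by nlinarith
    have h4 : |t - u₀| = 0 := by nlinarith
    rw [abs_eq_zero] at h3 h4
    exact hne (by linarith)
  · have hsm : ∀ᶠ ε : ℝ in 𝓝 0, |ε| < δ := by
      filter_upwards [Metric.ball_mem_nhds (0 : ℝ) hδ] with ε hε
      simpa [Real.dist_eq] using hε
    filter_upwards [hsm.filter_mono nhdsWithin_le_nhds] with ε hε
    rintro t ⟨u, ⟨ht, hu⟩, hu2⟩ t' ⟨u', ⟨ht', hu'⟩, hu2'⟩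
    simp only [Metric.mem_ball, Real.dist_eq] at ht hu ht' hu'
    have := hlow ε t t' u u' hε (by linarith) (by linarith) (by linarith) (by linarith)
    rw [hu2, hu2'] at this
    simp at this
    have h1 := abs_nonneg (t - t')
    have h2 := abs_nonneg (u - u')
    have h3 : |t - t'| = 0 := by nlinarith
    rw [abs_eq_zero] at h3
    linarith

/-- Covers the true diagonal (n = 0) and, for n = ±1, the pair formed by the two ends of a closed
curve, where the kernel is just as singular although the parameters are far apart. -/
lemma exists_goodBox_diag {s : ℝ → ℂ} (hs : ContDiff ℝ ∞ s) {t₀ u₀ n : ℝ} (h0 : deriv s t₀ ≠ 0)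
    (hn : u₀ = t₀ + n) (hn1 : n = 0 ∨ |n| = 1) (hper : ∀ u, s (u - n) = s u) :
    ∃ U ∈ 𝓝 (t₀, u₀), GoodBox s s (2 * Real.pi * Complex.I) U := by
  obtain ⟨c, δ, M, hc, hδ, hker⟩ := exists_kernel_local hs h0 0 le_rfl
  have hker' : ∀ t v ρ : ℝ, |t - t₀| < δ → |v - t₀| < δ → |ρ| < δ →
      c * ‖(v : ℂ) - t - ρ * Complex.I‖ ≤ ‖s v - (s t + ρ * Complex.I * deriv s t)‖ ∧
      ‖deriv s v / (s v - (s t + ρ * Complex.I * deriv s t)) -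
        1 / ((v : ℂ) - t - ρ * Complex.I)‖ ≤ M := fun t v ρ ht hv hρ =>
    hker t v ρ ht hv hρ _ (by simp)
  set r := min δ (1 / 4) with hr
  have hrp : 0 < r := lt_min hδ (by norm_num)
  refine ⟨Metric.ball t₀ r ×ˢ Metric.ball u₀ r,
    prod_mem_nhds (Metric.ball_mem_nhds _ hrp) (Metric.ball_mem_nhds _ hrp), ?_, ?_⟩
  · intro I J hI hJ hI1 hJ1 hIJ
    rcases I.eq_empty_or_nonempty with rfl | ⟨t₁, ht₁⟩
    · exact HasBoxLim.of_empty (Or.inl rfl)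
    rcases J.eq_empty_or_nonempty with rfl | ⟨u₁, hu₁⟩
    · exact HasBoxLim.of_empty (Or.inr rfl)
    have hIδ : ∀ t ∈ I, |t - t₀| < r := fun t ht => by
      have := (hIJ (mk_mem_prod ht hu₁)).1
      rwa [Metric.mem_ball, Real.dist_eq] at this
    have hJδ : ∀ u ∈ J, |u - n - t₀| < r := fun u hu => by
      have := (hIJ (mk_mem_prod ht₁ hu)).2
      rw [Metric.mem_ball, Real.dist_eq, hn] at this
      rwa [show u - n - t₀ = u - (t₀ + n) by ring]
    intro g hg
    obtain ⟨h, hh1, hh2⟩ := exists_l2Lim_diag hs hI hJ hJ1 hc hδ hper hker'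
      (fun t ht => (hIδ t ht).trans_le (min_le_left _ _))
      (fun u hu => (hJδ u hu).trans_le (min_le_left _ _)) hg
    refine ⟨h, hh1, hh2.congr (Eventually.of_forall fun ε => EventuallyEq.rfl) ?_⟩
    -- For |n| = 1 the radius at most 1/4 keeps I and J disjoint, and both v and v + n lie in [0, 1]
    -- only for v = 0 or v = 1, a null set. So the jump of the translated density is the expected
    -- one, namely zero.
    have key : (I.indicator fun v => J.indicator g (v + n)) =ᵐ[unitMeasure] (I ∩ J).indicator g := by
      rcases hn1 with rfl | hn1
      · refine Eventually.of_forall fun t => ?_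
        simp only [add_zero]
        rw [← indicator_indicator]
      · have hempty : I ∩ J = ∅ := by
          by_contra hne2
          obtain ⟨t, ht1, ht2⟩ := nonempty_iff_ne_empty.2 hne2
          have h1 := hIδ t ht1
          have h2 := hJδ t ht2
          have h3 : n = (t - t₀) - (t - n - t₀) := by ring
          have h4 := abs_sub (t - t₀) (t - n - t₀)
          rw [← h3, hn1] at h4
          have h5 : r ≤ 1 / 4 := min_le_right _ _
          linarith
        rw [hempty]
        have hae : ∀ᵐ t : ℝ ∂unitMeasure, t ≠ 0 ∧ t ≠ 1 :=
          ae_restrict_of_ae ((by simp [ae_iff] : ∀ᵐ t : ℝ, t ≠ 0).and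
            (by simp [ae_iff] : ∀ᵐ t : ℝ, t ≠ 1))
        filter_upwards [hae] with t ht
        simp only [indicator_empty]
        by_cases htI : t ∈ I
        · rw [indicator_of_mem htI, indicator_of_notMem]
          intro htJ
          have h1 := hI1 htI
          have h2 := hJ1 htJ
          rcases eq_or_eq_neg_of_abs_eq hn1 with rfl | rfl
          · exact ht.1 (le_antisymm (by linarith [h2.2]) h1.1)
          · exact ht.2 (le_antisymm h1.2 (by linarith [h2.1]))
        · rw [indicator_of_notMem htI]
    filter_upwards [key] with t ht
    simp [ht]
  · have hsm : ∀ᶠ ε : ℝ in 𝓝 0, |ε| < δ := by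
      filter_upwards [Metric.ball_mem_nhds (0 : ℝ) hδ] with ε hε
      simpa [Real.dist_eq] using hε
    filter_upwards [hsm.filter_mono nhdsWithin_le_nhds, self_mem_nhdsWithin] with ε hε hε0
    rintro t ⟨u, ⟨ht, hu⟩, hu2⟩
    simp only [Metric.mem_ball, Real.dist_eq] at ht hu
    have h1 := (hker' t (u - n) ε (ht.trans_le (min_le_left _ _)) (by
      rw [show u - n - t₀ = u - u₀ by rw [hn]; ring]; exact hu.trans_le (min_le_left _ _)) hε).1
    rw [hper, hu2, sub_self, norm_zero] at h1
    have h2 : 0 < ‖((u - n : ℝ) : ℂ) - t - ε * Complex.I‖ :=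
      norm_pos_iff.2 (sub_sub_mul_I_ne_zero _ _ hε0)
    nlinarith

/-! ### Good boxes around every pair of parameters of a contour -/

namespace Contour
variable (Γ : Contour)

/-- The parameters of a curve, without the double end point of a closed curve. -/
def dom (j : Fin Γ.n) : Set ℝ := if Γ.closed j then Ico 0 1 else Icc 0 1

variable {Γ}

/-- The hypotheses on intersections use [0, 1) for closed curves. The parameter 1 is replaced by 0,
and t − t' is then a period of the curve. -/
lemma exists_rep (j : Fin Γ.n) {t : ℝ} (ht : t ∈ Icc (0 : ℝ) 1) :
    ∃ t' ∈ Γ.dom j, (∀ x, Γ.curve j (x - (t - t')) = Γ.curve j x) ∧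
      (t' = t ∨ (t = 1 ∧ t' = 0)) := by
  by_cases hc : Γ.closed j = true
  · by_cases h1 : t = 1
    · refine ⟨0, by simp [dom, hc], fun x => ?_, Or.inr ⟨h1, rfl⟩⟩
      rw [h1, sub_zero]
      exact (Γ.periodic j hc).sub_eq x
    · exact ⟨t, by simp [dom, hc]; exact ⟨ht.1, lt_of_le_of_ne ht.2 h1⟩, by simp, Or.inl rfl⟩
  · exact ⟨t, by simpa [dom, hc] using ht, by simp, Or.inl rfl⟩

lemma _root_.SymRHP.not_linearIndependent_pair_self (a : ℂ) : ¬ LinearIndependent ℝ ![a, a] := by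
  intro h
  have := (LinearIndependent.pair_iff.1 h 1 (-1) (by simp)).1
  exact one_ne_zero this

lemma deriv_rep {j : Fin Γ.n} {t t' : ℝ} (h : ∀ x, Γ.curve j (x - (t - t')) = Γ.curve j x) :
    Γ.curve j t' = Γ.curve j t ∧ deriv (Γ.curve j) t' = deriv (Γ.curve j) t := by
  have h1 := h t
  rw [sub_sub_cancel] at h1
  refine ⟨h1, ?_⟩
  have h2 : (fun x => Γ.curve j (x - (t - t'))) = Γ.curve j := funext h
  conv_rhs => rw [← h2]
  rw [deriv_comp_sub_const, sub_sub_cancel]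

/-- The jump of the Cauchy integral. -/
def jumpConst (j k : Fin Γ.n) : ℂ := if j = k then 2 * Real.pi * Complex.I else 0

/-- Three cases: the points differ; they are the same parameter up to a period; or they are a
genuine intersection, which is transversal by assumption. -/
lemma exists_goodBox (j k : Fin Γ.n) {t₀ u₀ : ℝ} (ht : t₀ ∈ Icc (0 : ℝ) 1)
    (hu : u₀ ∈ Icc (0 : ℝ) 1) :
    ∃ U ∈ 𝓝 (t₀, u₀), GoodBox (Γ.curve j) (Γ.curve k) (jumpConst j k) U := by
  by_cases heq : Γ.curve k u₀ = Γ.curve j t₀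
  · obtain ⟨t', ht', htp, htc⟩ := Γ.exists_rep j ht
    obtain ⟨u', hu', hup, huc⟩ := Γ.exists_rep k hu
    obtain ⟨e1, e2⟩ := deriv_rep htp
    obtain ⟨e3, e4⟩ := deriv_rep hup
    by_cases hd : (j, t') = (k, u')
    · obtain ⟨rfl, rfl⟩ := Prod.mk.inj hd
      rw [jumpConst, if_pos rfl]
      refine exists_goodBox_diag (n := u₀ - t₀) (Γ.smooth j) (Γ.regular j t₀ ht) (by ring) ?_ ?_
      · rcases htc with h1 | ⟨h1, h2⟩ <;> rcases huc with h3 | ⟨h3, h4⟩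
        · left; linarith
        · right; rw [← h1, h3, h4]; norm_num
        · right; rw [← h3, h1, h2]; norm_num
        · left; linarith
      · intro u
        have h1 := hup (u + (t₀ - t'))
        have h2 := htp (u + (t₀ - t'))
        rw [show u + (t₀ - t') - (u₀ - t') = u - (u₀ - t₀) by ring] at h1
        rw [add_sub_cancel_right] at h2
        rw [h1, h2]
    · refine exists_goodBox_cross (Γ.smooth j) (Γ.smooth k) ?_ heq ?_
      · by_cases hjk : j = k
        · right
          subst hjk
          refine ⟨rfl, ?_⟩
          rintro rfl
          apply hd
          -- Two representatives of one parameter can differ only if one is 1 and the other 0. On a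
          -- closed curve 1 is not admissible; on an arc the two ends would coincide with equal
          -- tangents, against transversality.
          rcases htc with h1 | ⟨h1, h2⟩ <;> rcases huc with h3 | ⟨h3, h4⟩
          · rw [h1, h3]
          · exfalso
            rw [h3] at h1
            rw [h1] at ht'
            rw [h4] at hu'
            have := hup 1
            rw [h3, h4] at this
            by_cases hc : Γ.closed j = true
            · simp [dom, hc] at ht'
            · have h6 := Γ.transversal j j 0 (by simp [hc]) 1 (by simp [hc]) (by simp)
                (by simpa using this)
              have h7 := (deriv_rep (Γ := Γ) (j := j) (t := t₀) (t' := u') (by simpa using hup)).2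
              rw [h3, h4] at h7
              rw [h7] at h6
              exact not_linearIndependent_pair_self _ h6
          · exfalso
            rw [h1] at h3
            rw [h3] at hu'
            rw [h2] at ht'
            have := htp 1
            rw [h1, h2] at this
            by_cases hc : Γ.closed j = true
            · simp [dom, hc] at hu'
            · have h6 := Γ.transversal j j 0 (by simp [hc]) 1 (by simp [hc]) (by simp)
                (by simpa using this)
              have h7 := (deriv_rep (Γ := Γ) (j := j) (t := t₀) (t' := t') (by simpa using htp)).2
              rw [h1, h2] at h7
              rw [h7] at h6
              exact not_linearIndependent_pair_self _ h6
          · rw [h2, h4]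
        · left; simp [jumpConst, hjk]
      · rw [← e2, ← e4]
        exact Γ.transversal j k t' ht' u' hu' hd (by rw [e1, e3, heq])
  · refine exists_goodBox_far (Γ.smooth j) (Γ.smooth k) ?_ heq
    by_cases hjk : j = k
    · right; rw [hjk]
    · left; simp [jumpConst, hjk]

end Contour

/-! ### Subdivision of the parameter square and boundary values for a pair of curves -/

/-- The cells of a subdivision of the unit interval. -/
def cell (N i : ℕ) : Set ℝ := Ioc ((i : ℝ) / N) (((i + 1 : ℕ) : ℝ) / N)

lemma measurableSet_cell (N i : ℕ) : MeasurableSet (cell N i) := measurableSet_Ioc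

lemma monotone_div (N : ℕ) : Monotone fun i : ℕ => (i : ℝ) / N := fun i j hij => by
  dsimp only
  gcongr

lemma pairwise_disjoint_cell (N : ℕ) : Pairwise (Function.onFun Disjoint (cell N)) := by
  have := (monotone_div N).pairwise_disjoint_on_Ioc_succ
  exact this

lemma iUnion_cell {N : ℕ} (hN : 0 < N) : ⋃ i ∈ Finset.range N, cell N i = Ioc 0 1 := by
  have := (monotone_div N).biUnion_Ico_Ioc_map_succ 0 N
  have hN' : (N : ℝ) ≠ 0 := by positivity
  simp only [Nat.cast_zero, zero_div, div_self hN'] at this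
  rw [← this]
  ext x
  simp [cell]

lemma cell_subset {N i : ℕ} (hi : i < N) : cell N i ⊆ Icc 0 1 := by
  have hN : 0 < N := by omega
  refine Subset.trans ?_ Ioc_subset_Icc_self
  rw [← iUnion_cell hN]
  exact subset_biUnion_of_mem (u := fun i => cell N i) (by simpa using hi)

lemma sum_indicator_cell {N : ℕ} (hN : 0 < N) (f : ℝ → ℂ) :
    ∑ i ∈ Finset.range N, (cell N i).indicator f = (Ioc (0 : ℝ) 1).indicator f := by
  rw [← iUnion_cell hN, Finset.indicator_biUnion]
  · ext x
    simp
  · intro i _ j _ hij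
    exact pairwise_disjoint_cell N hij

lemma integral_cell {N : ℕ} (hN : 0 < N) {f : ℝ → ℂ} (hf : IntegrableOn f (Ioc 0 1)) :
    ∑ i ∈ Finset.range N, ∫ u in cell N i, f u = ∫ u in (0 : ℝ)..1, f u := by
  rw [intervalIntegral.integral_of_le zero_le_one, ← iUnion_cell hN,
    integral_biUnion_finset _ (fun i _ => measurableSet_cell N i)]
  · intro i _ j _ hij
    exact pairwise_disjoint_cell N hij
  · intro i hi
    refine hf.mono_set ?_
    rw [← iUnion_cell hN]
    exact subset_biUnion_of_mem (u := fun i => cell N i) hi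

lemma ae_mem_Ioc : ∀ᵐ t ∂unitMeasure, t ∈ Ioc (0 : ℝ) 1 := by
  rw [unitMeasure, ← restrict_Ioc_eq_restrict_Icc]
  exact ae_restrict_mem measurableSet_Ioc

lemma intervalIntegrable_cauchy {σ : ℝ → ℂ} (hσ : ContDiff ℝ ∞ σ) {z : ℂ}
    (hz : ∀ u ∈ Icc (0 : ℝ) 1, σ u ≠ z) {g : ℝ → ℂ} (hg : MemLp g 2 unitMeasure) :
    IntervalIntegrable (fun u => deriv σ u / (σ u - z) * g u) volume 0 1 := by
  rw [intervalIntegrable_iff_integrableOn_Icc_of_le zero_le_one]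
  have hgi : IntegrableOn g (Icc 0 1) := integrableOn_of_memLp_unitMeasure hg Subset.rfl
  have hc : ContinuousOn (fun u => deriv σ u / (σ u - z)) (Icc 0 1) := by
    refine ContinuousOn.div (hσ.continuous_deriv (by simp)).continuousOn
      (hσ.continuous.continuousOn.sub continuousOn_const) fun u hu => sub_ne_zero.2 (hz u hu)
  exact hgi.continuousOn_mul hc isCompact_Icc

namespace Contour
variable {Γ : Contour}

/-- A Lebesgue number of the cover of the compact unit square by good boxes. -/
lemma exists_grid (j k : Fin Γ.n) : ∃ N : ℕ, 0 < N ∧ ∀ a < N, ∀ b < N,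
    GoodBox (Γ.curve j) (Γ.curve k) (jumpConst j k)
      (Icc ((a : ℝ) / N) (((a + 1 : ℕ) : ℝ) / N) ×ˢ
        Icc ((b : ℝ) / N) (((b + 1 : ℕ) : ℝ) / N)) := by
  have hK : IsCompact (Icc (0 : ℝ) 1 ×ˢ Icc (0 : ℝ) 1) := isCompact_Icc.prod isCompact_Icc
  have hgood : ∀ x : (Icc (0 : ℝ) 1 ×ˢ Icc (0 : ℝ) 1 : Set (ℝ × ℝ)), ∃ U, IsOpen U ∧ (x : ℝ × ℝ) ∈ U ∧
      GoodBox (Γ.curve j) (Γ.curve k) (jumpConst j k) U := by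
    rintro ⟨⟨t, u⟩, ht, hu⟩
    obtain ⟨U, hU, hgb⟩ := exists_goodBox j k ht hu
    exact ⟨interior U, isOpen_interior, mem_interior_iff_mem_nhds.2 hU, hgb.mono interior_subset⟩
  choose U hUo hUm hUg using hgood
  obtain ⟨δ, hδ, hleb⟩ := lebesgue_number_lemma_of_metric hK hUo
    (fun x hx => mem_iUnion.2 ⟨⟨x, hx⟩, hUm ⟨x, hx⟩⟩)
  obtain ⟨N, hN⟩ := exists_nat_gt (1 / δ)
  have hNp : (0 : ℝ) < N := lt_trans (by positivity) hN
  have hN1 : 1 / (N : ℝ) < δ := by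
    rw [div_lt_iff₀ hNp]
    rw [div_lt_iff₀ hδ] at hN
    linarith
  have hmem : ∀ a < N, (a : ℝ) / N ∈ Icc (0 : ℝ) 1 := fun a ha => by
    refine ⟨by positivity, ?_⟩
    rw [div_le_one hNp]
    exact_mod_cast ha.le
  refine ⟨N, by exact_mod_cast hNp, fun a ha b hb => ?_⟩
  obtain ⟨i, hi⟩ := hleb ((a : ℝ) / N, (b : ℝ) / N) ⟨hmem a ha, hmem b hb⟩
  refine (hUg i).mono (Subset.trans ?_ hi)
  have key : ∀ (a : ℕ) (x : ℝ), x ∈ Icc ((a : ℝ) / N) (((a + 1 : ℕ) : ℝ) / N) →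
      dist x ((a : ℝ) / N) < δ := by
    intro a x hx
    rw [Real.dist_eq, abs_of_nonneg (by linarith [hx.1])]
    have := hx.2
    push_cast at this
    rw [add_div] at this
    linarith
  rintro ⟨t, u⟩ ⟨ht, hu⟩
  exact max_lt (key a t ht) (key b u hu)

lemma exists_mem_cell {N : ℕ} (hN : 0 < N) {t : ℝ} (ht : t ∈ Icc (0 : ℝ) 1) :
    ∃ a < N, t ∈ Icc ((a : ℝ) / N) (((a + 1 : ℕ) : ℝ) / N) := by
  rcases eq_or_lt_of_le ht.1 with h | h
  · exact ⟨0, hN, by simp [← h]⟩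
  · have : t ∈ ⋃ i ∈ Finset.range N, cell N i := by
      rw [iUnion_cell hN]; exact ⟨h, ht.2⟩
    simp only [mem_iUnion, Finset.mem_range] at this
    obtain ⟨i, hi, hti⟩ := this
    exact ⟨i, hi, Ioc_subset_Icc_self hti⟩

/-- Each box of the grid contains at most one parameter at which the translate meets the other
curve. Hence for small ε ≠ 0 the translate avoids Σ for almost every parameter, and there the Cauchy
integral converges absolutely. -/
lemma eventually_finite_hit (j k : Fin Γ.n) : ∀ᶠ ε : ℝ in 𝓝[≠] 0,
    {t | t ∈ Icc (0 : ℝ) 1 ∧ ∃ u ∈ Icc (0 : ℝ) 1,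
      Γ.curve k u = Γ.curve j t + ε * Complex.I * deriv (Γ.curve j) t}.Finite := by
  obtain ⟨N, hN, hgood⟩ := exists_grid j k
  have : ∀ᶠ ε : ℝ in 𝓝[≠] 0, ∀ a ∈ Finset.range N, ∀ b ∈ Finset.range N,
      {t | ∃ u, (t, u) ∈ (Icc ((a : ℝ) / N) (((a + 1 : ℕ) : ℝ) / N) ×ˢ
        Icc ((b : ℝ) / N) (((b + 1 : ℕ) : ℝ) / N)) ∧
        Γ.curve k u = Γ.curve j t + ε * Complex.I * deriv (Γ.curve j) t}.Subsingleton := by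
    simp only [Finset.eventually_all]
    intro a ha b hb
    exact (hgood a (by simpa using ha) b (by simpa using hb)).hit
  filter_upwards [this] with ε hε
  refine Finite.subset ((Finset.range N).finite_toSet.biUnion fun a ha =>
    (Finset.range N).finite_toSet.biUnion fun b hb => (hε a ha b hb).finite) ?_
  rintro t ⟨ht, u, hu, htu⟩
  obtain ⟨a, ha, hta⟩ := exists_mem_cell hN ht
  obtain ⟨b, hb, hub⟩ := exists_mem_cell hN hu
  simp only [mem_iUnion]
  exact ⟨a, by simpa using ha, b, by simpa using hb, u, ⟨hta, hub⟩, htu⟩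

lemma eventually_ae_notMem (j : Fin Γ.n) : ∀ᶠ ε : ℝ in 𝓝[≠] 0, ∀ᵐ t ∂unitMeasure,
    Γ.curve j t + ε * Complex.I * deriv (Γ.curve j) t ∉ Γ.support := by
  have := fun k => eventually_finite_hit (Γ := Γ) j k
  rw [← eventually_all] at this
  filter_upwards [this] with ε hε
  have h1 : (⋃ k, {t | t ∈ Icc (0 : ℝ) 1 ∧ ∃ u ∈ Icc (0 : ℝ) 1,
      Γ.curve k u = Γ.curve j t + ε * Complex.I * deriv (Γ.curve j) t}).Finite := finite_iUnion hε
  have h2 : ∀ᵐ t : ℝ ∂unitMeasure, t ∉ (⋃ k, {t | t ∈ Icc (0 : ℝ) 1 ∧ ∃ u ∈ Icc (0 : ℝ) 1,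
      Γ.curve k u = Γ.curve j t + ε * Complex.I * deriv (Γ.curve j) t}) :=
    ae_restrict_of_ae (measure_eq_zero_iff_ae_notMem.1 (h1.measure_zero volume))
  filter_upwards [h2, ae_restrict_mem measurableSet_Icc] with t ht ht1 hmem
  obtain ⟨k, u, hu, hku⟩ := mem_iUnion.1 hmem
  exact ht (mem_iUnion.2 ⟨k, ht1, u, hu, hku⟩)

lemma tendsto_side_nhdsNE {side : ℝ} (hside : side ≠ 0) :
    Tendsto (fun ε : ℝ => side * ε) (𝓝[>] 0) (𝓝[≠] 0) := by
  refine tendsto_nhdsWithin_iff.2 ⟨?_, ?_⟩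
  · have : Continuous fun ε : ℝ => side * ε := by fun_prop
    simpa using (this.tendsto 0).mono_left (nhdsWithin_le_nhds (s := Ioi 0))
  · filter_upwards [self_mem_nhdsWithin] with ε hε
    exact mul_ne_zero hside (ne_of_gt hε)

lemma curve_mem_support (k : Fin Γ.n) {u : ℝ} (hu : u ∈ Icc (0 : ℝ) 1) :
    Γ.curve k u ∈ Γ.support := mem_iUnion.2 ⟨k, u, hu, rfl⟩

/-- Sum of the limits over the boxes of the grid; the jumps supported on the intersections of cells
add up to χ·g. -/
lemma exists_l2Lim_curve (j k : Fin Γ.n) {g : ℝ → ℂ} (hg : MemLp g 2 unitMeasure) :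
    ∃ h, L2Lim (fun ε t => ∫ u in (0 : ℝ)..1, curveKernel (Γ.curve j) (Γ.curve k) ε t u * g u) h ∧
      L2Lim (fun ε t => ∫ u in (0 : ℝ)..1, curveKernel (Γ.curve j) (Γ.curve k) (-ε) t u * g u)
        (h - jumpConst j k • g) := by
  obtain ⟨N, hN, hgood⟩ := exists_grid j k
  have hbox : ∀ p : ℕ × ℕ, ∃ h : ℝ → ℂ, p ∈ Finset.range N ×ˢ Finset.range N →
      L2Lim (fun ε => kernelOp (curveKernel (Γ.curve j) (Γ.curve k) ε) (cell N p.1) (cell N p.2) g) h ∧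
      L2Lim (fun ε => kernelOp (curveKernel (Γ.curve j) (Γ.curve k) (-ε)) (cell N p.1) (cell N p.2) g)
        (h - jumpConst j k • (cell N p.1 ∩ cell N p.2).indicator g) := by
    rintro ⟨a, b⟩
    by_cases hp : (a, b) ∈ Finset.range N ×ˢ Finset.range N
    · simp only [Finset.mem_product, Finset.mem_range] at hp
      obtain ⟨h, h1⟩ := (hgood a hp.1 b hp.2).lim (cell N a) (cell N b) (measurableSet_cell N a)
        (measurableSet_cell N b) (cell_subset hp.1) (cell_subset hp.2)
        (prod_mono Ioc_subset_Icc_self Ioc_subset_Icc_self) g hg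
      exact ⟨h, fun _ => h1⟩
    · exact ⟨0, fun h => absurd h hp⟩
  choose h hh using hbox
  have hsum : ∀ side : ℝ, side ≠ 0 → ∀ᶠ ε in 𝓝[>] 0,
      (∑ p ∈ Finset.range N ×ˢ Finset.range N,
        kernelOp (curveKernel (Γ.curve j) (Γ.curve k) (side * ε)) (cell N p.1) (cell N p.2) g)
      =ᵐ[unitMeasure] fun t =>
        ∫ u in (0 : ℝ)..1, curveKernel (Γ.curve j) (Γ.curve k) (side * ε) t u * g u := by
    intro side hside
    -- Splitting the integral over the cells needs integrability on the whole curve, which holds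
    -- because almost every translated point lies off Σ.
    filter_upwards [(tendsto_side_nhdsNE hside).eventually (eventually_ae_notMem j)] with ε hε
    filter_upwards [hε, ae_mem_Ioc] with t ht ht1
    have hint : IntervalIntegrable (fun u =>
        curveKernel (Γ.curve j) (Γ.curve k) (side * ε) t u * g u) volume 0 1 :=
      intervalIntegrable_cauchy (Γ.smooth k)
        (fun u hu h => ht (by rw [← h]; exact curve_mem_support k hu)) hg
    rw [intervalIntegrable_iff_integrableOn_Ioc_of_le zero_le_one] at hint
    rw [Finset.sum_apply, Finset.sum_product]
    have hF := congrFun (sum_indicator_cell hN (fun t => ∫ u in (0 : ℝ)..1,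
      curveKernel (Γ.curve j) (Γ.curve k) (side * ε) t u * g u)) t
    rw [indicator_of_mem ht1, Finset.sum_apply] at hF
    rw [← hF]
    refine Finset.sum_congr rfl fun a _ => ?_
    by_cases hta : t ∈ cell N a
    · simp only [kernelOp, indicator_of_mem hta]
      exact integral_cell hN hint
    · simp [kernelOp, indicator_of_notMem hta]
  refine ⟨∑ p ∈ Finset.range N ×ˢ Finset.range N, h p, ?_, ?_⟩
  · refine (L2Lim.sum _ fun p hp => (hh p hp).1).congr ?_ EventuallyEq.rfl
    simpa using hsum 1 one_ne_zero
  · refine (L2Lim.sum _ fun p hp => (hh p hp).2).congr ?_ ?_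
    · simpa using hsum (-1) (by norm_num)
    · filter_upwards [ae_mem_Ioc] with t ht
      simp only [Finset.sum_sub_distrib, Pi.sub_apply, Finset.sum_apply, Pi.smul_apply]
      rw [← Finset.smul_sum]
      congr 2
      rw [Finset.sum_product]
      have h1 : ∀ a, ∑ b ∈ Finset.range N, (cell N a ∩ cell N b).indicator g t =
          (cell N a).indicator g t := by
        intro a
        have hF := congrFun (sum_indicator_cell hN ((cell N a).indicator g)) t
        rw [indicator_of_mem ht, Finset.sum_apply] at hF
        rw [← hF]
        refine Finset.sum_congr rfl fun b _ => ?_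
        rw [inter_comm, indicator_indicator]
      simp only [h1]
      have hF := congrFun (sum_indicator_cell hN g) t
      rwa [indicator_of_mem ht, Finset.sum_apply] at hF

end Contour

/-! ### Arc length in terms of the parameters -/

lemma memLp_two_sum_measure {α ι E : Type*} [MeasurableSpace α] [NormedAddCommGroup E]
    (s : Finset ι) {μ : ι → Measure α} {f : α → E} :
    MemLp f 2 (∑ i ∈ s, μ i) ↔ ∀ i ∈ s, MemLp f 2 (μ i) := by
  classical
  induction s using Finset.induction_on with
  | empty => simp
  | insert a s ha ih =>
    rw [Finset.sum_insert ha, Finset.forall_mem_insert, ← ih]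
    refine ⟨fun h => ⟨h.left_of_add_measure, h.right_of_add_measure⟩, fun ⟨h1, h2⟩ => ?_⟩
    refine ⟨h1.1.add_measure h2.1, ?_⟩
    have h3 : eLpNorm f 2 (μ a + ∑ i ∈ s, μ i) ^ 2 < ⊤ := by
      rw [eLpNorm_two_sq, lintegral_add_measure, ← eLpNorm_two_sq, ← eLpNorm_two_sq]
      exact ENNReal.add_lt_top.2 ⟨ENNReal.pow_lt_top h1.2, ENNReal.pow_lt_top h2.2⟩
    simpa using h3

lemma ae_finset_sum_measure_iff {α ι : Type*} [MeasurableSpace α] (s : Finset ι)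
    {μ : ι → Measure α} {p : α → Prop} :
    (∀ᵐ x ∂(∑ i ∈ s, μ i), p x) ↔ ∀ i ∈ s, ∀ᵐ x ∂(μ i), p x := by
  classical
  induction s using Finset.induction_on with
  | empty => simp
  | insert a s ha ih =>
    rw [Finset.sum_insert ha, Finset.forall_mem_insert, ← ih, ae_add_measure_iff]

namespace Contour
variable {Γ : Contour}

variable (Γ) in
/-- End points, intersections and self-intersections. -/
def exceptional : Set ℂ :=
  (⋃ j, {Γ.curve j 0, Γ.curve j 1}) ∪
    {z | ∃ j k, ∃ t ∈ Γ.dom j, ∃ u ∈ Γ.dom k, (j, t) ≠ (k, u) ∧ Γ.curve j t = z ∧ Γ.curve k u = z}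

lemma finite_exceptional : Γ.exceptional.Finite := by
  refine Finite.union (finite_iUnion fun j => by simp) ?_
  refine (Γ.finite_inter.image fun p => Γ.curve p.1.1 p.1.2).subset ?_
  rintro z ⟨j, k, t, ht, u, hu, hne, h1, h2⟩
  exact ⟨((j, t), (k, u)), ⟨hne, ht, hu, h1.trans h2.symm⟩, h1⟩

lemma dom_subset (j : Fin Γ.n) : Γ.dom j ⊆ Icc 0 1 := by
  unfold dom
  split_ifs
  · exact Ico_subset_Icc_self
  · exact Subset.rfl

lemma Ioo_subset_dom (j : Fin Γ.n) : Ioo 0 1 ⊆ Γ.dom j := by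
  unfold dom
  split_ifs
  · exact Ioo_subset_Ico_self
  · exact Ioo_subset_Icc_self

lemma finite_fiber (j : Fin Γ.n) (z : ℂ) : {t | t ∈ Icc (0 : ℝ) 1 ∧ Γ.curve j t = z}.Finite := by
  have h1 : {t | t ∈ Γ.dom j ∧ Γ.curve j t = z}.Finite := by
    by_cases hne : ∃ t₀ ∈ Γ.dom j, Γ.curve j t₀ = z
    · obtain ⟨t₀, ht₀, h0⟩ := hne
      refine ((Γ.finite_inter.image fun p => p.1.2).union (finite_singleton t₀)).subset ?_
      rintro t ⟨ht, htz⟩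
      by_cases h : t = t₀
      · exact Or.inr h
      · exact Or.inl ⟨((j, t), (j, t₀)), ⟨by simp [h], ht, ht₀, htz.trans h0.symm⟩, rfl⟩
    · convert finite_empty
      ext t
      simp only [mem_ofPred_eq, mem_empty_iff_false, iff_false]
      exact fun h => hne ⟨t, h⟩
  refine (h1.union (toFinite {0, 1})).subset ?_
  rintro t ⟨ht, htz⟩
  rcases eq_or_lt_of_le ht.1 with h | h
  · exact Or.inr (Or.inl h.symm)
  rcases eq_or_lt_of_le ht.2 with h' | h'
  · exact Or.inr (Or.inr h')
  exact Or.inl ⟨Ioo_subset_dom j ⟨h, h'⟩, htz⟩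

variable (Γ) in
/-- Parameters of non-exceptional points. -/
def good (j : Fin Γ.n) : Set ℝ := {t | t ∈ Icc (0 : ℝ) 1 ∧ Γ.curve j t ∉ Γ.exceptional}

lemma measurableSet_good (j : Fin Γ.n) : MeasurableSet (Γ.good j) :=
  measurableSet_Icc.inter
    ((Γ.smooth j).continuous.measurable finite_exceptional.measurableSet.compl)

lemma finite_preimage (j : Fin Γ.n) {P : Set ℂ} (hP : P.Finite) :
    {t | t ∈ Icc (0 : ℝ) 1 ∧ Γ.curve j t ∈ P}.Finite := by
  refine (hP.biUnion fun z _ => finite_fiber j z).subset ?_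
  rintro t ⟨ht, htz⟩
  exact mem_biUnion htz ⟨ht, rfl⟩

lemma ae_notMem_finite (j : Fin Γ.n) {P : Set ℂ} (hP : P.Finite) :
    ∀ᵐ t ∂unitMeasure, Γ.curve j t ∉ P := by
  have := ae_restrict_of_ae (s := Icc (0 : ℝ) 1)
    (measure_eq_zero_iff_ae_notMem.1 ((finite_preimage j hP).measure_zero volume))
  filter_upwards [this, ae_restrict_mem measurableSet_Icc] with t ht ht1 h
  exact ht ⟨ht1, h⟩

lemma ae_mem_good (j : Fin Γ.n) : ∀ᵐ t ∂unitMeasure, t ∈ Γ.good j := by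
  filter_upwards [ae_notMem_finite j finite_exceptional, ae_restrict_mem measurableSet_Icc]
    with t ht ht1 using ⟨ht1, ht⟩

lemma good_subset_Ioo (j : Fin Γ.n) : Γ.good j ⊆ Ioo 0 1 := by
  rintro t ⟨⟨h0, h1⟩, ht⟩
  refine ⟨lt_of_le_of_ne h0 ?_, lt_of_le_of_ne h1 ?_⟩
  · rintro rfl
    exact ht (Or.inl (mem_iUnion.2 ⟨j, Or.inl rfl⟩))
  · rintro rfl
    exact ht (Or.inl (mem_iUnion.2 ⟨j, Or.inr rfl⟩))

/-- A second parameter of the same point would make the point exceptional. Off a finite set Σ is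
thus injectively parametrised, across all curves at once. -/
lemma eq_of_mem_good {j k : Fin Γ.n} {t u : ℝ} (ht : t ∈ Γ.good j) (hu : u ∈ Icc (0 : ℝ) 1)
    (h : Γ.curve k u = Γ.curve j t) : k = j ∧ u = t := by
  have htd := good_subset_Ioo j ht
  have hu2 : u ∈ Γ.good k := ⟨hu, by rw [h]; exact ht.2⟩
  by_contra hne
  refine ht.2 (Or.inr ⟨j, k, t, Ioo_subset_dom j htd, u, Ioo_subset_dom k (good_subset_Ioo k hu2),
    ?_, rfl, h⟩)
  rintro h2
  obtain ⟨rfl, rfl⟩ := Prod.mk.inj h2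
  exact hne ⟨rfl, rfl⟩

lemma measurableEmbedding_good (j : Fin Γ.n) :
    MeasurableEmbedding fun t : Γ.good j => Γ.curve j t :=
  (Γ.smooth j).continuous.continuousOn.measurableEmbedding (measurableSet_good j)
    fun _ ht _ hu h => (eq_of_mem_good hu ht.1 h).2

/-- On good parameters the curve is a measurable embedding. This is what lets statements almost
everywhere, and `MemLp`, pass between Σ and the parameters in both directions, for arbitrary
predicates and functions. -/
lemma map_withDensity_eq (j : Fin Γ.n) :
    Measure.map (Γ.curve j) (unitMeasure.withDensity fun t => ‖deriv (Γ.curve j) t‖ₑ) =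
      Measure.map (fun t : Γ.good j => Γ.curve j t)
        (Measure.comap (↑) (unitMeasure.withDensity fun t => ‖deriv (Γ.curve j) t‖ₑ)) := by
  set ν := unitMeasure.withDensity fun t => ‖deriv (Γ.curve j) t‖ₑ
  have h1 : ν = ν.restrict (Γ.good j) := by
    refine (Measure.restrict_eq_self_of_ae_mem ?_).symm
    exact (withDensity_absolutelyContinuous _ _).ae_le (ae_mem_good j)
  conv_lhs => rw [h1, ← map_comap_subtype_coe (measurableSet_good j)]
  rw [Measure.map_map (Γ.smooth j).continuous.measurable measurable_subtype_coe]
  rfl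

lemma ae_withDensity_speed_iff (j : Fin Γ.n) {p : ℝ → Prop} :
    (∀ᵐ t ∂(unitMeasure.withDensity fun t => ‖deriv (Γ.curve j) t‖ₑ), p t) ↔
      ∀ᵐ t ∂unitMeasure, p t := by
  rw [ae_withDensity_iff ((Γ.smooth j).continuous_deriv (by simp)).measurable.enorm]
  refine ⟨fun h => ?_, fun h => h.mono fun t ht _ => ht⟩
  filter_upwards [h, ae_restrict_mem measurableSet_Icc] with t ht ht1
  exact ht (by simpa using Γ.regular j t ht1)

lemma ae_restrict_good_iff (j : Fin Γ.n) {ν : Measure ℝ} {p : ℝ → Prop}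
    (hν : ∀ᵐ t ∂ν, t ∈ Γ.good j) :
    (∀ᵐ t : Γ.good j ∂(Measure.comap (↑) ν), p t) ↔ ∀ᵐ t ∂ν, p t := by
  rw [← ae_restrict_iff_subtype (measurableSet_good j), Measure.restrict_eq_self_of_ae_mem hν]

lemma ae_arcLength_iff {p : ℂ → Prop} :
    (∀ᵐ z ∂Γ.arcLength, p z) ↔ ∀ j, ∀ᵐ t ∂unitMeasure, p (Γ.curve j t) := by
  rw [arcLength, ae_finset_sum_measure_iff]
  simp only [Finset.mem_univ, true_implies]
  refine forall_congr' fun j => ?_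
  rw [map_withDensity_eq, (measurableEmbedding_good j).ae_map_iff,
    ae_restrict_good_iff j (p := fun t => p (Γ.curve j t)), ae_withDensity_speed_iff]
  rw [ae_withDensity_speed_iff]
  exact ae_mem_good j

lemma exists_speed_bounds (j : Fin Γ.n) : ∃ c C : ℝ, 0 < c ∧ 0 < C ∧ ∀ t ∈ Icc (0 : ℝ) 1,
    c ≤ ‖deriv (Γ.curve j) t‖ ∧ ‖deriv (Γ.curve j) t‖ ≤ C := by
  obtain ⟨C, hC, hb⟩ := exists_deriv_bound (Γ.smooth j)
  have hcont : Continuous fun t => ‖deriv (Γ.curve j) t‖ :=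
    ((Γ.smooth j).continuous_deriv (by simp)).norm
  obtain ⟨t₀, ht₀, hmin⟩ := isCompact_Icc.exists_isMinOn (nonempty_Icc.2 zero_le_one)
    (hcont.continuousOn (s := Icc (0 : ℝ) 1))
  exact ⟨_, C, norm_pos_iff.2 (Γ.regular j t₀ ht₀), hC, fun t ht => ⟨hmin ht, hb t ht⟩⟩

/-- The speed is bounded above and below on [0, 1], so arc length and parameter length define the
same `L²` functions. -/
lemma memLp_arcLength_iff {E : Type*} [NormedAddCommGroup E] {f : ℂ → E} :
    MemLp f 2 Γ.arcLength ↔ ∀ j, MemLp (fun t => f (Γ.curve j t)) 2 unitMeasure := by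
  rw [arcLength, memLp_two_sum_measure]
  simp only [Finset.mem_univ, true_implies]
  refine forall_congr' fun j => ?_
  obtain ⟨c, C, hc, hC, hb⟩ := Γ.exists_speed_bounds j
  set ν := unitMeasure.withDensity fun t => ‖deriv (Γ.curve j) t‖ₑ with hν
  have hgood : ∀ᵐ t ∂ν, t ∈ Γ.good j := (ae_withDensity_speed_iff j).2 (ae_mem_good j)
  have e1 : MemLp f 2 (Measure.map (Γ.curve j) ν) ↔ MemLp (fun t => f (Γ.curve j t)) 2 ν := by
    rw [map_withDensity_eq, (measurableEmbedding_good j).memLp_map_measure_iff]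
    conv_rhs => rw [← Measure.restrict_eq_self_of_ae_mem hgood,
      ← map_comap_subtype_coe (measurableSet_good j),
      (MeasurableEmbedding.subtype_coe (measurableSet_good j)).memLp_map_measure_iff]
    rfl
  rw [e1]
  have hle : ν ≤ ENNReal.ofReal C • unitMeasure := by
    rw [← withDensity_const]
    refine withDensity_mono ?_
    filter_upwards [ae_restrict_mem measurableSet_Icc] with t ht
    rw [← ofReal_norm]
    exact ENNReal.ofReal_le_ofReal (hb t ht).2
  have hge : unitMeasure ≤ ENNReal.ofReal c⁻¹ • ν := by
    have : ENNReal.ofReal c • unitMeasure ≤ ν := by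
      rw [← withDensity_const]
      refine withDensity_mono ?_
      filter_upwards [ae_restrict_mem measurableSet_Icc] with t ht
      rw [← ofReal_norm]
      exact ENNReal.ofReal_le_ofReal (hb t ht).1
    intro S
    have h1 := this S
    rw [Measure.smul_apply, smul_eq_mul] at h1 ⊢
    calc unitMeasure S = ENNReal.ofReal c⁻¹ * (ENNReal.ofReal c * unitMeasure S) := by
          rw [← mul_assoc, ← ENNReal.ofReal_mul (by positivity), inv_mul_cancel₀ hc.ne',
            ENNReal.ofReal_one, one_mul]
      _ ≤ _ := by gcongr
  exact ⟨fun h => h.of_measure_le_smul ENNReal.ofReal_ne_top hge,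
    fun h => h.of_measure_le_smul ENNReal.ofReal_ne_top hle⟩

/-- A function on the contour is given by functions of the parameters. -/
lemma exists_function (h : Fin Γ.n → ℝ → ℂ) : ∃ F : ℂ → ℂ, ∀ j, ∀ t ∈ Γ.good j,
    F (Γ.curve j t) = h j t := by
  classical
  refine ⟨fun z => if hz : ∃ p : Fin Γ.n × ℝ, p.2 ∈ Γ.good p.1 ∧ Γ.curve p.1 p.2 = z then
    h hz.choose.1 hz.choose.2 else 0, fun j t ht => ?_⟩
  have hz : ∃ p : Fin Γ.n × ℝ, p.2 ∈ Γ.good p.1 ∧ Γ.curve p.1 p.2 = Γ.curve j t := ⟨(j, t), ht, rfl⟩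
  dsimp only
  rw [dif_pos hz]
  obtain ⟨h1, h2⟩ := eq_of_mem_good ht hz.choose_spec.1.1 hz.choose_spec.2
  rw [h1, h2]

end Contour

/-! ### Scalar boundary values and the Plemelj formula -/

namespace Contour
variable {Γ : Contour}

variable (Γ) in
/-- The scalar Cauchy integral. -/
def cauchy (f : ℂ → ℂ) (z : ℂ) : ℂ :=
  (2 * Real.pi * Complex.I : ℂ)⁻¹ *
    ∑ k, ∫ u in (0 : ℝ)..1, deriv (Γ.curve k) u / (Γ.curve k u - z) * f (Γ.curve k u)

variable (Γ) in
/-- The point at height `ρ` on the normal of a curve. -/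
def shift (j : Fin Γ.n) (ρ t : ℝ) : ℂ := Γ.curve j t + ρ * Complex.I * deriv (Γ.curve j) t

variable (Γ) in
/-- Scalar boundary values in the sense of `L²`. -/
structure BV (side : ℝ) (F f : ℂ → ℂ) : Prop where
  memLp : MemLp f 2 Γ.arcLength
  lim : ∀ j, L2Lim (fun ε t => F (Γ.shift j (side * ε) t)) fun t => f (Γ.curve j t)

lemma isCompact_support : IsCompact Γ.support :=
  isCompact_iUnion fun j => isCompact_Icc.image (Γ.smooth j).continuous

lemma continuous_shift (j : Fin Γ.n) : Continuous fun p : ℝ × ℝ => Γ.shift j p.1 p.2 := by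
  have h1 := (Γ.smooth j).continuous
  have h2 := (Γ.smooth j).continuous_deriv (by simp)
  unfold shift
  fun_prop

lemma dist_shift_le (j : Fin Γ.n) : ∃ B : ℝ, 0 < B ∧ ∀ ρ : ℝ, ∀ t ∈ Icc (0 : ℝ) 1,
    dist (Γ.shift j ρ t) (Γ.curve j t) ≤ B * |ρ| := by
  obtain ⟨B, hB, hb⟩ := exists_deriv_bound (Γ.smooth j)
  refine ⟨B, hB, fun ρ t ht => ?_⟩
  rw [dist_eq_norm, shift, add_sub_cancel_left]
  simp only [norm_mul, Complex.norm_real, Complex.norm_I, mul_one, Real.norm_eq_abs]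
  rw [mul_comm]
  exact mul_le_mul_of_nonneg_right (hb t ht) (abs_nonneg _)

lemma eventually_infDist_shift (j : Fin Γ.n) {δ : ℝ} (hδ : 0 < δ) (side : ℝ) :
    ∀ᶠ ε : ℝ in 𝓝[>] 0, ∀ t ∈ Icc (0 : ℝ) 1,
      Metric.infDist (Γ.shift j (side * ε) t) Γ.support < δ := by
  obtain ⟨B, hB, hb⟩ := Γ.dist_shift_le j
  refine eventually_side_mul (P := fun ρ => ∀ t ∈ Icc (0 : ℝ) 1,
      Metric.infDist (Γ.shift j ρ t) Γ.support < δ) ?_ side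
  filter_upwards [Metric.ball_mem_nhds (0 : ℝ) (div_pos hδ hB)] with ρ hρ t ht
  rw [Metric.mem_ball, dist_zero_right, Real.norm_eq_abs, lt_div_iff₀ hB] at hρ
  refine ((Metric.infDist_le_dist_of_mem (curve_mem_support j ht)).trans (hb ρ t ht)).trans_lt ?_
  linarith

lemma eventually_shift_notMem_closed (j : Fin Γ.n) {S : Set ℂ} (hS : IsClosed S)
    (hd : Disjoint S Γ.support) (side : ℝ) :
    ∀ᶠ ε : ℝ in 𝓝[>] 0, ∀ t ∈ Icc (0 : ℝ) 1, Γ.shift j (side * ε) t ∉ S := by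
  obtain ⟨δ, hδ, hdisj⟩ := hd.symm.exists_thickenings isCompact_support hS
  filter_upwards [eventually_infDist_shift j hδ side] with ε hε t ht hmem
  refine disjoint_left.1 hdisj ?_ (Metric.self_subset_thickening hδ S hmem)
  rw [Metric.mem_thickening_iff_infDist_lt ⟨_, curve_mem_support j ht⟩]
  exact hε t ht

lemma eventually_ae_shift_notMem (j : Fin Γ.n) {S : Set ℂ} (hS : IsClosed S)
    (hd : Disjoint S Γ.support) {side : ℝ} (hside : side ≠ 0) :
    ∀ᶠ ε : ℝ in 𝓝[>] 0, ∀ᵐ t ∂unitMeasure, Γ.shift j (side * ε) t ∉ Γ.support ∪ S := by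
  filter_upwards [eventually_shift_notMem_closed j hS hd side,
    (tendsto_side_nhdsNE hside).eventually (eventually_ae_notMem j)] with ε h1 h2
  filter_upwards [h2, ae_restrict_mem measurableSet_Icc] with t ht ht1 h
  exact h.elim ht (h1 t ht1)

lemma eventually_aestronglyMeasurable_shift (j : Fin Γ.n) {S : Set ℂ} (hS : IsClosed S)
    (hd : Disjoint S Γ.support) {side : ℝ} (hside : side ≠ 0) {F : ℂ → ℂ}
    (hF : ContinuousOn F (Γ.support ∪ S)ᶜ) :
    ∀ᶠ ε : ℝ in 𝓝[>] 0, AEStronglyMeasurable (fun t => F (Γ.shift j (side * ε) t)) unitMeasure := by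
  classical
  filter_upwards [eventually_ae_shift_notMem j hS hd hside] with ε hε
  have hclosed : IsClosed (Γ.support ∪ S) := isCompact_support.isClosed.union hS
  have hm : Measurable ((Γ.support ∪ S)ᶜ.piecewise F fun _ => 0) :=
    hF.measurable_piecewise continuousOn_const hclosed.measurableSet.compl
  have hsh : Measurable fun t => Γ.shift j (side * ε) t :=
    ((continuous_shift j).comp (by fun_prop : Continuous fun t : ℝ => (side * ε, t))).measurable
  refine ⟨_, (hm.comp hsh).stronglyMeasurable, ?_⟩
  filter_upwards [hε] with t ht
  simp only [Function.comp_apply]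
  rw [piecewise_eq_of_mem _ _ _ ht]

namespace BV
variable {side : ℝ} {F G f g : ℂ → ℂ}

lemma add (hF : Γ.BV side F f) (hG : Γ.BV side G g) :
    Γ.BV side (fun z => F z + G z) (fun z => f z + g z) :=
  ⟨hF.memLp.add hG.memLp, fun j => (hF.lim j).add (hG.lim j)⟩

lemma const_mul (c : ℂ) (hF : Γ.BV side F f) : Γ.BV side (fun z => c * F z) (fun z => c * f z) :=
  ⟨hF.memLp.const_mul c, fun j => (hF.lim j).const_mul c⟩

lemma sub (hF : Γ.BV side F f) (hG : Γ.BV side G g) :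
    Γ.BV side (fun z => F z - G z) (fun z => f z - g z) := by
  simpa [sub_eq_add_neg] using hF.add (hG.const_mul (-1))

lemma congr_right (hF : Γ.BV side F f) (h : f =ᵐ[Γ.arcLength] g) : Γ.BV side F g :=
  ⟨hF.memLp.ae_eq h, fun j => (hF.lim j).congr (Eventually.of_forall fun _ => EventuallyEq.rfl)
    (ae_arcLength_iff.1 h j)⟩

lemma congr_left (hF : Γ.BV side F f) (hside : side ≠ 0) {S : Set ℂ} (hS : IsClosed S)
    (hd : Disjoint S Γ.support) (h : ∀ z ∉ Γ.support ∪ S, F z = G z) : Γ.BV side G f := by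
  refine ⟨hF.memLp, fun j => (hF.lim j).congr ?_ EventuallyEq.rfl⟩
  filter_upwards [eventually_ae_shift_notMem j hS hd hside] with ε hε
  filter_upwards [hε] with t ht using h _ ht

lemma unique (hF : Γ.BV side F f) (hG : Γ.BV side F g) : f =ᵐ[Γ.arcLength] g :=
  ae_arcLength_iff.2 fun j => (hF.lim j).unique (hG.lim j)

lemma of_continuousOn (side : ℝ) {U : Set ℂ} (hU : IsOpen U) (hΓ : Γ.support ⊆ U)
    (hF : ContinuousOn F U) : Γ.BV side F F := by
  have hFj : ∀ j, ContinuousOn (fun t => F (Γ.curve j t)) (Icc 0 1) := fun j =>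
    hF.comp (Γ.smooth j).continuous.continuousOn fun t ht => hΓ (curve_mem_support j ht)
  have hmem : ∀ j, MemLp (fun t => F (Γ.curve j t)) 2 unitMeasure := by
    intro j
    obtain ⟨C, hC⟩ := isCompact_Icc.exists_bound_of_continuousOn (hFj j)
    refine MemLp.of_bound ((hFj j).aestronglyMeasurable measurableSet_Icc) C ?_
    filter_upwards [ae_restrict_mem measurableSet_Icc] with t ht using hC t ht
  refine ⟨memLp_arcLength_iff.2 hmem, fun j => ?_⟩
  obtain ⟨δ, hδ, hthick⟩ := isCompact_support.exists_cthickening_subset_open hU hΓ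
  have hK : IsCompact (Metric.cthickening δ Γ.support) := isCompact_support.cthickening
  have huc := hK.uniformContinuousOn_of_continuous (hF.mono hthick)
  rw [Metric.uniformContinuousOn_iff] at huc
  obtain ⟨B, hB, hb⟩ := Γ.dist_shift_le j
  have hin : ∀ᶠ ε : ℝ in 𝓝[>] 0, ∀ t ∈ Icc (0 : ℝ) 1,
      Γ.shift j (side * ε) t ∈ Metric.cthickening δ Γ.support := by
    filter_upwards [eventually_infDist_shift j hδ side] with ε hε t ht
    refine Metric.thickening_subset_cthickening _ _ ?_
    rw [Metric.mem_thickening_iff_infDist_lt ⟨_, curve_mem_support j ht⟩]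
    exact hε t ht
  refine ⟨?_, hmem j, ?_⟩
  · filter_upwards [hin] with ε hε
    refine ContinuousOn.aestronglyMeasurable ?_ measurableSet_Icc
    refine (hF.mono hthick).comp ?_ hε
    exact ((continuous_shift j).comp
      (by fun_prop : Continuous fun t : ℝ => (side * ε, t))).continuousOn
  · refine ENNReal.tendsto_nhds_zero.2 fun η hη => ?_
    rcases eq_or_ne η ⊤ with rfl | hηt
    · simp
    have hη' : 0 < η.toReal := ENNReal.toReal_pos hη.ne' hηt
    obtain ⟨r, hr, hur⟩ := huc η.toReal hη'
    have hsm : ∀ᶠ ε : ℝ in 𝓝[>] 0, |side * ε| < r / B := by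
      refine eventually_side_mul (P := fun x => |x| < r / B) ?_ side
      filter_upwards [Metric.ball_mem_nhds (0 : ℝ) (div_pos hr hB)] with ε hε
      simpa [Real.dist_eq] using hε
    filter_upwards [hin, hsm] with ε h1 h2
    have h3 : ∀ᵐ t ∂unitMeasure, ‖((fun t => F (Γ.shift j (side * ε) t)) -
        fun t => F (Γ.curve j t)) t‖ ≤ η.toReal := by
      filter_upwards [ae_restrict_mem measurableSet_Icc] with t ht
      rw [Pi.sub_apply, ← dist_eq_norm]
      refine (hur _ (h1 t ht) _ (Metric.self_subset_cthickening _ (curve_mem_support j ht)) ?_).le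
      refine (hb _ t ht).trans_lt ?_
      rw [lt_div_iff₀ hB] at h2
      linarith
    refine (eLpNorm_le_of_ae_bound h3).trans ?_
    simp [unitMeasure, ENNReal.ofReal_toReal hηt]

end BV

lemma memLp_curve {f : ℂ → ℂ} (hf : MemLp f 2 Γ.arcLength) (j : Fin Γ.n) :
    MemLp (fun t => f (Γ.curve j t)) 2 unitMeasure := memLp_arcLength_iff.1 hf j

/-- The Plemelj formula. -/
theorem exists_bv_cauchy {f : ℂ → ℂ} (hf : MemLp f 2 Γ.arcLength) :
    ∃ F, Γ.BV 1 (Γ.cauchy f) F ∧ Γ.BV (-1) (Γ.cauchy f) (fun z => F z - f z) := by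
  have h1 := fun j k => exists_l2Lim_curve j k (memLp_curve hf k)
  choose h hp hm using h1
  set c : ℂ := (2 * Real.pi * Complex.I : ℂ)⁻¹ with hc
  have hc0 : (2 * Real.pi * Complex.I : ℂ) ≠ 0 := Complex.two_pi_I_ne_zero
  -- The limits are functions of the parameter on each curve; they glue to one function on Σ because
  -- good points have a unique parameter.
  obtain ⟨F, hF⟩ := Γ.exists_function fun j => c • ∑ k, h j k
  have hFae : ∀ j, c • ∑ k, h j k =ᵐ[unitMeasure] fun t => F (Γ.curve j t) := fun j => by
    filter_upwards [ae_mem_good j] with t ht using (hF j t ht).symm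
  have hp' : ∀ j, L2Lim (fun ε t => Γ.cauchy f (Γ.shift j (1 * ε) t)) fun t => F (Γ.curve j t) := by
    intro j
    refine ((L2Lim.sum Finset.univ fun k _ => hp j k).const_mul c).congr
      (Eventually.of_forall fun ε => Eventually.of_forall fun t => ?_) (hFae j)
    simp [cauchy, shift, curveKernel, hc]
  have hm' : ∀ j, L2Lim (fun ε t => Γ.cauchy f (Γ.shift j (-1 * ε) t))
      fun t => F (Γ.curve j t) - f (Γ.curve j t) := by
    intro j
    refine ((L2Lim.sum Finset.univ fun k _ => hm j k).const_mul c).congr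
      (Eventually.of_forall fun ε => Eventually.of_forall fun t => ?_) ?_
    · simp [cauchy, shift, curveKernel, hc]
    · filter_upwards [hFae j] with t ht
      rw [← ht]
      have : (∑ k, jumpConst j k • fun t => f (Γ.curve k t)) t =
          (2 * Real.pi * Complex.I) * f (Γ.curve j t) := by
        simp [jumpConst, ite_apply, Finset.sum_apply]
      simp only [Finset.sum_sub_distrib, Pi.smul_apply, Pi.sub_apply, this, smul_sub]
      simp only [smul_eq_mul, hc]
      rw [inv_mul_cancel_left₀ hc0]
  have hFm : MemLp F 2 Γ.arcLength := memLp_arcLength_iff.2 fun j => (hp' j).memLp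
  exact ⟨F, ⟨hFm, hp'⟩, ⟨hFm.sub hf, hm'⟩⟩

lemma hasBoundaryValues_of_bv {side : ℝ} {F f : ℂ → Fin 2 → ℂ}
    (h : ∀ i, Γ.BV side (fun z => F z i) fun z => f z i) : HasBoundaryValues Γ side F f := by
  refine ⟨memLp_pi_iff.2 fun i => (h i).memLp, fun j => ?_⟩
  have hlim := fun i => (tendsto_eLpNorm_two_iff _).1 ((h i).lim j).lim
  have hsum := (hlim 0).add (hlim 1)
  rw [add_zero] at hsum
  refine tendsto_of_tendsto_of_tendsto_of_le_of_le' tendsto_const_nhds hsum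
    (Eventually.of_forall fun _ => zero_le) ?_
  filter_upwards [((h 0).lim j).meas] with ε hε
  have hm0 : AEMeasurable (fun t => ‖((fun t => F (Γ.shift j (side * ε) t) 0) -
      fun t => f (Γ.curve j t) 0) t‖ₑ ^ 2) unitMeasure :=
    (hε.sub ((h 0).lim j).memLp.1).enorm.pow_const 2
  rw [← lintegral_add_left' hm0]
  refine lintegral_mono fun t => ?_
  have : ∀ x : Fin 2 → ℂ, ‖x‖ₑ ^ 2 ≤ ‖x 0‖ₑ ^ 2 + ‖x 1‖ₑ ^ 2 := by
    intro x
    have hx : ‖x‖ ≤ max ‖x 0‖ ‖x 1‖ := by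
      rw [pi_norm_le_iff_of_nonneg (by positivity), Fin.forall_fin_two]
      exact ⟨le_max_left _ _, le_max_right _ _⟩
    rw [← ofReal_norm x, ← ofReal_norm (x 0), ← ofReal_norm (x 1)]
    rcases max_cases ‖x 0‖ ‖x 1‖ with h | h <;> rw [h.1] at hx
    · exact le_add_right (pow_le_pow_left₀ zero_le (ENNReal.ofReal_le_ofReal hx) 2)
    · exact le_add_left (pow_le_pow_left₀ zero_le (ENNReal.ofReal_le_ofReal hx) 2)
  exact this _

/-- `HasBoundaryValues` carries no measurability of the translates. It is recovered from the
continuity of `F` off Σ ∪ S, since almost every translated point avoids that set. -/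
lemma bv_of_hasBoundaryValues {side : ℝ} (hside : side ≠ 0) {F f : ℂ → Fin 2 → ℂ} {S : Set ℂ}
    (hS : IsClosed S) (hd : Disjoint S Γ.support) (hF : ContinuousOn F (Γ.support ∪ S)ᶜ)
    (h : HasBoundaryValues Γ side F f) (i : Fin 2) : Γ.BV side (fun z => F z i) fun z => f z i := by
  refine ⟨memLp_pi_iff.1 h.1 i, fun j => ⟨?_, ?_, ?_⟩⟩
  · exact eventually_aestronglyMeasurable_shift j hS hd hside
      ((continuous_apply i).comp_continuousOn hF)
  · exact memLp_curve (memLp_pi_iff.1 h.1 i) j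
  · rw [tendsto_eLpNorm_two_iff]
    refine tendsto_of_tendsto_of_tendsto_of_le_of_le tendsto_const_nhds (h.2 j)
      (fun _ => zero_le) fun ε => lintegral_mono fun t => ?_
    have : ∀ x : Fin 2 → ℂ, ‖x i‖ₑ ≤ ‖x‖ₑ := fun x => by
      rw [← ofReal_norm, ← ofReal_norm]
      exact ENNReal.ofReal_le_ofReal (norm_le_pi_norm x i)
    exact pow_le_pow_left₀ zero_le (this _) 2

end Contour

/-! ### Holomorphy, growth and decay of Cauchy integrals -/

lemma differentiableAt_integral_cauchy {α : Type*} [MeasurableSpace α] {μ : Measure α}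
    {φ γ : α → ℂ} (hφ : Integrable φ μ) (hγ : AEStronglyMeasurable γ μ) {r : ℝ} (hr : 0 < r)
    {w : ℂ} (h : ∀ᵐ a ∂μ, r ≤ ‖γ a - w‖) :
    DifferentiableAt ℂ (fun z => ∫ a, φ a / (γ a - z) ∂μ) w := by
  have hlow : ∀ᵐ a ∂μ, ∀ z ∈ Metric.ball w (r / 2), r / 2 ≤ ‖γ a - z‖ := by
    filter_upwards [h] with a ha z hz
    rw [Metric.mem_ball, dist_eq_norm] at hz
    have : ‖γ a - w‖ ≤ ‖γ a - z‖ + ‖z - w‖ := by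
      rw [show γ a - w = (γ a - z) + (z - w) by ring]; exact norm_add_le _ _
    linarith
  have hne : ∀ᵐ a ∂μ, ∀ z ∈ Metric.ball w (r / 2), γ a - z ≠ 0 := by
    filter_upwards [hlow] with a ha z hz h0
    have := ha z hz
    rw [h0, norm_zero] at this
    linarith
  have hmeas : ∀ z, AEStronglyMeasurable (fun a => φ a / (γ a - z)) μ := fun z =>
    (hφ.1.aemeasurable.div (hγ.aemeasurable.sub_const z)).aestronglyMeasurable
  have hw : w ∈ Metric.ball w (r / 2) := Metric.mem_ball_self (by positivity)
  refine (hasDerivAt_integral_of_dominated_loc_of_deriv_le (μ := μ) (x₀ := w)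
    (F' := fun z a => φ a / (γ a - z) ^ 2) (bound := fun a => ‖φ a‖ * (4 / r ^ 2))
    (Metric.ball_mem_nhds w (half_pos hr)) (Eventually.of_forall hmeas) ?_ ?_ ?_
    (hφ.norm.mul_const _) ?_).2.differentiableAt
  · refine (hφ.norm.mul_const (2 / r)).mono' (hmeas w) ?_
    filter_upwards [hlow] with a ha
    rw [norm_div, div_eq_mul_inv]
    refine mul_le_mul_of_nonneg_left ?_ (norm_nonneg _)
    rw [show 2 / r = (r / 2)⁻¹ by rw [inv_div]]
    exact inv_anti₀ (by positivity) (ha w hw)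
  · exact (hφ.1.aemeasurable.div ((hγ.aemeasurable.sub_const w).pow_const 2)).aestronglyMeasurable
  · filter_upwards [hlow] with a ha z hz
    rw [norm_div, norm_pow, div_eq_mul_inv]
    refine mul_le_mul_of_nonneg_left ?_ (norm_nonneg _)
    rw [show 4 / r ^ 2 = ((r / 2) ^ 2)⁻¹ by rw [div_pow, inv_div]; norm_num]
    exact inv_anti₀ (by positivity) (pow_le_pow_left₀ (by positivity) (ha z hz) 2)
  · filter_upwards [hne] with a ha z hz
    have h1 := ((hasDerivAt_const z (γ a)).sub (hasDerivAt_id z)).inv (ha z hz)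
    have h2 := h1.const_mul (φ a)
    simp only [zero_sub, neg_neg] at h2
    refine h2.congr_deriv ?_ |>.congr_of_eventuallyEq ?_
    · rw [div_eq_mul_inv, div_eq_mul_inv, one_mul]; rfl
    · exact Eventually.of_forall fun x => by simp [div_eq_mul_inv]

/-- The derivative is bounded below and uniformly continuous on [0, 1], so at a fixed small scale
the curve stays close to its tangent line, uniformly in the base point. -/
lemma exists_uniform_lower {s : ℝ → ℂ} (hs : ContDiff ℝ ∞ s)
    (h0 : ∀ t ∈ Icc (0 : ℝ) 1, deriv s t ≠ 0) :
    ∃ c δ : ℝ, 0 < c ∧ 0 < δ ∧ ∀ u ∈ Icc (0 : ℝ) 1, ∀ v ∈ Icc (0 : ℝ) 1, |u - v| < δ →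
      c * |u - v| ≤ ‖s u - s v‖ := by
  have hcd := hs.continuous_deriv (n := ∞) (by simp)
  obtain ⟨t₀, ht₀, hmin⟩ := isCompact_Icc.exists_isMinOn (nonempty_Icc.2 zero_le_one)
    (hcd.norm.continuousOn (s := Icc (0 : ℝ) 1))
  set c₀ := ‖deriv s t₀‖
  have hc₀ : 0 < c₀ := norm_pos_iff.2 (h0 t₀ ht₀)
  have huc := isCompact_Icc.uniformContinuousOn_of_continuous
    (hcd.continuousOn (s := Icc (0 : ℝ) 1))
  rw [Metric.uniformContinuousOn_iff] at huc
  obtain ⟨δ, hδ, hd⟩ := huc (c₀ / 2) (half_pos hc₀)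
  refine ⟨c₀ / 2, δ, half_pos hc₀, hδ, fun u hu v hv huv => ?_⟩
  have hdiff : Differentiable ℝ s := hs.differentiable (by simp)
  have key : ‖(fun x : ℝ => s x - (x : ℂ) * deriv s v) u - (fun x : ℝ => s x - (x : ℂ) * deriv s v) v‖ ≤
      c₀ / 2 * ‖u - v‖ := by
    refine Convex.norm_image_sub_le_of_norm_hasDerivWithin_le (𝕜 := ℝ) (s := uIcc v u) (C := c₀ / 2)
      (f := fun x : ℝ => s x - (x : ℂ) * deriv s v) (f' := fun x => deriv s x - deriv s v) (fun x _ => ?_) (fun x hx => ?_)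
      (convex_uIcc v u) left_mem_uIcc right_mem_uIcc
    · have h1 := (hdiff x).hasDerivAt
      have h2 := (Complex.ofRealCLM.hasDerivAt (x := x)).mul_const (deriv s v)
      simp only [Complex.ofRealCLM_apply, Complex.ofReal_one, one_mul] at h2
      exact (h1.sub h2).hasDerivWithinAt
    · have hx1 : x ∈ Icc (0 : ℝ) 1 := by
        have := uIcc_subset_Icc hv hu
        exact this hx
      have hx2 : dist x v < δ := by
        rw [Real.dist_eq]
        exact (abs_sub_left_of_mem_uIcc hx).trans_lt huv
      rw [← dist_eq_norm]
      exact (hd x hx1 v hv hx2).le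
  have h1 : ‖((u - v : ℝ) : ℂ) * deriv s v‖ ≤ ‖s u - s v‖ + c₀ / 2 * ‖u - v‖ := by
    have e : ((u - v : ℝ) : ℂ) * deriv s v =
        (s u - s v) - ((s u - (u : ℂ) * deriv s v) - (s v - (v : ℂ) * deriv s v)) := by
      push_cast; ring
    rw [e]
    exact (norm_sub_le _ _).trans (add_le_add le_rfl key)
  rw [norm_mul, Complex.norm_real, Real.norm_eq_abs] at h1
  have h2 : c₀ ≤ ‖deriv s v‖ := hmin hv
  have h3 := mul_le_mul_of_nonneg_left h2 (abs_nonneg (u - v))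
  linarith

lemma lintegral_inv_sub_sq_add_sq (v : ℝ) {ε : ℝ} (hε : 0 < ε) :
    ∫⁻ u : ℝ, ENNReal.ofReal (((v - u) ^ 2 + ε ^ 2)⁻¹) = ENNReal.ofReal (Real.pi / ε) := by
  rw [← ofReal_integral_eq_lintegral_ofReal (integrable_inv_sub_sq_add_sq v hε.ne')
    (Eventually.of_forall fun u => by positivity)]
  congr 1
  have h := integral_poisson hε
  rw [← integral_sub_left_eq_self _ _ v, integral_const_mul] at h
  rw [eq_div_iff hε.ne', mul_comm]
  exact h

/-- If v is a nearest parameter to z, then |s u − z| is at least d and at least c|u − v|/2. So the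
integrand is at most a multiple of a Poisson-type kernel at height 2d/c, whose integral is explicit.
-/
lemma lintegral_inv_sq_le_of_lower {s : ℝ → ℂ} (hs : Continuous s) {a b c d : ℝ} (hab : a ≤ b)
    (hc : 0 < c) (hd : 0 < d) {z : ℂ} (hlow : ∀ u ∈ Icc a b, d ≤ ‖s u - z‖)
    (hbi : ∀ u ∈ Icc a b, ∀ v ∈ Icc a b, c * |u - v| ≤ ‖s u - s v‖) :
    ∫⁻ u in Icc a b, ENNReal.ofReal ((‖s u - z‖ ^ 2)⁻¹) ≤
      ENNReal.ofReal (4 * Real.pi / c / d) := by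
  obtain ⟨v, hv, hmin⟩ := isCompact_Icc.exists_isMinOn (nonempty_Icc.2 hab)
    ((hs.sub continuous_const).norm.continuousOn (s := Icc a b))
  have hpt : ∀ u ∈ Icc a b, (‖s u - z‖ ^ 2)⁻¹ ≤
      8 / c ^ 2 * ((v - u) ^ 2 + (2 * d / c) ^ 2)⁻¹ := by
    intro u hu
    have h1 := hlow u hu
    have h2 : ‖s v - z‖ ≤ ‖s u - z‖ := hmin hu
    have h3 := hbi u hu v hv
    have h4 : ‖s u - s v‖ ≤ ‖s u - z‖ + ‖s v - z‖ := by
      rw [show s u - s v = (s u - z) - (s v - z) by ring]; exact norm_sub_le _ _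
    have h5 : c * |u - v| ≤ 2 * ‖s u - z‖ := by linarith
    have h6 : c ^ 2 * (v - u) ^ 2 ≤ 4 * ‖s u - z‖ ^ 2 := by
      have := pow_le_pow_left₀ (by positivity) h5 2
      rw [mul_pow, sq_abs] at this
      nlinarith
    have h7 : d ^ 2 ≤ ‖s u - z‖ ^ 2 := pow_le_pow_left₀ hd.le h1 2
    have h8 : 8 / c ^ 2 * ((v - u) ^ 2 + (2 * d / c) ^ 2)⁻¹ =
        ((c ^ 2 * (v - u) ^ 2 + 4 * d ^ 2) / 8)⁻¹ := by
      field_simp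
      ring
    rw [h8]
    refine inv_anti₀ (by positivity) ?_
    linarith
  calc _ ≤ ∫⁻ u in Icc a b, ENNReal.ofReal (8 / c ^ 2) *
          ENNReal.ofReal (((v - u) ^ 2 + (2 * d / c) ^ 2)⁻¹) := by
        refine setLIntegral_mono' measurableSet_Icc fun u hu => ?_
        rw [← ENNReal.ofReal_mul (by positivity)]
        exact ENNReal.ofReal_le_ofReal (hpt u hu)
    _ ≤ ∫⁻ u, ENNReal.ofReal (8 / c ^ 2) *
          ENNReal.ofReal (((v - u) ^ 2 + (2 * d / c) ^ 2)⁻¹) := setLIntegral_le_lintegral _ _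
    _ = _ := by
        rw [lintegral_const_mul' _ _ ENNReal.ofReal_ne_top,
          lintegral_inv_sub_sq_add_sq v (by positivity), ← ENNReal.ofReal_mul (by positivity)]
        congr 1
        field_simp
        ring

lemma exists_lintegral_inv_sq_le {s : ℝ → ℂ} (hs : ContDiff ℝ ∞ s)
    (h0 : ∀ t ∈ Icc (0 : ℝ) 1, deriv s t ≠ 0) :
    ∃ C : ℝ, 0 < C ∧ ∀ (z : ℂ) (d : ℝ), 0 < d → (∀ u ∈ Icc (0 : ℝ) 1, d ≤ ‖s u - z‖) →
      ∫⁻ u in Icc (0 : ℝ) 1, ENNReal.ofReal ((‖s u - z‖ ^ 2)⁻¹) ≤ ENNReal.ofReal (C / d) := by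
  obtain ⟨c, δ, hc, hδ, hbi⟩ := exists_uniform_lower hs h0
  obtain ⟨N, hN⟩ := exists_nat_gt (1 / δ)
  have hNp : (0 : ℝ) < N := lt_trans (by positivity) hN
  have hN0 : 0 < N := by exact_mod_cast hNp
  refine ⟨N * (4 * Real.pi / c), by positivity, fun z d hd hlow => ?_⟩
  have hN1 : 1 / (N : ℝ) < δ := by
    rw [div_lt_iff₀ hNp]
    rw [div_lt_iff₀ hδ] at hN
    linarith
  rw [← restrict_Ioc_eq_restrict_Icc, ← iUnion_cell hN0,
    lintegral_biUnion_finset (fun i _ j _ hij => pairwise_disjoint_cell N hij)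
      fun i _ => measurableSet_cell N i]
  have hcell : ∀ i ∈ Finset.range N, ∫⁻ u in cell N i, ENNReal.ofReal ((‖s u - z‖ ^ 2)⁻¹) ≤
      ENNReal.ofReal (4 * Real.pi / c / d) := by
    intro i hi
    have hab : (i : ℝ) / N < ((i + 1 : ℕ) : ℝ) / N := by
      gcongr
      simp
    have hsub : Icc ((i : ℝ) / N) (((i + 1 : ℕ) : ℝ) / N) ⊆ Icc 0 1 := by
      rw [← closure_Ioc hab.ne]
      exact closure_minimal (cell_subset (by simpa using hi)) isClosed_Icc
    refine (lintegral_mono_set Ioc_subset_Icc_self).trans ?_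
    refine lintegral_inv_sq_le_of_lower hs.continuous hab.le hc hd (fun u hu => hlow u (hsub hu))
      fun u hu v hv => hbi u (hsub hu) v (hsub hv) ((Real.dist_le_of_mem_Icc hu hv).trans_lt ?_)
    push_cast
    rw [← sub_div, add_sub_cancel_left]
    exact hN1
  refine (Finset.sum_le_sum hcell).trans (le_of_eq ?_)
  rw [Finset.sum_const, Finset.card_range, nsmul_eq_mul, ← ENNReal.ofReal_natCast,
    ← ENNReal.ofReal_mul hNp.le]
  congr 1
  ring

/-- Cauchy–Schwarz: the `L²` norm of 1/(s − z) is O(d^(-1/2)). This is the origin of the exponent in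
the growth condition. -/
lemma exists_norm_integral_mul_sqrt_le {s : ℝ → ℂ} (hs : ContDiff ℝ ∞ s)
    (h0 : ∀ t ∈ Icc (0 : ℝ) 1, deriv s t ≠ 0) {g : ℝ → ℂ} (hg : MemLp g 2 unitMeasure) :
    ∃ M : ℝ, ∀ (z : ℂ) (d : ℝ), 0 < d → (∀ u ∈ Icc (0 : ℝ) 1, d ≤ ‖s u - z‖) →
      ‖∫ u in (0 : ℝ)..1, deriv s u / (s u - z) * g u‖ * √d ≤ M := by
  obtain ⟨C, hC, hle⟩ := exists_lintegral_inv_sq_le hs h0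
  obtain ⟨B, hB, hb⟩ := exists_deriv_bound hs
  set G := (eLpNorm g 2 unitMeasure).toReal with hG
  refine ⟨B * √C * G, fun z d hd hlow => ?_⟩
  have hmeas : AEMeasurable (fun u => ENNReal.ofReal (‖s u - z‖⁻¹)) unitMeasure := by
    have := hs.continuous.measurable
    exact (by fun_prop : Measurable _).aemeasurable
  have h1 : ‖∫ u in (0 : ℝ)..1, deriv s u / (s u - z) * g u‖ₑ ≤
      ENNReal.ofReal B * ∫⁻ u in Icc (0 : ℝ) 1, ENNReal.ofReal (‖s u - z‖⁻¹) * ‖g u‖ₑ := by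
    rw [intervalIntegral.integral_of_le zero_le_one, restrict_Ioc_eq_restrict_Icc,
      ← lintegral_const_mul' _ _ ENNReal.ofReal_ne_top]
    refine (enorm_integral_le_lintegral_enorm _).trans
      (setLIntegral_mono' measurableSet_Icc fun u hu => ?_)
    rw [enorm_mul, ← mul_assoc, ← ENNReal.ofReal_mul hB.le]
    gcongr
    rw [← ofReal_norm, norm_div, div_eq_mul_inv]
    refine ENNReal.ofReal_le_ofReal ?_
    gcongr
    exact hb u hu
  have h2 : (∫⁻ u in Icc (0 : ℝ) 1, ENNReal.ofReal (‖s u - z‖⁻¹) * ‖g u‖ₑ) ^ 2 ≤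
      ENNReal.ofReal (C / d) * eLpNorm g 2 unitMeasure ^ 2 := by
    rw [eLpNorm_two_sq]
    refine (lintegral_mul_sq_le hmeas hg.1.enorm).trans ?_
    gcongr
    refine le_trans (le_of_eq ?_) (hle z d hd hlow)
    refine lintegral_congr fun u => ?_
    rw [← ENNReal.ofReal_pow (by positivity), inv_pow]
  have h3 : ‖∫ u in (0 : ℝ)..1, deriv s u / (s u - z) * g u‖ₑ ^ 2 ≤
      ENNReal.ofReal ((B * √C * G) ^ 2 / d) := by
    calc _ ≤ (ENNReal.ofReal B) ^ 2 *
          (ENNReal.ofReal (C / d) * eLpNorm g 2 unitMeasure ^ 2) := by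
          refine (pow_le_pow_left₀ zero_le h1 2).trans ?_
          rw [mul_pow]
          gcongr
      _ = _ := by
          rw [← ENNReal.ofReal_toReal hg.2.ne, ← hG, ← ENNReal.ofReal_pow (by positivity),
            ← ENNReal.ofReal_pow (by positivity), ← ENNReal.ofReal_mul (by positivity),
            ← ENNReal.ofReal_mul (by positivity), mul_pow, mul_pow, Real.sq_sqrt hC.le]
          congr 1
          ring
  rw [← ofReal_norm, ← ENNReal.ofReal_pow (norm_nonneg _),
    ENNReal.ofReal_le_ofReal_iff (by positivity), le_div_iff₀ hd] at h3
  refine le_of_sq_le_sq ?_ (by positivity)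
  rw [mul_pow, Real.sq_sqrt hd.le]
  exact h3

namespace Contour
variable {Γ : Contour}

lemma infDist_pos (h : Γ.support.Nonempty) {z : ℂ} (hz : z ∉ Γ.support) :
    0 < Metric.infDist z Γ.support :=
  (isCompact_support.isClosed.notMem_iff_infDist_pos h).1 hz

lemma infDist_le (j : Fin Γ.n) {u : ℝ} (hu : u ∈ Icc (0 : ℝ) 1) (z : ℂ) :
    Metric.infDist z Γ.support ≤ ‖Γ.curve j u - z‖ := by
  rw [← dist_eq_norm, dist_comm]
  exact Metric.infDist_le_dist_of_mem (curve_mem_support j hu)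

lemma nonempty_support (j : Fin Γ.n) : Γ.support.Nonempty :=
  ⟨_, curve_mem_support j (left_mem_Icc.2 zero_le_one)⟩

lemma differentiableOn_cauchy {f : ℂ → ℂ} (hf : MemLp f 2 Γ.arcLength) :
    DifferentiableOn ℂ (Γ.cauchy f) Γ.supportᶜ := by
  intro z hz
  refine DifferentiableAt.differentiableWithinAt ?_
  refine DifferentiableAt.const_mul ?_ _
  refine DifferentiableAt.fun_sum fun k _ => ?_
  have hgi : IntegrableOn (fun u => f (Γ.curve k u)) (Icc 0 1) :=
    integrableOn_of_memLp_unitMeasure (memLp_curve hf k) Subset.rfl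
  have h1 : IntegrableOn (fun u => deriv (Γ.curve k) u * f (Γ.curve k u)) (Icc 0 1) :=
    hgi.continuousOn_mul ((Γ.smooth k).continuous_deriv (by simp)).continuousOn isCompact_Icc
  have := differentiableAt_integral_cauchy h1
    (Γ.smooth k).continuous.aestronglyMeasurable (infDist_pos (nonempty_support k) hz) (w := z)
    (by filter_upwards [ae_restrict_mem measurableSet_Icc] with u hu using infDist_le k hu z)
  convert! this using 2 with w
  rw [intervalIntegral.integral_of_le zero_le_one, restrict_Ioc_eq_restrict_Icc]
  congr 1 with u
  ring

lemma exists_norm_cauchy_mul_sqrt_le {f : ℂ → ℂ} (hf : MemLp f 2 Γ.arcLength) :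
    ∃ K : ℝ, ∀ z ∉ Γ.support, ‖Γ.cauchy f z‖ * √(Metric.infDist z Γ.support) ≤ K := by
  choose M hM using fun k => exists_norm_integral_mul_sqrt_le (Γ.smooth k) (Γ.regular k)
    (memLp_curve hf k)
  refine ⟨‖(2 * Real.pi * Complex.I : ℂ)⁻¹‖ * ∑ k, M k, fun z hz => ?_⟩
  rw [cauchy, norm_mul, mul_assoc]
  refine mul_le_mul_of_nonneg_left ?_ (norm_nonneg _)
  refine (mul_le_mul_of_nonneg_right (norm_sum_le _ _) (Real.sqrt_nonneg _)).trans ?_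
  rw [Finset.sum_mul]
  exact Finset.sum_le_sum fun k _ =>
    hM k z _ (infDist_pos (nonempty_support k) hz) fun u hu => infDist_le k hu z

lemma tendsto_infDist_cocompact (h : Γ.support.Nonempty) :
    Tendsto (fun z => Metric.infDist z Γ.support) (cocompact ℂ) atTop := by
  obtain ⟨R, hR⟩ := isCompact_support.isBounded.exists_norm_le (s := Γ.support)
  refine tendsto_atTop_mono (fun z => ?_)
    (tendsto_atTop_add_const_right _ (-R) (tendsto_norm_cocompact_atTop (E := ℂ)))
  refine (Metric.le_infDist h).2 fun y hy => ?_
  have h1 := hR y hy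
  have h2 := norm_sub_norm_le z y
  rw [dist_eq_norm]
  linarith

/-- The bound by dist(z, Σ)^(-1/2) holds at all distances, so it also gives decay at infinity. -/
lemma tendsto_cauchy_cocompact {f : ℂ → ℂ} (hf : MemLp f 2 Γ.arcLength) :
    Tendsto (Γ.cauchy f) (cocompact ℂ) (𝓝 0) := by
  rcases Γ.support.eq_empty_or_nonempty with h | h
  · have : IsEmpty (Fin Γ.n) := ⟨fun j => by
      have := nonempty_support j
      simp [h] at this⟩
    have e : Γ.cauchy f = fun _ => 0 := by
      ext z
      simp [cauchy]
    rw [e]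
    exact tendsto_const_nhds
  · obtain ⟨K, hK⟩ := exists_norm_cauchy_mul_sqrt_le hf
    have h1 := tendsto_infDist_cocompact h
    have h2 := (Real.tendsto_sqrt_atTop.comp h1).const_div_atTop K
    refine squeeze_zero_norm' ?_ h2
    filter_upwards [h1.eventually_gt_atTop 0] with z hz
    have hz' : z ∉ Γ.support := fun h3 => by
      rw [Metric.infDist_zero_of_mem h3] at hz
      exact lt_irrefl _ hz
    rw [Function.comp_apply, le_div_iff₀ (Real.sqrt_pos.2 hz)]
    exact hK z hz'

end Contour

/-! ### Area mean values and local integrability of the growth bound -/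

lemma two_pi_mul_enorm_le {G : ℂ → ℂ} {z₀ : ℂ} {R r : ℝ} (hG : DifferentiableOn ℂ G (Metric.ball z₀ R))
    (hr : r ∈ Ioo 0 R) :
    ENNReal.ofReal (2 * Real.pi) * ‖G z₀‖ₑ ≤
      ∫⁻ θ in Ioo (-Real.pi) Real.pi, ‖G (circleMap z₀ r θ)‖ₑ := by
  have h1 : Real.circleAverage G z₀ r = G z₀ := by
    refine circleAverage_of_differentiable_on_off_countable countable_empty ?_ ?_
    · rw [abs_of_pos hr.1]
      exact hG.continuousOn.mono (Metric.closedBall_subset_ball hr.2)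
    · intro z hz
      rw [abs_of_pos hr.1] at hz
      exact hG.differentiableAt (Metric.isOpen_ball.mem_nhds (Metric.ball_subset_ball hr.2.le hz.1))
  rw [Real.circleAverage_eq_integral_add (-Real.pi)] at h1
  have h2 := intervalIntegral.integral_comp_add_right (a := 0) (b := 2 * Real.pi)
    (fun θ => G (circleMap z₀ r θ)) (-Real.pi)
  rw [h2, zero_add, show 2 * Real.pi + -Real.pi = Real.pi by ring] at h1
  have h3 : ∫ θ in (-Real.pi)..Real.pi, G (circleMap z₀ r θ) = (2 * Real.pi : ℝ) • G z₀ := by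
    rw [← h1, smul_smul, mul_inv_cancel₀ (by positivity), one_smul]
  calc ENNReal.ofReal (2 * Real.pi) * ‖G z₀‖ₑ = ‖(2 * Real.pi : ℝ) • G z₀‖ₑ := by
        rw [enorm_smul, Real.enorm_eq_ofReal (by positivity)]
    _ ≤ _ := by
        rw [← h3, intervalIntegral.integral_of_le (by linarith [Real.pi_pos]),
          integral_Ioc_eq_integral_Ioo]
        exact enorm_integral_le_lintegral_enorm _

/-- The area mean value inequality. -/
lemma enorm_mul_area_le {G : ℂ → ℂ} {z₀ : ℂ} {R : ℝ} (hR : 0 < R)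
    (hG : DifferentiableOn ℂ G (Metric.ball z₀ R)) :
    ENNReal.ofReal (Real.pi * R ^ 2) * ‖G z₀‖ₑ ≤ ∫⁻ z in Metric.ball z₀ R, ‖G z‖ₑ := by
  classical
  set f : ℂ → ℝ≥0∞ := (Metric.ball z₀ R).indicator fun z => ‖G z‖ₑ with hf
  have hfm : Measurable f := by
    have h1 : Measurable ((Metric.ball z₀ R).piecewise G fun _ => 0) :=
      hG.continuousOn.measurable_piecewise continuousOn_const Metric.isOpen_ball.measurableSet
    have h2 : f = fun z => ‖(Metric.ball z₀ R).piecewise G (fun _ => 0) z‖ₑ := by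
      ext z
      by_cases hz : z ∈ Metric.ball z₀ R
      · simp only [hf, indicator_of_mem hz, piecewise_eq_of_mem _ _ _ hz]
      · simp only [hf, indicator_of_notMem hz, piecewise_eq_of_notMem _ _ _ hz, enorm_zero]
    rw [h2]
    exact h1.enorm
  have hsymm : Measurable fun p : ℝ × ℝ => z₀ + Complex.polarCoord.symm p := by
    simp only [Complex.polarCoord_symm_apply]
    fun_prop
  have hFm : Measurable fun p : ℝ × ℝ =>
      ENNReal.ofReal p.1 • f (z₀ + Complex.polarCoord.symm p) := by
    have := hfm.comp hsymm
    simp only [smul_eq_mul]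
    exact (by fun_prop : Measurable fun p : ℝ × ℝ => ENNReal.ofReal p.1).mul this
  rw [← lintegral_indicator Metric.isOpen_ball.measurableSet, ← lintegral_add_left_eq_self _ z₀,
    ← Complex.lintegral_comp_polarCoord_symm]
  have htarget : polarCoord.target = Ioi (0 : ℝ) ×ˢ Ioo (-Real.pi) Real.pi := rfl
  rw [htarget, Measure.volume_eq_prod, ← Measure.prod_restrict, lintegral_prod _ hFm.aemeasurable]
  have hin : ∀ r ∈ Ioo 0 R, ENNReal.ofReal r * (ENNReal.ofReal (2 * Real.pi) * ‖G z₀‖ₑ) ≤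
      ∫⁻ θ in Ioo (-Real.pi) Real.pi,
        ENNReal.ofReal r • f (z₀ + Complex.polarCoord.symm (r, θ)) := by
    intro r hr
    simp only [smul_eq_mul]
    rw [lintegral_const_mul' _ _ ENNReal.ofReal_ne_top]
    gcongr
    refine (two_pi_mul_enorm_le hG hr).trans (le_of_eq (lintegral_congr fun θ => ?_))
    have e : z₀ + Complex.polarCoord.symm (r, θ) = circleMap z₀ r θ := by
      rw [Complex.polarCoord_symm_apply, circleMap, Complex.exp_mul_I]
      push_cast
      rfl
    have hmem : circleMap z₀ r θ ∈ Metric.ball z₀ R := by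
      rw [Metric.mem_ball, dist_eq_norm, circleMap_sub_center, norm_circleMap_zero, abs_of_pos hr.1]
      exact hr.2
    rw [e, hf, indicator_of_mem hmem]
  calc ENNReal.ofReal (Real.pi * R ^ 2) * ‖G z₀‖ₑ
      = ∫⁻ r in Ioo 0 R, ENNReal.ofReal r * (ENNReal.ofReal (2 * Real.pi) * ‖G z₀‖ₑ) := by
        rw [lintegral_mul_const' _ _ (by finiteness)]
        have h1 : ∫⁻ r in Ioo 0 R, ENNReal.ofReal r = ENNReal.ofReal (R ^ 2 / 2) := by
          rw [← ofReal_integral_eq_lintegral_ofReal, ← integral_Ioc_eq_integral_Ioo,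
            ← intervalIntegral.integral_of_le hR.le, integral_id]
          · congr 1; ring
          · exact (continuous_id.integrableOn_Icc (a := 0) (b := R)).mono_set Ioo_subset_Icc_self
          · filter_upwards [ae_restrict_mem measurableSet_Ioo] with r hr using hr.1.le
        rw [h1, ← mul_assoc, ← ENNReal.ofReal_mul (by positivity)]
        congr 2
        ring
    _ ≤ ∫⁻ r in Ioo 0 R, ∫⁻ θ in Ioo (-Real.pi) Real.pi,
        ENNReal.ofReal r • f (z₀ + Complex.polarCoord.symm (r, θ)) :=
        setLIntegral_mono' measurableSet_Ioo hin
    _ ≤ _ := lintegral_mono_set fun r hr => hr.1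

/-- The Riesz potential `|z|^(-3/2)` of the plane. -/
def planeKernel (w : ℂ) : ℝ≥0∞ := ENNReal.ofReal (‖w‖ ^ (-(3 / 2) : ℝ))

lemma measurable_planeKernel : Measurable planeKernel := by
  unfold planeKernel; fun_prop

lemma lintegral_planeKernel_ball_lt_top : ∫⁻ w in Metric.ball (0 : ℂ) 1, planeKernel w < ⊤ := by
  have h1 : IntegrableOn (fun w : ℂ => ‖w‖ ^ (-(3 / 2) : ℝ)) (Metric.ball 0 1) := by
    rw [integrableOn_fun_norm_addHaar (f := fun x : ℝ => x ^ (-(3 / 2) : ℝ)) volume]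
    have h2 : IntegrableOn (fun x : ℝ => x ^ (-(1 / 2) : ℝ)) (Ioo 0 1) :=
      ((intervalIntegrable_iff_integrableOn_Ioc_of_le zero_le_one).1
        (intervalIntegral.intervalIntegrable_rpow' (by norm_num))).mono_set Ioo_subset_Ioc_self
    refine h2.congr_fun (fun x hx => ?_) measurableSet_Ioo
    simp only [Complex.finrank_real_complex, smul_eq_mul]
    rw [← Real.rpow_natCast, ← Real.rpow_add hx.1]
    norm_num
  have := h1.2
  rw [HasFiniteIntegral] at this
  refine lt_of_le_of_lt (lintegral_mono fun w => ?_) this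
  rw [planeKernel, ← ofReal_norm, Real.norm_of_nonneg (by positivity)]

/-- The bound is uniform in s: within distance 1 of s the exponent 3/2 < 2 is integrable in the
plane, and farther away the kernel is at most 1. -/
lemma lintegral_planeKernel_sub_le (p s : ℂ) :
    ∫⁻ z in Metric.ball p 1, planeKernel (s - z) ≤
      (∫⁻ w in Metric.ball (0 : ℂ) 1, planeKernel w) + volume (Metric.ball (0 : ℂ) 1) := by
  have h1 : ∫⁻ z in Metric.ball p 1, planeKernel (s - z) ≤
      (∫⁻ z in Metric.ball s 1, planeKernel (s - z)) + ∫⁻ z in Metric.ball p 1, 1 := by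
    rw [← lintegral_indicator Metric.isOpen_ball.measurableSet,
      ← lintegral_indicator Metric.isOpen_ball.measurableSet,
      ← lintegral_indicator Metric.isOpen_ball.measurableSet, ← lintegral_add_right _
        (measurable_const.indicator Metric.isOpen_ball.measurableSet)]
    refine lintegral_mono fun z => ?_
    by_cases hz : z ∈ Metric.ball p 1
    · rw [indicator_of_mem hz, indicator_of_mem hz]
      by_cases hz2 : z ∈ Metric.ball s 1
      · rw [indicator_of_mem hz2]
        exact le_self_add
      · rw [indicator_of_notMem hz2, zero_add]
        rw [Metric.mem_ball, not_lt, dist_comm, dist_eq_norm] at hz2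
        rw [planeKernel, ← ENNReal.ofReal_one]
        exact ENNReal.ofReal_le_ofReal (Real.rpow_le_one_of_one_le_of_nonpos hz2 (by norm_num))
    · rw [indicator_of_notMem hz]
      exact zero_le
  have h2 : ∫⁻ z in Metric.ball s 1, planeKernel (s - z) =
      ∫⁻ w in Metric.ball (0 : ℂ) 1, planeKernel w := by
    rw [← lintegral_indicator Metric.isOpen_ball.measurableSet,
      ← lintegral_indicator Metric.isOpen_ball.measurableSet, ← lintegral_sub_left_eq_self _ s]
    refine lintegral_congr fun z => ?_
    by_cases hz : z ∈ Metric.ball (0 : ℂ) 1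
    · rw [indicator_of_mem hz, indicator_of_mem (by simpa [dist_eq_norm] using hz), sub_sub_cancel]
    · rw [indicator_of_notMem hz, indicator_of_notMem (by simpa [dist_eq_norm] using hz)]
  rw [h2, lintegral_one, Measure.restrict_apply_univ] at h1
  rwa [Complex.volume_ball, ← Complex.volume_ball 0] at h1

/-- Viewed as the map z ↦ s(Re z) of the plane, the curve has a singular derivative everywhere, so
its image is null. -/
lemma volume_image_curve {s : ℝ → ℂ} (hs : ContDiff ℝ ∞ s) (I : Set ℝ) : volume (s '' I) = 0 := by
  have h1 : s '' I = (fun z : ℂ => s z.re) '' ((fun x : ℝ => (x : ℂ)) '' I) := by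
    rw [image_image]
    simp
  rw [h1]
  refine addHaar_image_eq_zero_of_det_fderivWithin_eq_zero volume
    (f' := fun z => (ContinuousLinearMap.toSpanSingleton ℝ (deriv s z.re)).comp Complex.reCLM)
    (fun z _ => ?_) fun z _ => ?_
  · exact (((hs.differentiable (by simp) z.re).hasDerivAt.hasFDerivAt).comp z
      Complex.reCLM.hasFDerivAt).hasFDerivWithinAt
  · by_contra hdet
    have h2 : IsUnit ((ContinuousLinearMap.toSpanSingleton ℝ (deriv s z.re)).comp
        Complex.reCLM : ℂ →ₗ[ℝ] ℂ) := by
      refine LinearMap.isUnit_iff_isUnit_det _ |>.2 ?_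
      exact isUnit_iff_ne_zero.2 hdet
    have h3 := ((Module.End.isUnit_iff _).1 h2).1
    have h4 : Complex.I = 0 := h3 (by simp)
    exact Complex.I_ne_zero h4

namespace Contour
variable {Γ : Contour}

lemma volume_support : volume Γ.support = 0 :=
  measure_iUnion_null fun j => volume_image_curve (Γ.smooth j) _

/-- With d the distance from z to Σ, a parameter interval of length d/2 at a nearest point stays
within Ad of z. Its potential of exponent 3/2 is therefore at least a constant times d·d^(-3/2) =
d^(-1/2). -/
lemma exists_inv_sqrt_infDist_le : ∃ C : ℝ, ∀ z ∉ Γ.support, Metric.infDist z Γ.support ≤ 1 →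
    ENNReal.ofReal ((√(Metric.infDist z Γ.support))⁻¹) ≤
      ENNReal.ofReal C * ∑ k, ∫⁻ u in Icc (0 : ℝ) 1, planeKernel (Γ.curve k u - z) := by
  choose B hB hb using fun k => exists_deriv_bound (Γ.smooth k)
  set A := 1 + ∑ k, B k with hA
  have hA0 : 0 < A := by
    have : 0 ≤ ∑ k, B k := Finset.sum_nonneg fun k _ => (hB k).le
    linarith
  refine ⟨2 * A ^ (3 / 2 : ℝ), fun z hz hz1 => ?_⟩
  rcases Γ.support.eq_empty_or_nonempty with h | h
  · simp [h]
  set d := Metric.infDist z Γ.support with hd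
  have hdp : 0 < d := infDist_pos h hz
  obtain ⟨y, hy, hyd⟩ := isCompact_support.exists_infDist_eq_dist h z
  obtain ⟨k, v, hv, rfl⟩ := mem_iUnion.1 hy
  -- The interval is taken to the right of v if v ≤ 1/2 and to its left otherwise; it fits into [0,
  -- 1] because d ≤ 1.
  obtain ⟨a, ha0, ha1, hav⟩ : ∃ a, 0 ≤ a ∧ a + d / 2 ≤ 1 ∧ ∀ u ∈ Icc a (a + d / 2), |u - v| ≤ d / 2 := by
    rcases le_total v (1 / 2) with h2 | h2
    · refine ⟨v, hv.1, by linarith, fun u hu => ?_⟩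
      rw [abs_le]
      constructor <;> linarith [hu.1, hu.2]
    · refine ⟨v - d / 2, by linarith, by linarith [hv.2], fun u hu => ?_⟩
      rw [abs_le]
      constructor <;> linarith [hu.1, hu.2]
  have hsub : Icc a (a + d / 2) ⊆ Icc 0 1 := Icc_subset_Icc ha0 ha1
  have hle : ∀ u ∈ Icc a (a + d / 2), ENNReal.ofReal ((A * d) ^ (-(3 / 2) : ℝ)) ≤
      planeKernel (Γ.curve k u - z) := by
    intro u hu
    refine ENNReal.ofReal_le_ofReal ?_
    have h1 : 0 < ‖Γ.curve k u - z‖ := hdp.trans_le (infDist_le k (hsub hu) z)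
    refine Real.rpow_le_rpow_of_nonpos h1 ?_ (by norm_num)
    have h2 : ‖Γ.curve k u - Γ.curve k v‖ ≤ B k * ‖u - v‖ :=
      (convex_Icc (0 : ℝ) 1).norm_image_sub_le_of_norm_deriv_le
        (fun x _ => (Γ.smooth k).differentiable (by simp) x) (fun x hx => hb k x hx) hv (hsub hu)
    have h3 : ‖Γ.curve k v - z‖ = d := by rw [hd, hyd, dist_comm, dist_eq_norm]
    have h4 : ‖Γ.curve k u - z‖ ≤ ‖Γ.curve k u - Γ.curve k v‖ + ‖Γ.curve k v - z‖ := by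
      rw [show Γ.curve k u - z = (Γ.curve k u - Γ.curve k v) + (Γ.curve k v - z) by ring]
      exact norm_add_le _ _
    have h5 : B k ≤ ∑ k, B k := Finset.single_le_sum (fun k _ => (hB k).le) (Finset.mem_univ k)
    have h6 := hav u hu
    have h7 := hB k
    rw [Real.norm_eq_abs] at h2
    have h8 : B k * |u - v| ≤ (∑ k, B k) * d := by
      refine mul_le_mul h5 (by linarith) (abs_nonneg _) (h7.le.trans h5)
    rw [hA]
    nlinarith
  calc ENNReal.ofReal ((√d)⁻¹)
      = ENNReal.ofReal (2 * A ^ (3 / 2 : ℝ)) *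
        ∫⁻ u in Icc a (a + d / 2), ENNReal.ofReal ((A * d) ^ (-(3 / 2) : ℝ)) := by
        rw [setLIntegral_const, Real.volume_Icc, add_sub_cancel_left,
          ← ENNReal.ofReal_mul (by positivity), ← ENNReal.ofReal_mul (by positivity)]
        congr 1
        rw [Real.mul_rpow hA0.le hdp.le, Real.rpow_neg hA0.le, Real.sqrt_eq_rpow,
          ← Real.rpow_neg hdp.le, show (-(1 / 2) : ℝ) = -(3 / 2) + 1 by norm_num,
          Real.rpow_add hdp, Real.rpow_one]
        have : A ^ (3 / 2 : ℝ) ≠ 0 := (Real.rpow_pos_of_pos hA0 _).ne'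
        field_simp
    _ ≤ ENNReal.ofReal (2 * A ^ (3 / 2 : ℝ)) *
        ∫⁻ u in Icc a (a + d / 2), planeKernel (Γ.curve k u - z) := by
        exact mul_le_mul' le_rfl (setLIntegral_mono' measurableSet_Icc hle)
    _ ≤ ENNReal.ofReal (2 * A ^ (3 / 2 : ℝ)) *
        ∫⁻ u in Icc (0 : ℝ) 1, planeKernel (Γ.curve k u - z) := by
        gcongr
    _ ≤ _ := by
        gcongr
        exact Finset.single_le_sum (f := fun k => ∫⁻ u in Icc (0 : ℝ) 1, planeKernel (Γ.curve k u - z))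
          (fun _ _ => zero_le) (Finset.mem_univ k)

/-- Replace the bound by the potential of Σ and exchange the integrals: the potential of each single
point is uniformly integrable over the disc. -/
lemma lintegral_inv_sqrt_infDist_lt_top {p : ℂ} (hp : p ∈ Γ.support) :
    ∫⁻ z in Metric.ball p 1, ENNReal.ofReal ((√(Metric.infDist z Γ.support))⁻¹) < ⊤ := by
  obtain ⟨C, hC⟩ := Γ.exists_inv_sqrt_infDist_le
  have h1 : ∫⁻ z in Metric.ball p 1, ENNReal.ofReal ((√(Metric.infDist z Γ.support))⁻¹) ≤
      ∫⁻ z in Metric.ball p 1, ENNReal.ofReal C *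
        ∑ k, ∫⁻ u in Icc (0 : ℝ) 1, planeKernel (Γ.curve k u - z) := by
    refine lintegral_mono_ae ?_
    filter_upwards [ae_restrict_mem Metric.isOpen_ball.measurableSet,
      ae_restrict_of_ae (measure_eq_zero_iff_ae_notMem.1 (volume_support (Γ := Γ)))] with z hz hz2
    exact hC z hz2 ((Metric.infDist_le_dist_of_mem hp).trans (Metric.mem_ball.1 hz).le)
  refine h1.trans_lt ?_
  have hm : ∀ k, Measurable (Function.uncurry fun (z : ℂ) (u : ℝ) => planeKernel (Γ.curve k u - z)) := by
    intro k
    have := (Γ.smooth k).continuous.measurable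
    exact measurable_planeKernel.comp (by fun_prop)
  rw [lintegral_const_mul' _ _ ENNReal.ofReal_ne_top, lintegral_finsetSum]
  · refine ENNReal.mul_lt_top ENNReal.ofReal_lt_top (ENNReal.sum_lt_top.2 fun k _ => ?_)
    rw [lintegral_lintegral_swap (hm k).aemeasurable]
    refine (lintegral_mono fun u => lintegral_planeKernel_sub_le p (Γ.curve k u)).trans_lt ?_
    rw [setLIntegral_const]
    refine ENNReal.mul_lt_top (ENNReal.add_lt_top.2 ⟨lintegral_planeKernel_ball_lt_top, ?_⟩) ?_
    · exact measure_ball_lt_top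
    · simp
  · intro k _
    exact (hm k).lintegral_prod_right'

end Contour

/-! ### Cauchy's theorem and formula on curved squares -/

lemma tendsto_integral_mul_of_tendsto_two {α ι : Type*} [MeasurableSpace α] {μ : Measure α}
    [IsFiniteMeasure μ] {l : Filter ι} [l.IsCountablyGenerated] {u m : ι → α → ℂ} {h m₀ : α → ℂ}
    {C : ℝ} (hu : ∀ᶠ i in l, AEStronglyMeasurable (u i) μ) (hh : MemLp h 2 μ)
    (hlim : Tendsto (fun i => ∫⁻ x, ‖u i x - h x‖ₑ ^ 2 ∂μ) l (𝓝 0))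
    (hm : ∀ᶠ i in l, AEStronglyMeasurable (m i) μ) (hb : ∀ᶠ i in l, ∀ᵐ x ∂μ, ‖m i x‖ ≤ C)
    (hm0 : ∀ᵐ x ∂μ, Tendsto (fun i => m i x) l (𝓝 (m₀ x))) :
    Tendsto (fun i => ∫ x, u i x * m i x ∂μ) l (𝓝 (∫ x, h x * m₀ x ∂μ)) := by
  have hhi : Integrable h μ := hh.integrable (by norm_num)
  have h1 : Tendsto (fun i => ∫ x, h x * m i x ∂μ) l (𝓝 (∫ x, h x * m₀ x ∂μ)) := by
    refine tendsto_integral_filter_of_dominated_convergence (fun x => ‖h x‖ * C) ?_ ?_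
      (hhi.norm.mul_const C) ?_
    · filter_upwards [hm] with i hi using hhi.1.mul hi
    · filter_upwards [hb] with i hi
      filter_upwards [hi] with x hx
      rw [norm_mul]
      exact mul_le_mul_of_nonneg_left hx (norm_nonneg _)
    · filter_upwards [hm0] with x hx using tendsto_const_nhds.mul hx
  have hev : ∀ᶠ i in l, MemLp (fun x => u i x - h x) 2 μ := by
    filter_upwards [hu, hlim.eventually (gt_mem_nhds zero_lt_one)] with i h2 h3
    refine ⟨h2.sub hh.1, ?_⟩
    have : eLpNorm (fun x => u i x - h x) 2 μ ^ 2 < ⊤ := by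
      rw [eLpNorm_two_sq]; exact h3.trans ENNReal.one_lt_top
    simpa using this
  have h2 : Tendsto (fun i => ∫ x, (u i x - h x) * m i x ∂μ) l (𝓝 0) := by
    have h3 : Tendsto (fun i => ‖∫ x, (u i x - h x) * m i x ∂μ‖ₑ ^ 2) l (𝓝 0) := by
      have h4 : Tendsto (fun i => ENNReal.ofReal C ^ 2 *
          ((∫⁻ x, ‖u i x - h x‖ₑ ^ 2 ∂μ) * μ univ)) l (𝓝 0) := by
        have h5 := ENNReal.Tendsto.mul_const (b := μ univ) hlim (Or.inr (measure_ne_top _ _))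
        have h6 := ENNReal.Tendsto.const_mul (a := ENNReal.ofReal C ^ 2) h5
          (Or.inr (by finiteness))
        simpa using h6
      refine tendsto_of_tendsto_of_tendsto_of_le_of_le' tendsto_const_nhds h4
        (Eventually.of_forall fun _ => zero_le) ?_
      filter_upwards [hev, hb] with i h5 h6
      have h7 : ‖∫ x, (u i x - h x) * m i x ∂μ‖ₑ ≤
          ENNReal.ofReal C * ∫⁻ x, ‖u i x - h x‖ₑ * 1 ∂μ := by
        rw [← lintegral_const_mul' _ _ ENNReal.ofReal_ne_top]
        refine (enorm_integral_le_lintegral_enorm _).trans (lintegral_mono_ae ?_)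
        filter_upwards [h6] with x hx
        rw [enorm_mul, mul_one, mul_comm]
        gcongr
        rw [← ofReal_norm]
        exact ENNReal.ofReal_le_ofReal hx
      refine (pow_le_pow_left₀ zero_le h7 2).trans ?_
      rw [mul_pow]
      gcongr
      refine (lintegral_mul_sq_le h5.1.enorm aemeasurable_const).trans ?_
      simp
    have h8 : Tendsto (fun i => ‖∫ x, (u i x - h x) * m i x ∂μ‖ₑ) l (𝓝 0) := by
      have := (ENNReal.continuous_rpow_const (y := 1 / 2)).tendsto 0 |>.comp h3
      simp only [Function.comp_def] at this
      rw [ENNReal.zero_rpow_of_pos (by norm_num)] at this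
      refine this.congr fun i => ?_
      rw [← ENNReal.rpow_natCast, ← ENNReal.rpow_mul]
      norm_num
    exact tendsto_zero_iff_enorm_tendsto_zero.2 h8
  have h9 := h2.add h1
  rw [zero_add] at h9
  refine h9.congr' ?_
  filter_upwards [hev, hm, hb] with i h3 h4 h5
  have i1 : Integrable (fun x => (u i x - h x) * m i x) μ :=
    (h3.integrable (by norm_num)).mul_bdd h4 h5
  have i2 : Integrable (fun x => h x * m i x) μ := hhi.mul_bdd h4 h5
  rw [← integral_add i1 i2]
  congr 1 with x
  ring

/-- The coordinates given by the normal translates of a curve. -/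
def tube (s : ℝ → ℂ) (q : ℝ × ℝ) : ℂ := s q.1 + q.2 * Complex.I * deriv s q.1

/-- The derivative of `tube` in the tangential direction. -/
def tubeDeriv (s : ℝ → ℂ) (q : ℝ × ℝ) : ℂ := deriv s q.1 + q.2 * Complex.I * deriv (deriv s) q.1

section
variable {s : ℝ → ℂ}

lemma contDiff_deriv (hs : ContDiff ℝ ∞ s) : ContDiff ℝ ∞ (deriv s) := hs.deriv'

lemma continuous_tube (hs : ContDiff ℝ ∞ s) : Continuous (tube s) := by
  have h1 := hs.continuous
  have h2 := (contDiff_deriv hs).continuous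
  unfold tube
  fun_prop

lemma continuous_tubeDeriv (hs : ContDiff ℝ ∞ s) : Continuous (tubeDeriv s) := by
  have h1 := (contDiff_deriv hs).continuous
  have h2 := (contDiff_deriv (contDiff_deriv hs)).continuous
  unfold tubeDeriv
  fun_prop

lemma hasFDerivAt_comp_fst {k : ℝ → ℂ} (hk : ContDiff ℝ ∞ k) (q : ℝ × ℝ) :
    HasFDerivAt (fun q : ℝ × ℝ => k q.1)
      ((ContinuousLinearMap.toSpanSingleton ℝ (deriv k q.1)).comp
        (ContinuousLinearMap.fst ℝ ℝ ℝ)) q :=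
  ((hk.differentiable (by simp) q.1).hasDerivAt.hasFDerivAt).comp q hasFDerivAt_fst

lemma hasFDerivAt_tube (hs : ContDiff ℝ ∞ s) (q : ℝ × ℝ) :
    ∃ L : ℝ × ℝ →L[ℝ] ℂ, HasFDerivAt (tube s) L q ∧ L (1, 0) = tubeDeriv s q ∧
      L (0, 1) = Complex.I * deriv s q.1 := by
  have h2 : HasFDerivAt (fun q : ℝ × ℝ => (q.2 : ℂ)) (Complex.ofRealCLM.comp
      (ContinuousLinearMap.snd ℝ ℝ ℝ)) q := Complex.ofRealCLM.hasFDerivAt.comp q hasFDerivAt_snd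
  refine ⟨_, (hasFDerivAt_comp_fst hs q).add ((h2.mul_const Complex.I).mul
    (hasFDerivAt_comp_fst (contDiff_deriv hs) q)), ?_, ?_⟩
  · simp [tubeDeriv]
  · simp; ring

lemma hasFDerivAt_tubeDeriv (hs : ContDiff ℝ ∞ s) (q : ℝ × ℝ) :
    ∃ L : ℝ × ℝ →L[ℝ] ℂ, HasFDerivAt (tubeDeriv s) L q ∧
      L (0, 1) = Complex.I * deriv (deriv s) q.1 := by
  obtain ⟨L, h1, -, h2⟩ := hasFDerivAt_tube (contDiff_deriv hs) q
  exact ⟨L, h1, h2⟩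

/-- Cauchy's theorem for the image of a rectangle under `tube`: the form H dz pulls back to a form
with vanishing divergence by holomorphy of H. No injectivity of `tube` is involved. -/
lemma integral_boundary_tube (hs : ContDiff ℝ ∞ s) {H : ℂ → ℂ} {V : Set ℂ} (hV : IsOpen V)
    (hH : DifferentiableOn ℂ H V) {a b c d : ℝ} (hab : a ≤ b) (hcd : c ≤ d)
    (hmem : ∀ x ∈ Icc a b, ∀ τ ∈ Icc c d, tube s (x, τ) ∈ V) :
    (∫ x in a..b, H (tube s (x, d)) * tubeDeriv s (x, d)) -
        (∫ x in a..b, H (tube s (x, c)) * tubeDeriv s (x, c)) =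
      (∫ τ in c..d, H (tube s (b, τ)) * (Complex.I * deriv s b)) -
        ∫ τ in c..d, H (tube s (a, τ)) * (Complex.I * deriv s a) := by
  choose L hL hL1 hL2 using fun q => hasFDerivAt_tube hs q
  choose M hM hM2 using fun q => hasFDerivAt_tubeDeriv hs q
  have hcont : ContinuousOn (fun q => H (tube s q)) (Icc (a, c) (b, d)) := by
    refine hH.continuousOn.comp (continuous_tube hs).continuousOn fun q hq => ?_
    exact hmem q.1 ⟨hq.1.1, hq.2.1⟩ q.2 ⟨hq.1.2, hq.2.2⟩
  have hHd : ∀ q ∈ Ioo a b ×ˢ Ioo c d, HasFDerivAt (fun q => H (tube s q))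
      ((((ContinuousLinearMap.toSpanSingleton ℂ (deriv H (tube s q))).restrictScalars ℝ)).comp (L q)) q := by
    intro q hq
    have h1 : DifferentiableAt ℂ H (tube s q) := hH.differentiableAt (hV.mem_nhds
      (hmem q.1 (Ioo_subset_Icc_self hq.1) q.2 (Ioo_subset_Icc_self hq.2)))
    exact (h1.hasDerivAt.hasFDerivAt.restrictScalars ℝ).comp q (hL q)
  have key := integral_divergence_prod_Icc_of_hasFDerivAt_of_le
    (fun q => -(H (tube s q) * (Complex.I * deriv s q.1)))
    (fun q => H (tube s q) * tubeDeriv s q)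
    (fun q => -(H (tube s q) • (Complex.I • ((ContinuousLinearMap.toSpanSingleton ℝ
      (deriv (deriv s) q.1)).comp (ContinuousLinearMap.fst ℝ ℝ ℝ))) +
      (Complex.I * deriv s q.1) • ((((ContinuousLinearMap.toSpanSingleton ℂ
        (deriv H (tube s q))).restrictScalars ℝ)).comp (L q))))
    (fun q => H (tube s q) • M q + tubeDeriv s q • ((((ContinuousLinearMap.toSpanSingleton ℂ
        (deriv H (tube s q))).restrictScalars ℝ)).comp (L q)))
    (a, c) (b, d) ⟨hab, hcd⟩ ?_ ?_ ?_ ?_ ?_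
  · have hz : ∀ q, (-(H (tube s q) • (Complex.I • ((ContinuousLinearMap.toSpanSingleton ℝ
        (deriv (deriv s) q.1)).comp (ContinuousLinearMap.fst ℝ ℝ ℝ))) +
        (Complex.I * deriv s q.1) • ((((ContinuousLinearMap.toSpanSingleton ℂ
          (deriv H (tube s q))).restrictScalars ℝ)).comp (L q)))) (1, 0) +
        (H (tube s q) • M q + tubeDeriv s q • ((((ContinuousLinearMap.toSpanSingleton ℂ
          (deriv H (tube s q))).restrictScalars ℝ)).comp (L q))) (0, 1) = 0 := by
      intro q
      simp [hL1, hL2, hM2]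
      ring
    simp only [hz, integral_zero, intervalIntegral.integral_neg] at key
    linear_combination -key
  · exact (hcont.mul (continuous_const.mul
      ((contDiff_deriv hs).continuous.comp continuous_fst)).continuousOn).neg
  · exact hcont.mul (continuous_tubeDeriv hs).continuousOn
  · intro q hq
    exact ((hHd q hq).mul ((hasFDerivAt_comp_fst (contDiff_deriv hs) q).const_mul Complex.I)).neg
  · intro q hq
    exact (hHd q hq).mul (hM q)
  · refine (integrableOn_zero (ε' := ℂ)).congr_fun (fun q _ => ?_) measurableSet_Icc
    simp [hL1, hL2, hM2]
    ring

end

/-- The sides of the square of half side length `r`, parametrised counterclockwise. -/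
def boxSide (r x : ℝ) : Fin 4 → ℝ × ℝ := ![(x, -r), (r, x), (-x, r), (-r, -x)]

/-- The directions of the sides of a square. -/
def boxDir : Fin 4 → ℂ := ![1, Complex.I, -1, -Complex.I]

lemma boxSide_eq (r x : ℝ) (i : Fin 4) :
    ((boxSide r x i).1 : ℂ) + (boxSide r x i).2 * Complex.I = boxDir i * (x - r * Complex.I) := by
  fin_cases i <;> simp [boxSide, boxDir, Complex.ext_iff]

lemma abs_boxSide_le {r x : ℝ} (hx : x ∈ Icc (-r) r) (i : Fin 4) :
    |(boxSide r x i).1| ≤ r ∧ |(boxSide r x i).2| ≤ r := by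
  have h1 : |x| ≤ r := abs_le.2 hx
  have h2 : |r| ≤ r := by rw [abs_of_nonneg (by linarith [abs_nonneg x])]
  fin_cases i <;> simp [boxSide, h1, h2]

lemma norm_boxDir (i : Fin 4) : ‖boxDir i‖ = 1 := by
  fin_cases i <;> simp [boxDir]

lemma continuous_boxSide (r : ℝ) (i : Fin 4) : Continuous fun x => boxSide r x i := by
  fin_cases i
  · exact (by fun_prop : Continuous fun x : ℝ => (x, -r))
  · exact (by fun_prop : Continuous fun x : ℝ => (r, x))
  · exact (by fun_prop : Continuous fun x : ℝ => (-x, r))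
  · exact (by fun_prop : Continuous fun x : ℝ => (-r, -x))

/-- The derivative of `tube` along the sides of a square. -/
def boxCoef (s : ℝ → ℂ) (r x : ℝ) (i : Fin 4) : ℂ :=
  (boxDir i).re * tubeDeriv s (boxSide r x i) +
    (boxDir i).im * (Complex.I * deriv s (boxSide r x i).1)

/-- The integral over the boundary of a curved square with centre on a curve. -/
def boxIntegral (s : ℝ → ℂ) (r : ℝ) (k : ℂ → ℂ) : ℂ :=
  ∑ i, ∫ x in (-r)..r, k (tube s (boxSide r x i)) * boxCoef s r x i

section
variable {s : ℝ → ℂ} {r : ℝ}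

lemma continuous_boxCoef (hs : ContDiff ℝ ∞ s) (r : ℝ) (i : Fin 4) :
    Continuous fun x => boxCoef s r x i := by
  have h1 := (continuous_tubeDeriv hs).comp (continuous_boxSide r i)
  have h2 := (contDiff_deriv hs).continuous.comp ((continuous_boxSide r i).fst)
  simp only [Function.comp_def] at h1 h2
  unfold boxCoef
  fun_prop

lemma continuous_tube_boxSide (hs : ContDiff ℝ ∞ s) (r : ℝ) (i : Fin 4) :
    Continuous fun x => tube s (boxSide r x i) :=
  (continuous_tube hs).comp (continuous_boxSide r i)

lemma boxIntegral_eq (k : ℂ → ℂ) : boxIntegral s r k =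
    (∫ x in (-r)..r, k (tube s (x, -r)) * tubeDeriv s (x, -r)) +
    (∫ x in (-r)..r, k (tube s (r, x)) * (Complex.I * deriv s r)) -
    (∫ x in (-r)..r, k (tube s (x, r)) * tubeDeriv s (x, r)) -
    (∫ x in (-r)..r, k (tube s (-r, x)) * (Complex.I * deriv s (-r))) := by
  have h1 := intervalIntegral.integral_comp_neg (a := -r) (b := r)
    (fun x => k (tube s (x, r)) * tubeDeriv s (x, r))
  have h2 := intervalIntegral.integral_comp_neg (a := -r) (b := r)
    (fun x => k (tube s (-r, x)) * (Complex.I * deriv s (-r)))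
  rw [neg_neg] at h1 h2
  rw [← h1, ← h2, boxIntegral, Fin.sum_univ_four]
  simp [boxSide, boxCoef, boxDir, sub_eq_add_neg, intervalIntegral.integral_neg]

/-- Cut the square along τ = ±η and apply Cauchy's theorem to the upper and lower parts. As η ↓ 0
the two cuts cancel by assumption, and the vertical sides are exhausted because the integrand is
integrable on them. -/
lemma boxIntegral_eq_zero (hs : ContDiff ℝ ∞ s) (hr : 0 < r) {H : ℂ → ℂ} {V : Set ℂ}
    (hV : IsOpen V) (hH : DifferentiableOn ℂ H V)
    (hmem : ∀ x ∈ Icc (-r) r, ∀ τ ∈ Icc (-r) r, τ ≠ 0 → tube s (x, τ) ∈ V)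
    (hlim : Tendsto (fun η : ℝ => (∫ x in (-r)..r, H (tube s (x, η)) * tubeDeriv s (x, η)) -
      ∫ x in (-r)..r, H (tube s (x, -η)) * tubeDeriv s (x, -η)) (𝓝[>] 0) (𝓝 0))
    (hint : ∀ b, |b| = r → IntervalIntegrable (fun τ => H (tube s (b, τ))) volume (-r) r) :
    boxIntegral s r H = 0 := by
  have hint2 : ∀ b, |b| = r → IntervalIntegrable
      (fun τ => H (tube s (b, τ)) * (Complex.I * deriv s b)) volume (-r) r := fun b hb =>
    (hint b hb).mul_const _
  have hvert : ∀ b, |b| = r → Tendsto (fun η : ℝ =>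
      (∫ τ in η..r, H (tube s (b, τ)) * (Complex.I * deriv s b)) +
      ∫ τ in (-r)..(-η), H (tube s (b, τ)) * (Complex.I * deriv s b)) (𝓝[>] 0)
      (𝓝 (∫ τ in (-r)..r, H (tube s (b, τ)) * (Complex.I * deriv s b))) := by
    intro b hb
    have hi := hint2 b hb
    set f := fun τ => H (tube s (b, τ)) * (Complex.I * deriv s b)
    have hsub : ∀ x ∈ Icc (-r) r, ∀ y ∈ Icc (-r) r, IntervalIntegrable f volume x y := by
      intro x hx y hy
      refine hi.mono_set ?_
      rw [uIcc_of_le (by linarith : -r ≤ r)]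
      exact uIcc_subset_Icc hx hy
    have hP : ContinuousAt (fun y => ∫ τ in (-r)..y, f τ) 0 := by
      have h1 := intervalIntegral.continuousOn_primitive_interval' hi left_mem_uIcc
      refine h1.continuousAt ?_
      rw [uIcc_of_le (by linarith : -r ≤ r)]
      exact Icc_mem_nhds (by linarith) hr
    have hη : Tendsto (fun η : ℝ => η) (𝓝[>] 0) (𝓝 (0 : ℝ)) := nhdsWithin_le_nhds
    have hη' : Tendsto (fun η : ℝ => -η) (𝓝[>] 0) (𝓝 (0 : ℝ)) := by
      simpa using hη.neg
    have h2 := ((hP.tendsto.comp hη').sub (hP.tendsto.comp hη)).const_add (∫ τ in (-r)..r, f τ)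
    rw [sub_self, add_zero] at h2
    refine h2.congr' ?_
    filter_upwards [Ioo_mem_nhdsGT hr] with η hη1
    have m1 : η ∈ Icc (-r) r := ⟨by linarith [hη1.1], hη1.2.le⟩
    have m2 : -r ∈ Icc (-r) r := ⟨le_rfl, by linarith⟩
    have m3 : r ∈ Icc (-r) r := ⟨by linarith, le_rfl⟩
    have h3 := intervalIntegral.integral_add_adjacent_intervals (hsub _ m2 _ m1) (hsub _ m1 _ m3)
    simp only [Function.comp_apply]
    rw [← h3]
    ring
  have hall := (hvert r (abs_of_pos hr)).sub (hvert (-r) (by rw [abs_neg, abs_of_pos hr]))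
  have hcomb := hlim.add hall
  rw [zero_add] at hcomb
  have hconst : ∀ᶠ η : ℝ in 𝓝[>] 0,
      (∫ x in (-r)..r, H (tube s (x, r)) * tubeDeriv s (x, r)) -
        (∫ x in (-r)..r, H (tube s (x, -r)) * tubeDeriv s (x, -r)) =
      (∫ x in (-r)..r, H (tube s (x, η)) * tubeDeriv s (x, η)) -
      (∫ x in (-r)..r, H (tube s (x, -η)) * tubeDeriv s (x, -η)) +
      (((∫ τ in η..r, H (tube s (r, τ)) * (Complex.I * deriv s r)) +
      ∫ τ in (-r)..(-η), H (tube s (r, τ)) * (Complex.I * deriv s r)) -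
      ((∫ τ in η..r, H (tube s (-r, τ)) * (Complex.I * deriv s (-r))) +
      ∫ τ in (-r)..(-η), H (tube s (-r, τ)) * (Complex.I * deriv s (-r)))) := by
    filter_upwards [Ioo_mem_nhdsGT hr] with η hη
    have h1 := integral_boundary_tube hs hV hH (a := -r) (b := r) (c := η) (d := r)
      (by linarith) hη.2.le fun x hx τ hτ => hmem x hx τ ⟨by linarith [hτ.1, hη.1], hτ.2⟩
        (by linarith [hτ.1, hη.1] : 0 < τ).ne'
    have h2 := integral_boundary_tube hs hV hH (a := -r) (b := r) (c := -r) (d := -η)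
      (by linarith) (by linarith [hη.2]) fun x hx τ hτ =>
        hmem x hx τ ⟨hτ.1, by linarith [hτ.2, hη.1]⟩ (by linarith [hτ.2, hη.1] : τ < 0).ne
    linear_combination h1 + h2
  have := tendsto_nhds_unique (hcomb.congr' (hconst.mono fun η h => h.symm)) tendsto_const_nhds
  rw [boxIntegral_eq]
  linear_combination this

/-- To first order `tube` is s(0) + s'(0)·(x + iτ), and the parametrisation of the i-th side is that
of the bottom side rotated by `boxDir i`. The rotation cancels in dz/(z − s(0)), so all four sides
give dx/(x − ir) up to a bounded error. -/
lemma exists_boxCoef_bound (hs : ContDiff ℝ ∞ s) (h0 : deriv s 0 ≠ 0) :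
    ∃ c r₀ C : ℝ, 0 < c ∧ 0 < r₀ ∧ 0 ≤ C ∧ ∀ r ∈ Ioo 0 r₀, ∀ x ∈ Icc (-r) r, ∀ i,
      c * r ≤ ‖tube s (boxSide r x i) - s 0‖ ∧
      ‖boxCoef s r x i / (tube s (boxSide r x i) - s 0) - 1 / ((x : ℂ) - r * Complex.I)‖ ≤ C := by
  obtain ⟨c, δ, M, hc, hδ, hker⟩ := exists_kernel_local hs h0 0 le_rfl
  obtain ⟨L, hL0, hL⟩ := exists_curve_taylor hs 1
  obtain ⟨B, hB⟩ := isCompact_Icc.exists_bound_of_continuousOn (s := Icc (-1 : ℝ) 1)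
    (contDiff_deriv (contDiff_deriv hs)).continuous.continuousOn
  have hB0 : 0 ≤ B := (norm_nonneg _).trans (hB 0 ⟨by norm_num, by norm_num⟩)
  have hM0 : 0 ≤ M := (norm_nonneg _).trans (hker 0 0 0 (by simpa using hδ) (by simpa using hδ)
    (by simpa using hδ) (s 0) (by simp)).2
  set b := ‖deriv s 0‖ with hb
  have hbp : 0 < b := norm_pos_iff.2 h0
  refine ⟨c, min δ 1, M + (L + B) * M / b + (L + B) / b, hc, lt_min hδ one_pos, by positivity,
    fun r hr x hx i => ?_⟩
  have hrδ : r < δ := hr.2.trans_le (min_le_left _ _)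
  have hr1 : r < 1 := hr.2.trans_le (min_le_right _ _)
  obtain ⟨ha1, ha2⟩ := abs_boxSide_le hx i
  set q := boxSide r x i with hq
  obtain ⟨k1, k2⟩ := hker q.1 0 q.2 (by rw [sub_zero]; linarith) (by simpa using hδ)
    (by linarith) (tube s q) (by simp [tube])
  have e1 : ((0 : ℝ) : ℂ) - q.1 - q.2 * Complex.I = -(boxDir i * (x - r * Complex.I)) := by
    rw [← boxSide_eq r x i, ← hq]; push_cast; ring
  have hnr : r ≤ ‖(x : ℂ) - r * Complex.I‖ := by
    have := Complex.abs_im_le_norm ((x : ℂ) - r * Complex.I)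
    simp only [Complex.sub_im, Complex.ofReal_im, Complex.mul_im, Complex.ofReal_re, Complex.I_im,
      mul_one, Complex.I_re, mul_zero, add_zero, zero_sub, abs_neg] at this
    exact (le_abs_self r).trans this
  have hnpos : 0 < ‖(x : ℂ) - r * Complex.I‖ := hr.1.trans_le hnr
  have hκ : boxDir i ≠ 0 := by
    rw [← norm_pos_iff, norm_boxDir]; exact one_pos
  rw [e1, norm_neg, norm_mul, norm_boxDir, one_mul, norm_sub_rev (s 0)] at k1
  have k3 : c * r ≤ ‖tube s q - s 0‖ := (mul_le_mul_of_nonneg_left hnr hc.le).trans k1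
  refine ⟨k3, ?_⟩
  have hT : tube s q - s 0 ≠ 0 := by
    rw [← norm_pos_iff]; exact (mul_pos hc hr.1).trans_le k3
  have hz : (x : ℂ) - r * Complex.I ≠ 0 := norm_pos_iff.1 hnpos
  rw [e1] at k2
  have k4 : ‖deriv s 0 / (tube s q - s 0) - 1 / (boxDir i * (x - r * Complex.I))‖ ≤ M := by
    rw [← norm_neg]
    refine le_trans (le_of_eq ?_) k2
    congr 1
    rw [← neg_sub (tube s q) (s 0), div_neg, div_neg]
    ring
  have k5 : ‖deriv s 0 / (tube s q - s 0)‖ ≤ M + 1 / r := by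
    have h1 : ‖1 / (boxDir i * (x - r * Complex.I))‖ ≤ 1 / r := by
      rw [norm_div, norm_mul, norm_boxDir, one_mul, norm_one]
      exact one_div_le_one_div_of_le hr.1 hnr
    calc _ = ‖(deriv s 0 / (tube s q - s 0) - 1 / (boxDir i * (x - r * Complex.I))) +
          1 / (boxDir i * (x - r * Complex.I))‖ := by rw [sub_add_cancel]
      _ ≤ _ := (norm_add_le _ _).trans (add_le_add k4 h1)
  have hmem : ∀ y : ℝ, |y| ≤ r → y ∈ Icc (-1 : ℝ) 1 := fun y hy =>
    ⟨by linarith [neg_abs_le y], by linarith [le_abs_self y]⟩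
  have k6 : ‖deriv s q.1 - deriv s 0‖ ≤ L * r := by
    have := (hL 0 (hmem 0 (by simpa using hr.1.le)) q.1 (hmem _ ha1)).1
    rw [sub_zero] at this
    exact this.trans (mul_le_mul_of_nonneg_left ha1 hL0)
  have k7 : ‖tubeDeriv s q - deriv s 0‖ ≤ (L + B) * r := by
    have h1 : ‖(q.2 : ℂ) * Complex.I * deriv (deriv s) q.1‖ ≤ r * B := by
      rw [norm_mul, norm_mul, Complex.norm_I, mul_one, Complex.norm_real, Real.norm_eq_abs]
      exact mul_le_mul ha2 (hB _ (hmem _ ha1)) (norm_nonneg _) hr.1.le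
    have h2 : tubeDeriv s q - deriv s 0 = (deriv s q.1 - deriv s 0) +
        (q.2 : ℂ) * Complex.I * deriv (deriv s) q.1 := by
      rw [tubeDeriv]; ring
    rw [h2]
    refine (norm_add_le _ _).trans ?_
    linarith
  have k8 : ‖boxCoef s r x i - boxDir i * deriv s 0‖ ≤ (L + B) * r := by
    have h6 : ‖deriv s q.1 - deriv s 0‖ ≤ (L + B) * r :=
      k6.trans (mul_le_mul_of_nonneg_right (by linarith) hr.1.le)
    have h9 : ∀ y : ℂ, ‖Complex.I * deriv s q.1 - Complex.I * y‖ = ‖deriv s q.1 - y‖ := fun y => by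
      rw [← mul_sub, norm_mul, Complex.norm_I, one_mul]
    rw [boxCoef, ← hq]
    clear_value q
    fin_cases i
    · simpa [boxDir] using k7
    · simpa [boxDir, h9] using h6
    · rw [norm_sub_rev] at k7
      simpa [boxDir, sub_eq_add_neg, add_comm] using k7
    · rw [← h9, norm_sub_rev] at h6
      simpa [boxDir, sub_eq_add_neg, add_comm] using h6
  have e2 : boxCoef s r x i / (tube s q - s 0) - 1 / ((x : ℂ) - r * Complex.I) =
      boxDir i * (deriv s 0 / (tube s q - s 0) - 1 / (boxDir i * (x - r * Complex.I))) +
      (boxCoef s r x i - boxDir i * deriv s 0) / deriv s 0 *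
        (deriv s 0 / (tube s q - s 0)) := by
    field_simp
    ring
  rw [e2]
  refine (norm_add_le _ _).trans ?_
  rw [norm_mul, norm_boxDir, one_mul, norm_mul, norm_div, ← hb]
  have k9 : ‖boxCoef s r x i - boxDir i * deriv s 0‖ / b * ‖deriv s 0 / (tube s q - s 0)‖ ≤
      ((L + B) * r) / b * (M + 1 / r) := by
    have hrp := hr.1
    gcongr
  have k10 : ((L + B) * r) / b * (M + 1 / r) = r * ((L + B) * M / b) + (L + B) / b := by
    have := hr.1.ne'
    field_simp
  have k11 : r * ((L + B) * M / b) ≤ (L + B) * M / b :=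
    mul_le_of_le_one_left (by positivity) hr1.le
  linarith

end

lemma intervalIntegrable_inv_sqrt_abs (r : ℝ) (hr : 0 ≤ r) :
    IntervalIntegrable (fun x : ℝ => (√|x|)⁻¹) volume (-r) r := by
  have h1 : IntervalIntegrable (fun x : ℝ => (√|x|)⁻¹) volume 0 r := by
    refine (intervalIntegral.intervalIntegrable_rpow' (a := 0) (b := r) (r := -(1 / 2))
      (by norm_num)).congr fun x hx => ?_
    rw [uIoc_of_le hr] at hx
    rw [abs_of_pos hx.1, Real.sqrt_eq_rpow, ← Real.rpow_neg hx.1.le]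
  have h2 : IntervalIntegrable (fun x : ℝ => (√|x|)⁻¹) volume (-r) 0 := by
    have := (IntervalIntegrable.iff_comp_neg (by simp)).1 h1
    simp only [abs_neg, neg_zero] at this
    exact this.symm
  exact h2.trans h1

lemma abs_le_abs_boxSide {r x : ℝ} (hx : x ∈ Icc (-r) r) (i : Fin 4) :
    |x| ≤ |(boxSide r x i).2| := by
  have h1 : |x| ≤ |r| := (abs_le.2 hx).trans (le_abs_self r)
  fin_cases i <;> simp [boxSide, h1]

lemma boxSide_mem {r x : ℝ} (hx : x ∈ Icc (-r) r) (i : Fin 4) :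
    (boxSide r x i).1 ∈ Icc (-r) r ∧ (boxSide r x i).2 ∈ Icc (-r) r :=
  ⟨abs_le.1 (abs_boxSide_le hx i).1, abs_le.1 (abs_boxSide_le hx i).2⟩

section
variable {s : ℝ → ℂ} {r : ℝ}

lemma differentiableAt_boxIntegral (hs : ContDiff ℝ ∞ s) (hr : 0 ≤ r) {g : ℂ → ℂ}
    (hg : ∀ i, IntervalIntegrable (fun x => g (tube s (boxSide r x i))) volume (-r) r)
    {w : ℂ} {d : ℝ} (hd : 0 < d)
    (hw : ∀ x ∈ Icc (-r) r, ∀ i, d ≤ ‖tube s (boxSide r x i) - w‖) :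
    DifferentiableAt ℂ (fun w => boxIntegral s r fun z => g z / (z - w)) w := by
  unfold boxIntegral
  refine DifferentiableAt.fun_sum fun i _ => ?_
  have hle : -r ≤ r := by linarith
  have h1 : IntegrableOn (fun x => g (tube s (boxSide r x i)) * boxCoef s r x i) (Ioc (-r) r) :=
    (intervalIntegrable_iff_integrableOn_Ioc_of_le hle).1
      ((hg i).mul_continuousOn (continuous_boxCoef hs r i).continuousOn)
  have := differentiableAt_integral_cauchy h1 (w := w)
    (continuous_tube_boxSide hs r i).aestronglyMeasurable hd
    (by filter_upwards [ae_restrict_mem measurableSet_Ioc] with x hx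
          using hw x (Ioc_subset_Icc_self hx) i)
  convert! this using 2 with z
  rw [intervalIntegral.integral_of_le hle]
  congr 1 with x
  ring

/-- On each side the imaginary part of 1/(x − ir) is at least 1/(2r), so for small r the integral of
dz/(z − s(0)) over that side has imaginary part at least 2r(1/(2r) − C) > 0. Hence the winding
integral is nonzero at the centre, and near it by continuity; its exact value is never needed. -/
lemma exists_box (hs : ContDiff ℝ ∞ s) (h0 : deriv s 0 ≠ 0) :
    ∃ r₀ > 0, ∀ r ∈ Ioo 0 r₀, ∃ ρ > 0,
      (∀ x ∈ Icc (-r) r, ∀ i, 2 * ρ ≤ ‖tube s (boxSide r x i) - s 0‖) ∧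
      ∀ w ∈ Metric.ball (s 0) ρ, boxIntegral s r (fun z => 1 / (z - w)) ≠ 0 := by
  obtain ⟨c, r₀, C, hc, hr₀, hC, hb⟩ := exists_boxCoef_bound hs h0
  refine ⟨min r₀ (1 / (2 * C + 1)), lt_min hr₀ (by positivity), fun r hr => ?_⟩
  have hr1 : r ∈ Ioo 0 r₀ := ⟨hr.1, hr.2.trans_le (min_le_left _ _)⟩
  have hrC : C < 1 / (2 * r) := by
    have h1 := hr.2.trans_le (min_le_right _ _)
    rw [lt_div_iff₀ (by positivity)] at h1
    rw [lt_div_iff₀ (by linarith [hr.1])]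
    nlinarith [hr.1]
  have hle : -r ≤ r := by linarith [hr.1]
  have hcont : ∀ i, ContinuousOn (fun x => 1 / (tube s (boxSide r x i) - s 0) * boxCoef s r x i)
      (uIcc (-r) r) := by
    intro i
    rw [uIcc_of_le hle]
    refine ContinuousOn.mul (continuousOn_const.div
      ((continuous_tube_boxSide hs r i).sub continuous_const).continuousOn fun x hx => ?_)
      (continuous_boxCoef hs r i).continuousOn
    exact norm_pos_iff.1 ((mul_pos hc hr.1).trans_le (hb r hr1 x hx i).1)
  have hside : ∀ i, 0 < (∫ x in (-r)..r,
      1 / (tube s (boxSide r x i) - s 0) * boxCoef s r x i).im := by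
    intro i
    have hi := (hcont i).intervalIntegrable (μ := volume)
    have h1 := Complex.imCLM.intervalIntegral_comp_comm hi
    simp only [Complex.imCLM_apply] at h1
    rw [← h1]
    have h2 : ∫ x in (-r)..r, (1 / (2 * r) - C) ≤
        ∫ x in (-r)..r, (1 / (tube s (boxSide r x i) - s 0) * boxCoef s r x i).im := by
      refine intervalIntegral.integral_mono_on hle (by simp)
        ((Complex.continuous_im.comp_continuousOn (hcont i)).intervalIntegrable) fun x hx => ?_
      have h3 := (hb r hr1 x hx i).2
      have h4 := (Complex.abs_im_le_norm _).trans h3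
      have h5 : (1 / ((x : ℂ) - r * Complex.I)).im = r / (x ^ 2 + r ^ 2) := by
        rw [one_div, Complex.inv_im]
        simp [Complex.normSq_apply, pow_two]
      have h6 : 1 / (2 * r) ≤ r / (x ^ 2 + r ^ 2) := by
        have hx2 : x ^ 2 ≤ r ^ 2 := by nlinarith [hx.1, hx.2]
        have := hr.1
        rw [div_le_div_iff₀ (by positivity) (by positivity)]
        nlinarith
      rw [Complex.sub_im, h5, abs_le] at h4
      have e : 1 / (tube s (boxSide r x i) - s 0) * boxCoef s r x i =
          boxCoef s r x i / (tube s (boxSide r x i) - s 0) := by ring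
      rw [e]
      linarith [h4.1]
    refine lt_of_lt_of_le ?_ h2
    rw [intervalIntegral.integral_const, smul_eq_mul]
    exact mul_pos (by linarith [hr.1]) (by linarith)
  have hne : boxIntegral s r (fun z => 1 / (z - s 0)) ≠ 0 := by
    intro h
    have h1 : (boxIntegral s r (fun z => 1 / (z - s 0))).im = 0 := by rw [h]; rfl
    rw [boxIntegral, Complex.im_sum] at h1
    exact (Finset.sum_pos (fun i _ => hside i) Finset.univ_nonempty).ne' h1
  have hcts : ContinuousAt (fun w => boxIntegral s r fun z => 1 / (z - w)) (s 0) :=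
    (differentiableAt_boxIntegral hs hr.1.le (g := fun _ => 1) (fun i => by simp)
      (mul_pos hc hr.1) fun x hx i => (hb r hr1 x hx i).1).continuousAt
  obtain ⟨ρ, hρ, hball⟩ := Metric.eventually_nhds_iff_ball.1 (hcts.eventually_ne hne)
  refine ⟨min ρ (c * r / 2), lt_min hρ (by have := mul_pos hc hr.1; positivity), ?_, ?_⟩
  · intro x hx i
    have := (hb r hr1 x hx i).1
    have h2 := min_le_right ρ (c * r / 2)
    linarith
  · intro w hw
    exact hball w (Metric.ball_subset_ball (min_le_left _ _) hw)

/-- The extension is the quotient of the boundary integrals of g(z)/(z − w) and 1/(z − w). It is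
holomorphic near the centre, and it equals g(w) off the curve because the divided difference of g at
w has zero boundary integral. -/
lemma exists_extension_tube (hs : ContDiff ℝ ∞ s) (h0 : deriv s 0 ≠ 0) :
    ∃ r₀ > 0, ∀ r ∈ Ioo 0 r₀, ∃ ρ > 0, ∀ (V : Set ℂ) (g : ℂ → ℂ) (h : ℝ → ℂ) (K : ℝ), IsOpen V →
      DifferentiableOn ℂ g V →
      (∀ x ∈ Icc (-r) r, ∀ τ ∈ Icc (-r) r, τ ≠ 0 → tube s (x, τ) ∈ V) →
      (∀ x ∈ Icc (-r) r, s x ∉ V) →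
      (∀ x ∈ Icc (-r) r, ∀ τ ∈ Icc (-r) r, τ ≠ 0 → ‖g (tube s (x, τ))‖ * √|τ| ≤ K) →
      MemLp h 2 (volume.restrict (Icc (-r) r)) →
      (∀ side : ℝ, |side| = 1 → Tendsto
        (fun η => ∫⁻ x in Icc (-r) r, ‖g (tube s (x, side * η)) - h x‖ₑ ^ 2) (𝓝[>] 0) (𝓝 0)) →
      ∃ φ : ℂ → ℂ, DifferentiableOn ℂ φ (Metric.ball (s 0) ρ) ∧
        ∀ w ∈ Metric.ball (s 0) ρ, w ∈ V → φ w = g w := by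
  obtain ⟨r₀, hr₀, hbox⟩ := exists_box hs h0
  refine ⟨r₀, hr₀, fun r hr => ?_⟩
  obtain ⟨ρ, hρ, hdist, hW⟩ := hbox r hr
  refine ⟨ρ, hρ, fun V g h K hV hg hmem hnot hK hh hlim => ?_⟩
  have hrp := hr.1
  have hle : -r ≤ r := by linarith
  have hK0 : 0 ≤ K := le_trans (by positivity) (hK 0 ⟨by linarith, hrp.le⟩ r ⟨hle, le_rfl⟩ hrp.ne')
  have hfar : ∀ w ∈ Metric.ball (s 0) ρ, ∀ x ∈ Icc (-r) r, ∀ i,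
      ρ ≤ ‖tube s (boxSide r x i) - w‖ := by
    intro w hw x hx i
    have h1 := hdist x hx i
    rw [Metric.mem_ball, dist_eq_norm] at hw
    have h2 : ‖tube s (boxSide r x i) - s 0‖ ≤ ‖tube s (boxSide r x i) - w‖ + ‖w - s 0‖ := by
      rw [show tube s (boxSide r x i) - s 0 = (tube s (boxSide r x i) - w) + (w - s 0) by ring]
      exact norm_add_le _ _
    linarith
  have hside : ∀ x ∈ Icc (-r) r, x ≠ 0 → ∀ i, (boxSide r x i).2 ≠ 0 := by
    intro x hx hx0 i h3
    have := abs_le_abs_boxSide hx i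
    rw [h3, abs_zero] at this
    exact hx0 (abs_nonpos_iff.1 this)
  -- On every side the height |τ| is at least |x|, so the growth bound makes g at most a multiple of
  -- the integrable |x|^(-1/2).
  have hgint : ∀ i, IntervalIntegrable (fun x => g (tube s (boxSide r x i))) volume (-r) r := by
    intro i
    refine ((intervalIntegrable_inv_sqrt_abs r hrp.le).const_mul K).mono_fun' ?_ ?_
    · rw [uIoc_of_le hle]
      have h1 : ContinuousOn (fun x => g (tube s (boxSide r x i))) (Icc (-r) r \ {0}) :=
        hg.continuousOn.comp (continuous_tube_boxSide hs r i).continuousOn fun x hx =>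
          hmem _ (boxSide_mem hx.1 i).1 _ (boxSide_mem hx.1 i).2 (hside x hx.1 hx.2 i)
      have h2 := h1.aestronglyMeasurable (μ := volume) (measurableSet_Icc.diff (measurableSet_singleton 0))
      refine h2.mono_measure ?_
      refine Measure.restrict_mono_ae ?_
      have : ∀ᵐ x : ℝ, x ≠ 0 := by simp [ae_iff]
      filter_upwards [this] with x hx hx1
      exact ⟨Ioc_subset_Icc_self hx1, hx⟩
    · rw [uIoc_of_le hle]
      have : ∀ᵐ x : ℝ ∂volume.restrict (Ioc (-r) r), x ≠ 0 :=
        ae_restrict_of_ae (by simp [ae_iff])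
      filter_upwards [this, ae_restrict_mem measurableSet_Ioc] with x hx hx1
      have hx2 := Ioc_subset_Icc_self hx1
      have h1 := hK _ (boxSide_mem hx2 i).1 _ (boxSide_mem hx2 i).2 (hside x hx2 hx i)
      have h2 : 0 < √|x| := Real.sqrt_pos.2 (abs_pos.2 hx)
      rw [← div_eq_mul_inv, le_div_iff₀ h2]
      refine le_trans ?_ h1
      exact mul_le_mul_of_nonneg_left (Real.sqrt_le_sqrt (abs_le_abs_boxSide hx2 i)) (norm_nonneg _)
  set N : ℂ → ℂ := fun w => boxIntegral s r fun z => g z / (z - w) with hN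
  set W : ℂ → ℂ := fun w => boxIntegral s r fun z => 1 / (z - w) with hWdef
  refine ⟨fun w => N w / W w, fun w hw => ?_, fun w hw hwV => ?_⟩
  · refine DifferentiableAt.differentiableWithinAt (DifferentiableAt.div ?_ ?_ (hW w hw))
    · exact differentiableAt_boxIntegral hs hrp.le hgint hρ (hfar w hw)
    · exact differentiableAt_boxIntegral hs hrp.le (g := fun _ => 1) (fun i => by simp) hρ
        (hfar w hw)
  rw [div_eq_iff (hW w hw)]
  -- The divided difference is holomorphic at w too, so Cauchy's theorem can be applied to it on
  -- both halves of the square.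
  set H := dslope g w with hH
  have hHd : DifferentiableOn ℂ H V := (Complex.differentiableOn_dslope (hV.mem_nhds hwV)).2 hg
  have hHz : ∀ z, z ≠ w → H z = (g z - g w) / (z - w) := fun z hz => by
    rw [hH, dslope_of_ne _ hz, slope_def_field]
  have hHbox : ∀ x ∈ Icc (-r) r, ∀ i, H (tube s (boxSide r x i)) =
      (g (tube s (boxSide r x i)) - g w) / (tube s (boxSide r x i) - w) := by
    intro x hx i
    refine hHz _ fun h1 => ?_
    have := hfar w hw x hx i
    rw [h1, sub_self, norm_zero] at this
    linarith
  have hquot : ∀ i, ContinuousOn (fun x => 1 / (tube s (boxSide r x i) - w)) (uIcc (-r) r) := by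
    intro i
    rw [uIcc_of_le hle]
    refine continuousOn_const.div
      ((continuous_tube_boxSide hs r i).sub continuous_const).continuousOn fun x hx => ?_
    exact norm_pos_iff.1 (hρ.trans_le (hfar w hw x hx i))
  have hzero : boxIntegral s r H = 0 := by
    refine boxIntegral_eq_zero hs hrp hV hHd hmem ?_ ?_
    · have hsw : ∃ d > 0, ∀ x ∈ Icc (-r) r, 2 * d ≤ ‖s x - w‖ := by
        obtain ⟨x₀, hx₀, hmin⟩ := isCompact_Icc.exists_isMinOn (nonempty_Icc.2 hle)
          ((hs.continuous.sub continuous_const).norm.continuousOn (s := Icc (-r) r))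
        refine ⟨‖s x₀ - w‖ / 2, ?_, fun x hx => ?_⟩
        · have : s x₀ - w ≠ 0 := fun h1 => hnot x₀ hx₀ (by rw [sub_eq_zero.1 h1]; exact hwV)
          have := norm_pos_iff.2 this
          positivity
        · have : ‖s x₀ - w‖ ≤ ‖s x - w‖ := hmin hx
          linarith
      obtain ⟨d, hd, hsd⟩ := hsw
      obtain ⟨B, hB⟩ := isCompact_Icc.exists_bound_of_continuousOn (s := Icc (-r) r)
        (contDiff_deriv hs).continuous.continuousOn
      obtain ⟨T, hT⟩ := (isCompact_Icc.prod isCompact_Icc).exists_bound_of_continuousOn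
        (s := Icc (-r) r ×ˢ Icc (-r) r) (continuous_tubeDeriv hs).continuousOn
      have hlow : ∀ side : ℝ, |side| = 1 → ∀ᶠ η : ℝ in 𝓝[>] 0, side * η ∈ Icc (-r) r ∧ side * η ≠ 0 ∧
          ∀ x ∈ Icc (-r) r, d ≤ ‖tube s (x, side * η) - w‖ := by
        intro side hside1
        filter_upwards [Ioo_mem_nhdsGT (show (0 : ℝ) < min r (d / (|B| + 1)) by positivity)] with η hη
        have habs : |side * η| = η := by rw [abs_mul, hside1, one_mul, abs_of_pos hη.1]
        refine ⟨abs_le.1 (by rw [habs]; exact hη.2.le.trans (min_le_left _ _)), ?_, fun x hx => ?_⟩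
        · rw [← abs_pos, habs]; exact hη.1
        · have h1 : ‖((side * η : ℝ) : ℂ) * Complex.I * deriv s x‖ ≤ d := by
            rw [norm_mul, norm_mul, Complex.norm_I, mul_one, Complex.norm_real, Real.norm_eq_abs,
              habs]
            have h2 : η ≤ d / (|B| + 1) := hη.2.le.trans (min_le_right _ _)
            rw [le_div_iff₀ (by positivity)] at h2
            have h3 : ‖deriv s x‖ ≤ |B| + 1 := (hB x hx).trans (by linarith [le_abs_self B])
            exact (mul_le_mul_of_nonneg_left h3 hη.1.le).trans h2
          have h4 : s x - w = (tube s (x, side * η) - w) -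
              ((side * η : ℝ) : ℂ) * Complex.I * deriv s x := by rw [tube]; ring
          have h5 := hsd x hx
          rw [h4] at h5
          have h6 := norm_sub_le (tube s (x, side * η) - w)
            (((side * η : ℝ) : ℂ) * Complex.I * deriv s x)
          linarith
      -- From either side the integral tends to the same expression in `h`: an `L²` limit times
      -- bounded kernels that converge pointwise. This is where the absence of a jump enters.
      have hone : ∀ side : ℝ, |side| = 1 → Tendsto (fun η : ℝ =>
          ∫ x in (-r)..r, H (tube s (x, side * η)) * tubeDeriv s (x, side * η)) (𝓝[>] 0)
          (𝓝 (∫ x in Icc (-r) r, (h x - g w) * (tubeDeriv s (x, 0) / (tube s (x, 0) - w)))) := by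
        intro side hside1
        have hmemV : ∀ᶠ η : ℝ in 𝓝[>] 0, ∀ x ∈ Icc (-r) r, tube s (x, side * η) ∈ V := by
          filter_upwards [hlow side hside1] with η hη x hx using hmem x hx _ hη.1 hη.2.1
        have hct : ∀ ρ : ℝ, Continuous fun x : ℝ => tube s (x, ρ) := fun ρ =>
          (continuous_tube hs).comp (by fun_prop)
        have hctd : ∀ ρ : ℝ, Continuous fun x : ℝ => tubeDeriv s (x, ρ) := fun ρ =>
          (continuous_tubeDeriv hs).comp (by fun_prop)
        have key := tendsto_integral_mul_of_tendsto_two (μ := volume.restrict (Icc (-r) r))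
          (l := 𝓝[>] (0 : ℝ)) (u := fun η x => g (tube s (x, side * η)) - g w)
          (h := fun x => h x - g w)
          (m := fun η x => tubeDeriv s (x, side * η) / (tube s (x, side * η) - w))
          (m₀ := fun x => tubeDeriv s (x, 0) / (tube s (x, 0) - w)) (C := T / d)
          ?_ (hh.sub (memLp_const _)) ?_ ?_ ?_ ?_
        · refine key.congr' ?_
          filter_upwards [hlow side hside1] with η hη
          rw [intervalIntegral.integral_of_le hle, ← integral_Icc_eq_integral_Ioc]
          refine setIntegral_congr_fun measurableSet_Icc fun x hx => ?_
          rw [hHz]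
          · ring
          · intro h1
            have := hη.2.2 x hx
            rw [h1, sub_self, norm_zero] at this
            linarith
        · filter_upwards [hmemV] with η hη
          exact ((hg.continuousOn.comp (hct _).continuousOn hη).sub
            continuousOn_const).aestronglyMeasurable measurableSet_Icc
        · simpa using hlim side hside1
        · exact Eventually.of_forall fun η =>
            ((hctd _).measurable.div ((hct _).measurable.sub_const w)).aestronglyMeasurable
        · filter_upwards [hlow side hside1] with η hη
          filter_upwards [ae_restrict_mem measurableSet_Icc] with x hx
          have h1 : ‖tubeDeriv s (x, side * η)‖ ≤ T := hT _ ⟨hx, hη.1⟩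
          have h2 : 0 ≤ T := (norm_nonneg _).trans h1
          rw [norm_div]
          exact div_le_div₀ h2 h1 hd (hη.2.2 x hx)
        · filter_upwards [ae_restrict_mem measurableSet_Icc] with x hx
          have hc : ContinuousAt (fun η : ℝ =>
              tubeDeriv s (x, side * η) / (tube s (x, side * η) - w)) 0 := by
            refine ContinuousAt.div ((continuous_tubeDeriv hs).comp (by fun_prop)).continuousAt
              (((continuous_tube hs).comp (by fun_prop)).sub continuous_const).continuousAt ?_
            rw [mul_zero, tube]
            have h1 := hsd x hx
            simp only [Complex.ofReal_zero, zero_mul, add_zero]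
            exact norm_pos_iff.1 (by linarith)
          have := hc.tendsto.mono_left (nhdsWithin_le_nhds (s := Ioi 0))
          simpa using this
      have h1 := (hone 1 (by simp)).sub (hone (-1) (by simp))
      rw [sub_self] at h1
      simpa using h1
    · intro b hb
      have hbr : b = r ∨ b = -r := by
        rcases abs_choice b with h1 | h1
        · left; rw [← hb, h1]
        · right; rw [← hb, h1, neg_neg]
      have key : ∀ i, IntervalIntegrable (fun x => H (tube s (boxSide r x i))) volume (-r) r := by
        intro i
        refine (((hgint i).sub (by simp : IntervalIntegrable (fun _ => g w) volume (-r) r)).mul_continuousOn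
          (hquot i)).congr fun x hx => ?_
        rw [uIoc_of_le hle] at hx
        rw [hHbox x (Ioc_subset_Icc_self hx) i]
        ring
      rcases hbr with rfl | rfl
      · exact key 1
      · have := (IntervalIntegrable.iff_comp_neg (by simp)).1 (key 3)
        rw [neg_neg] at this
        simpa [boxSide] using this.symm
  have hlin : boxIntegral s r H = N w - g w * W w := by
    simp only [hN, hWdef, boxIntegral]
    rw [Finset.mul_sum, ← Finset.sum_sub_distrib]
    refine Finset.sum_congr rfl fun i _ => ?_
    rw [← intervalIntegral.integral_const_mul, ← intervalIntegral.integral_sub]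
    · refine intervalIntegral.integral_congr fun x hx => ?_
      rw [uIcc_of_le hle] at hx
      rw [hHbox x hx i]
      ring
    · refine (((hgint i).mul_continuousOn (hquot i)).mul_continuousOn
        (continuous_boxCoef hs r i).continuousOn).congr fun x _ => ?_
      ring
    · exact (((hquot i).mul (continuous_boxCoef hs r i).continuousOn).intervalIntegrable).const_mul _
  rw [hzero] at hlin
  exact (sub_eq_zero.1 hlin.symm)

end

/-! ### Removable singularities at generic points of the contour -/

/-- `g` extends holomorphically across `Z` near `p`. -/
def ExtendsAt (Z : Set ℂ) (g : ℂ → ℂ) (p : ℂ) : Prop :=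
  ∃ φ : ℂ → ℂ, ∃ U, IsOpen U ∧ p ∈ U ∧ DifferentiableOn ℂ φ U ∧ ∀ z ∈ U, z ∉ Z → φ z = g z

/-- Local extensions agree on overlaps, being continuous and equal to g on the dense complement of
Z. -/
lemma exists_patch {Z V : Set ℂ} (hZ : Dense Zᶜ) {g : ℂ → ℂ}
    (h : ∀ p ∈ V, ExtendsAt Z g p) :
    ∃ G : ℂ → ℂ, (∀ p ∈ V, DifferentiableAt ℂ G p) ∧ ∀ z ∈ V, z ∉ Z → G z = g z := by
  classical
  choose! φ U hU hpU hφ hφg using h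
  have hcomp : ∀ p ∈ V, ∀ q ∈ V, ∀ z ∈ U p, z ∈ U q → φ p z = φ q z := by
    intro p hp q hq z hzp hzq
    have : (𝓝[Zᶜ] z).NeBot := mem_closure_iff_nhdsWithin_neBot.1 (hZ z)
    have h1 : Tendsto (φ p) (𝓝[Zᶜ] z) (𝓝 (φ p z)) := (((hφ p hp).differentiableAt
      ((hU p hp).mem_nhds hzp)).continuousAt.tendsto).mono_left nhdsWithin_le_nhds
    have h2 : Tendsto (φ q) (𝓝[Zᶜ] z) (𝓝 (φ q z)) := (((hφ q hq).differentiableAt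
      ((hU q hq).mem_nhds hzq)).continuousAt.tendsto).mono_left nhdsWithin_le_nhds
    refine tendsto_nhds_unique (h1.congr' ?_) h2
    filter_upwards [nhdsWithin_le_nhds ((hU p hp).mem_nhds hzp),
      nhdsWithin_le_nhds ((hU q hq).mem_nhds hzq), self_mem_nhdsWithin] with w w1 w2 w3
    rw [hφg p hp w w1 w3, hφg q hq w w2 w3]
  set G : ℂ → ℂ := fun z => if h : ∃ p ∈ V, z ∈ U p then φ h.choose z else 0 with hG
  have hGφ : ∀ p ∈ V, ∀ z ∈ U p, G z = φ p z := by
    intro p hp z hz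
    have h : ∃ p ∈ V, z ∈ U p := ⟨p, hp, hz⟩
    simp only [hG, dif_pos h]
    exact hcomp _ h.choose_spec.1 p hp z h.choose_spec.2 hz
  refine ⟨G, fun p hp => ?_, fun z hz hzZ => ?_⟩
  · refine ((hφ p hp).differentiableAt ((hU p hp).mem_nhds (hpU p hp))).congr_of_eventuallyEq ?_
    filter_upwards [(hU p hp).mem_nhds (hpU p hp)] with z hz using hGφ p hp z hz
  · rw [hGφ z hz z (hpU z hz), hφg z hz z (hpU z hz) hzZ]

/-- Riemann's theorem applied to (z − p)g(z), which extends by 0 at p; the zero is then divided out.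
-/
lemma exists_extension_of_tendsto {g : ℂ → ℂ} {p : ℂ} {U : Set ℂ} (hU : IsOpen U) (hp : p ∈ U)
    (hg : DifferentiableOn ℂ g (U \ {p}))
    (hlim : Tendsto (fun z => (z - p) * g z) (𝓝[≠] p) (𝓝 0)) :
    ∃ φ : ℂ → ℂ, DifferentiableOn ℂ φ U ∧ ∀ z ∈ U, z ≠ p → φ z = g z := by
  set F : ℂ → ℂ := fun z => (z - p) * g z with hF
  have hF0 : F p = 0 := by simp [hF]
  have hd : DifferentiableOn ℂ F U := by
    refine (Complex.differentiableOn_compl_singleton_and_continuousAt_iff (hU.mem_nhds hp)).1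
      ⟨((differentiableOn_id.sub_const p).mul hg), ?_⟩
    rw [continuousAt_iff_punctured_nhds, hF0]
    exact hlim
  refine ⟨dslope F p, (Complex.differentiableOn_dslope (hU.mem_nhds hp)).2 hd, fun z hz hzp => ?_⟩
  rw [dslope_of_ne _ hzp, slope_def_field, hF0, sub_zero, hF]
  field_simp [sub_ne_zero.2 hzp]

/-- Removability of a pole that is excluded by a bound on a sequence. -/
lemma exists_extension_of_pole {g : ℂ → ℂ} {p : ℂ} {U : Set ℂ} (hU : IsOpen U) (hp : p ∈ U)
    (hg : DifferentiableOn ℂ g (U \ {p})) {n : ℕ}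
    (hlim : Tendsto (fun z => (z - p) ^ n * g z) (𝓝[≠] p) (𝓝 0)) {l : Filter ℂ} [l.NeBot]
    (hl : l ≤ 𝓝[≠] p) (hsub : Tendsto (fun z => (z - p) * g z) l (𝓝 0)) :
    ∃ φ : ℂ → ℂ, DifferentiableOn ℂ φ U ∧ ∀ z ∈ U, z ≠ p → φ z = g z := by
  refine exists_extension_of_tendsto hU hp hg ?_
  have hzp : Tendsto (fun z => z - p) (𝓝[≠] p) (𝓝 0) := by
    have : ContinuousAt (fun z : ℂ => z - p) p := by fun_prop
    simpa using this.tendsto.mono_left nhdsWithin_le_nhds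
  induction n with
  | zero =>
    have := hzp.mul hlim
    simpa using this
  | succ n ih =>
    rcases Nat.eq_zero_or_pos n with rfl | hn
    · simpa using hlim
    refine ih ?_
    obtain ⟨φ, hφ, hφg⟩ := exists_extension_of_tendsto (g := fun z => (z - p) ^ n * g z) hU hp
      (((differentiableOn_id.sub_const p).pow n).mul hg)
      (hlim.congr fun z => by rw [pow_succ]; ring)
    have hφc : Tendsto φ (𝓝[≠] p) (𝓝 (φ p)) :=
      (hφ.differentiableAt (hU.mem_nhds hp)).continuousAt.tendsto.mono_left nhdsWithin_le_nhds
    have hev : φ =ᶠ[𝓝[≠] p] fun z => (z - p) ^ n * g z := by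
      filter_upwards [nhdsWithin_le_nhds (hU.mem_nhds hp), self_mem_nhdsWithin] with z h1 h2
        using hφg z h1 h2
    have h1 := hφc.congr' hev
    -- Since n ≥ 1, the limit of (z − p)^n g along `l` is 0. The full limit exists, so it is 0 as
    -- well and the possible order of the pole drops by one.
    have h2 : Tendsto (fun z => (z - p) ^ n * g z) l (𝓝 0) := by
      obtain ⟨m, rfl⟩ := Nat.exists_eq_succ_of_ne_zero hn.ne'
      have h3 := ((hzp.mono_left hl).pow m).mul hsub
      rw [mul_zero] at h3
      exact h3.congr fun z => by rw [pow_succ]; ring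
    rwa [tendsto_nhds_unique (h1.mono_left hl) h2] at h1

namespace Contour
variable {Γ : Contour}

/-- Near a good point the only part of Σ nearby is the curve itself, from which a normal translate
by τ has distance at least c|τ|; the rest of Σ stays at a positive distance. -/
lemma exists_tube_lower {j : Fin Γ.n} {t₀ : ℝ} (ht : t₀ ∈ Γ.good j) :
    ∃ c r : ℝ, 0 < c ∧ 0 < r ∧ ∀ x τ : ℝ, |x| ≤ r → |τ| ≤ r →
      c * |τ| ≤ Metric.infDist (Γ.shift j τ (t₀ + x)) Γ.support := by
  have htI := good_subset_Ioo j ht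
  obtain ⟨c, δ, M, hc, hδ, hker⟩ := exists_kernel_local (Γ.smooth j) (Γ.regular j t₀ ht.1) 0 le_rfl
  set Z : Set ℂ := ⋃ k, Γ.curve k '' (Icc (0 : ℝ) 1 ∩ {u | k = j → δ ≤ |u - t₀|}) with hZ
  have hZc : IsClosed Z := by
    refine (isCompact_iUnion fun k => (isCompact_Icc.inter_right ?_).image
      (Γ.smooth k).continuous).isClosed
    by_cases hk : k = j
    · simp only [hk, true_implies]
      exact isClosed_le continuous_const (by fun_prop)
    · simp [hk]
  have hpZ : Γ.curve j t₀ ∉ Z := by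
    intro h
    obtain ⟨k, u, ⟨hu, hu2⟩, hku⟩ := mem_iUnion.1 h
    obtain ⟨rfl, rfl⟩ := eq_of_mem_good ht hu hku
    have := hu2 rfl
    simp at this
    linarith
  obtain ⟨η, hη, hball⟩ := Metric.isOpen_iff.1 hZc.isOpen_compl _ hpZ
  have hcts : ∀ᶠ q : ℝ × ℝ in 𝓝 (0, t₀), Γ.shift j q.1 q.2 ∈ Metric.ball (Γ.curve j t₀) (η / 2) := by
    have h1 := (Γ.continuous_shift j).tendsto (0, t₀)
    have h2 : Γ.shift j 0 t₀ = Γ.curve j t₀ := by simp [shift]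
    simp only [h2] at h1
    exact h1.eventually (Metric.ball_mem_nhds _ (half_pos hη))
  obtain ⟨r, hr, hrball⟩ := Metric.eventually_nhds_iff_ball.1 hcts
  refine ⟨min c (η / 2), min (r / 2) (min (δ / 2) 1), by positivity, by positivity,
    fun x τ hx hτ => ?_⟩
  have hx1 := hx.trans (min_le_left _ _)
  have hτ1 := hτ.trans (min_le_left _ _)
  have hx2 := hx.trans ((min_le_right _ _).trans (min_le_left _ _))
  have hτ2 := hτ.trans ((min_le_right _ _).trans (min_le_left _ _))
  have hτ3 := hτ.trans ((min_le_right _ _).trans (min_le_right _ _))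
  refine (Metric.le_infDist (nonempty_support j)).2 fun y hy => ?_
  obtain ⟨k, u, hu, rfl⟩ := mem_iUnion.1 hy
  rw [dist_comm, dist_eq_norm]
  by_cases hku : k = j ∧ |u - t₀| < δ
  · obtain ⟨rfl, hu2⟩ := hku
    have h1 := (hker (t₀ + x) u τ (by rw [add_sub_cancel_left]; linarith) hu2 (by linarith)
      (Γ.shift k τ (t₀ + x)) (by simp [shift])).1
    refine le_trans ?_ h1
    refine mul_le_mul (min_le_left _ _) ?_ (abs_nonneg _) hc.le
    have h2 := Complex.abs_im_le_norm ((u : ℂ) - ((t₀ + x : ℝ) : ℂ) - τ * Complex.I)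
    simpa using h2
  · have h1 : Γ.curve k u ∈ Z := mem_iUnion.2 ⟨k, u, ⟨hu, fun hk => not_lt.1 fun h => hku ⟨hk, h⟩⟩, rfl⟩
    have h2 : η ≤ dist (Γ.curve k u) (Γ.curve j t₀) := not_lt.1 fun h => hball h h1
    have h3 := hrball (τ, t₀ + x) (by
      rw [Metric.mem_ball, Prod.dist_eq, max_lt_iff, Real.dist_eq, Real.dist_eq, sub_zero,
        add_sub_cancel_left]
      exact ⟨by linarith, by linarith⟩)
    rw [Metric.mem_ball] at h3
    have h4 := dist_triangle (Γ.curve k u) (Γ.shift j τ (t₀ + x)) (Γ.curve j t₀)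
    rw [← dist_eq_norm]
    have h5 : min c (η / 2) * |τ| ≤ η / 2 * 1 :=
      mul_le_mul (min_le_right _ _) hτ3 (abs_nonneg _) (by positivity)
    simp only at h3
    linarith

/-- A function satisfies the growth condition near the contour. -/
def Growth (Γ : Contour) (g : ℂ → ℂ) : Prop :=
  ∃ K δ : ℝ, 0 < δ ∧ ∀ z ∉ Γ.support, Metric.infDist z Γ.support < δ →
    ‖g z‖ * √(Metric.infDist z Γ.support) ≤ K

/-- Moving t₀ to the origin reduces this to `exists_extension_tube`; as dist(z, Σ) ≥ c|τ|, the
growth condition becomes a bound by |τ|^(-1/2) with constant K/√c. -/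
lemma extendsAt_of_mem_good {g f : ℂ → ℂ} {S : Set ℂ} (hS : IsClosed S)
    (hd : Disjoint S Γ.support) (hg : DifferentiableOn ℂ g (Γ.support ∪ S)ᶜ) (hgr : Γ.Growth g)
    (hp : Γ.BV 1 g f) (hm : Γ.BV (-1) g f) {j : Fin Γ.n} {t₀ : ℝ} (ht : t₀ ∈ Γ.good j) :
    ExtendsAt (Γ.support ∪ S) g (Γ.curve j t₀) := by
  have htI := good_subset_Ioo j ht
  obtain ⟨c, r₁, hc, hr₁, hlow⟩ := exists_tube_lower ht
  obtain ⟨K, δ, hδ, hK⟩ := hgr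
  set s : ℝ → ℂ := fun x => Γ.curve j (t₀ + x) with hs_def
  have hs : ContDiff ℝ ∞ s := (Γ.smooth j).comp (contDiff_const.add contDiff_id)
  have hds : ∀ x, deriv s x = deriv (Γ.curve j) (t₀ + x) := fun x => by
    rw [hs_def, deriv_comp_const_add]
  have hs0 : s 0 = Γ.curve j t₀ := by simp [hs_def]
  have htube : ∀ x τ : ℝ, tube s (x, τ) = Γ.shift j τ (t₀ + x) := fun x τ => by
    simp only [tube, shift, hds]
    rfl
  obtain ⟨r₀, hr₀, hext⟩ := exists_extension_tube hs (by rw [hds, add_zero]; exact Γ.regular j t₀ ht.1)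
  have hnear : ∀ᶠ q : ℝ × ℝ in 𝓝 (0, t₀), Metric.infDist (Γ.shift j q.1 q.2) Γ.support < δ ∧
      Γ.shift j q.1 q.2 ∉ S := by
    have h1 := (Γ.continuous_shift j).tendsto (0, t₀)
    have h2 : Γ.shift j 0 t₀ = Γ.curve j t₀ := by simp [shift]
    simp only [h2] at h1
    have hmem := curve_mem_support j ht.1
    have h3 := (Metric.continuous_infDist_pt Γ.support).continuousAt.tendsto.comp h1
    refine (h3.eventually (gt_mem_nhds ?_)).and (h1.eventually (hS.isOpen_compl.mem_nhds ?_))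
    · rw [Metric.infDist_zero_of_mem hmem]; exact hδ
    · exact disjoint_right.1 hd hmem
  obtain ⟨r₂, hr₂, hball⟩ := Metric.eventually_nhds_iff_ball.1 hnear
  set r := min (min (r₀ / 2) r₁) (min (r₂ / 2) (min t₀ (1 - t₀))) with hr
  have h1t : 0 < 1 - t₀ := by linarith [htI.2]
  have h0t : 0 < t₀ := htI.1
  have hrp : 0 < r := by positivity
  have e0 : r ≤ r₀ / 2 := (min_le_left _ _).trans (min_le_left _ _)
  have e1 : r ≤ r₁ := (min_le_left _ _).trans (min_le_right _ _)
  have e2 : r ≤ r₂ / 2 := (min_le_right _ _).trans (min_le_left _ _)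
  have e3 : r ≤ t₀ := (min_le_right _ _).trans ((min_le_right _ _).trans (min_le_left _ _))
  have e4 : r ≤ 1 - t₀ := (min_le_right _ _).trans ((min_le_right _ _).trans (min_le_right _ _))
  clear_value r
  obtain ⟨ρ, hρ, hmain⟩ := hext r ⟨hrp, by linarith⟩
  have hloc : ∀ x ∈ Icc (-r) r, ∀ τ ∈ Icc (-r) r, c * |τ| ≤ Metric.infDist (tube s (x, τ)) Γ.support ∧
      Metric.infDist (tube s (x, τ)) Γ.support < δ ∧ tube s (x, τ) ∉ S := by
    intro x hx τ hτ
    have hx' := abs_le.2 hx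
    have hτ' := abs_le.2 hτ
    rw [htube]
    refine ⟨hlow x τ (by linarith) (by linarith), hball (τ, t₀ + x) ?_⟩
    rw [Metric.mem_ball, Prod.dist_eq, max_lt_iff, Real.dist_eq, Real.dist_eq, sub_zero,
        add_sub_cancel_left]
    exact ⟨by linarith, by linarith⟩
  have hnotin : ∀ x ∈ Icc (-r) r, ∀ τ ∈ Icc (-r) r, τ ≠ 0 → tube s (x, τ) ∉ Γ.support := by
    intro x hx τ hτ hτ0 h
    have h1 := (hloc x hx τ hτ).1
    rw [Metric.infDist_zero_of_mem h] at h1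
    have := mul_pos hc (abs_pos.2 hτ0)
    linarith
  have hI : Icc (t₀ - r) (t₀ + r) ⊆ Icc 0 1 := Icc_subset_Icc (by linarith) (by linarith)
  have hpre : (fun x => t₀ + x) ⁻¹' Icc (t₀ - r) (t₀ + r) = Icc (-r) r := by
    ext x
    simp only [mem_preimage, mem_Icc]
    constructor <;> rintro ⟨h1, h2⟩ <;> constructor <;> linarith
  have hmp := (measurePreserving_add_left (volume : Measure ℝ) t₀)
  have hemb := (Homeomorph.addLeft t₀).measurableEmbedding
  have hmp2 : MeasurePreserving (fun x => t₀ + x) (volume.restrict (Icc (-r) r))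
      (volume.restrict (Icc (t₀ - r) (t₀ + r))) := by
    have := hmp.restrict_preimage_emb hemb (Icc (t₀ - r) (t₀ + r))
    rwa [hpre] at this
  have hside : ∀ side : ℝ, |side| = 1 → Γ.BV side g f := by
    intro side h1
    rcases abs_choice side with h2 | h2
    · rw [h1] at h2; rw [← h2]; exact hp
    · have : side = -1 := by linarith
      rw [this]; exact hm
  refine Exists.elim (hmain (Γ.support ∪ S)ᶜ g (fun x => f (s x)) (K / √c)
    (isCompact_support.isClosed.union hS).isOpen_compl hg ?_ ?_ ?_ ?_ ?_) fun φ h => ?_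
  rotate_right
  · obtain ⟨hφ, hφg⟩ := h
    refine ⟨φ, _, Metric.isOpen_ball, ?_, hφ, fun z hz hz2 => hφg z hz hz2⟩
    rw [hs0]; exact Metric.mem_ball_self hρ
  · intro x hx τ hτ hτ0 h
    exact h.elim (hnotin x hx τ hτ hτ0) (hloc x hx τ hτ).2.2
  · intro x hx h
    exact h (Or.inl (curve_mem_support j (hI ⟨by linarith [hx.1], by linarith [hx.2]⟩)))
  · intro x hx τ hτ hτ0
    have h1 := hK _ (hnotin x hx τ hτ hτ0) (hloc x hx τ hτ).2.1
    have h2 := Real.sqrt_le_sqrt (hloc x hx τ hτ).1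
    rw [Real.sqrt_mul hc.le] at h2
    rw [le_div_iff₀ (Real.sqrt_pos.2 hc)]
    calc _ = ‖g (tube s (x, τ))‖ * (√c * √|τ|) := by ring
      _ ≤ _ := mul_le_mul_of_nonneg_left h2 (norm_nonneg _)
      _ ≤ K := h1
  · have h1 : MemLp (fun t => f (Γ.curve j t)) 2 (volume.restrict (Icc (t₀ - r) (t₀ + r))) :=
      (memLp_curve hp.memLp j).mono_measure (Measure.restrict_mono hI le_rfl)
    exact h1.comp_measurePreserving hmp2
  · intro side hs1
    have h1 := (tendsto_eLpNorm_two_iff _).1 ((hside side hs1).lim j).lim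
    refine tendsto_of_tendsto_of_tendsto_of_le_of_le tendsto_const_nhds h1
      (fun _ => zero_le) fun η => ?_
    have h2 := hmp2.lintegral_comp_emb hemb
      (fun t => ‖g (Γ.shift j (side * η) t) - f (Γ.curve j t)‖ₑ ^ 2)
    simp only [htube]
    simp only [hs_def]
    rw [h2]
    exact lintegral_mono_set hI

end Contour

/-! ### Exceptional points and Liouville's theorem -/

lemma exists_direction {T : Set ℂ} (hT : T.Finite) (h0 : ∀ d ∈ T, d ≠ 0) :
    ∃ e : ℂ, e ≠ 0 ∧ ∀ d ∈ T, LinearIndependent ℝ ![e, d] := by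
  obtain ⟨y, hy⟩ := (hT.image fun d : ℂ => d.im / d.re).exists_notMem
  refine ⟨⟨1, y⟩, fun h => by simpa using congrArg Complex.re h, fun d hd => ?_⟩
  have hne : d.im - d.re * y ≠ 0 := by
    intro h
    rcases eq_or_ne d.re 0 with h1 | h1
    · rw [h1, zero_mul, sub_zero] at h
      exact h0 d hd (Complex.ext h1 h)
    · exact hy ⟨d, hd, by simp only; rw [div_eq_iff h1]; linarith⟩
  rw [LinearIndependent.pair_iff]
  intro α β h
  have h1 := congrArg Complex.re h
  have h2 := congrArg Complex.im h
  simp at h1 h2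
  have h3 : β * (d.im - d.re * y) = 0 := by linear_combination h2 - y * h1
  have hβ : β = 0 := (mul_eq_zero.1 h3).resolve_right hne
  subst hβ
  exact ⟨by simpa using h1, rfl⟩

namespace Contour
variable {Γ : Contour}

/-- Only finitely many branches pass through p. A ray whose direction is not parallel to any of
their tangents leaves each of them linearly by `exists_cross_lower`, and the other parts of Σ are at
a positive distance. -/
lemma exists_nontangential {p : ℂ} (hp : p ∈ Γ.support) : ∃ e : ℂ, e ≠ 0 ∧ ∃ c : ℝ, 0 < c ∧
    ∀ᶠ t : ℝ in 𝓝[>] 0, c * t ≤ Metric.infDist (p + t * e) Γ.support := by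
  obtain ⟨e, he, hind⟩ := exists_direction
    (T := ⋃ k, (deriv (Γ.curve k)) '' {u | u ∈ Icc (0 : ℝ) 1 ∧ Γ.curve k u = p})
    (finite_iUnion fun k => (finite_fiber k p).image _) (by
      intro d hd
      obtain ⟨k, u, ⟨hu, -⟩, rfl⟩ := mem_iUnion.1 hd
      exact Γ.regular k u hu)
  have hpt : ∀ k, ∀ᶠ c : ℝ in 𝓝[>] 0, ∀ᶠ t : ℝ in 𝓝[>] 0, ∀ u ∈ Icc (0 : ℝ) 1,
      c * t ≤ ‖Γ.curve k u - (p + t * e)‖ := by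
    intro k
    -- Compact induction on the parameter makes c and the range of t uniform along the curve.
    refine (isCompact_Icc (a := (0 : ℝ)) (b := 1)).induction_on (p := fun A => ∀ᶠ c : ℝ in 𝓝[>] 0,
      ∀ᶠ t : ℝ in 𝓝[>] 0, ∀ u ∈ A, c * t ≤ ‖Γ.curve k u - (p + t * e)‖) (by simp) ?_ ?_ ?_
    · intro A B hAB h
      filter_upwards [h] with c hc
      filter_upwards [hc] with t ht u hu using ht u (hAB hu)
    · intro A B hA hB
      filter_upwards [hA, hB] with c h1 h2
      filter_upwards [h1, h2] with t h3 h4 u hu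
      exact hu.elim (h3 u) (h4 u)
    · intro u₀ hu₀
      by_cases hu : Γ.curve k u₀ = p
      · have hs : ContDiff ℝ ∞ (fun t : ℝ => p + t * e) :=
          contDiff_const.add (Complex.ofRealCLM.contDiff.mul contDiff_const)
        have hds : deriv (fun t : ℝ => p + t * e) 0 = e := by
          have : HasDerivAt (fun t : ℝ => p + t * e) (1 * e) 0 :=
            ((Complex.ofRealCLM.hasDerivAt (x := (0 : ℝ))).mul_const e).const_add p
          simpa using this.deriv
        obtain ⟨c, δ, hc, hδ, hlow⟩ := exists_cross_lower hs (Γ.smooth k) (t₀ := 0) (u₀ := u₀) (by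
          rw [hds]
          exact hind _ (mem_iUnion.2 ⟨k, u₀, ⟨hu₀, hu⟩, rfl⟩))
        refine ⟨Metric.ball u₀ δ, nhdsWithin_le_nhds (Metric.ball_mem_nhds _ hδ), ?_⟩
        filter_upwards [nhdsWithin_le_nhds (gt_mem_nhds hc), self_mem_nhdsWithin] with c' hc' hc0
        filter_upwards [nhdsWithin_le_nhds (gt_mem_nhds hδ), self_mem_nhdsWithin] with t ht ht0 u hu1
        rw [mem_Ioi] at ht0
        have h1 := hlow 0 t 0 u u₀ (by simpa) (by rwa [sub_zero, abs_of_pos ht0]) (by simpa) hu1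
          (by simpa)
        simp only [hu] at h1
        calc c' * t ≤ c * (|t - 0| + |u - u₀|) := by
              rw [sub_zero, abs_of_pos ht0]
              exact mul_le_mul hc'.le (by linarith [abs_nonneg (u - u₀)]) ht0.le hc.le
          _ ≤ _ := h1
          _ = _ := by congr 1; simp
      · set η := ‖Γ.curve k u₀ - p‖ with hη
        have hηp : 0 < η := norm_pos_iff.2 (sub_ne_zero.2 hu)
        refine ⟨{u | η / 2 < ‖Γ.curve k u - p‖}, nhdsWithin_le_nhds
          ((isOpen_lt continuous_const
            (((Γ.smooth k).continuous.sub continuous_const).norm)).mem_nhds (by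
              change η / 2 < η; linarith)), ?_⟩
        filter_upwards [nhdsWithin_le_nhds (gt_mem_nhds one_pos), self_mem_nhdsWithin] with c hc hc0
        have hpos : 0 < η / 2 / (1 + ‖e‖) := by positivity
        filter_upwards [nhdsWithin_le_nhds (gt_mem_nhds hpos), self_mem_nhdsWithin] with t ht ht0 u hu1
        rw [mem_Ioi] at ht0 hc0
        rw [lt_div_iff₀ (by positivity)] at ht
        have h1 : ‖Γ.curve k u - p‖ - ‖(t : ℂ) * e‖ ≤ ‖Γ.curve k u - (p + t * e)‖ := by
          rw [← sub_sub]; exact norm_sub_norm_le _ _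
        rw [norm_mul, Complex.norm_real, Real.norm_eq_abs, abs_of_pos ht0] at h1
        have h2 : c * t ≤ 1 * t := by gcongr
        have h3 : η / 2 < ‖Γ.curve k u - p‖ := hu1
        nlinarith
  obtain ⟨c, hc, hc0⟩ := ((eventually_all.2 hpt).and self_mem_nhdsWithin).exists
  refine ⟨e, he, c, hc0, ?_⟩
  filter_upwards [eventually_all.2 hc] with t ht
  refine (Metric.le_infDist ⟨p, hp⟩).2 fun y hy => ?_
  obtain ⟨k, u, hu, rfl⟩ := mem_iUnion.1 hy
  rw [dist_comm, dist_eq_norm]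
  exact ht k u hu

lemma dense_compl_union {S : Set ℂ} (hS : S.Finite) : Dense (Γ.support ∪ S)ᶜ := by
  have h : volume (Γ.support ∪ S) = 0 := by
    rw [measure_union_null_iff]
    exact ⟨volume_support, hS.measure_zero _⟩
  exact Measure.dense_of_ae (measure_eq_zero_iff_ae_notMem.1 h)

/-- The growth bound is integrable over a disc, so the area mean value inequality gives G(z) = O(|z
− p|⁻²). The singularity is thus at most a pole, and the bound O(t^(-1/2)) along a ray transversal
to Σ rules the pole out. -/
lemma extendsAt_of_punctured {g : ℂ → ℂ} {S : Set ℂ} (hS : S.Finite)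
    (hgr : Γ.Growth g) {p : ℂ} (hp : p ∈ Γ.support) (hpS : p ∉ S)
    (hext : ∀ᶠ q in 𝓝[≠] p, ExtendsAt (Γ.support ∪ S) g q) : ExtendsAt (Γ.support ∪ S) g p := by
  obtain ⟨K, δ, hδ, hK⟩ := hgr
  have hev : ∀ᶠ q in 𝓝 p, (q ≠ p → ExtendsAt (Γ.support ∪ S) g q) ∧ q ∉ S :=
    (eventually_nhdsWithin_iff.1 hext).and (hS.isClosed.isOpen_compl.mem_nhds hpS)
  obtain ⟨ρ₀, hρ₀, hball₀⟩ := Metric.eventually_nhds_iff_ball.1 hev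
  set ρ := min ρ₀ (min δ 1) with hρ
  have hρp : 0 < ρ := by positivity
  have hρ1 : ρ ≤ 1 := (min_le_right _ _).trans (min_le_right _ _)
  have hρδ : ρ ≤ δ := (min_le_right _ _).trans (min_le_left _ _)
  have hball : ∀ q ∈ Metric.ball p ρ, (q ≠ p → ExtendsAt (Γ.support ∪ S) g q) ∧ q ∉ S :=
    fun q hq => hball₀ q (Metric.ball_subset_ball (min_le_left _ _) hq)
  clear_value ρ
  obtain ⟨G, hG, hGg⟩ := exists_patch (V := Metric.ball p ρ \ {p}) (dense_compl_union hS)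
    (fun q hq => (hball q hq.1).1 hq.2)
  have hbd : ∀ z ∈ Metric.ball p ρ, z ∉ Γ.support →
      ‖G z‖ * √(Metric.infDist z Γ.support) ≤ K := by
    intro z hz hzs
    rw [hGg z ⟨hz, fun h => hzs (by rw [mem_singleton_iff.1 h]; exact hp)⟩
      (fun h => h.elim hzs (hball z hz).2)]
    refine hK z hzs (lt_of_le_of_lt (Metric.infDist_le_dist_of_mem hp) (lt_of_lt_of_le hz hρδ))
  set M := ∫⁻ z in Metric.ball p 1, ENNReal.ofReal K *
    ENNReal.ofReal ((√(Metric.infDist z Γ.support))⁻¹) with hM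
  have hMtop : M ≠ ⊤ := by
    rw [hM, lintegral_const_mul' _ _ ENNReal.ofReal_ne_top]
    exact ENNReal.mul_ne_top ENNReal.ofReal_ne_top (lintegral_inv_sqrt_infDist_lt_top hp).ne
  have hle : ∀ᵐ z, z ∈ Metric.ball p ρ → ‖G z‖ₑ ≤
      ENNReal.ofReal K * ENNReal.ofReal ((√(Metric.infDist z Γ.support))⁻¹) := by
    filter_upwards [measure_eq_zero_iff_ae_notMem.1 (volume_support (Γ := Γ))] with z hz hzb
    rw [← ENNReal.ofReal_mul' (by positivity), ← ofReal_norm]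
    refine ENNReal.ofReal_le_ofReal ?_
    rw [← div_eq_mul_inv, le_div_iff₀ (Real.sqrt_pos.2 (infDist_pos ⟨p, hp⟩ hz))]
    exact hbd z hzb hz
  -- The disc of radius |z − p|/2 about z may cross Σ, but it avoids p, and the patched function is
  -- holomorphic on it.
  have harea : ∀ z ∈ Metric.ball p (ρ / 2), z ≠ p →
      Real.pi * (dist z p / 2) ^ 2 * ‖G z‖ ≤ M.toReal := by
    intro z hz hzp
    have hd : 0 < dist z p := dist_pos.2 hzp
    rw [Metric.mem_ball] at hz
    have hsub : Metric.ball z (dist z p / 2) ⊆ Metric.ball p ρ \ {p} := by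
      intro w hw
      rw [Metric.mem_ball] at hw
      refine ⟨?_, ?_⟩
      · rw [Metric.mem_ball]
        linarith [dist_triangle w z p]
      · rintro rfl
        rw [dist_comm] at hw
        linarith
    have h1 := enorm_mul_area_le (half_pos hd)
      (fun w hw => (hG w (hsub hw)).differentiableWithinAt)
    have h2 : ∫⁻ w in Metric.ball z (dist z p / 2), ‖G w‖ₑ ≤ M := by
      calc _ ≤ ∫⁻ w in Metric.ball z (dist z p / 2), ENNReal.ofReal K *
            ENNReal.ofReal ((√(Metric.infDist w Γ.support))⁻¹) := by
            refine setLIntegral_mono_ae' Metric.isOpen_ball.measurableSet ?_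
            filter_upwards [hle] with w hw hwb using hw (hsub hwb).1
        _ ≤ M := lintegral_mono_set fun w hw =>
            Metric.ball_subset_ball hρ1 (hsub hw).1
    have h3 := ENNReal.toReal_mono hMtop (h1.trans h2)
    rwa [ENNReal.toReal_mul, ENNReal.toReal_ofReal (by positivity), toReal_enorm] at h3
  obtain ⟨e, he, c, hc, hdir⟩ := exists_nontangential hp
  set l : Filter ℂ := map (fun t : ℝ => p + t * e) (𝓝[>] 0) with hl
  have htend : Tendsto (fun t : ℝ => p + t * e) (𝓝[>] 0) (𝓝[≠] p) := by
    refine tendsto_nhdsWithin_iff.2 ⟨?_, ?_⟩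
    · have : ContinuousAt (fun t : ℝ => p + t * e) 0 := by fun_prop
      have := this.tendsto.mono_left (nhdsWithin_le_nhds (s := Ioi 0))
      simpa using this
    · filter_upwards [self_mem_nhdsWithin] with t ht
      rw [mem_Ioi] at ht
      simp [he, ht.ne']
  have hb2 : Metric.ball p (ρ / 2) ∈ 𝓝[≠] p :=
    nhdsWithin_le_nhds (Metric.ball_mem_nhds _ (half_pos hρp))
  have hcube : Tendsto (fun z => (z - p) ^ 3 * G z) (𝓝[≠] p) (𝓝 0) := by
    have h1 : Tendsto (fun z : ℂ => ‖z - p‖ * (4 / Real.pi * M.toReal)) (𝓝[≠] p) (𝓝 0) := by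
      have : ContinuousAt (fun z : ℂ => ‖z - p‖ * (4 / Real.pi * M.toReal)) p := by fun_prop
      simpa using this.tendsto.mono_left (nhdsWithin_le_nhds (s := {p}ᶜ))
    refine squeeze_zero_norm' ?_ h1
    filter_upwards [hb2, self_mem_nhdsWithin] with z hz hzp
    have h2 := harea z hz hzp
    rw [dist_eq_norm] at h2
    rw [norm_mul, norm_pow]
    have h3 : ‖z - p‖ ^ 2 * ‖G z‖ ≤ 4 / Real.pi * M.toReal := by
      rw [div_mul_eq_mul_div, le_div_iff₀ Real.pi_pos]
      nlinarith
    calc _ = ‖z - p‖ * (‖z - p‖ ^ 2 * ‖G z‖) := by ring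
      _ ≤ _ := mul_le_mul_of_nonneg_left h3 (norm_nonneg (z - p))
  -- Along the ray |z − p| is of order t and G of order t^(-1/2), so the product is O(√t).
  have hsub : Tendsto (fun z => (z - p) * G z) l (𝓝 0) := by
    rw [hl, tendsto_map'_iff]
    have h1 : Tendsto (fun t : ℝ => √t * (‖e‖ * K / √c)) (𝓝[>] 0) (𝓝 0) := by
      have : ContinuousAt (fun t : ℝ => √t * (‖e‖ * K / √c)) 0 := by fun_prop
      simpa using this.tendsto.mono_left (nhdsWithin_le_nhds (s := Ioi 0))
    refine squeeze_zero_norm' ?_ h1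
    filter_upwards [hdir, self_mem_nhdsWithin, htend hb2] with t h2 ht h3
    rw [mem_Ioi] at ht
    have h4 : 0 < Metric.infDist (p + t * e) Γ.support := lt_of_lt_of_le (by positivity) h2
    have h5 : p + t * e ∉ Γ.support := fun h => h4.ne' (Metric.infDist_zero_of_mem h)
    have h6 := hbd _ (Metric.ball_subset_ball (by linarith) h3) h5
    have h7 : ‖G (p + t * e)‖ * (√c * √t) ≤ K := by
      rw [← Real.sqrt_mul hc.le]
      exact (mul_le_mul_of_nonneg_left (Real.sqrt_le_sqrt h2) (norm_nonneg _)).trans h6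
    simp only [Function.comp, add_sub_cancel_left]
    rw [norm_mul, norm_mul, Complex.norm_real, Real.norm_eq_abs, abs_of_pos ht, ← mul_div_assoc,
      le_div_iff₀ (Real.sqrt_pos.2 hc)]
    calc t * ‖e‖ * ‖G (p + t * e)‖ * √c
        = √t * ‖e‖ * (‖G (p + t * e)‖ * (√c * √t)) := by
          linear_combination (-(‖e‖ * ‖G (p + t * e)‖ * √c)) * Real.mul_self_sqrt ht.le
      _ ≤ √t * ‖e‖ * K := mul_le_mul_of_nonneg_left h7 (by positivity)
      _ = _ := by ring
  obtain ⟨φ, hφ, hφG⟩ := exists_extension_of_pole (l := l) (n := 3) Metric.isOpen_ball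
    (Metric.mem_ball_self hρp) (fun z hz => (hG z hz).differentiableWithinAt) hcube htend hsub
  refine ⟨φ, _, Metric.isOpen_ball, Metric.mem_ball_self hρp, hφ, fun z hz hzZ => ?_⟩
  have hzp : z ≠ p := by
    rintro rfl
    exact hzZ (Or.inl hp)
  rw [hφG z hz hzp, hGg z ⟨hz, hzp⟩ hzZ]

lemma exceptional_subset : Γ.exceptional ⊆ Γ.support := by
  rintro z (h | ⟨j, k, t, ht, u, hu, hne, h1, h2⟩)
  · obtain ⟨j, rfl | rfl⟩ := mem_iUnion.1 h
    · exact curve_mem_support j (by simp)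
    · exact curve_mem_support j (by simp)
  · rw [← h1]
    exact curve_mem_support j (dom_subset j ht)

/-- A function without jump across the contour, with the growth condition and removable
singularities on `S`, agrees with an entire function. -/
theorem exists_entire {g f : ℂ → ℂ} {S : Set ℂ} (hS : S.Finite)
    (hd : Disjoint S Γ.support) (hg : DifferentiableOn ℂ g (Γ.support ∪ S)ᶜ) (hgr : Γ.Growth g)
    (hp : Γ.BV 1 g f) (hm : Γ.BV (-1) g f)
    (hpole : ∀ a ∈ S, Tendsto (fun z => (z - a) * g z) (𝓝[≠] a) (𝓝 0)) :
    ∃ G : ℂ → ℂ, Differentiable ℂ G ∧ ∀ z ∉ Γ.support ∪ S, G z = g z := by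
  have hZ : IsClosed (Γ.support ∪ S) := isCompact_support.isClosed.union hS.isClosed
  have hreg : ∀ p ∉ Γ.exceptional, ExtendsAt (Γ.support ∪ S) g p := by
    intro p hpe
    by_cases hpZ : p ∈ Γ.support ∪ S
    · by_cases hps : p ∈ Γ.support
      · obtain ⟨j, t, ht, rfl⟩ := mem_iUnion.1 hps
        exact extendsAt_of_mem_good hS.isClosed hd hg hgr hp hm ⟨ht, hpe⟩
      · have hpS := hpZ.resolve_left hps
        have hO : IsOpen (Γ.support ∪ S \ {p})ᶜ :=
          (isCompact_support.isClosed.union (hS.subset sdiff_subset).isClosed).isOpen_compl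
        have hpO : p ∈ (Γ.support ∪ S \ {p})ᶜ := fun h => h.elim hps fun h => h.2 rfl
        have hsub : (Γ.support ∪ S \ {p})ᶜ \ {p} ⊆ (Γ.support ∪ S)ᶜ := by
          rintro z ⟨hz, hzp⟩ h
          exact hz (h.imp id fun h => ⟨h, hzp⟩)
        obtain ⟨φ, hφ, hφg⟩ := exists_extension_of_tendsto hO hpO (hg.mono hsub) (hpole p hpS)
        refine ⟨φ, _, hO, hpO, hφ, fun z hz hzZ => hφg z hz ?_⟩
        rintro rfl
        exact hzZ hpZ
    · exact ⟨g, _, hZ.isOpen_compl, hpZ, hg, fun _ _ _ => rfl⟩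
  have hall : ∀ p ∈ univ, ExtendsAt (Γ.support ∪ S) g p := by
    intro p _
    by_cases hpe : p ∈ Γ.exceptional
    · by_cases hps : p ∈ Γ.support
      · refine extendsAt_of_punctured hS hgr hps (disjoint_right.1 hd hps) ?_
        have h1 : (Γ.exceptional \ {p})ᶜ ∈ 𝓝 p :=
          (finite_exceptional.subset sdiff_subset).isClosed.isOpen_compl.mem_nhds fun h => h.2 rfl
        filter_upwards [nhdsWithin_le_nhds h1, self_mem_nhdsWithin] with q hq hqp
        exact hreg q fun h => hq ⟨h, hqp⟩
      · exact absurd hpe fun h => hps (exceptional_subset h)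
    · exact hreg p hpe
  obtain ⟨G, hG, hGg⟩ := exists_patch (dense_compl_union hS) hall
  exact ⟨G, fun z => hG z (mem_univ z), fun z hz => hGg z (mem_univ z) hz⟩

/-- The entire extension has a finite limit at infinity, so Liouville's theorem applies. -/
theorem eq_const_of_no_jump {g f : ℂ → ℂ} {S : Set ℂ} (hS : S.Finite)
    (hd : Disjoint S Γ.support) (hg : DifferentiableOn ℂ g (Γ.support ∪ S)ᶜ) (hgr : Γ.Growth g)
    (hp : Γ.BV 1 g f) (hm : Γ.BV (-1) g f)
    (hpole : ∀ a ∈ S, Tendsto (fun z => (z - a) * g z) (𝓝[≠] a) (𝓝 0)) {c : ℂ}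
    (hinf : Tendsto g (cocompact ℂ) (𝓝 c)) : ∀ z ∉ Γ.support ∪ S, g z = c := by
  obtain ⟨G, hG, hGg⟩ := exists_entire hS hd hg hgr hp hm hpole
  intro z hz
  rw [← hGg z hz]
  refine hG.apply_eq_of_tendsto_cocompact z (hinf.congr' ?_)
  filter_upwards [(isCompact_support.union hS.isCompact).compl_mem_cocompact] with w hw
  exact (hGg w hw).symm

end Contour

/-! ### The inversion in the parameters of the contour -/

namespace Contour
variable {Γ : Contour}

/-- The contour avoids the origin and is invariant under inversion, which exchanges its sides. -/
structure InvSymm (Γ : Contour) : Prop where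
  zero_notMem : (0 : ℂ) ∉ Γ.support
  inversion : ∀ j, ∀ t ∈ Set.Icc (0 : ℝ) 1, ∃ k, ∃ u ∈ Set.Icc (0 : ℝ) 1,
    Γ.curve k u = (Γ.curve j t)⁻¹ ∧
    ∃ r : ℝ, 0 < r ∧
      -deriv (Γ.curve j) t / Γ.curve j t ^ 2 = -((r : ℂ) * deriv (Γ.curve k) u)

lemma InvSymm.curve_ne_zero (h : Γ.InvSymm) {j : Fin Γ.n} {t : ℝ} (ht : t ∈ Icc (0 : ℝ) 1) :
    Γ.curve j t ≠ 0 := fun h0 => h.zero_notMem (h0 ▸ curve_mem_support j ht)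

lemma InvSymm.inv_mem (h : Γ.InvSymm) {z : ℂ} (hz : z ∈ Γ.support) : z⁻¹ ∈ Γ.support := by
  obtain ⟨j, t, ht, rfl⟩ := mem_iUnion.1 hz
  obtain ⟨k, u, hu, hk, -⟩ := h.inversion j t ht
  rw [← hk]
  exact curve_mem_support k hu

lemma InvSymm.inv_mem_iff (h : Γ.InvSymm) {z : ℂ} : z⁻¹ ∈ Γ.support ↔ z ∈ Γ.support :=
  ⟨fun hz => by simpa using h.inv_mem hz, h.inv_mem⟩

variable (Γ) in
/-- Parameters in `good j` whose point is mapped by the inversion to a non-exceptional point of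
the `k`-th curve. -/
def mate (j k : Fin Γ.n) : Set ℝ :=
  {t | t ∈ Γ.good j ∧ (Γ.curve j t)⁻¹ ∉ Γ.exceptional ∧
    (Γ.curve j t)⁻¹ ∈ Γ.curve k '' Icc (0 : ℝ) 1}

open Classical in
variable (Γ) in
/-- The inversion in the parameters of the curves. -/
def mateFun (j k : Fin Γ.n) (t : ℝ) : ℝ :=
  if h : (Γ.curve j t)⁻¹ ∈ Γ.curve k '' Icc (0 : ℝ) 1 then h.choose else 0

lemma measurableSet_mate (j k : Fin Γ.n) : MeasurableSet (Γ.mate j k) := by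
  have hm : Measurable fun t => (Γ.curve j t)⁻¹ := (Γ.smooth j).continuous.measurable.inv
  exact (measurableSet_good j).inter ((hm finite_exceptional.measurableSet.compl).inter
    (hm (isCompact_Icc.image (Γ.smooth k).continuous).isClosed.measurableSet))

lemma mate_subset_Icc {j k : Fin Γ.n} : Γ.mate j k ⊆ Icc 0 1 := fun _ h => h.1.1

lemma mateFun_mem_Icc {j k : Fin Γ.n} {t : ℝ} (ht : t ∈ Γ.mate j k) :
    Γ.mateFun j k t ∈ Icc (0 : ℝ) 1 := by
  rw [mateFun, dif_pos ht.2.2]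
  exact ht.2.2.choose_spec.1

lemma curve_mateFun {j k : Fin Γ.n} {t : ℝ} (ht : t ∈ Γ.mate j k) :
    Γ.curve k (Γ.mateFun j k t) = (Γ.curve j t)⁻¹ := by
  rw [mateFun, dif_pos ht.2.2]
  exact ht.2.2.choose_spec.2

lemma mateFun_mem {j k : Fin Γ.n} {t : ℝ} (ht : t ∈ Γ.mate j k) : Γ.mateFun j k t ∈ Γ.mate k j := by
  refine ⟨⟨mateFun_mem_Icc ht, ?_⟩, ?_, ?_⟩ <;> rw [curve_mateFun ht]
  · exact ht.2.1
  · rw [inv_inv]; exact ht.1.2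
  · rw [inv_inv]; exact ⟨t, ht.1.1, rfl⟩

lemma eq_mateFun {j k l : Fin Γ.n} {t u : ℝ} (ht : t ∈ Γ.mate j k) (hu : u ∈ Icc (0 : ℝ) 1)
    (h : Γ.curve l u = (Γ.curve j t)⁻¹) : l = k ∧ u = Γ.mateFun j k t :=
  eq_of_mem_good (mateFun_mem ht).1 hu (by rw [h, curve_mateFun ht])

lemma mateFun_mateFun {j k : Fin Γ.n} {t : ℝ} (ht : t ∈ Γ.mate j k) :
    Γ.mateFun k j (Γ.mateFun j k t) = t :=
  ((eq_mateFun (mateFun_mem ht) ht.1.1 (by rw [curve_mateFun ht, inv_inv])).2).symm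

lemma injOn_mateFun (j k : Fin Γ.n) : InjOn (Γ.mateFun j k) (Γ.mate j k) := fun t ht t' ht' h => by
  rw [← mateFun_mateFun ht, h, mateFun_mateFun ht']

lemma image_mateFun (j k : Fin Γ.n) : Γ.mateFun j k '' Γ.mate j k = Γ.mate k j := by
  refine Subset.antisymm ?_ fun u hu => ⟨_, mateFun_mem hu, mateFun_mateFun hu⟩
  rintro _ ⟨t, ht, rfl⟩
  exact mateFun_mem ht

lemma pairwise_disjoint_mate (j : Fin Γ.n) : Pairwise (Function.onFun Disjoint fun k => Γ.mate j k) := by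
  intro k l hkl
  rw [Function.onFun, disjoint_left]
  intro t hk hl
  exact hkl (eq_mateFun hl (mateFun_mem_Icc hk) (curve_mateFun hk)).1

lemma ae_mem_iUnion_mate (hΓ : Γ.InvSymm) (j : Fin Γ.n) :
    ∀ᵐ t ∂unitMeasure, t ∈ ⋃ k, Γ.mate j k := by
  filter_upwards [ae_mem_good j, ae_notMem_finite j (finite_exceptional (Γ := Γ)).inv] with t ht h2
  obtain ⟨k, u, hu, hk, -⟩ := hΓ.inversion j t ht.1
  exact mem_iUnion.2 ⟨k, ht, fun h => h2 h, u, hu, hk⟩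

/-- The inverted point stays away from the compact image of the parameters at distance at least δ
from the mate, because that image misses the limit point. -/
lemma tendsto_mateFun (hΓ : Γ.InvSymm) {j k : Fin Γ.n} {t : ℝ} (ht : t ∈ Γ.mate j k) :
    Tendsto (Γ.mateFun j k) (𝓝[Γ.mate j k] t) (𝓝 (Γ.mateFun j k t)) := by
  rw [Metric.tendsto_nhds]
  intro δ hδ
  set u₀ := Γ.mateFun j k t
  set Z : Set ℂ := Γ.curve k '' (Icc (0 : ℝ) 1 ∩ {u | δ ≤ dist u u₀}) with hZ
  have hZc : IsClosed Z := ((isCompact_Icc.inter_right (isClosed_le continuous_const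
    (continuous_id.dist continuous_const))).image (Γ.smooth k).continuous).isClosed
  have hnot : (Γ.curve j t)⁻¹ ∉ Z := by
    rintro ⟨u, ⟨hu, hu2⟩, h⟩
    have := (eq_mateFun ht hu h).2
    rw [this] at hu2
    simp only [mem_ofPred_eq, u₀, dist_self] at hu2
    linarith
  have hcont : ContinuousAt (fun t => (Γ.curve j t)⁻¹) t :=
    (Γ.smooth j).continuous.continuousAt.inv₀ (hΓ.curve_ne_zero ht.1.1)
  filter_upwards [nhdsWithin_le_nhds (hcont.eventually (hZc.isOpen_compl.mem_nhds hnot)),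
    self_mem_nhdsWithin] with t' h1 h2
  by_contra hcon
  exact h1 ⟨_, ⟨mateFun_mem_Icc h2, not_lt.1 hcon⟩, curve_mateFun h2⟩

/-- Near the mate, the real part of the curve divided by its tangent d is a coordinate with
derivative 1. The map is the local inverse of this coordinate applied to the inverted curve, whose
tangent is −r·d by the orientation hypothesis. -/
lemma exists_hasDerivWithinAt_mateFun (hΓ : Γ.InvSymm) {j k : Fin Γ.n} {t : ℝ}
    (ht : t ∈ Γ.mate j k) : ∃ r : ℝ, 0 < r ∧
      HasDerivWithinAt (Γ.mateFun j k) (-r) (Γ.mate j k) t ∧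
      deriv (Γ.curve j) t / Γ.curve j t ^ 2 = r * deriv (Γ.curve k) (Γ.mateFun j k t) := by
  obtain ⟨l, u, hu, hlu, r, hr, hder⟩ := hΓ.inversion j t ht.1.1
  obtain ⟨rfl, rfl⟩ := eq_mateFun ht hu hlu
  refine ⟨r, hr, ?_, by rw [neg_div] at hder; exact neg_injective hder⟩
  set u₀ := Γ.mateFun j l t with hu₀
  set d := deriv (Γ.curve l) u₀ with hd
  have hd0 : d ≠ 0 := Γ.regular l u₀ hu
  have hstrict : HasStrictDerivAt (Γ.curve l) d u₀ :=
    (Γ.smooth l).contDiffAt.hasStrictDerivAt (by simp)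
  have ha : HasStrictDerivAt (fun u => (Γ.curve l u / d).re) 1 u₀ := by
    have h1 := hstrict.div_const d
    rw [div_self hd0] at h1
    have h2 := Complex.reCLM.hasStrictFDerivAt.comp_hasStrictDerivAt u₀ h1
    rw [Complex.reCLM_apply, Complex.one_re] at h2
    exact h2
  have hb : HasDerivAt (fun t' => ((Γ.curve j t')⁻¹ / d).re) (-r) t := by
    have h1 : HasDerivAt (fun t' => (Γ.curve j t')⁻¹) (-((r : ℂ) * d)) t := by
      rw [← hder]
      exact (((Γ.smooth j).differentiable (by simp)) t).hasDerivAt.fun_inv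
        (hΓ.curve_ne_zero ht.1.1)
    have h2 := h1.div_const d
    rw [neg_div, mul_div_cancel_right₀ _ hd0] at h2
    have h3 := Complex.reCLM.hasFDerivAt.comp_hasDerivAt t h2
    rw [Complex.reCLM_apply, Complex.neg_re, Complex.ofReal_re] at h3
    exact h3
  have hloc := ha.to_localInverse one_ne_zero
  have hval : (Γ.curve l u₀ / d).re = ((Γ.curve j t)⁻¹ / d).re := by rw [hlu]
  have hcomp : HasDerivAt (fun t' => ha.localInverse _ _ _ one_ne_zero ((Γ.curve j t')⁻¹ / d).re)
      (-r) t := by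
    have h1 := hloc.hasDerivAt
    simp only [hval, inv_one] at h1
    have h2 := h1.comp t hb
    rw [one_mul] at h2
    exact h2
  refine hcomp.hasDerivWithinAt.congr_of_eventuallyEq ?_ ?_
  · filter_upwards [(tendsto_mateFun hΓ ht).eventually
      (ha.eventually_left_inverse one_ne_zero), self_mem_nhdsWithin] with t' h1 h2
    rw [← h1, curve_mateFun h2]
  · have h1 := (ha.eventually_left_inverse one_ne_zero).self_of_nhds
    simp only [hlu] at h1
    exact h1.symm

/-- The exceptional parameters form the image of a null set under the inverse map, which is
differentiable on its domain and so preserves null sets. -/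
lemma ae_mateFun (hΓ : Γ.InvSymm) (j k : Fin Γ.n) {p : ℝ → Prop} (h : ∀ᵐ u ∂unitMeasure, p u) :
    ∀ᵐ t ∂unitMeasure, t ∈ Γ.mate j k → p (Γ.mateFun j k t) := by
  rw [unitMeasure, ae_restrict_iff' measurableSet_Icc] at h ⊢
  set N : Set ℝ := Γ.mate k j ∩ {u | ¬ (u ∈ Icc (0 : ℝ) 1 → p u)} with hN
  have hN0 : volume N = 0 := measure_mono_null inter_subset_right (ae_iff.1 h)
  have himg : volume (Γ.mateFun k j '' N) = 0 := by
    refine addHaar_image_eq_zero_of_differentiableOn_of_addHaar_eq_zero volume ?_ hN0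
    intro u hu
    obtain ⟨r, -, hd, -⟩ := exists_hasDerivWithinAt_mateFun hΓ hu.1
    exact (hd.mono inter_subset_left).differentiableWithinAt
  filter_upwards [measure_eq_zero_iff_ae_notMem.1 himg] with t ht _ htm
  by_contra hp
  exact ht ⟨Γ.mateFun j k t, ⟨mateFun_mem htm, fun hcon => hp (hcon (mateFun_mem_Icc htm))⟩,
    mateFun_mateFun htm⟩

/-- Null sets of the contour are invariant under inversion. -/
lemma ae_inv (hΓ : Γ.InvSymm) {p : ℂ → Prop} (h : ∀ᵐ z ∂Γ.arcLength, p z) :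
    ∀ᵐ z ∂Γ.arcLength, p z⁻¹ := by
  rw [ae_arcLength_iff] at h ⊢
  intro j
  filter_upwards [ae_mem_iUnion_mate hΓ j, ae_all_iff.2 fun k => ae_mateFun hΓ j k (h k)]
    with t h1 h2
  obtain ⟨k, hk⟩ := mem_iUnion.1 h1
  rw [← curve_mateFun hk]
  exact h2 k hk

/-- Change of variables under inversion in contour integrals. -/
lemma sum_integral_inv (hΓ : Γ.InvSymm) {g : ℂ → ℂ}
    (hg : ∀ k, Integrable (fun u => deriv (Γ.curve k) u * g (Γ.curve k u)) unitMeasure) :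
    ∑ k, ∫ u in (0 : ℝ)..1, deriv (Γ.curve k) u * g (Γ.curve k u) =
      ∑ j, ∫ t in (0 : ℝ)..1, deriv (Γ.curve j) t / Γ.curve j t ^ 2 * g (Γ.curve j t)⁻¹ := by
  have hsplit : ∀ (j : Fin Γ.n) (φ : ℝ → ℂ), (∀ k, IntegrableOn φ (Γ.mate j k)) →
      ∫ t in (0 : ℝ)..1, φ t = ∑ k, ∫ t in Γ.mate j k, φ t := by
    intro j φ hφ
    rw [intervalIntegral.integral_of_le zero_le_one, ← integral_Icc_eq_integral_Ioc,
      ← integral_iUnion_fintype (measurableSet_mate j) (pairwise_disjoint_mate j) hφ]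
    refine setIntegral_congr_set ?_
    have h1 := ae_mem_iUnion_mate hΓ j
    rw [unitMeasure, ae_restrict_iff' measurableSet_Icc] at h1
    filter_upwards [h1] with t ht
    exact propext ⟨fun h => ht h, fun h => by
      obtain ⟨k, hk⟩ := mem_iUnion.1 h
      exact mate_subset_Icc hk⟩
  have hr : ∀ j k t, ∃ r : ℝ, t ∈ Γ.mate j k → 0 < r ∧
      HasDerivWithinAt (Γ.mateFun j k) (-r) (Γ.mate j k) t ∧
      deriv (Γ.curve j) t / Γ.curve j t ^ 2 = r * deriv (Γ.curve k) (Γ.mateFun j k t) := by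
    intro j k t
    by_cases ht : t ∈ Γ.mate j k
    · obtain ⟨r, h⟩ := exists_hasDerivWithinAt_mateFun hΓ ht
      exact ⟨r, fun _ => h⟩
    · exact ⟨0, fun h => absurd h ht⟩
  choose r hr using hr
  have hgk : ∀ k j, IntegrableOn (fun u => deriv (Γ.curve k) u * g (Γ.curve k u)) (Γ.mate k j) :=
    fun k j => IntegrableOn.mono_set (hg k) mate_subset_Icc
  -- The inversion reverses orientation, so |−r| = r absorbs the sign of the differential −dz/z²,
  -- and the factor becomes +s'/s².
  have hpt : ∀ j k, ∀ t ∈ Γ.mate j k, |-r j k t| • (deriv (Γ.curve k) (Γ.mateFun j k t) *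
      g (Γ.curve k (Γ.mateFun j k t))) =
      deriv (Γ.curve j) t / Γ.curve j t ^ 2 * g (Γ.curve j t)⁻¹ := by
    intro j k t ht
    obtain ⟨h1, -, h3⟩ := hr j k t ht
    rw [h3, curve_mateFun ht, abs_neg, abs_of_pos h1, Complex.real_smul, mul_assoc]
  have hgj : ∀ j k, IntegrableOn (fun t => deriv (Γ.curve j) t / Γ.curve j t ^ 2 *
      g (Γ.curve j t)⁻¹) (Γ.mate j k) := by
    intro j k
    have h1 := (integrableOn_image_iff_integrableOn_abs_deriv_smul (measurableSet_mate j k)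
      (fun t ht => (hr j k t ht).2.1) (injOn_mateFun j k)
      (fun u => deriv (Γ.curve k) u * g (Γ.curve k u))).1 (by
        rw [image_mateFun]; exact hgk k j)
    exact h1.congr_fun (hpt j k) (measurableSet_mate j k)
  rw [Finset.sum_congr rfl fun k _ => hsplit k _ (hgk k),
    Finset.sum_congr rfl fun j _ => hsplit j _ (hgj j), Finset.sum_comm]
  refine Finset.sum_congr rfl fun j _ => Finset.sum_congr rfl fun k _ => ?_
  rw [← image_mateFun j k, integral_image_eq_integral_abs_deriv_smul (measurableSet_mate j k)
      (fun t ht => (hr j k t ht).2.1) (injOn_mateFun j k)]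
  exact setIntegral_congr_fun (measurableSet_mate j k) (hpt j k)

end Contour

/-! ### Boundary values under inversion: approach inside cones -/

/-- Simultaneous almost everywhere convergence along a sequence. -/
lemma exists_seq_ae_tendsto {ι α : Type*} [Finite ι] [MeasurableSpace α] {μ : ι → Measure α}
    {h : ι → ℝ → α → ℝ≥0∞} (hm : ∀ i, ∀ᶠ ε in 𝓝[>] 0, AEMeasurable (h i ε) (μ i))
    (hlim : ∀ i, Tendsto (fun ε => ∫⁻ x, h i ε x ∂μ i) (𝓝[>] 0) (𝓝 0)) :
    ∃ e : ℕ → ℝ, Tendsto e atTop (𝓝[>] 0) ∧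
      ∀ i, ∀ᵐ x ∂μ i, Tendsto (fun n => h i (e n) x) atTop (𝓝 0) := by
  have hev : ∀ n : ℕ, ∃ ε : ℝ, 0 < ε ∧ ε < 1 / ((n : ℝ) + 1) ∧ ∀ i, AEMeasurable (h i ε) (μ i) ∧
      ∫⁻ x, h i ε x ∂μ i ≤ 2⁻¹ ^ n := by
    intro n
    have hpos : (0 : ℝ≥0∞) < 2⁻¹ ^ n := by
      refine pos_iff_ne_zero.2 (pow_ne_zero _ (by simp))
    have h1 : ∀ᶠ ε : ℝ in 𝓝[>] 0, ε < 1 / ((n : ℝ) + 1) :=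
      nhdsWithin_le_nhds (gt_mem_nhds (by positivity))
    obtain ⟨ε, h0, h2, h3⟩ := ((eventually_mem_nhdsWithin (a := (0 : ℝ)) (s := Ioi 0)).and
      (h1.and (eventually_all.2 fun i => (hm i).and ((hlim i).eventually (ge_mem_nhds hpos))))).exists
    exact ⟨ε, h0, h2, h3⟩
  choose e he0 he1 he using hev
  refine ⟨e, tendsto_nhdsWithin_iff.2 ⟨squeeze_zero (fun n => (he0 n).le) (fun n => (he1 n).le)
    tendsto_one_div_add_atTop_nhds_zero_nat, Eventually.of_forall he0⟩, fun i => ?_⟩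
  have hsum : ∫⁻ x, ∑' n, h i (e n) x ∂μ i ≠ ⊤ := by
    rw [lintegral_tsum fun n => (he n i).1]
    refine ne_top_of_le_ne_top ?_ (ENNReal.tsum_le_tsum fun n => (he n i).2)
    rw [ENNReal.tsum_geometric]
    simp
  filter_upwards [ae_lt_top' (AEMeasurable.tsum fun n => (he n i).1) hsum] with x hx
  exact ENNReal.tendsto_atTop_zero_of_tsum_ne_top hx.ne

/-- The quotient is real and nonpositive only if w lies on the segment from a to b; with w ≠ b the
point is a convex combination parametrised by κ. -/
lemma exists_of_div_notMem_slitPlane {a b w : ℂ} (hb : w ≠ b)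
    (h : (w - a) / (w - b) ∉ Complex.slitPlane) :
    ∃ κ : ℝ, 0 ≤ κ ∧ w = (a + κ * b) / (1 + κ) := by
  rw [Complex.mem_slitPlane_iff, not_or, not_lt, not_not] at h
  have hq : (w - a) / (w - b) = -((-((w - a) / (w - b)).re : ℝ) : ℂ) := by
    apply Complex.ext <;> simp [h.2]
  set κ : ℝ := -((w - a) / (w - b)).re
  have hκ : 0 ≤ κ := by simp only [κ]; linarith [h.1]
  refine ⟨κ, hκ, ?_⟩
  have h1 : (1 + κ : ℂ) ≠ 0 := by
    have : (1 + κ : ℝ) ≠ 0 := by positivity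
    exact_mod_cast this
  rw [div_eq_iff (sub_ne_zero.2 hb)] at hq
  rw [eq_div_iff h1]
  linear_combination hq

/-- If the curve avoids the segment from z' to z, the principal logarithm of (s − z)/(s − z') is an
antiderivative, and its values at both ends tend to log 1 = 0. So the mass of the kernel difference
vanishes in the limit, and the density may be replaced by its deviation from a constant. -/
lemma tendsto_integral_sub_inv {s : ℝ → ℂ} (hs : ContDiff ℝ ∞ s) {a b : ℝ} (hab : a ≤ b) {p : ℂ}
    (ha : s a ≠ p) (hb : s b ≠ p) {l : Filter ℝ} {z z' : ℝ → ℂ} (hz : Tendsto z l (𝓝 p))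
    (hz' : Tendsto z' l (𝓝 p))
    (hne : ∀ᶠ ε in l, ∀ v ∈ Icc a b, s v ≠ z' ε ∧
      ∀ κ : ℝ, 0 ≤ κ → s v ≠ (z ε + κ * z' ε) / (1 + κ)) :
    Tendsto (fun ε => ∫ v in a..b, deriv s v * (1 / (s v - z ε) - 1 / (s v - z' ε))) l (𝓝 0) := by
  have hend : ∀ w, w ≠ p → Tendsto (fun ε => Complex.log ((w - z ε) / (w - z' ε))) l (𝓝 0) := by
    intro w hw
    have hwp := sub_ne_zero.2 hw
    have h1 : Tendsto (fun ε => (w - z ε) / (w - z' ε)) l (𝓝 1) := by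
      rw [← div_self hwp]
      exact (tendsto_const_nhds.sub hz).div (tendsto_const_nhds.sub hz') hwp
    simpa using h1.clog (by simp)
  have hlim := (hend _ hb).sub (hend _ ha)
  rw [sub_zero] at hlim
  refine hlim.congr' ?_
  filter_upwards [hne] with ε hε
  have hcont := hs.continuous_deriv (by simp)
  have h1 : ∀ v ∈ Icc a b, s v - z ε ≠ 0 := fun v hv => by
    have := (hε v hv).2 0 le_rfl
    rw [sub_ne_zero]
    simpa using this
  have h2 : ∀ v ∈ Icc a b, s v - z' ε ≠ 0 := fun v hv => sub_ne_zero.2 (hε v hv).1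
  symm
  rw [← uIcc_of_le hab] at h1 h2
  refine intervalIntegral.integral_eq_sub_of_hasDerivAt
    (f := fun v => Complex.log ((s v - z ε) / (s v - z' ε))) (fun v hv => ?_) ?_
  · have hd : HasDerivAt s (deriv s v) v := ((hs.differentiable (by simp)) v).hasDerivAt
    have hq := (hd.sub_const (z ε)).fun_div (hd.sub_const (z' ε)) (h2 v hv)
    have hsl : (s v - z ε) / (s v - z' ε) ∈ Complex.slitPlane := by
      by_contra hcon
      rw [uIcc_of_le hab] at hv
      obtain ⟨κ, hκ, h⟩ := exists_of_div_notMem_slitPlane (hε v hv).1 hcon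
      exact (hε v hv).2 κ hκ h
    have := hq.clog_real hsl
    refine this.congr_deriv ?_
    have e1 := h1 v hv
    have e2 := h2 v hv
    field_simp
  · refine ContinuousOn.intervalIntegrable (μ := volume) ?_
    exact hcont.continuousOn.mul ((continuousOn_const.div
      (hs.continuous.continuousOn.sub continuousOn_const) h1).sub
      (continuousOn_const.div (hs.continuous.continuousOn.sub continuousOn_const) h2))

lemma norm_sub_mul_I_sq (x ρ : ℝ) : ‖(x : ℂ) - ρ * Complex.I‖ ^ 2 = x ^ 2 + ρ ^ 2 := by
  rw [← Complex.normSq_eq_norm_sq, Complex.normSq_apply]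
  simp
  ring

lemma norm_inv_sub_inv_le {w a b : ℂ} {P Q R : ℝ} (hP : 0 < P) (hQ : 0 < Q)
    (ha : P ≤ ‖w - a‖) (hb : Q ≤ ‖w - b‖) (hab : ‖a - b‖ ≤ R) :
    ‖1 / (w - a) - 1 / (w - b)‖ ≤ R / (P * Q) := by
  have h1 : w - a ≠ 0 := norm_pos_iff.1 (hP.trans_le ha)
  have h2 : w - b ≠ 0 := norm_pos_iff.1 (hQ.trans_le hb)
  have e : 1 / (w - a) - 1 / (w - b) = (a - b) / ((w - a) * (w - b)) := by
    field_simp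
    ring
  rw [e, norm_div, norm_mul]
  exact div_le_div₀ ((norm_nonneg _).trans hab) hab (by positivity)
    (mul_le_mul ha hb hQ.le (hP.le.trans ha))

namespace Contour
variable {Γ : Contour}

set_option maxHeartbeats 800000 in
/-- Near a non-exceptional point, the resolvent kernels at two points approaching it inside a
cone from the same side differ by a multiple of the Poisson kernel. -/
lemma exists_kernel_sub_bound {k : Fin Γ.n} {t₀ : ℝ} (ht : t₀ ∈ Γ.good k) {side : ℝ}
    (hside : |side| = 1) {r A : ℝ} (hr : 0 < r) (hA : 0 ≤ A) {z : ℝ → ℂ}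
    (hz : ∀ᶠ ε in 𝓝[>] 0, ‖z ε - Γ.shift k (side * (ε * r)) t₀‖ ≤ A * ε ^ 2) :
    ∃ η C : ℝ, 0 < η ∧ Icc (t₀ - η) (t₀ + η) ⊆ Icc 0 1 ∧ 0 ≤ C ∧
      Tendsto z (𝓝[>] 0) (𝓝 (Γ.curve k t₀)) ∧
      Tendsto (fun ε => Γ.shift k (side * ε) t₀) (𝓝[>] 0) (𝓝 (Γ.curve k t₀)) ∧
      ∀ᶠ ε in 𝓝[>] 0, z ε ∉ Γ.support ∧ Γ.shift k (side * ε) t₀ ∉ Γ.support ∧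
        (∀ v ∈ Icc (t₀ - η) (t₀ + η),
          ‖1 / (Γ.curve k v - z ε) - 1 / (Γ.curve k v - Γ.shift k (side * ε) t₀)‖ ≤
            C * (ε * ((v - t₀) ^ 2 + ε ^ 2)⁻¹)) ∧
        (∀ l, ∀ v ∈ Icc (0 : ℝ) 1, (l = k → v ∉ Ioo (t₀ - η) (t₀ + η)) →
          ‖1 / (Γ.curve l v - z ε) - 1 / (Γ.curve l v - Γ.shift k (side * ε) t₀)‖ ≤ C * ε) ∧
        (∀ v ∈ Icc (t₀ - η) (t₀ + η), Γ.curve k v ≠ Γ.shift k (side * ε) t₀ ∧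
          ∀ κ : ℝ, 0 ≤ κ → Γ.curve k v ≠ (z ε + κ * Γ.shift k (side * ε) t₀) / (1 + κ)) := by
  have htI := good_subset_Ioo k ht
  -- All points of the segment between z and the normal point have height at least εm up to O(ε²).
  -- The tolerance A/m² in `exists_kernel_local` therefore covers the error Aε².
  set m := min r 1 with hm
  have hmp : 0 < m := by positivity
  have hm1 : m ≤ 1 := min_le_right _ _
  have hmr : m ≤ r := min_le_left _ _
  obtain ⟨c, δ, M, hc, hδ, hker⟩ := exists_kernel_local (Γ.smooth k) (Γ.regular k t₀ ht.1)
    (A / m ^ 2) (by positivity)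
  set η := min (δ / 2) (min t₀ (1 - t₀)) with hη
  have h1t : 0 < 1 - t₀ := by linarith [htI.2]
  have h0t : 0 < t₀ := htI.1
  have hηp : 0 < η := by positivity
  have hηδ : η ≤ δ / 2 := min_le_left _ _
  have hη0 : η ≤ t₀ := (min_le_right _ _).trans (min_le_left _ _)
  have hη1 : η ≤ 1 - t₀ := (min_le_right _ _).trans (min_le_right _ _)
  clear_value η m
  set Z : Set ℂ := ⋃ l, Γ.curve l '' (Icc (0 : ℝ) 1 ∩ {u | l = k → u ∉ Ioo (t₀ - η) (t₀ + η)})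
    with hZ
  have hZc : IsClosed Z := by
    refine (isCompact_iUnion fun l => (isCompact_Icc.inter_right ?_).image
      (Γ.smooth l).continuous).isClosed
    by_cases hk : l = k
    · simp only [hk, true_implies]
      exact isOpen_Ioo.isClosed_compl
    · simp [hk]
  set p := Γ.curve k t₀ with hp
  have hpZ : p ∉ Z := by
    intro h
    obtain ⟨l, u, ⟨hu, hu2⟩, hlu⟩ := mem_iUnion.1 h
    obtain ⟨rfl, rfl⟩ := eq_of_mem_good ht hu hlu
    exact hu2 rfl ⟨by linarith, by linarith⟩
  obtain ⟨d, hd, hball⟩ := Metric.isOpen_iff.1 hZc.isOpen_compl _ hpZ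
  have hfar : ∀ y, dist y p < d / 2 → ∀ w ∈ Z, d / 2 ≤ ‖w - y‖ := by
    intro y hy w hw
    have h2 : d ≤ dist w p := not_lt.1 fun h => hball h hw
    rw [← dist_eq_norm]
    linarith [dist_triangle w y p]
  have hshift : ∀ a : ℝ, Tendsto (fun ε => Γ.shift k (side * (ε * a)) t₀) (𝓝[>] 0) (𝓝 p) := by
    intro a
    have h1 : Continuous fun ε : ℝ => Γ.shift k (side * (ε * a)) t₀ :=
      Γ.continuous_shift k |>.comp (by fun_prop : Continuous fun ε : ℝ => (side * (ε * a), t₀))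
    have h2 := (h1.tendsto 0).mono_left (nhdsWithin_le_nhds (s := Ioi 0))
    simpa [shift, hp] using h2
  have hz' : Tendsto (fun ε => Γ.shift k (side * ε) t₀) (𝓝[>] 0) (𝓝 p) := by
    simpa using hshift 1
  have hzlim : Tendsto z (𝓝[>] 0) (𝓝 p) := by
    have h1 : Tendsto (fun ε => z ε - Γ.shift k (side * (ε * r)) t₀) (𝓝[>] 0) (𝓝 0) := by
      refine squeeze_zero_norm' hz ?_
      have : ContinuousAt (fun ε : ℝ => A * ε ^ 2) 0 := by fun_prop
      simpa using this.tendsto.mono_left (nhdsWithin_le_nhds (s := Ioi 0))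
    simpa using h1.add (hshift r)
  set B := A + |r - 1| * ‖deriv (Γ.curve k) t₀‖ with hB
  have hB0 : 0 ≤ B := by positivity
  refine ⟨η, max (B / (c ^ 2 * m)) (B / (d / 2 * (d / 2))), hηp,
    Icc_subset_Icc (by linarith) (by linarith), le_max_of_le_left (by positivity), hzlim, hz', ?_⟩
  have hsmall : ∀ᶠ ε : ℝ in 𝓝[>] 0, ε < min 1 (δ / (r + 1)) :=
    nhdsWithin_le_nhds (gt_mem_nhds (by positivity))
  filter_upwards [hz, hsmall, self_mem_nhdsWithin,
    hz'.eventually (Metric.ball_mem_nhds p (half_pos hd)),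
    hzlim.eventually (Metric.ball_mem_nhds p (half_pos hd))] with ε hzε hε1 hε hz'd hzd
  rw [mem_Ioi] at hε
  have hεδ : ε * (r + 1) < δ := (lt_div_iff₀ (by positivity)).1 (hε1.trans_le (min_le_right _ _))
  have hε1 : ε < 1 := hε1.trans_le (min_le_left _ _)
  set y := Γ.shift k (side * ε) t₀ with hy
  -- A point (z + κy)/(1 + κ) of the segment lies within Aε² of the normal point at height ε(r +
  -- κ)/(1 + κ), so the lower bound for a normal point applies to the whole segment; κ = 0 gives z
  -- itself.
  have hseg : ∀ κ : ℝ, 0 ≤ κ → ∀ v, |v - t₀| < δ →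
      c * ‖((v - t₀ : ℝ) : ℂ) - (side * (ε * ((r + κ) / (1 + κ))) : ℝ) * Complex.I‖ ≤
        ‖Γ.curve k v - (z ε + κ * y) / (1 + κ)‖ := by
    intro κ hκ v hv
    have hκ1 : (1 + κ : ℂ) ≠ 0 := by
      have : (1 + κ : ℝ) ≠ 0 := by positivity
      exact_mod_cast this
    have hlam1 : m ≤ (r + κ) / (1 + κ) := by
      rw [le_div_iff₀ (by positivity)]
      nlinarith
    have hlam2 : (r + κ) / (1 + κ) ≤ r + 1 := by
      rw [div_le_iff₀ (by positivity)]
      nlinarith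
    set lam := (r + κ) / (1 + κ) with hlam
    have hlp : 0 < lam := hmp.trans_le hlam1
    have habs : |side * (ε * lam)| = ε * lam := by
      rw [abs_mul, hside, one_mul, abs_of_pos (by positivity)]
    have hlt : |side * (ε * lam)| < δ := by
      rw [habs]
      exact (mul_le_mul_of_nonneg_left hlam2 hε.le).trans_lt hεδ
    have := (hker t₀ v (side * (ε * lam)) (by simpa) hv hlt ((z ε + κ * y) / (1 + κ)) ?_).1
    · simpa using this
    · have e : (z ε + κ * y) / (1 + κ) - (Γ.curve k t₀ +
          (side * (ε * lam) : ℝ) * Complex.I * deriv (Γ.curve k) t₀) =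
          (z ε - Γ.shift k (side * (ε * r)) t₀) / (1 + κ) := by
        simp only [hy, shift, hlam]
        push_cast
        field_simp
        ring
      have hn : ‖(1 + κ : ℂ)‖ = 1 + κ := by
        have : (1 + κ : ℂ) = ((1 + κ : ℝ) : ℂ) := by push_cast; rfl
        rw [this, Complex.norm_real, Real.norm_eq_abs, abs_of_pos (by positivity)]
      rw [e, norm_div, hn]
      have h2 : (side * (ε * lam)) ^ 2 = ε ^ 2 * lam ^ 2 := by
        rw [← sq_abs, habs]; ring
      rw [h2]
      calc _ ≤ ‖z ε - Γ.shift k (side * (ε * r)) t₀‖ :=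
            div_le_self (norm_nonneg _) (by linarith)
        _ ≤ A * ε ^ 2 := hzε
        _ = A / m ^ 2 * (ε ^ 2 * m ^ 2) := by field_simp
        _ ≤ A / m ^ 2 * (ε ^ 2 * lam ^ 2) := by gcongr
  have hpos : ∀ x lam : ℝ, 0 < lam →
      0 < ‖(x : ℂ) - (side * (ε * lam) : ℝ) * Complex.I‖ := by
    intro x lam hl
    refine norm_pos_iff.2 fun h => ?_
    have h1 := congrArg Complex.im h
    have hs0 : side ≠ 0 := by
      rintro rfl
      simp at hside
    simp [hs0, hε.ne', hl.ne'] at h1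
  have hnear0 : ∀ v, |v - t₀| < δ → c * ‖((v - t₀ : ℝ) : ℂ) - (side * (ε * r) : ℝ) * Complex.I‖ ≤
      ‖Γ.curve k v - z ε‖ := by
    intro v hv
    simpa using hseg 0 le_rfl v hv
  have hnear1 : ∀ v, |v - t₀| < δ → c * ‖((v - t₀ : ℝ) : ℂ) - (side * (ε * 1) : ℝ) * Complex.I‖ ≤
      ‖Γ.curve k v - y‖ := by
    intro v hv
    have hεδ' : |side * ε| < δ := by
      rw [abs_mul, hside, one_mul, abs_of_pos hε]
      nlinarith
    have := (hker t₀ v (side * ε) (by simpa) hv hεδ' y (by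
      simp only [hy, shift, sub_self, norm_zero]
      positivity)).1
    simpa using this
  have hIcc : ∀ v ∈ Icc (t₀ - η) (t₀ + η), |v - t₀| < δ := fun v hv =>
    (abs_le.2 ⟨by linarith [hv.1], by linarith [hv.2]⟩ : |v - t₀| ≤ η).trans_lt (by linarith)
  have hnot : ∀ w, dist w p < d / 2 → (∀ v, |v - t₀| < δ → Γ.curve k v ≠ w) → w ∉ Γ.support := by
    intro w hw h1 hws
    obtain ⟨l, u, hu, hlu⟩ := mem_iUnion.1 hws
    by_cases h2 : l = k ∧ u ∈ Ioo (t₀ - η) (t₀ + η)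
    · obtain ⟨rfl, h2⟩ := h2
      exact h1 u (hIcc u (Ioo_subset_Icc_self h2)) hlu
    · have h3 := hfar w hw w (mem_iUnion.2 ⟨l, u, ⟨hu, fun hl hcon => h2 ⟨hl, hcon⟩⟩, hlu⟩)
      simp at h3
      linarith
  have hne0 : ∀ v, |v - t₀| < δ → Γ.curve k v ≠ z ε := fun v hv h => by
    have h1 := hnear0 v hv
    rw [h, sub_self, norm_zero] at h1
    exact absurd h1 (not_le.2 (mul_pos hc (hpos _ _ hr)))
  have hne1 : ∀ v, |v - t₀| < δ → Γ.curve k v ≠ y := fun v hv h => by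
    have h1 := hnear1 v hv
    rw [h, sub_self, norm_zero] at h1
    exact absurd h1 (not_le.2 (mul_pos hc (hpos _ _ one_pos)))
  have hzy : ‖z ε - y‖ ≤ B * ε := by
    have e : z ε - y = (z ε - Γ.shift k (side * (ε * r)) t₀) +
        ((side * ε * (r - 1) : ℝ) : ℂ) * Complex.I * deriv (Γ.curve k) t₀ := by
      simp only [hy, shift]
      push_cast
      ring
    rw [e]
    refine (norm_add_le _ _).trans ?_
    rw [norm_mul, norm_mul, Complex.norm_I, mul_one, Complex.norm_real, Real.norm_eq_abs, abs_mul,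
      abs_mul, hside, one_mul, abs_of_pos hε, hB]
    have : A * ε ^ 2 ≤ A * ε := by
      refine mul_le_mul_of_nonneg_left ?_ hA
      nlinarith
    nlinarith
  refine ⟨hnot _ hzd hne0, hnot _ hz'd hne1, fun v hv => ?_, fun l v hv hlv => ?_, fun v hv =>
    ⟨hne1 v (hIcc v hv), fun κ hκ h => ?_⟩⟩
  · have hv' := hIcc v hv
    have h1 := norm_inv_sub_inv_le (mul_pos hc (hpos _ _ hr)) (mul_pos hc (hpos _ _ one_pos))
      (hnear0 v hv') (hnear1 v hv') hzy
    refine h1.trans ?_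
    set X := ‖((v - t₀ : ℝ) : ℂ) - (side * (ε * r) : ℝ) * Complex.I‖ with hX
    set Y := ‖((v - t₀ : ℝ) : ℂ) - (side * (ε * 1) : ℝ) * Complex.I‖ with hY
    have hXp : 0 < X := hpos _ _ hr
    have hYp : 0 < Y := hpos _ _ one_pos
    have hsq : side ^ 2 = 1 := by rw [← sq_abs, hside, one_pow]
    have hX2 : X ^ 2 = (v - t₀) ^ 2 + ε ^ 2 * r ^ 2 := by
      rw [hX, norm_sub_mul_I_sq]
      linear_combination (ε * r) ^ 2 * hsq
    have hY2 : Y ^ 2 = (v - t₀) ^ 2 + ε ^ 2 := by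
      rw [hY, norm_sub_mul_I_sq]
      linear_combination ε ^ 2 * hsq
    have hXY : m * Y ≤ X := by
      refine le_of_sq_le_sq ?_ hXp.le
      rw [mul_pow, hX2, hY2]
      have h3 : m ^ 2 ≤ 1 := pow_le_one₀ hmp.le hm1
      have h4 : m ^ 2 ≤ r ^ 2 := pow_le_pow_left₀ hmp.le hmr 2
      have h5 := mul_le_mul_of_nonneg_right h3 (sq_nonneg (v - t₀))
      have h6 := mul_le_mul_of_nonneg_right h4 (sq_nonneg ε)
      linarith
    have h2 : c ^ 2 * m * Y ^ 2 ≤ c * X * (c * Y) := by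
      calc c ^ 2 * m * Y ^ 2 = c ^ 2 * Y * (m * Y) := by ring
        _ ≤ c ^ 2 * Y * X := mul_le_mul_of_nonneg_left hXY (by positivity)
        _ = c * X * (c * Y) := by ring
    rw [← hY2]
    calc B * ε / (c * X * (c * Y)) ≤ B * ε / (c ^ 2 * m * Y ^ 2) := by gcongr
      _ = B / (c ^ 2 * m) * (ε * (Y ^ 2)⁻¹) := by
        field_simp
      _ ≤ _ := mul_le_mul_of_nonneg_right (le_max_left _ _) (by positivity)
  · have hw : Γ.curve l v ∈ Z := mem_iUnion.2 ⟨l, v, ⟨hv, hlv⟩, rfl⟩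
    have h1 := norm_inv_sub_inv_le (half_pos hd) (half_pos hd) (hfar _ hzd _ hw)
      (hfar _ hz'd _ hw) hzy
    refine h1.trans ?_
    rw [mul_div_right_comm]
    exact mul_le_mul_of_nonneg_right (le_max_right _ _) hε.le
  · have h1 := hseg κ hκ v (hIcc v hv)
    rw [← h, sub_self, norm_zero] at h1
    exact absurd h1 (not_le.2 (mul_pos hc (hpos _ _ (by positivity))))

end Contour

namespace Contour
variable {Γ : Contour}

lemma curve_ne {z : ℂ} (hz : z ∉ Γ.support) {l : Fin Γ.n} {u : ℝ} (hu : u ∈ Icc (0 : ℝ) 1) :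
    Γ.curve l u ≠ z := by
  rintro rfl
  exact hz (curve_mem_support l hu)

lemma cauchy_sub_cauchy {f : ℂ → ℂ} (hf : MemLp f 2 Γ.arcLength) {z y : ℂ} (hz : z ∉ Γ.support)
    (hy : y ∉ Γ.support) : Γ.cauchy f z - Γ.cauchy f y = (2 * Real.pi * Complex.I : ℂ)⁻¹ *
      ∑ l, ∫ v in (0 : ℝ)..1, deriv (Γ.curve l) v * (1 / (Γ.curve l v - z) - 1 / (Γ.curve l v - y)) *
        f (Γ.curve l v) := by
  rw [cauchy, cauchy, ← mul_sub, ← Finset.sum_sub_distrib]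
  congr 1
  refine Finset.sum_congr rfl fun l _ => ?_
  rw [← intervalIntegral.integral_sub
    (intervalIntegrable_cauchy (Γ.smooth l) (fun u hu => curve_ne hz hu)
      (memLp_curve hf l))
    (intervalIntegrable_cauchy (Γ.smooth l) (fun u hu => curve_ne hy hu)
      (memLp_curve hf l))]
  refine intervalIntegral.integral_congr fun v _ => ?_
  ring

set_option maxHeartbeats 800000 in
/-- At a Lebesgue point, the Cauchy integral has the same limits inside a cone as along the
normal. -/
lemma tendsto_cauchy_sub {f : ℂ → ℂ} (hf : MemLp f 2 Γ.arcLength) {k : Fin Γ.n} {t₀ : ℝ}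
    (ht : t₀ ∈ Γ.good k) {l : Filter ℝ} (hl : l ≤ 𝓝[>] 0)
    (hosc : Tendsto (fun ε => poissonOsc ((Icc (0 : ℝ) 1).indicator fun t => f (Γ.curve k t)) ε t₀)
      l (𝓝 0)) {side : ℝ} (hside : |side| = 1) {r A : ℝ} (hr : 0 < r) (hA : 0 ≤ A) {z : ℝ → ℂ}
    (hz : ∀ᶠ ε in 𝓝[>] 0, ‖z ε - Γ.shift k (side * (ε * r)) t₀‖ ≤ A * ε ^ 2) :
    Tendsto (fun ε => Γ.cauchy f (z ε) - Γ.cauchy f (Γ.shift k (side * ε) t₀)) l (𝓝 0) := by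
  obtain ⟨η, C, hη, hsub, hC, hzl, hyl, hev⟩ := exists_kernel_sub_bound ht hside hr hA hz
  obtain ⟨D, hD0, hD⟩ : ∃ D : ℝ, 0 ≤ D ∧ ∀ j, ∀ t ∈ Icc (0 : ℝ) 1, ‖deriv (Γ.curve j) t‖ ≤ D := by
    choose c C hc hC h using Γ.exists_speed_bounds
    refine ⟨∑ j, C j, Finset.sum_nonneg fun j _ => (hC j).le, fun j t ht => (h j t ht).2.trans ?_⟩
    exact Finset.single_le_sum (fun j _ => (hC j).le) (Finset.mem_univ j)
  set y : ℝ → ℂ := fun ε => Γ.shift k (side * ε) t₀ with hy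
  set a := t₀ - η with ha
  set b := t₀ + η with hb
  have hab : a ≤ b := by linarith
  have haI : a ∈ Icc (0 : ℝ) 1 := hsub (left_mem_Icc.2 hab)
  have hbI : b ∈ Icc (0 : ℝ) 1 := hsub (right_mem_Icc.2 hab)
  set f₀ := f (Γ.curve k t₀) with hf₀
  set fk : ℝ → ℂ := (Icc (0 : ℝ) 1).indicator fun t => f (Γ.curve k t) with hfk
  have hfk0 : fk t₀ = f₀ := indicator_of_mem ht.1 _
  set K : ℝ → Fin Γ.n → ℝ → ℂ := fun ε l v => deriv (Γ.curve l) v *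
    (1 / (Γ.curve l v - z ε) - 1 / (Γ.curve l v - y ε)) with hK
  -- The value f(t₀) is subtracted only near t₀ on the k-th curve, where the kernel difference is of
  -- Poisson type; elsewhere the kernel difference is already O(ε).
  set g : Fin Γ.n → ℝ → ℂ := fun l v => f (Γ.curve l v) -
    if l = k then (Ioc a b).indicator (fun _ => f₀) v else 0 with hg
  have hIoc : Ioc (0 : ℝ) 1 ∩ Ioc a b = Ioc a b :=
    inter_eq_right.2 (Ioc_subset_Ioc haI.1 hbI.2)
  have hdecomp : ∀ᶠ ε in 𝓝[>] 0, Γ.cauchy f (z ε) - Γ.cauchy f (y ε) =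
      (2 * Real.pi * Complex.I : ℂ)⁻¹ * ((∑ l, ∫ v in (0 : ℝ)..1, K ε l v * g l v) +
        (∫ v in a..b, K ε k v) * f₀) := by
    filter_upwards [hev] with ε hε
    have hKc : ∀ l, ContinuousOn (K ε l) (Icc 0 1) := by
      intro l
      refine ((Γ.smooth l).continuous_deriv (by simp)).continuousOn.mul
        ((continuousOn_const.div ((Γ.smooth l).continuous.continuousOn.sub continuousOn_const) ?_).sub
        (continuousOn_const.div ((Γ.smooth l).continuous.continuousOn.sub continuousOn_const) ?_))
      · exact fun v hv => sub_ne_zero.2 (curve_ne hε.1 hv)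
      · exact fun v hv => sub_ne_zero.2 (curve_ne hε.2.1 hv)
    have hii : ∀ l, IntervalIntegrable (fun v => K ε l v * f (Γ.curve l v)) volume 0 1 := by
      intro l
      have h1 := intervalIntegrable_cauchy (Γ.smooth l)
        (fun u hu => curve_ne hε.1 hu) (memLp_curve hf l)
      have h2 := intervalIntegrable_cauchy (Γ.smooth l)
        (fun u hu => curve_ne hε.2.1 hu) (memLp_curve hf l)
      refine (h1.sub h2).congr fun v _ => ?_
      simp only [hK]
      ring
    have hcorr : ∀ l, IntervalIntegrable (fun v => K ε l v *
        if l = k then (Ioc a b).indicator (fun _ => f₀) v else 0) volume 0 1 := by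
      intro l
      split_ifs with hlk
      · have h1 : IntegrableOn (fun v => K ε l v * f₀) (Ioc 0 1) :=
          (((hKc l).mul continuousOn_const).integrableOn_Icc).mono_set Ioc_subset_Icc_self
        rw [intervalIntegrable_iff_integrableOn_Ioc_of_le zero_le_one]
        refine (h1.indicator (measurableSet_Ioc (a := a) (b := b))).congr (ae_of_all _ fun v => ?_)
        by_cases hv : v ∈ Ioc a b <;> simp [hv]
      · simp
    have hcorr2 : ∑ l, ∫ v in (0 : ℝ)..1, K ε l v *
        (if l = k then (Ioc a b).indicator (fun _ => f₀) v else 0) = (∫ v in a..b, K ε k v) * f₀ := by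
      rw [Finset.sum_eq_single k (fun l _ hl => by simp [hl]) (by simp)]
      simp only [if_true]
      rw [← intervalIntegral.integral_mul_const, intervalIntegral.integral_of_le zero_le_one,
        intervalIntegral.integral_of_le hab]
      have h1 : ∫ v in Ioc a b, K ε k v * f₀ =
          ∫ v in Ioc (0 : ℝ) 1, (Ioc a b).indicator (fun v => K ε k v * f₀) v := by
        rw [setIntegral_indicator measurableSet_Ioc, hIoc]
      rw [h1]
      refine integral_congr_ae (ae_of_all _ fun v => ?_)
      by_cases hv : v ∈ Ioc a b <;> simp [hv]
    rw [cauchy_sub_cauchy hf hε.1 hε.2.1, ← hcorr2, ← Finset.sum_add_distrib]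
    congr 1
    refine Finset.sum_congr rfl fun l _ => ?_
    rw [← intervalIntegral.integral_add ?_ (hcorr l)]
    · refine intervalIntegral.integral_congr fun v _ => ?_
      simp only [hK, hg]
      ring
    · refine ((hii l).sub (hcorr l)).congr fun v _ => ?_
      simp only [hg]
      ring
  have hlog : Tendsto (fun ε => (∫ v in a..b, K ε k v) * f₀) l (𝓝 0) := by
    have hne : ∀ t ∈ Icc (0 : ℝ) 1, t ≠ t₀ → Γ.curve k t ≠ Γ.curve k t₀ :=
      fun t h1 h2 h3 => h2 (eq_of_mem_good ht h1 h3).2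
    have := tendsto_integral_sub_inv (Γ.smooth k) hab (hne a haI (by linarith))
      (hne b hbI (by linarith)) (hzl.mono_left hl) (hyl.mono_left hl)
      ((hev.filter_mono hl).mono fun ε hε => hε.2.2.2.2)
    have h2 := this.mul_const f₀
    rwa [zero_mul] at h2
  have hsum : Tendsto (fun ε => ∑ l, ∫ v in (0 : ℝ)..1, K ε l v * g l v) l (𝓝 0) := by
    suffices ∀ j, Tendsto (fun ε => ∫ v in (0 : ℝ)..1, K ε j v * g j v) l (𝓝 0) by
      simpa using tendsto_finsetSum Finset.univ fun j _ => this j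
    intro j
    set N := ∫⁻ v in Icc (0 : ℝ) 1, ‖f (Γ.curve j v)‖ₑ with hN
    have hNtop : N ≠ ⊤ := ((memLp_curve hf j).integrable (by norm_num)).2.ne
    -- The far part contributes O(ε) times the `L¹` norm, the near part the Poisson mean oscillation
    -- at t₀, which tends to 0 along `l` by assumption.
    have hbd : ∀ᶠ ε in 𝓝[>] 0, ‖∫ v in (0 : ℝ)..1, K ε j v * g j v‖ₑ ≤
        ENNReal.ofReal (D * C) * (ENNReal.ofReal ε * N + poissonOsc fk ε t₀) := by
      filter_upwards [hev, self_mem_nhdsWithin] with ε hε hε0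
      rw [mem_Ioi] at hε0
      rw [intervalIntegral.integral_of_le zero_le_one, ← integral_Icc_eq_integral_Ioc]
      refine (enorm_integral_le_lintegral_enorm _).trans ?_
      have hpt : ∀ v ∈ Icc (0 : ℝ) 1, ‖K ε j v * g j v‖ₑ ≤ ENNReal.ofReal (D * C) *
          (ENNReal.ofReal ε * ‖f (Γ.curve j v)‖ₑ +
            ‖fk v - fk t₀‖ₑ * ENNReal.ofReal (ε * ((v - t₀) ^ 2 + ε ^ 2)⁻¹)) := by
        intro v hv
        have hKb : ∀ R : ℝ, ‖1 / (Γ.curve j v - z ε) - 1 / (Γ.curve j v - y ε)‖ ≤ C * R →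
            ‖K ε j v‖ₑ ≤ ENNReal.ofReal (D * C) * ENNReal.ofReal R := by
          intro R hR
          rw [← ENNReal.ofReal_mul (by positivity), ← ofReal_norm]
          refine ENNReal.ofReal_le_ofReal ?_
          rw [hK, norm_mul, mul_assoc]
          exact mul_le_mul (hD j v hv) hR (norm_nonneg _) hD0
        rw [enorm_mul]
        by_cases hjk : j = k ∧ v ∈ Ioc a b
        · obtain ⟨rfl, hv2⟩ := hjk
          have e : g j v = fk v - fk t₀ := by
            simp only [hg, if_true, indicator_of_mem hv2, hfk0]
            rw [hfk, indicator_of_mem hv]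
          rw [e]
          refine (mul_le_mul' (hKb _ (hε.2.2.1 v (Ioc_subset_Icc_self hv2))) le_rfl).trans ?_
          rw [mul_assoc]
          refine mul_le_mul' le_rfl (le_trans ?_ le_add_self)
          rw [mul_comm]
        · have e : g j v = f (Γ.curve j v) := by
            simp only [hg]
            split_ifs with h1
            · rw [indicator_of_notMem fun h2 => hjk ⟨h1, h2⟩, sub_zero]
            · rw [sub_zero]
          rw [e]
          refine (mul_le_mul' (hKb _ (hε.2.2.2.1 j v hv fun h1 h2 =>
            hjk ⟨h1, Ioo_subset_Ioc_self h2⟩)) le_rfl).trans ?_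
          rw [mul_assoc]
          exact mul_le_mul' le_rfl le_self_add
      calc _ ≤ ∫⁻ v in Icc (0 : ℝ) 1, ENNReal.ofReal (D * C) *
          (ENNReal.ofReal ε * ‖f (Γ.curve j v)‖ₑ +
            ‖fk v - fk t₀‖ₑ * ENNReal.ofReal (ε * ((v - t₀) ^ 2 + ε ^ 2)⁻¹)) :=
            setLIntegral_mono' measurableSet_Icc hpt
        _ ≤ _ := by
          rw [lintegral_const_mul' _ _ ENNReal.ofReal_ne_top, lintegral_add_left',
            lintegral_const_mul' _ _ ENNReal.ofReal_ne_top,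
            ← lintegral_poisson_le_poissonOsc fk hε0 t₀]
          · exact mul_le_mul' le_rfl (add_le_add le_rfl (setLIntegral_le_lintegral _ _))
          · exact (memLp_curve hf j).1.enorm.const_mul _
    rw [tendsto_zero_iff_enorm_tendsto_zero]
    have h0 : Tendsto (fun ε : ℝ => ENNReal.ofReal ε) l (𝓝 0) := by
      have h1 : Tendsto (fun ε : ℝ => ENNReal.ofReal ε) (𝓝 0) (𝓝 (ENNReal.ofReal 0)) :=
        ENNReal.continuous_ofReal.tendsto 0
      rw [ENNReal.ofReal_zero] at h1
      exact h1.mono_left (hl.trans nhdsWithin_le_nhds)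
    have hlim := ENNReal.Tendsto.const_mul (a := ENNReal.ofReal (D * C))
      ((ENNReal.Tendsto.mul_const (b := N) h0 (Or.inr hNtop)).add hosc) (Or.inr ENNReal.ofReal_ne_top)
    rw [zero_mul, add_zero, mul_zero] at hlim
    exact tendsto_of_tendsto_of_tendsto_of_le_of_le' tendsto_const_nhds hlim
      (Eventually.of_forall fun _ => zero_le) (hbd.filter_mono hl)
  have htot := (hsum.add hlog).const_mul (2 * Real.pi * Complex.I : ℂ)⁻¹
  rw [add_zero, mul_zero] at htot
  exact htot.congr' ((hdecomp.filter_mono hl).mono fun ε hε => hε.symm)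

end Contour

lemma tendsto_zero_of_enorm_sq {ι : Type*} {l : Filter ι} {F : ι → ℂ} {c : ℂ}
    (h : Tendsto (fun i => ‖F i - c‖ₑ ^ 2) l (𝓝 0)) : Tendsto F l (𝓝 c) := by
  have h1 : Tendsto (fun i => ‖F i - c‖ ^ 2) l (𝓝 0) := by
    have := (ENNReal.tendsto_toReal ENNReal.zero_ne_top).comp h
    simpa [Function.comp_def] using this
  have h2 := h1.sqrt
  simp only [Real.sqrt_zero, Real.sqrt_sq (norm_nonneg _)] at h2
  exact tendsto_iff_norm_sub_tendsto_zero.2 h2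

/-- The inversion sends a point at height ε on a normal to a point at height of order ε on the image
normal, up to O(ε²). This is the second-order expansion behind that statement. -/
lemma norm_inv_sub_sub_le {w h : ℂ} (hw : w ≠ 0) (hh : ‖h‖ ≤ ‖w‖ / 2) :
    ‖(w - h)⁻¹ - (w⁻¹ + h / w ^ 2)‖ ≤ 2 / ‖w‖ ^ 3 * ‖h‖ ^ 2 := by
  have hwp : 0 < ‖w‖ := norm_pos_iff.2 hw
  have h1 : ‖w‖ / 2 ≤ ‖w - h‖ := by linarith [norm_sub_norm_le w h]
  have h2 : w - h ≠ 0 := norm_pos_iff.1 (lt_of_lt_of_le (by positivity) h1)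
  have e : (w - h)⁻¹ - (w⁻¹ + h / w ^ 2) = h ^ 2 / (w ^ 2 * (w - h)) := by
    field_simp
    ring
  rw [e, norm_div, norm_mul, norm_pow, norm_pow]
  calc ‖h‖ ^ 2 / (‖w‖ ^ 2 * ‖w - h‖) ≤ ‖h‖ ^ 2 / (‖w‖ ^ 2 * (‖w‖ / 2)) := by gcongr
    _ = _ := by field_simp

namespace Contour
variable {Γ : Contour}

lemma tendsto_lintegral_bv {F f : ℂ → ℂ} {side : ℝ} (h : Γ.BV side F f) (j : Fin Γ.n) :
    Tendsto (fun ε => ∫⁻ t, ‖F (Γ.shift j (side * ε) t) - f (Γ.curve j t)‖ₑ ^ 2 ∂unitMeasure)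
      (𝓝[>] 0) (𝓝 0) :=
  (tendsto_eLpNorm_two_iff _).1 (h.lim j).lim

lemma eventually_aemeasurable_bv {F f : ℂ → ℂ} {side : ℝ} (h : Γ.BV side F f) (j : Fin Γ.n) :
    ∀ᶠ ε in 𝓝[>] 0, AEMeasurable (fun t => ‖F (Γ.shift j (side * ε) t) - f (Γ.curve j t)‖ₑ ^ 2)
      unitMeasure :=
  (h.lim j).meas.mono fun _ hm => (hm.sub (h.lim j).memLp.1).enorm.pow_const 2

/-- The boundary values of a Cauchy integral and of its composition with the inversion. -/
theorem ae_bv_inv (hΓ : Γ.InvSymm) {f p q : ℂ → ℂ} (hf : MemLp f 2 Γ.arcLength) {side : ℝ}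
    (hside : |side| = 1) (hp : Γ.BV side (Γ.cauchy f) p)
    (hq : Γ.BV (-side) (fun z => Γ.cauchy f z⁻¹) q) : ∀ᵐ z ∂Γ.arcLength, q z = p z⁻¹ := by
  set fk : Fin Γ.n → ℝ → ℂ := fun k => (Icc (0 : ℝ) 1).indicator fun t => f (Γ.curve k t) with hfk
  have hfkm : ∀ k, MemLp (fk k) 2 := fun k =>
    (memLp_indicator_iff_restrict measurableSet_Icc).2 (memLp_curve hf k)
  -- One sequence of heights serves for the oscillations and for both families of boundary values,
  -- so that all of them converge pointwise almost everywhere.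
  obtain ⟨e, he, hae⟩ := exists_seq_ae_tendsto
    (ι := Fin Γ.n ⊕ Fin Γ.n ⊕ Fin Γ.n) (μ := fun _ => unitMeasure)
    (h := Sum.elim (fun k ε t => poissonOsc (fk k) ε t ^ 2)
      (Sum.elim (fun k ε t => ‖Γ.cauchy f (Γ.shift k (side * ε) t) - p (Γ.curve k t)‖ₑ ^ 2)
        (fun k ε t => ‖Γ.cauchy f (Γ.shift k (-side * ε) t)⁻¹ - q (Γ.curve k t)‖ₑ ^ 2))) (by
      rintro (k | k | k)
      · filter_upwards [self_mem_nhdsWithin] with ε hε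
        exact ((aemeasurable_poissonOsc (hfkm k).1 ε (ne_of_gt hε)).mono_measure
          Measure.restrict_le_self).pow_const 2
      · exact eventually_aemeasurable_bv hp k
      · exact eventually_aemeasurable_bv hq k) (by
      rintro (k | k | k)
      · exact tendsto_of_tendsto_of_tendsto_of_le_of_le tendsto_const_nhds
          (tendsto_lintegral_poissonOsc_sq (hfkm k)) (fun _ => zero_le)
          fun ε => setLIntegral_le_lintegral _ _
      · exact tendsto_lintegral_bv hp k
      · exact tendsto_lintegral_bv hq k)
  rw [ae_arcLength_iff]
  intro j
  filter_upwards [ae_mem_iUnion_mate hΓ j, hae (Sum.inr (Sum.inr j)),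
    ae_all_iff.2 fun k => ae_mateFun hΓ j k (hae (Sum.inl k)),
    ae_all_iff.2 fun k => ae_mateFun hΓ j k (hae (Sum.inr (Sum.inl k)))] with t h1 h2 h3 h4
  obtain ⟨k, hk⟩ := mem_iUnion.1 h1
  specialize h3 k hk
  specialize h4 k hk
  simp only [Sum.elim_inl, Sum.elim_inr] at h2 h3 h4
  have hq' := tendsto_zero_of_enorm_sq h2
  have hp' := tendsto_zero_of_enorm_sq h4
  obtain ⟨r, hr, -, hder⟩ := exists_hasDerivWithinAt_mateFun hΓ hk
  set w := Γ.curve j t with hw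
  set d := deriv (Γ.curve j) t with hd
  have hw0 : w ≠ 0 := hΓ.curve_ne_zero hk.1.1
  have hwp : 0 < ‖w‖ := norm_pos_iff.2 hw0
  set u := Γ.mateFun j k t with hu
  have hosc : Tendsto (fun ε => poissonOsc (fk k) ε u) (map e atTop) (𝓝 0) := by
    rw [tendsto_map'_iff]
    have h5 := h3.ennrpow_const (1 / 2)
    have : (0 : ℝ≥0∞) ^ (1 / 2 : ℝ) = 0 := ENNReal.zero_rpow_of_pos (by norm_num)
    rw [this] at h5
    refine h5.congr fun n => ?_
    rw [← ENNReal.rpow_natCast, ← ENNReal.rpow_mul]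
    norm_num
  -- To first order the inversion maps the normal vector at w to the normal vector of the k-th curve
  -- scaled by r and with the side reversed, by the relation between the tangents.
  have hz : ∀ᶠ ε : ℝ in 𝓝[>] 0, ‖(Γ.shift j (-side * ε) t)⁻¹ - Γ.shift k (side * (ε * r)) u‖ ≤
      2 / ‖w‖ ^ 3 * ‖d‖ ^ 2 * ε ^ 2 := by
    have hpos : 0 < ‖w‖ / 2 / (‖d‖ + 1) := by positivity
    filter_upwards [nhdsWithin_le_nhds (gt_mem_nhds hpos), self_mem_nhdsWithin] with ε hε hε0
    rw [mem_Ioi] at hε0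
    rw [lt_div_iff₀ (by positivity)] at hε
    have hn : ‖((side * ε : ℝ) : ℂ) * Complex.I * d‖ = ε * ‖d‖ := by
      rw [norm_mul, norm_mul, Complex.norm_I, mul_one, Complex.norm_real, Real.norm_eq_abs, abs_mul,
        hside, one_mul, abs_of_pos hε0]
    have h5 := norm_inv_sub_sub_le (h := ((side * ε : ℝ) : ℂ) * Complex.I * d) hw0 (by
      rw [hn]; nlinarith)
    have e1 : Γ.shift j (-side * ε) t = w - ((side * ε : ℝ) : ℂ) * Complex.I * d := by
      rw [shift, ← hw, ← hd]
      push_cast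
      ring
    have e2 : Γ.shift k (side * (ε * r)) u =
        w⁻¹ + ((side * ε : ℝ) : ℂ) * Complex.I * d / w ^ 2 := by
      rw [shift, curve_mateFun hk, mul_div_assoc, hder]
      push_cast
      ring
    rw [e1, e2]
    refine h5.trans (le_of_eq ?_)
    rw [hn]
    ring
  have hdiff := tendsto_cauchy_sub hf (mateFun_mem hk).1 he hosc
    hside hr (by positivity) hz
  rw [tendsto_map'_iff] at hdiff
  have h6 := hdiff.add hp'
  rw [zero_add, curve_mateFun hk] at h6
  refine tendsto_nhds_unique hq' (h6.congr fun n => ?_)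
  simp only [Function.comp, ← hu, sub_add_cancel]

end Contour

/-! ### Symmetry of Cauchy integrals under inversion -/

namespace Contour
variable {Γ : Contour}

lemma cauchy_add {f g : ℂ → ℂ} (hf : MemLp f 2 Γ.arcLength) (hg : MemLp g 2 Γ.arcLength) {z : ℂ}
    (hz : z ∉ Γ.support) : Γ.cauchy (fun s => f s + g s) z = Γ.cauchy f z + Γ.cauchy g z := by
  simp only [cauchy, mul_add]
  rw [← mul_add, ← Finset.sum_add_distrib]
  congr 1
  refine Finset.sum_congr rfl fun k _ => ?_
  exact intervalIntegral.integral_add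
    (intervalIntegrable_cauchy (Γ.smooth k) (fun u hu => curve_ne hz hu) (memLp_curve hf k))
    (intervalIntegrable_cauchy (Γ.smooth k) (fun u hu => curve_ne hz hu) (memLp_curve hg k))

/-- Substituting s ↦ 1/s turns the kernel at 1/z into z/(s(s − z)) = 1/(s − z) − 1/s once the sign
of f(1/s) = −g(s) is included; the term 1/s gives the value at 0. -/
lemma cauchy_inv (hΓ : Γ.InvSymm) {f g : ℂ → ℂ} (hf : MemLp f 2 Γ.arcLength)
    (hg : MemLp g 2 Γ.arcLength) (h : ∀ᵐ z ∂Γ.arcLength, f z⁻¹ = -g z) {z : ℂ}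
    (hz : z ∉ Γ.support) (hz0 : z ≠ 0) :
    Γ.cauchy f z⁻¹ = Γ.cauchy g z - Γ.cauchy g 0 := by
  have hzi : z⁻¹ ∉ Γ.support := fun h => hz (hΓ.inv_mem_iff.1 h)
  rw [cauchy_sub_cauchy hg hz hΓ.zero_notMem, cauchy]
  congr 1
  have h1 := sum_integral_inv hΓ (g := fun s => f s / (s - z⁻¹)) fun k => by
    have := (intervalIntegrable_iff_integrableOn_Icc_of_le zero_le_one).1
      (intervalIntegrable_cauchy (Γ.smooth k) (fun u hu => curve_ne hzi hu) (memLp_curve hf k))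
    refine this.congr (ae_of_all _ fun u => ?_)
    simp only
    ring
  calc _ = ∑ k, ∫ u in (0 : ℝ)..1, deriv (Γ.curve k) u * (f (Γ.curve k u) / (Γ.curve k u - z⁻¹)) := by
        refine Finset.sum_congr rfl fun k _ => intervalIntegral.integral_congr fun u _ => ?_
        ring
    _ = _ := h1
    _ = _ := by
        refine Finset.sum_congr rfl fun k _ => ?_
        rw [intervalIntegral.integral_of_le zero_le_one, intervalIntegral.integral_of_le zero_le_one,
          ← integral_Icc_eq_integral_Ioc, ← integral_Icc_eq_integral_Ioc]
        refine setIntegral_congr_ae measurableSet_Icc ?_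
        have h2 := (ae_restrict_iff' measurableSet_Icc).1 (ae_arcLength_iff.1 h k)
        filter_upwards [h2] with u hu hui
        rw [hu hui]
        have e1 := hΓ.curve_ne_zero (j := k) hui
        have e2 := sub_ne_zero.2 (curve_ne (l := k) hz hui)
        have e3 : (Γ.curve k u)⁻¹ - z⁻¹ ≠ 0 := by
          rw [Ne, sub_eq_zero, inv_inj]
          exact curve_ne hz hui
        have e4 : z - Γ.curve k u ≠ 0 := fun h => e2 (by linear_combination -h)
        have e5 : (Γ.curve k u)⁻¹ - z⁻¹ = (z - Γ.curve k u) / (Γ.curve k u * z) := by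
          field_simp
        rw [e5]
        simp only [sub_zero]
        field_simp
        ring

/-- Let z → ∞ in the previous identity. -/
lemma cauchy_zero_eq_neg (hΓ : Γ.InvSymm) {f g : ℂ → ℂ} (hf : MemLp f 2 Γ.arcLength)
    (hg : MemLp g 2 Γ.arcLength) (h : ∀ᵐ z ∂Γ.arcLength, f z⁻¹ = -g z) :
    Γ.cauchy f 0 = -Γ.cauchy g 0 := by
  have h1 : Tendsto (fun z => Γ.cauchy f z⁻¹) (cocompact ℂ) (𝓝 (Γ.cauchy f 0)) := by
    have hc : ContinuousAt (Γ.cauchy f) 0 := ((differentiableOn_cauchy hf).differentiableAt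
      (isCompact_support.isClosed.isOpen_compl.mem_nhds hΓ.zero_notMem)).continuousAt
    exact hc.tendsto.comp (tendsto_inv₀_cobounded (α := ℂ) |>.mono_left
      (Metric.cobounded_eq_cocompact (α := ℂ)).ge)
  have h2 : Tendsto (fun z => Γ.cauchy g z - Γ.cauchy g 0) (cocompact ℂ) (𝓝 (0 - Γ.cauchy g 0)) :=
    (tendsto_cauchy_cocompact hg).sub tendsto_const_nhds
  rw [zero_sub] at h2
  refine tendsto_nhds_unique h1 (h2.congr' ?_)
  filter_upwards [(isCompact_support (Γ := Γ)).compl_mem_cocompact,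
    (isCompact_singleton (x := (0 : ℂ))).compl_mem_cocompact] with z h3 h4
  exact (cauchy_inv hΓ hf hg h h3 h4).symm

end Contour

/-! ### The Cauchy operator in components -/

/-- The zeros of the entries of the kernel `cauchyKernel ζ s`. -/
def kernelZero (ζ : ℂ) : Fin 2 → ℂ := ![ζ⁻¹, ζ]

lemma vecMul_cauchyKernel (ζ s z : ℂ) (x : Fin 2 → ℂ) (i : Fin 2) :
    (x ᵥ* cauchyKernel ζ s z) i =
      (z - kernelZero ζ i) / (s - kernelZero ζ i) * (1 / (s - z)) * x i := by
  fin_cases i <;> simp [cauchyKernel, kernelZero, Matrix.vecMul, dotProduct, mul_comm]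

lemma vecMul_swapMatrix (x : Fin 2 → ℂ) : x ᵥ* swapMatrix = ![x 1, x 0] := by
  ext i
  fin_cases i <;> simp [swapMatrix, Matrix.vecMul, dotProduct]

lemma swapMatrix_mul_swapMatrix : swapMatrix * swapMatrix = 1 := by
  ext i j
  fin_cases i <;> fin_cases j <;> simp [swapMatrix, Matrix.mul_apply]

variable {Γ : Contour} {ζ : ℝ}

/-- Partial fractions in s. The component differs from a scalar Cauchy integral only by a constant,
so boundary values, growth and decay are inherited. -/
lemma cauchyOp_apply {f : ℂ → Fin 2 → ℂ} (hf : ∀ i, MemLp (fun z => f z i) 2 Γ.arcLength)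
    (hζ : ∀ i, kernelZero ζ i ∉ Γ.support) {z : ℂ} (hz : z ∉ Γ.support) (i : Fin 2) :
    cauchyOp Γ ζ f z i =
      Γ.cauchy (fun s => f s i) z - Γ.cauchy (fun s => f s i) (kernelZero ζ i) := by
  have hker : ∀ k, ∀ i, ∀ u ∈ Icc (0 : ℝ) 1,
      (deriv (Γ.curve k) u • (f (Γ.curve k u) ᵥ* cauchyKernel ζ (Γ.curve k u) z)) i =
      deriv (Γ.curve k) u * (1 / (Γ.curve k u - z) - 1 / (Γ.curve k u - kernelZero ζ i)) *
        f (Γ.curve k u) i := by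
    intro k i u hu
    rw [Pi.smul_apply, vecMul_cauchyKernel, smul_eq_mul]
    have e1 := sub_ne_zero.2 (Contour.curve_ne (l := k) hz hu)
    have e2 := sub_ne_zero.2 (Contour.curve_ne (l := k) (hζ i) hu)
    field_simp
    ring
  have hint : ∀ k i, IntegrableOn (fun u =>
      (deriv (Γ.curve k) u • (f (Γ.curve k u) ᵥ* cauchyKernel ζ (Γ.curve k u) z)) i)
      (Ioc (0 : ℝ) 1) := by
    intro k i
    have h1 := intervalIntegrable_cauchy (Γ.smooth k) (fun u hu => Contour.curve_ne hz hu)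
      (Contour.memLp_curve (hf i) k)
    have h2 := intervalIntegrable_cauchy (Γ.smooth k) (fun u hu => Contour.curve_ne (hζ i) hu)
      (Contour.memLp_curve (hf i) k)
    refine ((intervalIntegrable_iff_integrableOn_Ioc_of_le zero_le_one).1 (h1.sub h2)).congr_fun
      (fun u hu => ?_) measurableSet_Ioc
    rw [hker k i u (Ioc_subset_Icc_self hu)]
    simp only
    ring
  rw [Contour.cauchy_sub_cauchy (hf i) hz (hζ i), cauchyOp, Pi.smul_apply, Contour.integral,
    Finset.sum_apply, smul_eq_mul]
  congr 1
  refine Finset.sum_congr rfl fun k _ => ?_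
  rw [intervalIntegral.integral_of_le zero_le_one, intervalIntegral.integral_of_le zero_le_one,
    eval_integral (hint k)]
  exact setIntegral_congr_fun measurableSet_Ioc fun u hu => hker k i u (Ioc_subset_Icc_self hu)

lemma cauchyOp_kernelZero {f : ℂ → Fin 2 → ℂ} (hf : ∀ i, MemLp (fun z => f z i) 2 Γ.arcLength)
    (hζ : ∀ i, kernelZero ζ i ∉ Γ.support) (i : Fin 2) :
    cauchyOp Γ ζ f (kernelZero ζ i) i = 0 := by
  rw [cauchyOp_apply hf hζ (hζ i), sub_self]

lemma cauchyOp_add {f g : ℂ → Fin 2 → ℂ} (hf : ∀ i, MemLp (fun z => f z i) 2 Γ.arcLength)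
    (hg : ∀ i, MemLp (fun z => g z i) 2 Γ.arcLength)
    (hζ : ∀ i, kernelZero ζ i ∉ Γ.support) {z : ℂ} (hz : z ∉ Γ.support) :
    cauchyOp Γ ζ (fun s => f s + g s) z = cauchyOp Γ ζ f z + cauchyOp Γ ζ g z := by
  funext i
  rw [Pi.add_apply, cauchyOp_apply hf hζ hz, cauchyOp_apply hg hζ hz,
    cauchyOp_apply (f := fun s => f s + g s) (fun i => (hf i).add (hg i)) hζ hz]
  simp only [Pi.add_apply]
  rw [Contour.cauchy_add (hf i) (hg i) hz, Contour.cauchy_add (hf i) (hg i) (hζ i)]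
  ring

lemma cauchyOp_smul (c : ℂ) (f : ℂ → Fin 2 → ℂ) (z : ℂ) :
    cauchyOp Γ ζ (fun s => c • f s) z = c • cauchyOp Γ ζ f z := by
  simp only [cauchyOp, Contour.integral, Matrix.smul_vecMul, smul_comm _ c,
    intervalIntegral.integral_smul, ← Finset.smul_sum]

/-- The density is antisymmetric under inversion. -/
def AntiSymm (Γ : Contour) (f : ℂ → Fin 2 → ℂ) : Prop :=
  ∀ᵐ z ∂Γ.arcLength, f z⁻¹ = -(f z ᵥ* swapMatrix)

lemma AntiSymm.apply {f : ℂ → Fin 2 → ℂ} (h : AntiSymm Γ f) {i j : Fin 2} (hij : i ≠ j) :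
    ∀ᵐ z ∂Γ.arcLength, f z⁻¹ i = -f z j := by
  filter_upwards [h] with z hz
  rw [hz, vecMul_swapMatrix]
  fin_cases i <;> fin_cases j <;> simp_all

/-- The kernel zeros ζ⁻¹ and ζ are exchanged by the inversion, so the two values at the origin
produced by `Contour.cauchy_inv` cancel. -/
lemma cauchyOp_inv (hΓ : Γ.InvSymm) {f : ℂ → Fin 2 → ℂ}
    (hf : ∀ i, MemLp (fun z => f z i) 2 Γ.arcLength) (hanti : AntiSymm Γ f)
    (hζ0 : (ζ : ℂ) ≠ 0) (hζ : ∀ i, kernelZero ζ i ∉ Γ.support) {z : ℂ} (hz : z ∉ Γ.support)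
    (hz0 : z ≠ 0) : cauchyOp Γ ζ f z⁻¹ = cauchyOp Γ ζ f z ᵥ* swapMatrix := by
  have hzi : z⁻¹ ∉ Γ.support := fun h => hz (hΓ.inv_mem_iff.1 h)
  have hk : ∀ i j : Fin 2, i ≠ j → kernelZero ζ i = (kernelZero ζ j)⁻¹ := by
    intro i j hij
    fin_cases i <;> fin_cases j <;> simp_all [kernelZero]
  have hk0 : ∀ i, kernelZero ζ i ≠ 0 := by
    intro i
    fin_cases i <;> simpa [kernelZero] using hζ0
  have main : ∀ i j : Fin 2, i ≠ j → cauchyOp Γ ζ f z⁻¹ i = cauchyOp Γ ζ f z j := by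
    intro i j hij
    rw [cauchyOp_apply hf hζ hzi, cauchyOp_apply hf hζ hz, hk i j hij,
      Contour.cauchy_inv hΓ (hf i) (hf j) (hanti.apply hij) hz hz0,
      Contour.cauchy_inv hΓ (hf i) (hf j) (hanti.apply hij) (hζ j) (hk0 j)]
    ring
  rw [vecMul_swapMatrix]
  funext i
  fin_cases i
  · exact main 0 1 (by decide)
  · exact main 1 0 (by decide)

/-- The limit of the second component at infinity is the value of the first one at the origin. -/
lemma tendsto_cauchyOp_cocompact (hΓ : Γ.InvSymm) {f : ℂ → Fin 2 → ℂ}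
    (hf : ∀ i, MemLp (fun z => f z i) 2 Γ.arcLength) (hanti : AntiSymm Γ f)
    (hζ0 : (ζ : ℂ) ≠ 0) (hζ : ∀ i, kernelZero ζ i ∉ Γ.support) :
    Tendsto (fun z => cauchyOp Γ ζ f z 1) (cocompact ℂ) (𝓝 (cauchyOp Γ ζ f 0 0)) := by
  have h1 : Tendsto (fun z => Γ.cauchy (fun s => f s 1) z - Γ.cauchy (fun s => f s 1) ζ)
      (cocompact ℂ) (𝓝 (0 - Γ.cauchy (fun s => f s 1) ζ)) :=
    (Contour.tendsto_cauchy_cocompact (hf 1)).sub tendsto_const_nhds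
  have h2 : cauchyOp Γ ζ f 0 0 = 0 - Γ.cauchy (fun s => f s 1) ζ := by
    have h01 := hanti.apply (i := 0) (j := 1) (by decide)
    rw [cauchyOp_apply hf hζ hΓ.zero_notMem,
      Contour.cauchy_zero_eq_neg hΓ (hf 0) (hf 1) h01]
    have h3 := Contour.cauchy_inv hΓ (hf 0) (hf 1) h01 (hζ 1) (by simpa [kernelZero] using hζ0)
    simp only [kernelZero, Matrix.cons_val_zero, Matrix.cons_val_one] at h3 ⊢
    rw [h3]
    ring
  rw [h2]
  refine h1.congr' ?_
  filter_upwards [(Contour.isCompact_support (Γ := Γ)).compl_mem_cocompact] with z hz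
  rw [cauchyOp_apply hf hζ hz]
  rfl

lemma differentiableAt_cauchyOp {f : ℂ → Fin 2 → ℂ}
    (hf : ∀ i, MemLp (fun z => f z i) 2 Γ.arcLength) (hζ : ∀ i, kernelZero ζ i ∉ Γ.support)
    {z : ℂ} (hz : z ∉ Γ.support) : DifferentiableAt ℂ (cauchyOp Γ ζ f) z := by
  have hnhds := Contour.isCompact_support.isClosed.isOpen_compl.mem_nhds hz
  rw [differentiableAt_pi]
  intro i
  refine (((Contour.differentiableOn_cauchy (hf i)).differentiableAt hnhds).sub_const
    (Γ.cauchy (fun s => f s i) (kernelZero ζ i))).congr_of_eventuallyEq ?_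
  filter_upwards [hnhds] with w hw
  exact cauchyOp_apply hf hζ hw i

/-- Boundary values of the components of the Cauchy operator. -/
lemma exists_bv_cauchyOp {f : ℂ → Fin 2 → ℂ} (hf : ∀ i, MemLp (fun z => f z i) 2 Γ.arcLength)
    (hζ : ∀ i, kernelZero ζ i ∉ Γ.support) : ∃ P : ℂ → Fin 2 → ℂ,
      (∀ i, Γ.BV 1 (fun z => cauchyOp Γ ζ f z i) fun z => P z i) ∧
      ∀ i, Γ.BV (-1) (fun z => cauchyOp Γ ζ f z i) fun z => P z i - f z i := by
  choose F hp hm using fun i => Contour.exists_bv_cauchy (hf i)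
  have hcst : ∀ i, ∀ side : ℝ, Γ.BV side
      (fun _ => Γ.cauchy (fun s => f s i) (kernelZero ζ i))
      (fun _ => Γ.cauchy (fun s => f s i) (kernelZero ζ i)) := fun i side =>
    Contour.BV.of_continuousOn side isOpen_univ (subset_univ _) continuousOn_const
  refine ⟨fun z i => F i z - Γ.cauchy (fun s => f s i) (kernelZero ζ i), fun i => ?_, fun i => ?_⟩
  · refine ((hp i).sub (hcst i 1)).congr_left one_ne_zero isClosed_empty (empty_disjoint _)
      fun z hz => ?_
    rw [union_empty] at hz
    exact (cauchyOp_apply hf hζ hz i).symm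
  · refine (((hm i).sub (hcst i (-1))).congr_left (by norm_num) isClosed_empty (empty_disjoint _)
      fun z hz => ?_).congr_right (ae_of_all _ fun z => ?_)
    · rw [union_empty] at hz
      exact (cauchyOp_apply hf hζ hz i).symm
    · simp only
      ring

lemma memLp_vecMul {μ : ℂ → Fin 2 → ℂ} {w : ℂ → Matrix (Fin 2) (Fin 2) ℂ}
    (hμ : ∀ i, MemLp (fun z => μ z i) 2 Γ.arcLength) (hw : ContinuousOn w Γ.support) (i : Fin 2) :
    MemLp (fun z => (μ z ᵥ* w z) i) 2 Γ.arcLength := by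
  rw [Contour.memLp_arcLength_iff]
  intro j
  have hterm : ∀ k, MemLp (fun t => μ (Γ.curve j t) k * w (Γ.curve j t) k i) 2 unitMeasure := by
    intro k
    have hc : ContinuousOn (fun t => w (Γ.curve j t) k i) (Icc 0 1) :=
      ((continuous_apply_apply k i).comp_continuousOn hw).comp
        (Γ.smooth j).continuous.continuousOn fun t ht => Contour.curve_mem_support j ht
    obtain ⟨C, hC⟩ := isCompact_Icc.exists_bound_of_continuousOn hc
    refine (Contour.memLp_curve (hμ k) j).of_le_mul (c := C)
      ((Contour.memLp_curve (hμ k) j).1.mul (hc.aestronglyMeasurable measurableSet_Icc)) ?_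
    filter_upwards [ae_restrict_mem measurableSet_Icc] with t ht
    rw [norm_mul, mul_comm]
    exact mul_le_mul_of_nonneg_right (hC t ht) (norm_nonneg _)
  have := (hterm 0).add (hterm 1)
  refine this.ae_eq (ae_of_all _ fun t => ?_)
  simp [Matrix.vecMul, dotProduct, Fin.sum_univ_two]

/-! ### The growth condition and the symmetric jump data -/

namespace Contour
variable {Γ : Contour} {F G : ℂ → ℂ}

lemma Growth.add (hF : Γ.Growth F) (hG : Γ.Growth G) : Γ.Growth fun z => F z + G z := by
  obtain ⟨K, δ, hδ, hK⟩ := hF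
  obtain ⟨L, η, hη, hL⟩ := hG
  refine ⟨K + L, min δ η, lt_min hδ hη, fun z hz hzd => ?_⟩
  calc _ ≤ (‖F z‖ + ‖G z‖) * √(Metric.infDist z Γ.support) :=
        mul_le_mul_of_nonneg_right (norm_add_le _ _) (Real.sqrt_nonneg _)
    _ ≤ K + L := by
        rw [add_mul]
        exact add_le_add (hK z hz (hzd.trans_le (min_le_left _ _)))
          (hL z hz (hzd.trans_le (min_le_right _ _)))

lemma Growth.const_mul (c : ℂ) (hF : Γ.Growth F) : Γ.Growth fun z => c * F z := by
  obtain ⟨K, δ, hδ, hK⟩ := hF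
  refine ⟨‖c‖ * K, δ, hδ, fun z hz hzd => ?_⟩
  rw [norm_mul, mul_assoc]
  exact mul_le_mul_of_nonneg_left (hK z hz hzd) (norm_nonneg _)

lemma Growth.sub (hF : Γ.Growth F) (hG : Γ.Growth G) : Γ.Growth fun z => F z - G z := by
  simpa [sub_eq_add_neg] using hF.add (hG.const_mul (-1))

lemma Growth.congr (hF : Γ.Growth F) {S : Set ℂ} (hS : IsClosed S) (hd : Disjoint S Γ.support)
    (h : ∀ z ∉ Γ.support ∪ S, F z = G z) : Γ.Growth G := by
  obtain ⟨K, δ, hδ, hK⟩ := hF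
  rcases Γ.support.eq_empty_or_nonempty with he | hne
  · refine ⟨0, 1, one_pos, fun z _ _ => ?_⟩
    rw [he, Metric.infDist_empty, Real.sqrt_zero, mul_zero]
  obtain ⟨η, hη, hdisj⟩ := hd.symm.exists_thickenings isCompact_support hS
  refine ⟨K, min δ η, lt_min hδ hη, fun z hz hzd => ?_⟩
  rw [← h z]
  · exact hK z hz (hzd.trans_le (min_le_left _ _))
  · rintro (h1 | h1)
    · exact hz h1
    · refine disjoint_left.1 hdisj ?_ (Metric.self_subset_thickening hη S h1)
      rw [Metric.mem_thickening_iff_infDist_lt hne]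
      exact hzd.trans_le (min_le_right _ _)

lemma growth_of_continuousOn {U : Set ℂ} (hU : IsOpen U) (hΓ : Γ.support ⊆ U)
    (hF : ContinuousOn F U) : Γ.Growth F := by
  rcases Γ.support.eq_empty_or_nonempty with he | hne
  · refine ⟨0, 1, one_pos, fun z _ _ => ?_⟩
    rw [he, Metric.infDist_empty, Real.sqrt_zero, mul_zero]
  obtain ⟨δ, hδ, hsub⟩ := isCompact_support.exists_cthickening_subset_open hU hΓ
  obtain ⟨C, hC⟩ := (isCompact_support (Γ := Γ)).cthickening (r := δ)
    |>.exists_bound_of_continuousOn (hF.mono hsub)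
  refine ⟨C * √δ, δ, hδ, fun z _ hzd => ?_⟩
  have hz : z ∈ Metric.cthickening δ Γ.support :=
    Metric.thickening_subset_cthickening _ _ ((Metric.mem_thickening_iff_infDist_lt hne).2 hzd)
  exact mul_le_mul (hC z hz) (Real.sqrt_le_sqrt hzd.le) (Real.sqrt_nonneg _)
    ((norm_nonneg _).trans (hC z hz))

lemma ae_mem_support : ∀ᵐ z ∂Γ.arcLength, z ∈ Γ.support := by
  rw [ae_arcLength_iff]
  intro j
  filter_upwards [ae_restrict_mem measurableSet_Icc] with t ht using curve_mem_support j ht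

end Contour

variable {Γ : Contour} {ζ γ : ℝ} {v wp wm : ℂ → Matrix (Fin 2) (Fin 2) ℂ}

lemma growth_cauchyOp {f : ℂ → Fin 2 → ℂ} (hf : ∀ i, MemLp (fun z => f z i) 2 Γ.arcLength)
    (hζ : ∀ i, kernelZero ζ i ∉ Γ.support) (i : Fin 2) :
    Γ.Growth fun z => cauchyOp Γ ζ f z i := by
  obtain ⟨K, hK⟩ := Contour.exists_norm_cauchy_mul_sqrt_le (hf i)
  have h1 : Γ.Growth (Γ.cauchy fun s => f s i) := ⟨K, 1, one_pos, fun z hz _ => hK z hz⟩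
  have h2 : Γ.Growth fun _ => Γ.cauchy (fun s => f s i) (kernelZero ζ i) :=
    Contour.growth_of_continuousOn isOpen_univ (subset_univ _) continuousOn_const
  refine (h1.sub h2).congr isClosed_empty (empty_disjoint _) fun z hz => ?_
  rw [union_empty] at hz
  exact (cauchyOp_apply hf hζ hz i).symm

namespace SymmetricHypothesis

lemma invSymm (h : SymmetricHypothesis Γ ζ v wp wm) : Γ.InvSymm := ⟨h.zero_notMem, h.inversion⟩

lemma kernelZero_notMem (h : SymmetricHypothesis Γ ζ v wp wm) (i : Fin 2) :
    kernelZero ζ i ∉ Γ.support := by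
  fin_cases i
  · exact fun h1 => h.zeta_notMem (h.invSymm.inv_mem_iff.1 h1)
  · exact h.zeta_notMem

/-- b₊ at z is conjugate under σ to b₋ at 1/z, so invertibility needs to be assumed only for b₋. -/
lemma one_add_wp (h : SymmetricHypothesis Γ ζ v wp wm) {z : ℂ} (hz : z ∈ Γ.support) :
    1 + wp z = swapMatrix * (1 - wm z⁻¹) * swapMatrix := by
  have hs := swapMatrix_mul_swapMatrix
  rw [h.symm_wm z hz, mul_sub, sub_mul, mul_one, hs, mul_neg, neg_mul, sub_neg_eq_add]
  congr 1
  rw [show swapMatrix * (swapMatrix * wp z * swapMatrix) * swapMatrix =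
    (swapMatrix * swapMatrix) * wp z * (swapMatrix * swapMatrix) by simp only [mul_assoc], hs,
    one_mul, mul_one]

lemma isUnit_swapMatrix : IsUnit swapMatrix :=
  ⟨⟨swapMatrix, swapMatrix, swapMatrix_mul_swapMatrix, swapMatrix_mul_swapMatrix⟩, rfl⟩

lemma isUnit_bp (h : SymmetricHypothesis Γ ζ v wp wm) {z : ℂ} (hz : z ∈ Γ.support) :
    IsUnit (1 + wp z) := by
  rw [h.one_add_wp hz]
  exact (isUnit_swapMatrix.mul (h.isUnit_bm _ (h.invSymm.inv_mem hz))).mul isUnit_swapMatrix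

/-- The minus sign in the symmetry of w_± survives in the sum, which the inversion maps to minus its
conjugate under σ. -/
lemma antiSymm (h : SymmetricHypothesis Γ ζ v wp wm) {μ : ℂ → Fin 2 → ℂ}
    (hμ : ∀ᵐ z ∂Γ.arcLength, μ z⁻¹ = μ z ᵥ* swapMatrix) :
    AntiSymm Γ fun s => μ s ᵥ* (wp s + wm s) := by
  filter_upwards [hμ, Contour.ae_mem_support] with z h1 h2
  rw [h1, h.symm_wp z h2, h.symm_wm z h2, ← neg_add, Matrix.vecMul_vecMul, Matrix.vecMul_vecMul,
    ← Matrix.vecMul_neg, ← add_mul, ← mul_add, mul_neg, ← mul_assoc, ← mul_assoc,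
    swapMatrix_mul_swapMatrix, one_mul, add_comm (wm z)]

end SymmetricHypothesis

/-! ### The one-soliton solution and its residues -/

/-- The poles of the components of the one-soliton solution. -/
def pole (ζ : ℂ) : Fin 2 → ℂ := ![ζ, ζ⁻¹]

/-- The values at infinity of the components of the one-soliton solution. -/
def solitonConst (ζ γ : ℝ) : Fin 2 → ℂ := ![(1 - ζ ^ 2 + γ * ζ ^ 2) / (1 - ζ ^ 2 + γ), 1]

/-- The residues of the components of the one-soliton solution. -/
def solitonRes (ζ γ : ℝ) : Fin 2 → ℂ :=
  ![-(ζ * γ * (1 - ζ ^ 2)) / (1 - ζ ^ 2 + γ), γ * (1 - ζ ^ 2) / (ζ * (1 - ζ ^ 2 + γ))]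

lemma zeta_ne_zero (hζ : ζ ∈ Ioo (-1 : ℝ) 0 ∪ Ioo (0 : ℝ) 1) : (ζ : ℂ) ≠ 0 := by
  rw [Ne, Complex.ofReal_eq_zero]
  rcases hζ with h | h
  · exact h.2.ne
  · exact h.1.ne'

lemma zeta_sq_lt (hζ : ζ ∈ Ioo (-1 : ℝ) 0 ∪ Ioo (0 : ℝ) 1) : 0 < 1 - ζ ^ 2 := by
  rcases hζ with h | h
  · nlinarith [h.1, h.2]
  · nlinarith [h.1, h.2]

lemma one_sub_zeta_sq_ne (hζ : ζ ∈ Ioo (-1 : ℝ) 0 ∪ Ioo (0 : ℝ) 1) : (1 - ζ ^ 2 : ℂ) ≠ 0 := by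
  have := (zeta_sq_lt hζ).ne'
  exact_mod_cast this

lemma soliton_den_ne (hζ : ζ ∈ Ioo (-1 : ℝ) 0 ∪ Ioo (0 : ℝ) 1) (hγ : 0 ≤ γ) :
    (1 - ζ ^ 2 + γ : ℂ) ≠ 0 := by
  have := (add_pos_of_pos_of_nonneg (zeta_sq_lt hζ) hγ).ne'
  exact_mod_cast this

lemma oneSoliton_apply (hζ : ζ ∈ Ioo (-1 : ℝ) 0 ∪ Ioo (0 : ℝ) 1) (hγ : 0 ≤ γ) {z : ℂ} (i : Fin 2)
    (hz : z ≠ pole ζ i) :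
    oneSoliton ζ γ z i = solitonConst ζ γ i + solitonRes ζ γ i / (z - pole ζ i) := by
  have h0 := zeta_ne_zero hζ
  have hd := soliton_den_ne hζ hγ
  have hz' := sub_ne_zero.2 hz
  fin_cases i
  · simp only [oneSoliton, solitonConst, solitonRes, pole, Fin.zero_eta, Matrix.cons_val_zero] at hz' ⊢
    field_simp
    ring
  · simp only [oneSoliton, solitonConst, solitonRes, pole, Fin.mk_one, Matrix.cons_val_one,
      Matrix.cons_val_fin_one] at hz' ⊢
    have h1 : 1 - (ζ : ℂ) * z ≠ 0 := by
      intro h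
      apply hz'
      field_simp
      linear_combination -h
    have h2 : z - (ζ : ℂ)⁻¹ = -(1 - ζ * z) / ζ := by
      field_simp
      ring
    rw [h2]
    field_simp
    ring

lemma oneSoliton_zero (hζ : ζ ∈ Ioo (-1 : ℝ) 0 ∪ Ioo (0 : ℝ) 1) (hγ : 0 ≤ γ) :
    oneSoliton ζ γ 0 0 = 1 := by
  have h0 := zeta_ne_zero hζ
  have hd := soliton_den_ne hζ hγ
  simp only [oneSoliton, Matrix.cons_val_zero, zero_sub]
  field_simp
  ring

lemma oneSoliton_inv (hζ : ζ ∈ Ioo (-1 : ℝ) 0 ∪ Ioo (0 : ℝ) 1) {z : ℂ}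
    (hz0 : z ≠ 0) (hz : z ≠ ζ) (hz' : z ≠ (ζ : ℂ)⁻¹) :
    oneSoliton ζ γ z⁻¹ = oneSoliton ζ γ z ᵥ* swapMatrix := by
  have h0 := zeta_ne_zero hζ
  have h1 := sub_ne_zero.2 hz
  have h2 : 1 - (ζ : ℂ) * z ≠ 0 := fun h => hz' (by field_simp; linear_combination -h)
  have e1 : (z⁻¹ - (ζ : ℂ)⁻¹) / (z⁻¹ - ζ) = (1 - (ζ : ℂ)⁻¹ * z) / (1 - ζ * z) := by
    have e : z⁻¹ - (ζ : ℂ) = (1 - ζ * z) / z := by field_simp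
    rw [e]
    field_simp
  have e2 : (1 - (ζ : ℂ)⁻¹ * z⁻¹) / (1 - ζ * z⁻¹) = (z - (ζ : ℂ)⁻¹) / (z - ζ) := by
    have e : 1 - (ζ : ℂ) * z⁻¹ = (z - ζ) / z := by field_simp
    rw [e]
    field_simp
  rw [vecMul_swapMatrix]
  funext i
  fin_cases i
  · simp [oneSoliton, e1]
  · simp [oneSoliton, e2]

/-- The residue relation at ζ for m₀: the factor in parentheses is the second component evaluated at
ζ. -/
lemma solitonRes_zero (hζ : ζ ∈ Ioo (-1 : ℝ) 0 ∪ Ioo (0 : ℝ) 1) (hγ : 0 ≤ γ) :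
    -(ζ : ℂ) * γ * (solitonConst ζ γ 1 + solitonRes ζ γ 1 / (ζ - (ζ : ℂ)⁻¹)) =
      solitonRes ζ γ 0 := by
  have h0 := zeta_ne_zero hζ
  have hd := soliton_den_ne hζ hγ
  have h1 := one_sub_zeta_sq_ne hζ
  have e : (ζ : ℂ) - (ζ : ℂ)⁻¹ = -(1 - ζ ^ 2) / ζ := by field_simp; ring
  rw [e]
  simp only [solitonConst, solitonRes, Matrix.cons_val_zero, Matrix.cons_val_one]
  field_simp
  ring

lemma solitonRes_one (hζ : ζ ∈ Ioo (-1 : ℝ) 0 ∪ Ioo (0 : ℝ) 1) (hγ : 0 ≤ γ) :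
    (ζ : ℂ)⁻¹ * γ * (solitonConst ζ γ 0 + solitonRes ζ γ 0 / ((ζ : ℂ)⁻¹ - ζ)) =
      solitonRes ζ γ 1 := by
  have h0 := zeta_ne_zero hζ
  have hd := soliton_den_ne hζ hγ
  have h1 := one_sub_zeta_sq_ne hζ
  have e : (ζ : ℂ)⁻¹ - (ζ : ℂ) = (1 - ζ ^ 2) / ζ := by field_simp
  rw [e]
  simp only [solitonConst, solitonRes, Matrix.cons_val_zero, Matrix.cons_val_one]
  field_simp
  ring

lemma tendsto_sub_mul_pole {g : ℂ → ℂ} {p : ℂ} (c ρ : ℂ) (hg : ContinuousAt g p) :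
    Tendsto (fun z => (z - p) * (c + ρ / (z - p) + g z)) (𝓝[≠] p) (𝓝 ρ) := by
  have h1 : ContinuousAt (fun z => (z - p) * (c + g z) + ρ) p := by fun_prop
  have h2 : Tendsto (fun z => (z - p) * (c + g z) + ρ) (𝓝[≠] p) (𝓝 ρ) := by
    simpa using h1.tendsto.mono_left nhdsWithin_le_nhds
  refine h2.congr' ?_
  filter_upwards [self_mem_nhdsWithin] with z hz
  have := sub_ne_zero.2 hz
  field_simp
  ring

/-- The situation at either pole: one component has a simple pole, the other is continuous there,
and the residue matrix maps the latter into the former. -/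
lemma residueCondition_of {m : ℂ → Fin 2 → ℂ} {p κ c ρ : ℂ} {i j : Fin 2} (hij : i ≠ j)
    {A : Matrix (Fin 2) (Fin 2) ℂ} (hA : ∀ x, x ᵥ* A = Pi.single i (κ * x j)) {g g' : ℂ → ℂ}
    (hg : ContinuousAt g p) (hg' : ContinuousAt g' p)
    (hi : ∀ᶠ z in 𝓝[≠] p, m z i = c + ρ / (z - p) + g z) (hj : ∀ᶠ z in 𝓝[≠] p, m z j = g' z)
    (hκ : κ * g' p = ρ) : ResidueCondition m p A := by
  have hcase : ∀ l : Fin 2, l = i ∨ l = j := by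
    intro l
    fin_cases l <;> fin_cases i <;> fin_cases j <;> simp_all
  have hj2 : Tendsto (fun z => m z j) (𝓝[≠] p) (𝓝 (g' p)) :=
    (hg'.tendsto.mono_left nhdsWithin_le_nhds).congr' (hj.mono fun z hz => hz.symm)
  refine ⟨Pi.single i ρ, ?_, ?_⟩
  · rw [tendsto_pi_nhds]
    intro l
    rcases hcase l with rfl | rfl
    · rw [Pi.single_eq_same]
      refine (tendsto_sub_mul_pole c ρ hg).congr' (hi.mono fun z hz => ?_)
      change _ = (z - p) * m z l
      rw [hz]
    · rw [Pi.single_eq_of_ne hij.symm]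
      have h1 : Tendsto (fun z => z - p) (𝓝[≠] p) (𝓝 0) := by
        have : ContinuousAt (fun z : ℂ => z - p) p := by fun_prop
        simpa using this.tendsto.mono_left nhdsWithin_le_nhds
      simpa using h1.mul hj2
  · simp only [hA]
    have h1 := hj2.const_mul κ
    rw [hκ] at h1
    rw [tendsto_pi_nhds]
    intro l
    rcases hcase l with rfl | rfl
    · simpa using h1
    · simp [Pi.single_eq_of_ne hij.symm]

lemma vecMul_residue_zero (c : ℂ) (x : Fin 2 → ℂ) :
    x ᵥ* !![0, 0; c, 0] = Pi.single 0 (c * x 1) := by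
  ext i
  fin_cases i <;> simp [Matrix.vecMul, dotProduct, mul_comm]

lemma vecMul_residue_one (c : ℂ) (x : Fin 2 → ℂ) :
    x ᵥ* !![0, c; 0, 0] = Pi.single 1 (c * x 0) := by
  ext i
  fin_cases i <;> simp [Matrix.vecMul, dotProduct, mul_comm]

/-! ### From the singular integral equation to the Riemann–Hilbert problem -/

variable {Γ : Contour} {ζ γ : ℝ} {v wp wm : ℂ → Matrix (Fin 2) (Fin 2) ℂ}

lemma pole_mem (i : Fin 2) : pole ζ i ∈ ({(ζ : ℂ), (ζ : ℂ)⁻¹} : Set ℂ) := by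
  fin_cases i <;> simp [pole]

lemma ne_pole {z : ℂ} (hz : z ∉ ({(ζ : ℂ), (ζ : ℂ)⁻¹} : Set ℂ)) (i : Fin 2) : z ≠ pole ζ i := by
  rintro rfl
  exact hz (pole_mem i)

lemma pole_injective (hζ : ζ ∈ Ioo (-1 : ℝ) 0 ∪ Ioo (0 : ℝ) 1) : (ζ : ℂ) ≠ (ζ : ℂ)⁻¹ := by
  have h0 := zeta_ne_zero hζ
  have h1 := one_sub_zeta_sq_ne hζ
  intro h
  apply h1
  field_simp at h
  linear_combination -h

lemma isClosed_poles : IsClosed ({(ζ : ℂ), (ζ : ℂ)⁻¹} : Set ℂ) :=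
  (toFinite _).isClosed

lemma SymmetricHypothesis.disjoint_poles (h : SymmetricHypothesis Γ ζ v wp wm) :
    Disjoint ({(ζ : ℂ), (ζ : ℂ)⁻¹} : Set ℂ) Γ.support := by
  rw [disjoint_left]
  rintro z (rfl | rfl) hz
  · exact h.kernelZero_notMem 1 hz
  · exact h.kernelZero_notMem 0 hz

lemma SymmetricHypothesis.eventually_notMem (h : SymmetricHypothesis Γ ζ v wp wm) (a : ℂ)
    (ha : a ∈ ({(ζ : ℂ), (ζ : ℂ)⁻¹} : Set ℂ)) :
    ∀ᶠ z in 𝓝[≠] a, z ∉ Γ.support ∪ {(ζ : ℂ), (ζ : ℂ)⁻¹} := by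
  have h1 : (Γ.support ∪ ({(ζ : ℂ), (ζ : ℂ)⁻¹} : Set ℂ) \ {a})ᶜ ∈ 𝓝 a :=
    (Contour.isCompact_support.isClosed.union
      ((toFinite ({(ζ : ℂ), (ζ : ℂ)⁻¹} : Set ℂ)).subset sdiff_subset).isClosed).isOpen_compl.mem_nhds
      fun h2 => h2.elim (disjoint_left.1 h.disjoint_poles ha) fun h2 => h2.2 rfl
  filter_upwards [nhdsWithin_le_nhds h1, self_mem_nhdsWithin] with z hz hza hmem
  exact hz (hmem.imp id fun h => ⟨h, hza⟩)

lemma differentiableAt_oneSoliton (hζ : ζ ∈ Ioo (-1 : ℝ) 0 ∪ Ioo (0 : ℝ) 1) (hγ : 0 ≤ γ)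
    {z : ℂ} {i : Fin 2} (hz : z ≠ pole ζ i) :
    DifferentiableAt ℂ (fun z => oneSoliton ζ γ z i) z := by
  have h1 : DifferentiableAt ℂ (fun z => solitonConst ζ γ i + solitonRes ζ γ i / (z - pole ζ i)) z :=
    (differentiableAt_const _).add ((differentiableAt_const _).div
      (differentiableAt_id.sub_const _) (sub_ne_zero.2 hz))
  refine h1.congr_of_eventuallyEq ?_
  filter_upwards [isOpen_ne.mem_nhds hz] with w hw using oneSoliton_apply hζ hγ i hw

lemma continuousOn_oneSoliton (hζ : ζ ∈ Ioo (-1 : ℝ) 0 ∪ Ioo (0 : ℝ) 1) (hγ : 0 ≤ γ) (i : Fin 2) :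
    ContinuousOn (fun z => oneSoliton ζ γ z i) ({(ζ : ℂ), (ζ : ℂ)⁻¹} : Set ℂ)ᶜ := fun _ hz =>
  (differentiableAt_oneSoliton hζ hγ (ne_pole hz i)).continuousAt.continuousWithinAt

lemma continuousOn_cauchyOp {f : ℂ → Fin 2 → ℂ}
    (hf : ∀ i, MemLp (fun z => f z i) 2 Γ.arcLength) (hζ : ∀ i, kernelZero ζ i ∉ Γ.support) :
    ContinuousOn (cauchyOp Γ ζ f) Γ.supportᶜ := fun _ hz =>
  (differentiableAt_cauchyOp hf hζ hz).continuousAt.continuousWithinAt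

lemma Contour.BV.unique_of_hasBoundaryValues {f p : ℂ → Fin 2 → ℂ} {side : ℝ} (hside : side ≠ 0)
    (hf : ∀ i, MemLp (fun z => f z i) 2 Γ.arcLength) (hζ : ∀ i, kernelZero ζ i ∉ Γ.support)
    (hp : HasBoundaryValues Γ side (cauchyOp Γ ζ f) p) {P : ℂ → ℂ} {i : Fin 2}
    (hP : Γ.BV side (fun z => cauchyOp Γ ζ f z i) P) : ∀ᵐ z ∂Γ.arcLength, p z i = P z :=
  (Contour.bv_of_hasBoundaryValues hside isClosed_empty (empty_disjoint _)
    (by rw [union_empty]; exact continuousOn_cauchyOp hf hζ) hp i).unique hP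

/-- The integral equation identifies the boundary values as multiples of μ̃b₊ and μ̃b₋, and v =
b₋⁻¹b₊ gives the jump. Residues come from m₀ because the Cauchy term vanishes in the relevant
component, and the symmetry comes from the antisymmetric density. -/
theorem solvesRHP_of_solvesSIE (hζ : ζ ∈ Ioo (-1 : ℝ) 0 ∪ Ioo (0 : ℝ) 1) (hγ : 0 ≤ γ)
    (h : SymmetricHypothesis Γ ζ v wp wm) {μt : ℂ → Fin 2 → ℂ}
    (hμ : SolvesSIE Γ ζ wp wm μt (oneSoliton ζ γ)) {ct : ℂ}
    (hct : ct = cauchyOp Γ ζ (fun s => μt s ᵥ* (wp s + wm s)) 0 0) (hne : ct ≠ -1)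
    {m : ℂ → Fin 2 → ℂ} (hm : ∀ z ∉ Γ.support ∪ {(ζ : ℂ), (ζ : ℂ)⁻¹},
      m z = (1 + ct)⁻¹ • (oneSoliton ζ γ z + cauchyOp Γ ζ (fun s => μt s ᵥ* (wp s + wm s)) z)) :
    SolvesRHP Γ ζ γ v m (fun z => (1 + ct)⁻¹ • (μt z ᵥ* (1 + wp z)))
      (fun z => (1 + ct)⁻¹ • (μt z ᵥ* (1 - wm z))) := by
  obtain ⟨⟨hμ2, hμs⟩, g, ⟨p, q, hp, hq, hg⟩, hsie⟩ := hμ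
  have hΓ := h.invSymm
  have hk := h.kernelZero_notMem
  have h0 := zeta_ne_zero hζ
  have hμi : ∀ i, MemLp (fun z => μt z i) 2 Γ.arcLength := fun i => memLp_pi_iff.1 hμ2 i
  have hf₁ := memLp_vecMul hμi h.continuousOn_wp
  have hf₂ := memLp_vecMul hμi h.continuousOn_wm
  set F : ℂ → Fin 2 → ℂ := fun s => μt s ᵥ* (wp s + wm s) with hF
  have hFi : ∀ i, MemLp (fun z => F z i) 2 Γ.arcLength :=
    memLp_vecMul hμi (h.continuousOn_wp.add h.continuousOn_wm)
  have hFadd : F = fun s => μt s ᵥ* wp s + μt s ᵥ* wm s := by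
    funext s
    simp only [hF, Matrix.vecMul_add]
  have hanti : AntiSymm Γ F := h.antiSymm hμs
  set c := (1 + ct)⁻¹ with hc
  have hc1 : c * (1 + ct) = 1 := inv_mul_cancel₀ fun h1 => hne (by linear_combination h1)
  have hS := isClosed_poles (ζ := ζ)
  have hd := h.disjoint_poles
  have hsub : Γ.support ⊆ ({(ζ : ℂ), (ζ : ℂ)⁻¹} : Set ℂ)ᶜ := disjoint_left.1 hd.symm
  have hadd : ∀ z ∉ Γ.support ∪ {(ζ : ℂ), (ζ : ℂ)⁻¹}, ∀ i,
      c * (oneSoliton ζ γ z i + (cauchyOp Γ ζ (fun s => μt s ᵥ* wp s) z i +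
        cauchyOp Γ ζ (fun s => μt s ᵥ* wm s) z i)) = m z i := by
    intro z hz i
    rw [hm z hz, hFadd, cauchyOp_add hf₁ hf₂ hk fun h => hz (Or.inl h)]
    rfl
  obtain ⟨P₁, hP₁, hP₁'⟩ := exists_bv_cauchyOp hf₁ hk
  obtain ⟨P₂, hP₂, hP₂'⟩ := exists_bv_cauchyOp hf₂ hk
  have hp2 := fun i => Contour.BV.unique_of_hasBoundaryValues one_ne_zero hf₂ hk hp (hP₂ i)
  have hq1 := fun i => Contour.BV.unique_of_hasBoundaryValues (by norm_num) hf₁ hk hq (hP₁' i)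
  -- The integral equation with C₋(μ̃w₊) written as C₊(μ̃w₊) − μ̃w₊. Uniqueness of `L²` limits
  -- identifies the given boundary values p and q with those from the Plemelj formula.
  have hkey : ∀ i, ∀ᵐ z ∂Γ.arcLength,
      μt z i = oneSoliton ζ γ z i + (P₁ z i + P₂ z i) - (μt z ᵥ* wp z) i := by
    intro i
    filter_upwards [hp2 i, hq1 i, hg, hsie] with z h1 h2 h3 h4
    have h5 := congrFun h4 i
    have h6 := congrFun h3 i
    simp only [Pi.sub_apply, Pi.add_apply] at h5 h6
    linear_combination h5 + h6 + h1 + h2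
  have hsol : ∀ i side, Γ.BV side (fun z => oneSoliton ζ γ z i) fun z => oneSoliton ζ γ z i :=
    fun i side => Contour.BV.of_continuousOn side hS.isOpen_compl hsub
      (continuousOn_oneSoliton hζ hγ i)
  have hnear := h.eventually_notMem
  have hcont : ∀ z ∉ Γ.support, ∀ i, ContinuousAt (fun z => cauchyOp Γ ζ F z i) z := fun z hz i =>
    (continuous_apply i).continuousAt.comp (differentiableAt_cauchyOp hFi hk hz).continuousAt
  refine ⟨?_, ?_, ?_, ?_, ?_, ?_, ?_, ?_, ?_⟩
  · intro z hz
    refine DifferentiableAt.differentiableWithinAt ?_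
    have h1 : DifferentiableAt ℂ (fun z => c • (oneSoliton ζ γ z + cauchyOp Γ ζ F z)) z :=
      ((differentiableAt_pi.2 fun i => differentiableAt_oneSoliton hζ hγ
        (ne_pole (fun h => hz (Or.inr h)) i)).add
        (differentiableAt_cauchyOp hFi hk fun h => hz (Or.inl h))).const_smul c
    refine h1.congr_of_eventuallyEq ?_
    filter_upwards [(Contour.isCompact_support.isClosed.union hS).isOpen_compl.mem_nhds hz]
      with w hw using hm w hw
  · have hgr : ∀ i, Γ.Growth fun z => m z i := fun i =>
      (((Contour.growth_of_continuousOn hS.isOpen_compl hsub (continuousOn_oneSoliton hζ hγ i)).add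
        (growth_cauchyOp hFi hk i)).const_mul c).congr hS hd fun z hz => by
          rw [hm z hz]; rfl
    obtain ⟨K, δ, hδ, hK⟩ := hgr 0
    obtain ⟨L, η, hη, hL⟩ := hgr 1
    refine ⟨K + L, min δ η, lt_min hδ hη, fun z hz hzd => ?_⟩
    have h1 := hK z hz (hzd.trans_le (min_le_left _ _))
    have h2 := hL z hz (hzd.trans_le (min_le_right _ _))
    have h3 : ‖m z‖ ≤ ‖m z 0‖ + ‖m z 1‖ :=
      (pi_norm_le_iff_of_nonneg (by positivity)).2 (Fin.forall_fin_two.2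
        ⟨le_add_of_nonneg_right (norm_nonneg _), le_add_of_nonneg_left (norm_nonneg _)⟩)
    have h4 := mul_le_mul_of_nonneg_right h3 (Real.sqrt_nonneg (Metric.infDist z Γ.support))
    rw [add_mul] at h4
    linarith
  · refine Contour.hasBoundaryValues_of_bv fun i => ?_
    refine ((((hsol i 1).add ((hP₁ i).add (hP₂ i))).const_mul c).congr_left one_ne_zero hS hd
      fun z hz => hadd z hz i).congr_right ?_
    filter_upwards [hkey i] with z hz
    rw [Matrix.vecMul_add, Matrix.vecMul_one]
    simp only [Pi.smul_apply, Pi.add_apply, smul_eq_mul]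
    rw [hz]
    ring
  · refine Contour.hasBoundaryValues_of_bv fun i => ?_
    refine ((((hsol i (-1)).add ((hP₁' i).add (hP₂' i))).const_mul c).congr_left (by norm_num) hS hd
      fun z hz => hadd z hz i).congr_right ?_
    filter_upwards [hkey i] with z hz
    rw [Matrix.vecMul_sub, Matrix.vecMul_one]
    simp only [Pi.smul_apply, Pi.sub_apply, smul_eq_mul]
    rw [hz]
    ring
  · filter_upwards [Contour.ae_mem_support] with z hz
    rw [h.jump_eq z hz, Matrix.smul_vecMul, Matrix.vecMul_vecMul, ← mul_assoc,
      Matrix.mul_nonsing_inv _ ((Matrix.isUnit_iff_isUnit_det _).1 (h.isUnit_bm z hz)), one_mul]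
  · have hζm : (ζ : ℂ) ∈ ({(ζ : ℂ), (ζ : ℂ)⁻¹} : Set ℂ) := by simp
    have hpole : (ζ : ℂ) ≠ pole ζ 1 := pole_injective hζ
    refine residueCondition_of (i := 0) (j := 1) (by decide) (vecMul_residue_zero _)
      (c := c * solitonConst ζ γ 0) (ρ := c * solitonRes ζ γ 0)
      (g := fun z => c * cauchyOp Γ ζ F z 0)
      (g' := fun z => c * (oneSoliton ζ γ z 1 + cauchyOp Γ ζ F z 1))
      (continuousAt_const.mul (hcont _ h.zeta_notMem 0))
      (continuousAt_const.mul ((differentiableAt_oneSoliton hζ hγ hpole).continuousAt.add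
        (hcont _ h.zeta_notMem 1))) ?_ ?_ ?_
    · filter_upwards [hnear _ hζm, self_mem_nhdsWithin] with z hz hz1
      rw [hm z hz, Pi.smul_apply, Pi.add_apply, oneSoliton_apply hζ hγ 0 hz1, smul_eq_mul]
      simp only [pole, Matrix.cons_val_zero]
      ring
    · filter_upwards [hnear _ hζm] with z hz
      rw [hm z hz]
      rfl
    -- The second component of the Cauchy term vanishes at the pole of the first, so only the
    -- relation for m₀ remains.
    · have e1 : cauchyOp Γ ζ F ζ 1 = 0 := cauchyOp_kernelZero hFi hk 1
      rw [e1, oneSoliton_apply hζ hγ 1 hpole, add_zero, ← solitonRes_zero hζ hγ]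
      simp only [pole, Matrix.cons_val_one, Matrix.cons_val_fin_one]
      ring
  · have hζm : (ζ : ℂ)⁻¹ ∈ ({(ζ : ℂ), (ζ : ℂ)⁻¹} : Set ℂ) := by simp
    have hpole : (ζ : ℂ)⁻¹ ≠ pole ζ 0 := (pole_injective hζ).symm
    refine residueCondition_of (i := 1) (j := 0) (by decide) (vecMul_residue_one _)
      (c := c * solitonConst ζ γ 1) (ρ := c * solitonRes ζ γ 1)
      (g := fun z => c * cauchyOp Γ ζ F z 1)
      (g' := fun z => c * (oneSoliton ζ γ z 0 + cauchyOp Γ ζ F z 0))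
      (continuousAt_const.mul (hcont _ (hk 0) 1))
      (continuousAt_const.mul ((differentiableAt_oneSoliton hζ hγ hpole).continuousAt.add
        (hcont _ (hk 0) 0))) ?_ ?_ ?_
    · filter_upwards [hnear _ hζm, self_mem_nhdsWithin] with z hz hz1
      rw [hm z hz, Pi.smul_apply, Pi.add_apply, oneSoliton_apply hζ hγ 1 hz1, smul_eq_mul]
      simp only [pole, Matrix.cons_val_one, Matrix.cons_val_fin_one]
      ring
    · filter_upwards [hnear _ hζm] with z hz
      rw [hm z hz]
      rfl
    · have e1 : cauchyOp Γ ζ F (ζ : ℂ)⁻¹ 0 = 0 := cauchyOp_kernelZero hFi hk 0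
      rw [e1, oneSoliton_apply hζ hγ 0 hpole, add_zero, ← solitonRes_one hζ hγ]
      simp only [pole, Matrix.cons_val_zero]
      ring
  · intro z hz
    simp only [mem_union, mem_insert_iff, mem_singleton_iff, not_or] at hz
    obtain ⟨hz1, hz2, hz3, hz4⟩ := hz
    have hz5 : z ∉ Γ.support ∪ {(ζ : ℂ), (ζ : ℂ)⁻¹} := by simp [hz1, hz3, hz4]
    have hz6 : z⁻¹ ∉ Γ.support ∪ {(ζ : ℂ), (ζ : ℂ)⁻¹} := by
      simp only [mem_union, hΓ.inv_mem_iff, mem_insert_iff, mem_singleton_iff, inv_inj, not_or]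
      exact ⟨hz1, fun h => hz4 (inv_eq_iff_eq_inv.1 h), hz3⟩
    rw [hm z hz5, hm _ hz6, oneSoliton_inv hζ hz2 hz3 hz4,
      cauchyOp_inv hΓ hFi hanti h0 hk hz1 hz2, ← Matrix.add_vecMul, Matrix.smul_vecMul]
  · have hz : (0 : ℂ) ∉ Γ.support ∪ {(ζ : ℂ), (ζ : ℂ)⁻¹} := by
      simp [h.zero_notMem, h0.symm, (inv_ne_zero h0).symm]
    rw [hm 0 hz, Pi.smul_apply, Pi.add_apply, oneSoliton_zero hζ hγ, ← hct, smul_eq_mul, hc1]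

/-! ### From the Riemann–Hilbert problem to the singular integral equation -/

lemma tendsto_inv_cocompact : Tendsto (fun z : ℂ => z⁻¹) (cocompact ℂ) (𝓝 0) :=
  (tendsto_inv₀_cobounded (α := ℂ)).mono_left (Metric.cobounded_eq_cocompact (α := ℂ)).ge

namespace Contour
variable {Γ : Contour}

/-- A function with one simple pole is recovered from its jump. -/
theorem eq_add_cauchy {g f gp gm : ℂ → ℂ} {p p' ρ L : ℂ} (hpp : p ≠ p')
    (hd : Disjoint ({p, p'} : Set ℂ) Γ.support)
    (hg : DifferentiableOn ℂ g (Γ.support ∪ {p, p'})ᶜ) (hgr : Γ.Growth g)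
    (hf : MemLp f 2 Γ.arcLength) (hp : Γ.BV 1 g gp) (hm : Γ.BV (-1) g gm)
    (hjump : ∀ᵐ z ∂Γ.arcLength, gp z - gm z = f z)
    (hres : Tendsto (fun z => (z - p) * g z) (𝓝[≠] p) (𝓝 ρ))
    (hreg : Tendsto (fun z => (z - p') * g z) (𝓝[≠] p') (𝓝 0))
    (hinf : Tendsto g (cocompact ℂ) (𝓝 L)) :
    ∀ z ∉ Γ.support ∪ {p, p'}, g z = L + ρ / (z - p) + Γ.cauchy f z := by
  have hpS : p ∉ Γ.support := disjoint_left.1 hd (by simp)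
  have hp'S : p' ∉ Γ.support := disjoint_left.1 hd (by simp)
  have hcd : ∀ z ∉ Γ.support, DifferentiableAt ℂ (Γ.cauchy f) z := fun z hz =>
    (differentiableOn_cauchy hf).differentiableAt (isCompact_support.isClosed.isOpen_compl.mem_nhds hz)
  have hRc : ContinuousOn (fun z => ρ / (z - p)) ({p}ᶜ : Set ℂ) :=
    continuousOn_const.div (continuousOn_id.sub continuousOn_const) fun z hz => sub_ne_zero.2 hz
  have hsub : Γ.support ⊆ ({p}ᶜ : Set ℂ) := fun z hz h => hpS (mem_singleton_iff.1 h ▸ hz)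
  have hO : IsOpen ({p}ᶜ : Set ℂ) := isOpen_compl_singleton
  obtain ⟨P, hP, hP'⟩ := exists_bv_cauchy hf
  have hR := fun side => BV.of_continuousOn (Γ := Γ) side hO hsub hRc
  have hcgr : Γ.Growth (Γ.cauchy f) := by
    obtain ⟨K, hK⟩ := exists_norm_cauchy_mul_sqrt_le hf
    exact ⟨K, 1, one_pos, fun z hz _ => hK z hz⟩
  have hm' : Γ.BV (-1) (fun z => g z - Γ.cauchy f z - ρ / (z - p))
      (fun z => gp z - P z - ρ / (z - p)) := by
    refine ((hm.sub hP').sub (hR (-1))).congr_right ?_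
    filter_upwards [hjump] with z hz
    rw [← hz]
    ring
  have hsubz : ∀ a b : ℂ, Tendsto (fun z : ℂ => z - b) (𝓝[≠] a) (𝓝 (a - b)) := fun a b =>
    (by fun_prop : ContinuousAt (fun z : ℂ => z - b) a).tendsto.mono_left nhdsWithin_le_nhds
  have hct : ∀ a ∉ Γ.support, Tendsto (Γ.cauchy f) (𝓝[≠] a) (𝓝 (Γ.cauchy f a)) := fun a ha =>
    (hcd a ha).continuousAt.tendsto.mono_left nhdsWithin_le_nhds
  have hlim : Tendsto (fun z => g z - Γ.cauchy f z - ρ / (z - p)) (cocompact ℂ) (𝓝 L) := by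
    have h1 : Tendsto (fun z : ℂ => ρ / (z - p)) (cocompact ℂ) (𝓝 0) := by
      have h2 : Tendsto (fun z : ℂ => z - p) (cocompact ℂ) (cocompact ℂ) :=
        (Homeomorph.subRight p).isClosedEmbedding.tendsto_cocompact
      simpa [div_eq_mul_inv, Function.comp_def] using (tendsto_inv_cocompact.comp h2).const_mul ρ
    simpa using (hinf.sub (tendsto_cauchy_cocompact hf)).sub h1
  have hdiff : DifferentiableOn ℂ (fun z => g z - Γ.cauchy f z - ρ / (z - p))
      (Γ.support ∪ {p, p'})ᶜ := by
    refine (hg.sub fun z hz => (hcd z fun h => hz (Or.inl h)).differentiableWithinAt).sub ?_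
    refine (differentiableOn_const ρ).div (differentiableOn_id.sub_const p) fun z hz => ?_
    exact sub_ne_zero.2 fun h => hz (Or.inr (Or.inl h))
  -- At p the residue cancels against ρ/(z − p); at p' the residue of g is zero and the subtracted
  -- terms are continuous.
  have hpole : ∀ a ∈ ({p, p'} : Set ℂ), Tendsto
      (fun z => (z - a) * (g z - Γ.cauchy f z - ρ / (z - p))) (𝓝[≠] a) (𝓝 0) := by
    rintro a (rfl | rfl)
    · have h1 := (hres.sub ((hsubz a a).mul (hct a hpS))).sub
        (tendsto_const_nhds (x := ρ) (f := 𝓝[≠] a))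
      simp only [sub_self, zero_mul, sub_zero] at h1
      refine h1.congr' ?_
      filter_upwards [self_mem_nhdsWithin] with z hz
      have := sub_ne_zero.2 hz
      field_simp
    · have h1 := (hreg.sub ((hsubz a a).mul (hct a hp'S))).sub
        ((hsubz a a).mul ((tendsto_const_nhds (x := ρ)).div (hsubz a p) (sub_ne_zero.2 hpp.symm)))
      simp only [sub_self, zero_mul] at h1
      refine h1.congr fun z => ?_
      simp only [Pi.div_apply]
      ring
  have := eq_const_of_no_jump (toFinite _) hd hdiff
    ((hgr.sub hcgr).sub (growth_of_continuousOn hO hsub hRc)) ((hp.sub hP).sub (hR 1)) hm' hpole hlim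
  intro z hz
  rw [← this z hz]
  ring

end Contour

variable {Γ : Contour} {ζ γ : ℝ} {v wp wm : ℂ → Matrix (Fin 2) (Fin 2) ℂ}

lemma continuousOn_matrix_inv {A : ℂ → Matrix (Fin 2) (Fin 2) ℂ} {s : Set ℂ}
    (hA : ContinuousOn A s) (hu : ∀ z ∈ s, IsUnit (A z)) : ContinuousOn (fun z => (A z)⁻¹) s := by
  simp only [Matrix.inv_def, Ring.inverse_eq_inv']
  refine ContinuousOn.smul (ContinuousOn.inv₀
    ((continuous_id.matrix_det).comp_continuousOn hA) fun z hz => ?_)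
    ((continuous_id.matrix_adjugate).comp_continuousOn hA)
  exact ((Matrix.isUnit_iff_isUnit_det _).1 (hu z hz)).ne_zero

lemma vecMul_mul_inv {A : Matrix (Fin 2) (Fin 2) ℂ} (hA : IsUnit A) (x : Fin 2 → ℂ) :
    (x ᵥ* A) ᵥ* A⁻¹ = x := by
  rw [Matrix.vecMul_vecMul, Matrix.mul_nonsing_inv _ ((Matrix.isUnit_iff_isUnit_det _).1 hA),
    Matrix.vecMul_one]

lemma vecMul_inv_mul {A : Matrix (Fin 2) (Fin 2) ℂ} (hA : IsUnit A) (x : Fin 2 → ℂ) :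
    (x ᵥ* A⁻¹) ᵥ* A = x := by
  rw [Matrix.vecMul_vecMul, Matrix.nonsing_inv_mul _ ((Matrix.isUnit_iff_isUnit_det _).1 hA),
    Matrix.vecMul_one]

namespace SolvesRHP
variable {m mp mm : ℂ → Fin 2 → ℂ}

lemma bv (h : SymmetricHypothesis Γ ζ v wp wm) (hm : SolvesRHP Γ ζ γ v m mp mm) (i : Fin 2) :
    Γ.BV 1 (fun z => m z i) (fun z => mp z i) ∧ Γ.BV (-1) (fun z => m z i) (fun z => mm z i) :=
  ⟨Contour.bv_of_hasBoundaryValues one_ne_zero isClosed_poles h.disjoint_poles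
    hm.holomorphic.continuousOn hm.boundary_plus i,
  Contour.bv_of_hasBoundaryValues (by norm_num) isClosed_poles h.disjoint_poles
    hm.holomorphic.continuousOn hm.boundary_minus i⟩

lemma growth_apply (hm : SolvesRHP Γ ζ γ v m mp mm) (i : Fin 2) : Γ.Growth fun z => m z i := by
  obtain ⟨K, δ, hδ, hK⟩ := hm.growth
  refine ⟨K, δ, hδ, fun z hz hzd => le_trans ?_ (hK z hz hzd)⟩
  exact mul_le_mul_of_nonneg_right (norm_le_pi_norm _ i) (Real.sqrt_nonneg _)

/-- Residues and limits of the components at the poles. -/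
lemma exists_residues (hm : SolvesRHP Γ ζ γ v m mp mm) : ∃ ρ : Fin 2 → ℂ,
    (∀ i, Tendsto (fun z => (z - pole ζ i) * m z i) (𝓝[≠] (pole ζ i)) (𝓝 (ρ i))) ∧
    (∀ i, Tendsto (fun z => (z - kernelZero ζ i) * m z i) (𝓝[≠] (kernelZero ζ i)) (𝓝 0)) ∧
    Tendsto (fun z => (ζ : ℂ)⁻¹ * γ * m z 0) (𝓝[≠] (ζ : ℂ)⁻¹) (𝓝 (ρ 1)) := by
  obtain ⟨r, h1, h2⟩ := hm.residue
  obtain ⟨r', h1', h2'⟩ := hm.residue_inv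
  simp only [vecMul_residue_zero] at h2
  simp only [vecMul_residue_one] at h2'
  rw [tendsto_pi_nhds] at h1 h2 h1' h2'
  -- One column of the residue matrix is zero, so the second component has no residue at ζ;
  -- similarly the first has none at 1/ζ.
  have hr : r 1 = 0 := tendsto_nhds_unique (h2 1) (by simp)
  have hr' : r' 0 = 0 := tendsto_nhds_unique (h2' 0) (by simp)
  refine ⟨![r 0, r' 1], ?_, ?_, ?_⟩
  · rw [Fin.forall_fin_two]
    exact ⟨h1 0, h1' 1⟩
  · rw [Fin.forall_fin_two]
    refine ⟨?_, ?_⟩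
    · have := h1' 0
      rw [hr'] at this
      exact this
    · have := h1 1
      rw [hr] at this
      exact this
  · have := h2' 1
    simpa using this

/-- By symmetry the behaviour at infinity is that at the origin with the components exchanged. -/
lemma tendsto_cocompact (h : SymmetricHypothesis Γ ζ v wp wm)
    (hζ : ζ ∈ Ioo (-1 : ℝ) 0 ∪ Ioo (0 : ℝ) 1) (hm : SolvesRHP Γ ζ γ v m mp mm) :
    Tendsto m (cocompact ℂ) (𝓝 (m 0 ᵥ* swapMatrix)) := by
  have h0 := zeta_ne_zero hζ
  have h0mem : (0 : ℂ) ∉ Γ.support ∪ {(ζ : ℂ), (ζ : ℂ)⁻¹} := by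
    simp [h.zero_notMem, h0.symm, (inv_ne_zero h0).symm]
  have hc : ContinuousAt m 0 := (hm.holomorphic.differentiableAt
    ((Contour.isCompact_support.isClosed.union isClosed_poles).isOpen_compl.mem_nhds
      h0mem)).continuousAt
  have h1 : Tendsto (fun z : ℂ => m z⁻¹ ᵥ* swapMatrix) (cocompact ℂ) (𝓝 (m 0 ᵥ* swapMatrix)) := by
    have h2 : Continuous fun x : Fin 2 → ℂ => x ᵥ* swapMatrix :=
      continuous_id.matrix_vecMul continuous_const
    exact (h2.tendsto _).comp (hc.tendsto.comp tendsto_inv_cocompact)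
  refine h1.congr' ?_
  have hfin : IsCompact (Γ.support ∪ {0, (ζ : ℂ), (ζ : ℂ)⁻¹}) :=
    Contour.isCompact_support.union (toFinite _).isCompact
  filter_upwards [hfin.compl_mem_cocompact] with z hz
  rw [hm.symm z hz, Matrix.vecMul_vecMul, swapMatrix_mul_swapMatrix, Matrix.vecMul_one]

end SolvesRHP

variable {Γ : Contour} {ζ γ : ℝ} {v wp wm : ℂ → Matrix (Fin 2) (Fin 2) ℂ}

namespace SolvesRHP
variable {m mp mm : ℂ → Fin 2 → ℂ}

lemma inv_notMem (h : SymmetricHypothesis Γ ζ v wp wm) {z : ℂ}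
    (hz : z ∉ Γ.support ∪ {(ζ : ℂ), (ζ : ℂ)⁻¹}) : z⁻¹ ∉ Γ.support ∪ {(ζ : ℂ), (ζ : ℂ)⁻¹} := by
  simp only [mem_union, h.invSymm.inv_mem_iff, mem_insert_iff, mem_singleton_iff, inv_inj,
    not_or] at hz ⊢
  exact ⟨hz.1, fun h => hz.2.2 (inv_eq_iff_eq_inv.1 h), hz.2.1⟩

/-- The components of a solution in terms of their jumps and residues. -/
lemma exists_eq_cauchy (h : SymmetricHypothesis Γ ζ v wp wm)
    (hζ : ζ ∈ Ioo (-1 : ℝ) 0 ∪ Ioo (0 : ℝ) 1) (hm : SolvesRHP Γ ζ γ v m mp mm)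
    {F : ℂ → Fin 2 → ℂ} (hF : ∀ i, MemLp (fun z => F z i) 2 Γ.arcLength)
    (hjump : ∀ᵐ z ∂Γ.arcLength, mp z - mm z = F z) : ∃ ρ L : Fin 2 → ℂ, L 1 = 1 ∧
    Tendsto (fun z => (ζ : ℂ)⁻¹ * γ * m z 0) (𝓝[≠] (ζ : ℂ)⁻¹) (𝓝 (ρ 1)) ∧
    ∀ i, ∀ z ∉ Γ.support ∪ {(ζ : ℂ), (ζ : ℂ)⁻¹},
      m z i = L i + ρ i / (z - pole ζ i) + Γ.cauchy (fun s => F s i) z := by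
  obtain ⟨ρ, h1, h2, h3⟩ := hm.exists_residues
  have hset : ∀ i, ({pole ζ i, kernelZero ζ i} : Set ℂ) = {(ζ : ℂ), (ζ : ℂ)⁻¹} := by
    rw [Fin.forall_fin_two]
    exact ⟨rfl, pair_comm _ _⟩
  have hne : ∀ i, pole ζ i ≠ kernelZero ζ i := by
    rw [Fin.forall_fin_two]
    exact ⟨pole_injective hζ, (pole_injective hζ).symm⟩
  refine ⟨ρ, m 0 ᵥ* swapMatrix, ?_, h3, fun i z hz => ?_⟩
  · rw [vecMul_swapMatrix]
    exact hm.normalization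
  · rw [← hset i] at hz
    refine Contour.eq_add_cauchy (hne i) (by rw [hset i]; exact h.disjoint_poles) ?_
      (hm.growth_apply i) (hF i) (hm.bv h i).1 (hm.bv h i).2 ?_ (h1 i) (h2 i) ?_ z hz
    · rw [hset i]
      exact fun w hw => (differentiableWithinAt_pi.1 (hm.holomorphic w hw)) i
    · filter_upwards [hjump] with w hw using congrFun hw i
    · exact ((continuous_apply i).tendsto _).comp (hm.tendsto_cocompact h hζ)

/-- The inversion exchanges the boundary values of a solution. -/
lemma boundary_inv (h : SymmetricHypothesis Γ ζ v wp wm)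
    (hζ : ζ ∈ Ioo (-1 : ℝ) 0 ∪ Ioo (0 : ℝ) 1) (hm : SolvesRHP Γ ζ γ v m mp mm) :
    (∀ᵐ z ∂Γ.arcLength, mp z⁻¹ = mm z ᵥ* swapMatrix) ∧
      ∀ᵐ z ∂Γ.arcLength, mm z⁻¹ = mp z ᵥ* swapMatrix := by
  have hΓ := h.invSymm
  have h0 := zeta_ne_zero hζ
  have hF : ∀ i, MemLp (fun z => (mp z - mm z) i) 2 Γ.arcLength := fun i =>
    (hm.bv h i).1.memLp.sub (hm.bv h i).2.memLp
  obtain ⟨ρ, L, -, -, hm0⟩ := hm.exists_eq_cauchy h hζ hF (ae_of_all _ fun _ => rfl)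
  set C := Γ.cauchy fun s => (mp s - mm s) 0 with hC
  set R : ℂ → ℂ := fun z => L 0 + ρ 0 / (z - ζ) with hR
  have hζS := h.zeta_notMem
  have hRc : ContinuousOn R ({(ζ : ℂ)}ᶜ : Set ℂ) := continuousOn_const.add
    (continuousOn_const.div (continuousOn_id.sub continuousOn_const) fun z hz => sub_ne_zero.2 hz)
  have hRic : ContinuousOn (fun z => R z⁻¹) ({0, (ζ : ℂ)⁻¹}ᶜ : Set ℂ) := by
    refine hRc.comp (continuousOn_id.inv₀ fun z hz h => hz (Or.inl h)) fun z hz h => hz (Or.inr ?_)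
    rw [mem_singleton_iff] at h ⊢
    rw [← h, inv_inv]
  have hO : IsOpen ({0, (ζ : ℂ)⁻¹}ᶜ : Set ℂ) := (toFinite _).isClosed.isOpen_compl
  have hsub : Γ.support ⊆ ({(ζ : ℂ)}ᶜ : Set ℂ) := fun z hz h => hζS (mem_singleton_iff.1 h ▸ hz)
  have hsub' : Γ.support ⊆ ({0, (ζ : ℂ)⁻¹}ᶜ : Set ℂ) := by
    rintro z hz (rfl | rfl)
    · exact h.zero_notMem hz
    · exact h.kernelZero_notMem 0 hz
  have hd3 : Disjoint ({0, (ζ : ℂ), (ζ : ℂ)⁻¹} : Set ℂ) Γ.support := by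
    rw [disjoint_left]
    rintro z (rfl | hz)
    · exact h.zero_notMem
    · exact disjoint_left.1 h.disjoint_poles hz
  -- The first component is the Cauchy integral C plus a rational function R continuous near Σ, and
  -- the second is the first at 1/z. So both kinds of boundary values reduce to those of C and of z
  -- ↦ C(1/z).
  have hBV : ∀ side : ℝ, side ≠ 0 → ∀ f, Γ.BV side (fun z => m z 0) f →
      Γ.BV side C fun z => f z - R z := fun side hs f hf =>
    (hf.sub (Contour.BV.of_continuousOn side isOpen_compl_singleton hsub hRc)).congr_left hs
      isClosed_poles h.disjoint_poles fun z hz => by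
        rw [hm0 0 z hz]
        simp only [hR, pole, Matrix.cons_val_zero]
        ring
  have hBVi : ∀ side : ℝ, side ≠ 0 → ∀ f, Γ.BV side (fun z => m z 1) f →
      Γ.BV side (fun z => C z⁻¹) fun z => f z - R z⁻¹ := fun side hs f hf =>
    (hf.sub (Contour.BV.of_continuousOn side hO hsub' hRic)).congr_left hs
      (toFinite _).isClosed hd3 fun z hz => by
        have hz2 : z ∉ Γ.support ∪ {(ζ : ℂ), (ζ : ℂ)⁻¹} := fun h => hz (h.imp id Or.inr)
        have e := congrFun (hm.symm z hz) 0
        rw [vecMul_swapMatrix, hm0 0 _ (inv_notMem h hz2)] at e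
        simp only [Matrix.cons_val_zero] at e
        rw [← e]
        simp only [hR, pole, Matrix.cons_val_zero]
        ring
  -- Each application relates opposite sides of the two components; replacing z by 1/z in the
  -- results yields the remaining two identities.
  have h1 := Contour.ae_bv_inv hΓ (hF 0) (by simp) (hBV 1 one_ne_zero _ (hm.bv h 0).1)
    (hBVi (-1) (by norm_num) _ (hm.bv h 1).2)
  have h2 := Contour.ae_bv_inv hΓ (hF 0) (by simp) (hBV (-1) (by norm_num) _ (hm.bv h 0).2)
    (hBVi (- -1) (by norm_num) _ (by simpa using (hm.bv h 1).1))
  have h3 := Contour.ae_inv hΓ h1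
  have h4 := Contour.ae_inv hΓ h2
  refine ⟨?_, ?_⟩
  · filter_upwards [h1, h4] with z e1 e4
    simp only [inv_inv] at e4
    rw [vecMul_swapMatrix]
    funext i
    fin_cases i
    · simp only [Fin.zero_eta, Matrix.cons_val_zero]
      linear_combination -e1
    · simp only [Fin.mk_one, Matrix.cons_val_one, Matrix.cons_val_fin_one]
      linear_combination e4
  · filter_upwards [h2, h3] with z e2 e3
    simp only [inv_inv] at e3
    rw [vecMul_swapMatrix]
    funext i
    fin_cases i
    · simp only [Fin.zero_eta, Matrix.cons_val_zero]
      linear_combination -e2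
    · simp only [Fin.mk_one, Matrix.cons_val_one, Matrix.cons_val_fin_one]
      linear_combination e3

/-- The scalar representation leaves four unknowns, the constants A i and residues ρ i. The limit at
infinity, the normalization at 0, the polar part of the symmetry relation and the residue condition
at 1/ζ determine them; the integral equation is then the boundary value of the resulting formula. -/
theorem eq_and_solvesSIE (hζ : ζ ∈ Ioo (-1 : ℝ) 0 ∪ Ioo (0 : ℝ) 1) (hγ : 0 ≤ γ)
    (h : SymmetricHypothesis Γ ζ v wp wm) (hm : SolvesRHP Γ ζ γ v m mp mm) {μ : ℂ → Fin 2 → ℂ}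
    (hμ : ∀ᵐ z ∂Γ.arcLength, μ z = mp z ᵥ* (1 + wp z)⁻¹) {c₀ : ℂ}
    (hc₀ : c₀ = cauchyOp Γ ζ (fun s => μ s ᵥ* (wp s + wm s)) 0 0) :
    (∀ᵐ z ∂Γ.arcLength, μ z = mm z ᵥ* (1 - wm z)⁻¹) ∧
    (∀ z ∉ Γ.support ∪ {(ζ : ℂ), (ζ : ℂ)⁻¹},
      m z = (1 - c₀) • oneSoliton ζ γ z + cauchyOp Γ ζ (fun s => μ s ᵥ* (wp s + wm s)) z) ∧
    SolvesSIE Γ ζ wp wm μ (fun z => (1 - c₀) • oneSoliton ζ γ z) := by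
  have hΓ := h.invSymm
  have hk := h.kernelZero_notMem
  have h0 := zeta_ne_zero hζ
  have hq := one_sub_zeta_sq_ne hζ
  have hden := soliton_den_ne hζ hγ
  have hμm : ∀ᵐ z ∂Γ.arcLength, μ z = mm z ᵥ* (1 - wm z)⁻¹ := by
    filter_upwards [hμ, hm.jump, Contour.ae_mem_support] with z h1 h2 h3
    rw [h1, h2, h.jump_eq z h3, ← Matrix.vecMul_vecMul, vecMul_mul_inv (h.isUnit_bp h3)]
  have hmp : ∀ᵐ z ∂Γ.arcLength, mp z = μ z + μ z ᵥ* wp z := by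
    filter_upwards [hμ, Contour.ae_mem_support] with z h1 h3
    have := vecMul_inv_mul (h.isUnit_bp h3) (mp z)
    rw [← h1, Matrix.vecMul_add, Matrix.vecMul_one] at this
    exact this.symm
  have hmm : ∀ᵐ z ∂Γ.arcLength, mm z = μ z - μ z ᵥ* wm z := by
    filter_upwards [hμm, Contour.ae_mem_support] with z h1 h3
    have := vecMul_inv_mul (h.isUnit_bm z h3) (mm z)
    rw [← h1, Matrix.vecMul_sub, Matrix.vecMul_one] at this
    exact this.symm
  have hμi : ∀ i, MemLp (fun z => μ z i) 2 Γ.arcLength := by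
    intro i
    refine (memLp_vecMul (fun i => (hm.bv h i).1.memLp) (continuousOn_matrix_inv
      (continuousOn_const.add h.continuousOn_wp) fun z hz => h.isUnit_bp hz) i).ae_eq ?_
    filter_upwards [hμ] with z hz
    rw [hz]
    rfl
  -- Combines m₊(1/z) = m₋(z)σ with b₊(1/z) = σb₋(z)σ.
  have hμs : ∀ᵐ z ∂Γ.arcLength, μ z⁻¹ = μ z ᵥ* swapMatrix := by
    filter_upwards [Contour.ae_inv hΓ hμ, hμm, (hm.boundary_inv h hζ).1, Contour.ae_mem_support]
      with z h1 h2 h3 h4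
    have hU := h.isUnit_bp (hΓ.inv_mem h4)
    rw [h1, h3, ← vecMul_mul_inv hU (μ z ᵥ* swapMatrix)]
    congr 1
    have e := h.one_add_wp (hΓ.inv_mem h4)
    rw [inv_inv] at e
    rw [e, Matrix.vecMul_vecMul, ← mul_assoc, ← mul_assoc, swapMatrix_mul_swapMatrix, one_mul,
      ← Matrix.vecMul_vecMul, h2, vecMul_inv_mul (h.isUnit_bm z h4)]
  have hf₁ := memLp_vecMul hμi h.continuousOn_wp
  have hf₂ := memLp_vecMul hμi h.continuousOn_wm
  set F : ℂ → Fin 2 → ℂ := fun s => μ s ᵥ* (wp s + wm s) with hF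
  have hFi : ∀ i, MemLp (fun z => F z i) 2 Γ.arcLength :=
    memLp_vecMul hμi (h.continuousOn_wp.add h.continuousOn_wm)
  have hFadd : F = fun s => μ s ᵥ* wp s + μ s ᵥ* wm s := by
    funext s
    simp only [hF, Matrix.vecMul_add]
  have hanti : AntiSymm Γ F := h.antiSymm hμs
  have hjump : ∀ᵐ z ∂Γ.arcLength, mp z - mm z = F z := by
    filter_upwards [hmp, hmm] with z h1 h2
    simp only [h1, h2, hFadd]
    abel
  obtain ⟨ρ, L, hL1, hρ1, hform⟩ := hm.exists_eq_cauchy h hζ hFi hjump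
  set A : Fin 2 → ℂ := fun i => L i + Γ.cauchy (fun s => F s i) (kernelZero ζ i) with hA
  have hmA : ∀ i, ∀ z ∉ Γ.support ∪ {(ζ : ℂ), (ζ : ℂ)⁻¹},
      m z i = A i + ρ i / (z - pole ζ i) + cauchyOp Γ ζ F z i := by
    intro i z hz
    rw [hform i z hz, cauchyOp_apply hFi hk fun h => hz (Or.inl h), hA]
    ring
  set a := 1 - c₀ with ha
  -- The second component of m tends to m₁(0) = 1 at infinity (m₁ being the first component), while
  -- that of the Cauchy term tends to c₀.
  have hA1 : A 1 = a := by
    have h1 : Tendsto (fun z => cauchyOp Γ ζ F z 1) (cocompact ℂ)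
        (𝓝 (0 - Γ.cauchy (fun s => F s 1) (kernelZero ζ 1))) := by
      refine ((Contour.tendsto_cauchy_cocompact (hFi 1)).sub tendsto_const_nhds).congr' ?_
      filter_upwards [(Contour.isCompact_support (Γ := Γ)).compl_mem_cocompact] with z hz
      exact (cauchyOp_apply hFi hk hz 1).symm
    have h2 := tendsto_nhds_unique (tendsto_cauchyOp_cocompact hΓ hFi hanti h0 hk) h1
    rw [← hc₀] at h2
    simp only [hA, hL1, ha]
    linear_combination h2
  -- The normalization of the first component at the origin.
  have hA0 : A 0 = a + ρ 0 / ζ := by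
    have hz : (0 : ℂ) ∉ Γ.support ∪ {(ζ : ℂ), (ζ : ℂ)⁻¹} := by
      simp [h.zero_notMem, h0.symm, (inv_ne_zero h0).symm]
    have h1 := hmA 0 0 hz
    rw [hm.normalization, ← hc₀, zero_sub, div_neg] at h1
    simp only [pole, Matrix.cons_val_zero] at h1
    linear_combination -h1
  have hnear := h.eventually_notMem
  -- In the symmetry relation near ζ the Cauchy terms cancel; comparing the polar parts relates the
  -- two residues.
  have hρ : ρ 0 = -(ζ : ℂ) ^ 2 * ρ 1 := by
    have h1 : ContinuousAt (fun z : ℂ => (z - ζ) * A 0 + ρ 0) ζ := by fun_prop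
    have h2 : ContinuousAt (fun z : ℂ => (z - ζ) * A 1 - ρ 1 * z * ζ) ζ := by fun_prop
    have h3 : (fun z : ℂ => (z - ζ) * A 0 + ρ 0) =ᶠ[𝓝[≠] (ζ : ℂ)]
        fun z => (z - ζ) * A 1 - ρ 1 * z * ζ := by
      filter_upwards [hnear ζ (by simp), nhdsWithin_le_nhds (isOpen_ne.mem_nhds h0),
        self_mem_nhdsWithin] with z hz hz0 hzζ
      have hzζ' := sub_ne_zero.2 hzζ
      have hz3 : z ∉ Γ.support ∪ {0, (ζ : ℂ), (ζ : ℂ)⁻¹} := by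
        rintro (h1 | rfl | h1)
        · exact hz (Or.inl h1)
        · exact hz0 rfl
        · exact hz (Or.inr h1)
      have e1 := congrFun (hm.symm z hz3) 1
      have e2 := congrFun (cauchyOp_inv hΓ hFi hanti h0 hk (fun h => hz (Or.inl h)) hz0) 1
      rw [vecMul_swapMatrix, hmA 1 _ (inv_notMem h hz)] at e1
      rw [vecMul_swapMatrix] at e2
      simp only [Matrix.cons_val_one, Matrix.cons_val_fin_one] at e1 e2
      rw [hmA 0 z hz, e2] at e1
      simp only [pole, Matrix.cons_val_zero, Matrix.cons_val_one, Matrix.cons_val_fin_one] at e1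
      have e3 : z⁻¹ - (ζ : ℂ)⁻¹ = -(z - ζ) / (z * ζ) := by
        field_simp
        ring
      rw [e3] at e1
      have e4 : A 1 + ρ 1 / (-(z - ζ) / (z * ζ)) = A 0 + ρ 0 / (z - ζ) := by
        linear_combination e1
      field_simp at e4
      linear_combination -e4
    have h4 := tendsto_nhds_unique (h1.tendsto.mono_left (nhdsWithin_le_nhds (s := {(ζ : ℂ)}ᶜ)))
      ((h2.tendsto.mono_left nhdsWithin_le_nhds).congr' h3.symm)
    linear_combination h4
  -- The residue condition at 1/ζ, where the first component of the Cauchy term vanishes.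
  have hρ1' : ρ 1 = (ζ : ℂ)⁻¹ * γ * (A 0 + ρ 0 / ((ζ : ℂ)⁻¹ - ζ)) := by
    have hne := (pole_injective hζ).symm
    have hc : ContinuousAt (fun z => (ζ : ℂ)⁻¹ * γ * (A 0 + ρ 0 / (z - ζ) + cauchyOp Γ ζ F z 0))
        (ζ : ℂ)⁻¹ := by
      refine continuousAt_const.mul ((continuousAt_const.add (continuousAt_const.div
        (continuousAt_id.sub continuousAt_const) (sub_ne_zero.2 hne))).add ?_)
      exact (continuous_apply 0).continuousAt.comp (differentiableAt_cauchyOp hFi hk (hk 0)).continuousAt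
    have h1 := (hc.tendsto.mono_left (nhdsWithin_le_nhds (s := {(ζ : ℂ)⁻¹}ᶜ))).congr'
      (f₂ := fun z => (ζ : ℂ)⁻¹ * γ * m z 0) (by
        filter_upwards [hnear _ (show (ζ : ℂ)⁻¹ ∈ _ by simp)] with z hz
        rw [hmA 0 z hz]
        rfl)
    have h2 := tendsto_nhds_unique hρ1 h1
    have e : cauchyOp Γ ζ F (ζ : ℂ)⁻¹ 0 = 0 := cauchyOp_kernelZero hFi hk 0
    rw [e, add_zero] at h2
    exact h2
  -- Eliminating A 0 and ρ 0 leaves one linear equation for ρ 1, solvable because 1 − ζ² + γ is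
  -- nonzero.
  have hr1 : ρ 1 = a * solitonRes ζ γ 1 := by
    rw [hA0, hρ] at hρ1'
    have e : (ζ : ℂ)⁻¹ - (ζ : ℂ) = (1 - ζ ^ 2) / ζ := by field_simp
    rw [e] at hρ1'
    simp only [solitonRes, Matrix.cons_val_one, Matrix.cons_val_fin_one]
    field_simp at hρ1' ⊢
    linear_combination hρ1'
  have hr0 : ρ 0 = a * solitonRes ζ γ 0 := by
    rw [hρ, hr1]
    simp only [solitonRes, Matrix.cons_val_zero, Matrix.cons_val_one, Matrix.cons_val_fin_one]
    field_simp
  have hAi : ∀ i, A i = a * solitonConst ζ γ i := by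
    rw [Fin.forall_fin_two]
    refine ⟨?_, by rw [hA1]; simp [solitonConst]⟩
    rw [hA0, hr0]
    simp only [solitonRes, solitonConst, Matrix.cons_val_zero]
    field_simp
    ring
  have hri : ∀ i, ρ i = a * solitonRes ζ γ i := Fin.forall_fin_two.2 ⟨hr0, hr1⟩
  have hmain : ∀ z ∉ Γ.support ∪ {(ζ : ℂ), (ζ : ℂ)⁻¹},
      m z = a • oneSoliton ζ γ z + cauchyOp Γ ζ F z := by
    intro z hz
    funext i
    rw [hmA i z hz, Pi.add_apply, Pi.smul_apply,
      oneSoliton_apply hζ hγ i (ne_pole (fun h => hz (Or.inr h)) i), hAi, hri, smul_eq_mul]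
    ring
  refine ⟨hμm, hmain, ⟨memLp_pi_iff.2 hμi, hμs⟩, ?_⟩
  obtain ⟨P₁, hP₁, hP₁'⟩ := exists_bv_cauchyOp hf₁ hk
  obtain ⟨P₂, hP₂, hP₂'⟩ := exists_bv_cauchyOp hf₂ hk
  refine ⟨fun z => P₂ z + (P₁ z - μ z ᵥ* wp z), ⟨P₂, fun z => P₁ z - μ z ᵥ* wp z,
    Contour.hasBoundaryValues_of_bv hP₂, Contour.hasBoundaryValues_of_bv hP₁',
    ae_of_all _ fun _ => rfl⟩, ?_⟩
  have hsub : Γ.support ⊆ ({(ζ : ℂ), (ζ : ℂ)⁻¹} : Set ℂ)ᶜ := disjoint_left.1 h.disjoint_poles.symm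
  -- The boundary values of the representation formula from the positive side; with m₊ = μ + μw₊
  -- this is the integral equation.
  have hkey : ∀ i, ∀ᵐ z ∂Γ.arcLength, mp z i = a * oneSoliton ζ γ z i + (P₁ z i + P₂ z i) := by
    intro i
    refine (hm.bv h i).1.unique ((((Contour.BV.of_continuousOn 1 isClosed_poles.isOpen_compl hsub
      (continuousOn_oneSoliton hζ hγ i)).const_mul a).add ((hP₁ i).add (hP₂ i))).congr_left
      one_ne_zero isClosed_poles h.disjoint_poles fun z hz => ?_)
    rw [hmain z hz, hFadd, cauchyOp_add hf₁ hf₂ hk fun h => hz (Or.inl h)]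
    rfl
  filter_upwards [hkey 0, hkey 1, hmp] with z e0 e1 e2
  have e : ∀ i, mp z i = a * oneSoliton ζ γ z i + (P₁ z i + P₂ z i) := Fin.forall_fin_two.2 ⟨e0, e1⟩
  funext i
  have e3 := congrFun e2 i
  rw [e i] at e3
  simp only [Pi.add_apply, Pi.sub_apply, Pi.smul_apply, smul_eq_mul] at e3 ⊢
  linear_combination -e3

end SolvesRHP

end SymRHP

end

theorem theoremA3 (Γ : Contour) (ζ γ : ℝ)
    (hζ : ζ ∈ Set.Ioo (-1 : ℝ) 0 ∪ Set.Ioo (0 : ℝ) 1) (hγ : 0 ≤ γ)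
    (v wp wm : ℂ → Matrix (Fin 2) (Fin 2) ℂ) (h : SymmetricHypothesis Γ ζ v wp wm) :
    (∀ m mp mm : ℂ → Fin 2 → ℂ, SolvesRHP Γ ζ γ v m mp mm →
      ∀ μ : ℂ → Fin 2 → ℂ, (∀ᵐ z ∂Γ.arcLength, μ z = mp z ᵥ* (1 + wp z)⁻¹) →
      ∀ c₀ : ℂ, c₀ = cauchyOp Γ ζ (fun s => μ s ᵥ* (wp s + wm s)) 0 0 →
        (∀ᵐ z ∂Γ.arcLength, μ z = mm z ᵥ* (1 - wm z)⁻¹) ∧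
        (∀ z ∉ Γ.support ∪ {(ζ : ℂ), (ζ : ℂ)⁻¹},
          m z = (1 - c₀) • oneSoliton ζ γ z + cauchyOp Γ ζ (fun s => μ s ᵥ* (wp s + wm s)) z) ∧
        SolvesSIE Γ ζ wp wm μ (fun z => (1 - c₀) • oneSoliton ζ γ z)) ∧
    (∀ μt : ℂ → Fin 2 → ℂ, SolvesSIE Γ ζ wp wm μt (oneSoliton ζ γ) →
      ∀ ct : ℂ, ct = cauchyOp Γ ζ (fun s => μt s ᵥ* (wp s + wm s)) 0 0 → ct ≠ -1 →
      ∀ μ : ℂ → Fin 2 → ℂ, μ = (fun z => (1 + ct)⁻¹ • μt z) →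
      ∀ m : ℂ → Fin 2 → ℂ,
        (∀ z ∉ Γ.support ∪ {(ζ : ℂ), (ζ : ℂ)⁻¹},
          m z = (1 + ct)⁻¹ • oneSoliton ζ γ z + cauchyOp Γ ζ (fun s => μ s ᵥ* (wp s + wm s)) z) →
        ∃ mp mm : ℂ → Fin 2 → ℂ, SolvesRHP Γ ζ γ v m mp mm ∧
          (∀ᵐ z ∂Γ.arcLength, μ z = mp z ᵥ* (1 + wp z)⁻¹) ∧
          (∀ᵐ z ∂Γ.arcLength, μ z = mm z ᵥ* (1 - wm z)⁻¹)) := by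
  refine ⟨fun m mp mm hm μ hμ c₀ hc₀ => hm.eq_and_solvesSIE hζ hγ h hμ hc₀, ?_⟩
  rintro μt hsie ct hct hne μ rfl m hm
  refine ⟨_, _, solvesRHP_of_solvesSIE hζ hγ h hsie hct hne fun z hz => ?_, ?_, ?_⟩
  · rw [hm z hz, smul_add, ← cauchyOp_smul]
    simp only [Matrix.smul_vecMul]
  · filter_upwards [Contour.ae_mem_support] with z hz
    rw [Matrix.smul_vecMul, vecMul_mul_inv (h.isUnit_bp hz)]
  · filter_upwards [Contour.ae_mem_support] with z hz
    rw [Matrix.smul_vecMul, vecMul_mul_inv (h.isUnit_bm z hz)]
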